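/- Let $(M,\xi)$ be a contact three-manifold and let $V_0,V_1$ be smooth Legendrian vector fields on $M$ that are linearly independent at each point. Put $V(\theta,m)=\cos\theta\,V_0(m)+\sin\theta\,V_1(m)$. The standard Engel domain $\Omega=\Omega(V_0,V_1)\cong M\times[0,\pi/2]$ is the set of the directions $V(\theta,m)$, $0\le\theta\le\pi/2$, in the oriented prolongation $S\xi$ (the bundle of rays in $\xi$). With $\pi$ the projection to $M$, its Engel structure $\mathcal D_0$ has at $(m,\theta)$ the plane $d\pi^{-1}(\mathbb R\,V(\theta,m))$. Its bottom is $V_0$ ($\theta=0$) and its top is $V_1$ ($\theta=\pi/2$). Fix $m\in M$. (1) There are local coordinates $(x,y,p)$ centred at $m$ in which, up to positive factors, $V_0=\partial_p$ and $V_1=\partial_x+p\,\partial_y+f(x,y,p)\,\partial_p$, with $f$ smooth; one can choose them with $f(0)=0$. The equations $y''=f(x,y,y')$ obtained from any two such coordinate systems are projectively equivalent as germs: a germ of a diffeomorphism of the $(x,y)$-plane, fixing the origin and the oriented $x$-direction there, takes solutions of the one to solutions of the other, as unparameterized curves. For any such coordinates, the solution curves of $y''=f(x,y,y')$ near the contact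 element $(0,0,0)$ are the projections of the integral curves of $V_1$ to the local quotient by the integral curves of $V_0$, which has coordinates $(x,y)$. (2) Fix such coordinates and $f$. Let $q\in\Omega$ lie over $m$ and let $U$ be any open neighbourhood of $q$. Consider the smooth one-parameter deformations $\mathcal D_t$ ($|t|$ small) of $\mathcal D_0$ through Engel structures on $\Omega$ with compact support in $U$. Identify $\mathcal D_t$ and $\mathcal D'_t$ if near the leaf $\{m\}\times[0,\pi/2]$ they are related by an Engel isotopy, that is by a smooth family $\psi_t$ of diffeomorphisms between neighbourhoods of the leaf in $\Omega$, $\psi_0=\mathrm{id}$, preserving bottom and top, with $(\psi_t)_*\mathcal D_t=\mathcal D'_t$ for small $t$. Consider also the germs at the origin of smooth deformations $y''=f_t(x,y,y')$ of the equation, $f_0=f$. Identify $f_t$ and $f'_t$ if they are projectively equivalent: there is a smooth family of germs $g_t$ of diffeomorphisms of the plane near the origin, $g_0=\mathrm{id}$, taking the solutions of $y''=f_t$ with contact elements near $(0,0,0)$ to solutions of $y''=f'_t$, as unparameterized curves. Both identifications are equivalence relations, and the two quotient spaces are in bijection as follows. Straighten $\mathcal D_t$ near the leaf by a smooth family of maps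 $\Psi_t$ into $S\xi$, with $\Psi_0$ the inclusion and $(\Psi_t)_*\mathcal D_t=\mathcal D_0$. The images of the bottom and the top are two direction fields $V_{0t},V_{1t}$ near $m$. Put this pair into the form of (1) by coordinates depending smoothly on $t$ and equal to the given ones at $t=0$. This gives $f_t$. Every $\mathcal D_t$ can be so treated, and the class of $f_t$ depends only on the class of $\mathcal D_t$. (3) For each such $f$, the space of germs of deformations of $y''=f(x,y,y')$ modulo projective equivalence is infinite-dimensional: for each $n$ there are smooth germs $g_1,\dots,g_n$ at the origin such that two deformations of $f$ with initial velocities $\partial_t f_t|_{t=0}=\sum s_ig_i$ and $\partial_t f'_t|_{t=0}=\sum s'_ig_i$ (for example $f+t\sum s_ig_i$ and $f+t\sum s'_ig_i$) are projectively equivalent only if $s=s'$. -/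

import Mathlib

open Set Filter Topology Manifold
open scoped ContDiff

noncomputable section

namespace EngelODE

/-! ### Second-order equations `y'' = f (x, y, y')` and projective equivalence -/

/-- Coordinates `(x, y, p)`, where `p` stands for `dy/dx`. -/
abbrev Jet : Type := ℝ × ℝ × ℝ

/-- `u` is a solution of `y'' = f (x, y, y')` on the open interval `(a, b)`. -/
def IsSolutionOn (f : Jet → ℝ) (u : ℝ → ℝ) (a b : ℝ) : Prop :=
  ∀ x ∈ Ioo a b, DifferentiableAt ℝ u x ∧ HasDerivAt (deriv u) (f (x, u x, deriv u x)) x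

/-- The unparameterized curve `y = u x`, `a < x < b`, in the plane. -/
def graphOn (u : ℝ → ℝ) (a b : ℝ) : Set (ℝ × ℝ) := (fun x => (x, u x)) '' Ioo a b

/-- The map `g` of the plane takes those solutions of `y'' = f (x, y, y')` whose 1-jets stay in `N`
to solutions of `y'' = f' (x, y, y')`, solutions being viewed as unparameterized curves. -/
def MapsSolutions (g : ℝ × ℝ → ℝ × ℝ) (f f' : Jet → ℝ) (N : Set Jet) : Prop :=
  ∀ (u : ℝ → ℝ) (a b : ℝ), IsSolutionOn f u a b → (∀ x ∈ Ioo a b, (x, u x, deriv u x) ∈ N) →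
    ∃ (v : ℝ → ℝ) (c d : ℝ), IsSolutionOn f' v c d ∧ g '' graphOn u a b = graphOn v c d

/-- Projective (point) equivalence of the germs at `(0, 0, 0)` of two equations: the germ of a
diffeomorphism of the plane that fixes the origin and the oriented direction of the `x`-axis there
(the contact element `p = 0`), and takes solutions to solutions. -/
def ProjEquivGerm (f f' : Jet → ℝ) : Prop :=
  ∃ g : ℝ × ℝ → ℝ × ℝ,
    (∃ O : Set (ℝ × ℝ), IsOpen O ∧ (0 : ℝ × ℝ) ∈ O ∧ ContDiffOn ℝ ∞ g O) ∧
    g 0 = 0 ∧ Function.Bijective (fderiv ℝ g 0) ∧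
    (∃ c : ℝ, 0 < c ∧ fderiv ℝ g 0 (1, 0) = (c, 0)) ∧
    ∃ N ∈ 𝓝 (0 : Jet), MapsSolutions g f f' N

/-- (Representatives of) germs at the origin of smooth one-parameter deformations of the equation
`y'' = f (x, y, y')`. -/
structure ODEDeformation (f : Jet → ℝ) where
  rhs : ℝ → Jet → ℝ
  smooth : ∃ O : Set (ℝ × Jet), IsOpen O ∧ (0 : ℝ × Jet) ∈ O ∧
    ContDiffOn ℝ ∞ (fun z : ℝ × Jet => rhs z.1 z.2) O
  rhs_zero : rhs 0 =ᶠ[𝓝 0] f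

/-- Projective equivalence of germs of deformations: a smooth family `g t`, with `g 0 = id`, of
germs of maps of the plane (hence of diffeomorphisms, near the origin and for small `t`)
that takes the solutions of the first equation at time `t` to solutions of the second one.
Deformations with the same germ are equivalent through the constant family `g t = id`. -/
def ODEDeformation.ProjEquiv {f : Jet → ℝ} (F F' : ODEDeformation f) : Prop :=
  ∃ g : ℝ → ℝ × ℝ → ℝ × ℝ,
    (∃ O : Set (ℝ × ℝ × ℝ), IsOpen O ∧ (0 : ℝ × ℝ × ℝ) ∈ O ∧
      ContDiffOn ℝ ∞ (fun z : ℝ × ℝ × ℝ => g z.1 z.2) O) ∧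
    (∀ᶠ z in 𝓝 (0 : ℝ × ℝ), g 0 z = z) ∧
    ∃ N ∈ 𝓝 (0 : Jet), ∀ᶠ t in 𝓝 (0 : ℝ), MapsSolutions (g t) (F.rhs t) (F'.rhs t) N

/-- The initial velocity of a deformation. -/
def ODEDeformation.velocity {f : Jet → ℝ} (F : ODEDeformation f) : Jet → ℝ :=
  fun z => deriv (fun t => F.rhs t z) 0

/-- The space of germs of deformations of `y'' = f (x, y, y')` modulo projective equivalence is
infinite-dimensional: for each `n` there are `n` smooth germs `g i` such that deformations with
initial velocities `∑ i, s i * g i` and `∑ i, s' i * g i` (for example `f + t * ∑ i, s i * g i` and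
`f + t * ∑ i, s' i * g i`) are never equivalent unless `s = s'`. -/
def InfiniteDimensionalModuli (f : Jet → ℝ) : Prop :=
  ∀ n : ℕ, ∃ g : Fin n → Jet → ℝ,
    (∀ i, ∃ O : Set Jet, IsOpen O ∧ (0 : Jet) ∈ O ∧ ContDiffOn ℝ ∞ (g i) O) ∧
    ∀ (F F' : ODEDeformation f) (s s' : Fin n → ℝ),
      F.velocity =ᶠ[𝓝 0] (fun z => ∑ i, s i * g i z) →
      F'.velocity =ᶠ[𝓝 0] (fun z => ∑ i, s' i * g i z) →
      F.ProjEquiv F' → s = s'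

/-! ### Contact three-manifolds and the standard Engel domain -/

section Manifold

variable {M : Type*} [TopologicalSpace M] [ChartedSpace (EuclideanSpace ℝ (Fin 3)) M]
  [IsManifold (𝓡 3) ∞ M]

/-- The model of `M × ℝ`. -/
abbrev IQ : ModelWithCorners ℝ (EuclideanSpace ℝ (Fin 3) × ℝ)
    (ModelProd (EuclideanSpace ℝ (Fin 3)) ℝ) :=
  (𝓡 3).prod 𝓘(ℝ, ℝ)

/-- `ξ` is a contact structure on the three-manifold `M`: a smooth field of planes with local
frames `X, Y` for which `X, Y, [X, Y]` are linearly independent. -/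
def IsContact (ξ : (m : M) → Submodule ℝ (TangentSpace (𝓡 3) m)) : Prop :=
  ∀ m : M, ∃ (X Y : (m : M) → TangentSpace (𝓡 3) m) (O : Set M), IsOpen O ∧ m ∈ O ∧
    ContMDiffOn (𝓡 3) (𝓡 3).tangent ∞ (fun m => (⟨m, X m⟩ : TangentBundle (𝓡 3) M)) O ∧
    ContMDiffOn (𝓡 3) (𝓡 3).tangent ∞ (fun m => (⟨m, Y m⟩ : TangentBundle (𝓡 3) M)) O ∧
    (∀ m' ∈ O, ξ m' = Submodule.span ℝ {X m', Y m'}) ∧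
    LinearIndependent ℝ ![X m, Y m, VectorField.mlieBracket (𝓡 3) X Y m]

variable (V₀ V₁ : (m : M) → TangentSpace (𝓡 3) m)

/-- The Legendrian direction `V(θ, m) = cos θ V₀(m) + sin θ V₁(m)`. -/
def direction (x : M × ℝ) : TangentSpace (𝓡 3) x.1 :=
  Real.cos x.2 • V₀ x.1 + Real.sin x.2 • V₁ x.1

/-- The canonical Engel distribution of the oriented prolongation `Sξ` of `ξ = span (V₀, V₁)`, in
the trivialization `(m, θ) ↦ V(θ, m)` (with `θ ∈ ℝ` as local coordinate on the circle): the plane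
at a direction is the preimage, under the differential of the projection to `M`, of the line spanned
by that direction. -/
def stdEngel (x : M × ℝ) : Submodule ℝ (TangentSpace IQ x) :=
  (Submodule.span ℝ {direction V₀ V₁ x}).comap
    (mfderiv IQ (𝓡 3) (Prod.fst : M × ℝ → M) x).toLinearMap

variable (M) in
/-- The standard Engel domain `Ω(V₀, V₁)`, that is `M × [0, π/2]` in this trivialization. Its bottom
`θ = 0` is the image of `V₀` and its top `θ = π/2` is the image of `V₁`. -/
def domain : Set (M × ℝ) := {x | x.2 ∈ Icc 0 (Real.pi / 2)}

/-- The leaf of the characteristic line field of the standard Engel domain over `m`. -/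
def leaf (m : M) : Set (M × ℝ) := {x | x.1 = m ∧ x.2 ∈ Icc 0 (Real.pi / 2)}

/-- Near time `t` and the point `x` of the standard domain, `D` is a smooth family of plane fields
(smooth up to the boundary), and at time `t` it is an Engel structure at `x`: it has a frame `X, Y`
for which `X, Y, [X, Y], [X, [X, Y]]` are linearly independent. -/
def IsEngelFamilyAt (D : ℝ → (x : M × ℝ) → Submodule ℝ (TangentSpace IQ x)) (t : ℝ)
    (x : M × ℝ) : Prop :=
  ∃ (X Y : ℝ → (x : M × ℝ) → TangentSpace IQ x) (O : Set (ℝ × (M × ℝ))), IsOpen O ∧ (t, x) ∈ O ∧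
    ContMDiffOn (𝓘(ℝ, ℝ).prod IQ) IQ.tangent ∞
      (fun z : ℝ × (M × ℝ) => (⟨z.2, X z.1 z.2⟩ : TangentBundle IQ (M × ℝ))) O ∧
    ContMDiffOn (𝓘(ℝ, ℝ).prod IQ) IQ.tangent ∞
      (fun z : ℝ × (M × ℝ) => (⟨z.2, Y z.1 z.2⟩ : TangentBundle IQ (M × ℝ))) O ∧
    (∀ z ∈ O, z.2 ∈ domain M → D z.1 z.2 = Submodule.span ℝ {X z.1 z.2, Y z.1 z.2}) ∧
    LinearIndependent ℝ ![X t x, Y t x, VectorField.mlieBracket IQ (X t) (Y t) x,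
      VectorField.mlieBracket IQ (X t) (VectorField.mlieBracket IQ (X t) (Y t)) x]

/-- Engel deformations of the standard Engel domain `Ω(V₀, V₁)` with (compact) support in `U`,
defined for small times. Only the values of `plane` on the domain matter. -/
structure EngelDeformation (U : Set (M × ℝ)) where
  plane : ℝ → (x : M × ℝ) → Submodule ℝ (TangentSpace IQ x)
  plane_zero : ∀ x ∈ domain M, plane 0 x = stdEngel V₀ V₁ x
  engel : ∃ ε > 0, ∃ K : Set (M × ℝ), IsCompact K ∧ K ⊆ U ∧ ∀ t ∈ Ioo (-ε) ε, ∀ x ∈ domain M,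
    IsEngelFamilyAt plane t x ∧ (x ∉ K → plane t x = stdEngel V₀ V₁ x)

/-- `ψ` is, near the leaf over `m` and for small times, a smooth family of maps of `M × ℝ` with
`ψ 0 = id` (hence of diffeomorphisms onto their images) whose differentials take the planes `D t`,
at points of the standard domain, to the planes `D' t`. -/
def IsEngelFamilyNear (m : M) (D D' : ℝ → (x : M × ℝ) → Submodule ℝ (TangentSpace IQ x))
    (ψ : ℝ → M × ℝ → M × ℝ) (ε : ℝ) (N : Set (M × ℝ)) : Prop :=
  0 < ε ∧ IsOpen N ∧ leaf m ⊆ N ∧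
    ContMDiffOn (𝓘(ℝ, ℝ).prod IQ) IQ ∞ (fun z : ℝ × (M × ℝ) => ψ z.1 z.2) (Ioo (-ε) ε ×ˢ N) ∧
    (∀ x ∈ N, ψ 0 x = x) ∧
    ∀ t ∈ Ioo (-ε) ε, ∀ x ∈ N, x ∈ domain M →
      (D t x).map (mfderiv IQ IQ (ψ t) x).toLinearMap = D' t (ψ t x)

variable {V₀ V₁}

/-- The germs at (the leaf over) `m` of two Engel deformations agree up to Engel isotopy: there is
an isotopy `ψ` of neighbourhoods of the leaf in the domain, taking top to top and bottom to bottom,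
which takes the first Engel structure at time `t` to the second one. -/
def EngelDeformation.Isotopic {U : Set (M × ℝ)} (m : M) (D D' : EngelDeformation V₀ V₁ U) : Prop :=
  ∃ (ψ : ℝ → M × ℝ → M × ℝ) (ε : ℝ) (N : Set (M × ℝ)),
    IsEngelFamilyNear m D.plane D'.plane ψ ε N ∧
    ∀ t ∈ Ioo (-ε) ε, ∀ x ∈ N,
      (x ∈ domain M → ψ t x ∈ domain M) ∧ (x.2 = 0 → (ψ t x).2 = 0) ∧
      (x.2 = Real.pi / 2 → (ψ t x).2 = Real.pi / 2)

/-! ### From a pair of Legendrian direction fields to an equation -/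

/-- Smooth local coordinates `χ = (x, y, p)` centred at `m` in which `V₀` spans (positively) the
direction `∂/∂p` and `V₁` spans `∂/∂x + p ∂/∂y + f(x, y, p) ∂/∂p`. -/
def IsNormalForm (V₀ V₁ : (m : M) → TangentSpace (𝓡 3) m) (m : M) (χ : M → Jet)
    (f : Jet → ℝ) : Prop :=
  (∃ O : Set M, IsOpen O ∧ m ∈ O ∧ ContMDiffOn (𝓡 3) 𝓘(ℝ, Jet) ∞ χ O) ∧
  χ m = 0 ∧ Function.Bijective (mfderiv (𝓡 3) 𝓘(ℝ, Jet) χ m) ∧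
  (∃ O : Set Jet, IsOpen O ∧ (0 : Jet) ∈ O ∧ ContDiffOn ℝ ∞ f O) ∧
  ∀ᶠ m' in 𝓝 m,
    (∃ a : ℝ, 0 < a ∧ mfderiv (𝓡 3) 𝓘(ℝ, Jet) χ m' (V₀ m') = a • ((0, 0, 1) : Jet)) ∧
    ∃ b : ℝ, 0 < b ∧
      mfderiv (𝓡 3) 𝓘(ℝ, Jet) χ m' (V₁ m') = b • ((1, (χ m').2.2, f (χ m')) : Jet)

/-- The equation `y'' = f (x, y, y')` is the one defined near `m` by the pair `V₀, V₁` in the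
coordinates `χ`: on the local quotient by the integral curves of `V₀`, with coordinates `(x, y)`,
its solution curves are the projections of the integral curves of `V₁`. -/
def SolutionsAreProjections (V₀ V₁ : (m : M) → TangentSpace (𝓡 3) m) (m : M) (χ : M → Jet)
    (f : Jet → ℝ) : Prop :=
  (∀ᶠ m' in 𝓝 m, (mfderiv (𝓡 3) 𝓘(ℝ, ℝ × ℝ) (fun z => ((χ z).1, (χ z).2.1)) m' (V₀ m')) = 0) ∧
  (∃ N ∈ 𝓝 m, ∀ (γ : ℝ → M) (a b : ℝ), IsMIntegralCurveOn γ V₁ (Ioo a b) →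
    (∀ τ ∈ Ioo a b, γ τ ∈ N) → ∃ (u : ℝ → ℝ) (c d : ℝ), IsSolutionOn f u c d ∧
      (fun τ => ((χ (γ τ)).1, (χ (γ τ)).2.1)) '' Ioo a b = graphOn u c d) ∧
  ∀ N ∈ 𝓝 m, ∃ N' ∈ 𝓝 (0 : Jet), ∀ (u : ℝ → ℝ) (c d : ℝ), IsSolutionOn f u c d →
    (∀ x ∈ Ioo c d, (x, u x, deriv u x) ∈ N') → ∃ (γ : ℝ → M) (a b : ℝ),
      IsMIntegralCurveOn γ V₁ (Ioo a b) ∧ (∀ τ ∈ Ioo a b, γ τ ∈ N) ∧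
      (fun τ => ((χ (γ τ)).1, (χ (γ τ)).2.1)) '' Ioo a b = graphOn u c d

/-- The deformation `F` of the equation `y'' = f (x, y, y')` is defined by the Engel deformation
`D`, starting from the coordinates `χ` at `m`.
First, `D` is straightened: `Ψ t` takes `D t` to the standard Engel structure of `Sξ`, with
`Ψ 0 = id`. It takes the bottom and the top of `Ω` to the images of two direction fields `V₀ₜ` and
`V₁ₜ`: the value of `V₀ₜ` at the point `(Ψ t (m', 0)).1` is the direction `Ψ t (m', 0)` itself, and
likewise for the top. Then the pair `V₀ₜ, V₁ₜ` is put into normal form, with right-hand side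
`F t`, by coordinates `κ t` that start from `κ 0 = χ`. -/
def Defines {U : Set (M × ℝ)} (m : M) (χ : M → Jet) {f : Jet → ℝ} (D : EngelDeformation V₀ V₁ U)
    (F : ODEDeformation f) : Prop :=
  ∃ (Ψ : ℝ → M × ℝ → M × ℝ) (ε : ℝ) (N : Set (M × ℝ)) (κ : ℝ → M → Jet),
    IsEngelFamilyNear m D.plane (fun _ => stdEngel V₀ V₁) Ψ ε N ∧
    (∃ O : Set (ℝ × M), IsOpen O ∧ ((0 : ℝ), m) ∈ O ∧
      ContMDiffOn (𝓘(ℝ, ℝ).prod (𝓡 3)) 𝓘(ℝ, Jet) ∞ (fun z : ℝ × M => κ z.1 z.2) O) ∧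
    κ 0 =ᶠ[𝓝 m] χ ∧
    ∀ᶠ z in 𝓝 ((0 : ℝ), m),
      (∃ a : ℝ, 0 < a ∧
        mfderiv (𝓡 3) 𝓘(ℝ, Jet) (κ z.1) (Ψ z.1 (z.2, 0)).1
          (direction V₀ V₁ (Ψ z.1 (z.2, 0))) = a • ((0, 0, 1) : Jet)) ∧
      ∃ b : ℝ, 0 < b ∧
        mfderiv (𝓡 3) 𝓘(ℝ, Jet) (κ z.1) (Ψ z.1 (z.2, Real.pi / 2)).1
          (direction V₀ V₁ (Ψ z.1 (z.2, Real.pi / 2))) =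
        b • ((1, (κ z.1 (Ψ z.1 (z.2, Real.pi / 2)).1).2.2,
          F.rhs z.1 (κ z.1 (Ψ z.1 (z.2, Real.pi / 2)).1)) : Jet)

end Manifold

end EngelODE

end

noncomputable section

namespace EngelODE

/-- Coordinates `(t, z, θ)`: time, contact element and angle. -/
abbrev Cyl : Type := ℝ × Jet × ℝ

abbrev TJet : Type := ℝ × Jet

abbrev E3 : Type := EuclideanSpace ℝ (Fin 3)

theorem _root_.ContDiffAt.diffAt {E F : Type*} [NormedAddCommGroup E] [NormedSpace ℝ E]
    [NormedAddCommGroup F] [NormedSpace ℝ F] {f : E → F} {x : E} (h : ContDiffAt ℝ ∞ f x) :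
    DifferentiableAt ℝ f x := h.differentiableAt (by simp)


/-! ### Functions that are smooth near a point -/

section SmoothNear

variable {E F G : Type*} [NormedAddCommGroup E] [NormedSpace ℝ E] [NormedAddCommGroup F]
  [NormedSpace ℝ F] [NormedAddCommGroup G] [NormedSpace ℝ G]

/-- `f` is smooth in a neighbourhood of `x`. -/
def SmoothNear (f : E → F) (x : E) : Prop := ∀ᶠ y in 𝓝 x, ContDiffAt ℝ ∞ f y

theorem SmoothNear.contDiffAt {f : E → F} {x : E} (h : SmoothNear f x) : ContDiffAt ℝ ∞ f x :=
  h.self_of_nhds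

theorem SmoothNear.eventually {f : E → F} {x : E} (h : SmoothNear f x) :
    ∀ᶠ y in 𝓝 x, SmoothNear f y := eventually_eventually_nhds.2 h

theorem SmoothNear.continuousAt {f : E → F} {x : E} (h : SmoothNear f x) : ContinuousAt f x :=
  h.contDiffAt.continuousAt

theorem SmoothNear.differentiableAt {f : E → F} {x : E} (h : SmoothNear f x) :
    DifferentiableAt ℝ f x := h.contDiffAt.diffAt

theorem SmoothNear.hasFDerivAt {f : E → F} {x : E} (h : SmoothNear f x) :
    HasFDerivAt f (fderiv ℝ f x) x := h.differentiableAt.hasFDerivAt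

theorem _root_.ContDiff.smoothNear {f : E → F} (h : ContDiff ℝ ∞ f) (x : E) : SmoothNear f x :=
  Eventually.of_forall fun _ => h.contDiffAt

theorem SmoothNear.congr {f g : E → F} {x : E} (h : SmoothNear f x) (hg : g =ᶠ[𝓝 x] f) :
    SmoothNear g x := by
  filter_upwards [h, hg.eventually_nhds] with y hy hy' using hy.congr_of_eventuallyEq hy'

theorem SmoothNear.comp {g : F → G} {f : E → F} {x : E} (hg : SmoothNear g (f x))
    (hf : SmoothNear f x) : SmoothNear (fun y => g (f y)) x := by
  filter_upwards [hf, hf.continuousAt.eventually hg] with y hy hy' using hy'.comp y hy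

theorem SmoothNear.comp_of_eq {g : F → G} {f : E → F} {x : E} {z : F} (hg : SmoothNear g z)
    (hf : SmoothNear f x) (hz : f x = z) : SmoothNear (fun y => g (f y)) x := by
  subst hz; exact hg.comp hf

theorem SmoothNear.prodMk {f : E → F} {g : E → G} {x : E} (hf : SmoothNear f x)
    (hg : SmoothNear g x) : SmoothNear (fun y => (f y, g y)) x := by
  filter_upwards [hf, hg] with y hy hy' using hy.prodMk hy'

theorem SmoothNear.fderivMap {f : E → F} {x : E} (hf : SmoothNear f x) :
    SmoothNear (fderiv ℝ f) x := by
  filter_upwards [hf] with y hy using hy.fderiv_right (m := ∞) (by simp)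

theorem SmoothNear.clm_apply {f : E → F →L[ℝ] G} {g : E → F} {x : E} (hf : SmoothNear f x)
    (hg : SmoothNear g x) : SmoothNear (fun y => f y (g y)) x := by
  filter_upwards [hf, hg] with y hy hy' using hy.clm_apply hy'

theorem SmoothNear.fderiv_apply {f : E → F} {g : E → E} {x : E} (hf : SmoothNear f x)
    (hg : SmoothNear g x) : SmoothNear (fun y => _root_.fderiv ℝ f y (g y)) x :=
  hf.fderivMap.clm_apply hg

theorem SmoothNear.fst {f : E → F × G} {x : E} (hf : SmoothNear f x) :
    SmoothNear (fun y => (f y).1) x := by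
  filter_upwards [hf] with y hy using hy.fst

theorem SmoothNear.snd {f : E → F × G} {x : E} (hf : SmoothNear f x) :
    SmoothNear (fun y => (f y).2) x := by
  filter_upwards [hf] with y hy using hy.snd

theorem SmoothNear.add {f g : E → F} {x : E} (hf : SmoothNear f x) (hg : SmoothNear g x) :
    SmoothNear (fun y => f y + g y) x := by
  filter_upwards [hf, hg] with y hy hy' using hy.add hy'

theorem SmoothNear.sub {f g : E → F} {x : E} (hf : SmoothNear f x) (hg : SmoothNear g x) :
    SmoothNear (fun y => f y - g y) x := by
  filter_upwards [hf, hg] with y hy hy' using hy.sub hy'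

theorem SmoothNear.neg {f : E → F} {x : E} (hf : SmoothNear f x) :
    SmoothNear (fun y => - f y) x := by
  filter_upwards [hf] with y hy using hy.neg

theorem SmoothNear.smul {f : E → ℝ} {g : E → F} {x : E} (hf : SmoothNear f x)
    (hg : SmoothNear g x) : SmoothNear (fun y => f y • g y) x := by
  filter_upwards [hf, hg] with y hy hy' using hy.smul hy'

theorem SmoothNear.mul {f g : E → ℝ} {x : E} (hf : SmoothNear f x) (hg : SmoothNear g x) :
    SmoothNear (fun y => f y * g y) x := by
  filter_upwards [hf, hg] with y hy hy' using hy.mul hy'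

theorem SmoothNear.div {f g : E → ℝ} {x : E} (hf : SmoothNear f x) (hg : SmoothNear g x)
    (h : g x ≠ 0) : SmoothNear (fun y => f y / g y) x := by
  filter_upwards [hf, hg, hg.continuousAt.eventually_ne h] with y hy hy' h' using hy.div hy' h'

theorem smoothNear_of_contDiffOn {f : E → F} {O : Set E} (hO : IsOpen O) (hf : ContDiffOn ℝ ∞ f O)
    {x : E} (hx : x ∈ O) : SmoothNear f x := by
  filter_upwards [hO.mem_nhds hx] with y hy using hf.contDiffAt (hO.mem_nhds hy)

theorem SmoothNear.exists_isOpen {f : E → F} {x : E} (h : SmoothNear f x) :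
    ∃ O : Set E, IsOpen O ∧ x ∈ O ∧ ContDiffOn ℝ ∞ f O := by
  obtain ⟨O, hO, h1, h2⟩ := eventually_nhds_iff.1 h
  exact ⟨O, h1, h2, fun y hy => (hO y hy).contDiffWithinAt⟩

/-- The inverse function theorem. -/
theorem SmoothNear.exists_local_inverse [CompleteSpace E] {f : E → F} {x : E}
    (hf : SmoothNear f x) (f' : E ≃L[ℝ] F) (hf' : HasFDerivAt f (f' : E →L[ℝ] F) x) :
    ∃ g : F → E, SmoothNear g (f x) ∧ g (f x) = x ∧ (∀ᶠ y in 𝓝 x, g (f y) = y) ∧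
      ∀ᶠ z in 𝓝 (f x), f (g z) = z := by
  have hn : (∞ : WithTop ℕ∞) ≠ 0 := by simp
  set e := hf.contDiffAt.toOpenPartialHomeomorph f hf' hn with he
  have hex : x ∈ e.source := hf.contDiffAt.mem_toOpenPartialHomeomorph_source hf' hn
  have hec : ∀ y, e y = f y := fun y => rfl
  have hfx : f x ∈ e.target := e.map_source hex
  have hgx : e.symm (f x) = x := e.left_inv hex
  have hcont : ContinuousAt e.symm (f x) := e.continuousAt_symm hfx
  refine ⟨e.symm, ?_, hgx, ?_, ?_⟩
  · have h1 : ∀ᶠ y in 𝓝 x, ∃ f'' : E ≃L[ℝ] F, HasFDerivAt f (f'' : E →L[ℝ] F) y := by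
      have : ∀ᶠ y in 𝓝 x, _root_.fderiv ℝ f y ∈ range ((↑) : (E ≃L[ℝ] F) → E →L[ℝ] F) := by
        apply hf.fderivMap.continuousAt.eventually
        rw [hf'.fderiv]
        exact ContinuousLinearEquiv.nhds f'
      filter_upwards [this, hf] with y ⟨f'', h''⟩ hy
      exact ⟨f'', h'' ▸ (hy.diffAt).hasFDerivAt⟩
    rw [← hgx] at h1
    have h2 := hf
    unfold SmoothNear at h2 ⊢
    rw [← hgx] at h2
    filter_upwards [hcont.eventually h1, hcont.eventually h2, e.open_target.mem_nhds hfx]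
      with z ⟨f'', h''⟩ hz hz'
    exact e.contDiffAt_symm hz' h'' hz
  · filter_upwards [e.open_source.mem_nhds hex] with y hy using e.left_inv hy
  · filter_upwards [e.open_target.mem_nhds hfx] with y hy using e.right_inv hy

end SmoothNear

/-! ### Smooth dependence of solutions of differential equations -/

section Flow

variable {K : Type} [TopologicalSpace K] [CompactSpace K]
  {E G : Type} [NormedAddCommGroup E] [NormedSpace ℝ E] [NormedAddCommGroup G] [NormedSpace ℝ G]

/-- Pointwise application of a continuous family of linear maps. -/
def pointwiseApply (K : Type) [TopologicalSpace K] [CompactSpace K]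
    (E G : Type) [NormedAddCommGroup E] [NormedSpace ℝ E] [NormedAddCommGroup G]
    [NormedSpace ℝ G] : C(K, E →L[ℝ] G) →L[ℝ] C(K, E) →L[ℝ] C(K, G) :=
  LinearMap.mkContinuous₂
    (LinearMap.mk₂ ℝ (fun (A : C(K, E →L[ℝ] G)) (h : C(K, E)) =>
      (⟨fun k => A k (h k), A.continuous.clm_apply h.continuous⟩ : C(K, G)))
      (fun _ _ _ => by ext; simp) (fun _ _ _ => by ext; simp)
      (fun _ _ _ => by ext; simp) (fun _ _ _ => by ext; simp)) 1 (by
    intro A h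
    rw [one_mul]
    refine (ContinuousMap.norm_le _ (by positivity)).2 fun k => ?_
    exact ((A k).le_opNorm _).trans
      (mul_le_mul (A.norm_coe_le_norm k) (h.norm_coe_le_norm k) (norm_nonneg _) (by positivity)))

/-- Composition with a fixed continuous function. -/
def superposition (K : Type) [TopologicalSpace K] (F : E → G) (hF : Continuous F)
    (w : C(K, E)) : C(K, G) := ⟨fun k => F (w k), hF.comp w.continuous⟩

theorem hasFDerivAt_superposition [FiniteDimensional ℝ E] {F : E → G} (hF : ContDiff ℝ 1 F)
    (w : C(K, E)) :
    HasFDerivAt (superposition K F hF.continuous)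
      (pointwiseApply K E G (superposition K (fderiv ℝ F) (hF.continuous_fderiv (by simp)) w)) w := by
  rw [hasFDerivAt_iff_isLittleO_nhds_zero, Asymptotics.isLittleO_iff]
  intro c hc
  set R := ‖w‖ + 1
  have hcomp : IsCompact (Metric.closedBall (0 : E) R) := isCompact_closedBall _ _
  have huc := hcomp.uniformContinuousOn_of_continuous
    (hF.continuous_fderiv (by simp)).continuousOn
  rw [Metric.uniformContinuousOn_iff] at huc
  obtain ⟨δ, hδ, huc⟩ := huc c hc
  have hmin : 0 < min δ 1 := lt_min hδ one_pos
  filter_upwards [Metric.ball_mem_nhds (0 : C(K, E)) hmin] with h hh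
  rw [mem_ball_zero_iff, lt_min_iff] at hh
  refine (ContinuousMap.norm_le _ (by positivity)).2 fun k => ?_
  have hk : ‖h k‖ ≤ ‖h‖ := h.norm_coe_le_norm k
  have hwk : ‖w k‖ ≤ ‖w‖ := w.norm_coe_le_norm k
  have hball : ∀ x ∈ Metric.closedBall (w k) ‖h k‖, ‖fderiv ℝ F x - fderiv ℝ F (w k)‖ ≤ c := by
    intro x hx
    rw [mem_closedBall_iff_norm] at hx
    have := huc x (by
      rw [mem_closedBall_zero_iff]
      calc ‖x‖ = ‖(x - w k) + w k‖ := by simp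
        _ ≤ ‖x - w k‖ + ‖w k‖ := norm_add_le _ _
        _ ≤ R := by simp only [R]; linarith [hh.2]) (w k) (by
      rw [mem_closedBall_zero_iff]; simp only [R]; linarith) (by
      rw [dist_eq_norm]; linarith [hh.1])
    rw [dist_eq_norm] at this
    exact this.le
  have := (convex_closedBall (w k) ‖h k‖).norm_image_sub_le_of_norm_hasFDerivWithin_le'
    (f := F) (f' := fderiv ℝ F) (φ := fderiv ℝ F (w k)) (C := c) (x := w k) (y := w k + h k)
    (fun x _ => (hF.differentiable (by simp) x).hasFDerivAt.hasFDerivWithinAt) hball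
    (by simp) (by simp)
  simp only [add_sub_cancel_left] at this
  calc ‖_‖ = ‖F (w k + h k) - F (w k) - fderiv ℝ F (w k) (h k)‖ := rfl
    _ ≤ c * ‖h k‖ := this
    _ ≤ c * ‖h‖ := by gcongr

theorem contDiff_superposition_nat [FiniteDimensional ℝ E] (n : ℕ) :
    ∀ {G : Type} [NormedAddCommGroup G] [NormedSpace ℝ G] {F : E → G} (hF : ContDiff ℝ ∞ F),
      ContDiff ℝ n (superposition K F hF.continuous) := by
  induction n with
  | zero =>
    intro G _ _ F hF
    have h1 : ContDiff ℝ 1 F := hF.of_le (by exact_mod_cast le_top)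
    exact contDiff_zero.2 (continuous_iff_continuousAt.2 fun w =>
      (hasFDerivAt_superposition h1 w).continuousAt)
  | succ n ih =>
    intro G _ _ F hF
    have h1 : ContDiff ℝ 1 F := hF.of_le (by exact_mod_cast le_top)
    have h2 : ContDiff ℝ ∞ (fderiv ℝ F) := hF.fderiv_right (by simp)
    push_cast
    rw [contDiff_succ_iff_fderiv]
    refine ⟨fun w => (hasFDerivAt_superposition h1 w).differentiableAt, by simp, ?_⟩
    have : fderiv ℝ (superposition K F hF.continuous) =
        fun w => pointwiseApply K E G (superposition K (fderiv ℝ F) h2.continuous w) := by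
      ext1 w
      exact (hasFDerivAt_superposition h1 w).fderiv
    rw [this]
    exact (pointwiseApply K E G).contDiff.comp (ih h2)

theorem contDiff_superposition [FiniteDimensional ℝ E] {F : E → G} (hF : ContDiff ℝ ∞ F) :
    ContDiff ℝ ∞ (superposition K F hF.continuous) :=
  contDiff_infty.2 fun n => contDiff_superposition_nat n hF

/-- The interval `[-1, 1]`. -/
abbrev UnitIcc : Type := Icc (-1 : ℝ) 1

theorem neg_one_le_one' : (-1 : ℝ) ≤ 1 := by norm_num

/-- Extension of a path on `[-1, 1]` by constants. -/
def extendPath (w : C(UnitIcc, E)) (r : ℝ) : E := w (projIcc (-1) 1 neg_one_le_one' r)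

omit [NormedSpace ℝ E] in
theorem continuous_extendPath (w : C(UnitIcc, E)) : Continuous (extendPath w) :=
  w.continuous.comp continuous_projIcc

/-- The primitive of a path that vanishes at `0`. -/
def primitive (E : Type) [NormedAddCommGroup E] [NormedSpace ℝ E] [CompleteSpace E] :
    C(UnitIcc, E) →L[ℝ] C(UnitIcc, E) :=
  LinearMap.mkContinuous
    { toFun := fun w => ⟨fun σ => ∫ r in (0 : ℝ)..σ, extendPath w r, by
        have : Continuous fun s : ℝ => ∫ r in (0 : ℝ)..s, extendPath w r :=
          intervalIntegral.continuous_primitive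
            (fun a b => (continuous_extendPath w).intervalIntegrable a b) 0
        exact this.comp continuous_subtype_val⟩
      map_add' := fun w w' => by
        ext σ
        exact intervalIntegral.integral_add ((continuous_extendPath w).intervalIntegrable _ _)
          ((continuous_extendPath w').intervalIntegrable _ _)
      map_smul' := fun c w => by
        ext σ
        exact intervalIntegral.integral_smul c (extendPath w) } 1 (by
    intro w
    rw [one_mul]
    refine (ContinuousMap.norm_le _ (by positivity)).2 fun σ => ?_
    have := intervalIntegral.norm_integral_le_of_norm_le_const (a := 0) (b := (σ : ℝ))
      (f := extendPath w) (C := ‖w‖) (fun x _ => w.norm_coe_le_norm _)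
    refine this.trans ?_
    have h1 : |(σ : ℝ) - 0| ≤ 1 := by rw [sub_zero, abs_le]; exact σ.2
    calc ‖w‖ * |(σ : ℝ) - 0| ≤ ‖w‖ * 1 := by gcongr
      _ = ‖w‖ := mul_one _)

end Flow

section Flow

variable {Λ E : Type} [NormedAddCommGroup Λ] [NormedSpace ℝ Λ] [NormedAddCommGroup E]
  [NormedSpace ℝ E]

/-- The path `σ ↦ (λ, u σ, s σ)`. -/
def timedPath (p : Λ × E × ℝ) (u : C(UnitIcc, E)) : C(UnitIcc, Λ × E × ℝ) :=
  ⟨fun σ => (p.1, u σ, p.2.2 * σ), by fun_prop⟩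

/-- Constant paths, as a continuous linear map. -/
def constPath (E : Type) [NormedAddCommGroup E] [NormedSpace ℝ E] : E →L[ℝ] C(UnitIcc, E) :=
  LinearMap.mkContinuous
    { toFun := fun z => ContinuousMap.const _ z
      map_add' := fun _ _ => by ext; simp
      map_smul' := fun _ _ => by ext; simp } 1 (fun z => by
    rw [one_mul]; exact (ContinuousMap.norm_le _ (by positivity)).2 fun _ => le_rfl)

@[simp] theorem constPath_apply (z : E) (σ : UnitIcc) : constPath E z σ = z := rfl

theorem contDiff_timedPath :
    ContDiff ℝ ∞ (fun q : (Λ × E × ℝ) × C(UnitIcc, E) => timedPath q.1 q.2) := by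
  have : (fun q : (Λ × E × ℝ) × C(UnitIcc, E) => timedPath q.1 q.2) = fun q =>
      constPath (Λ × E × ℝ) (q.1.1, 0, 0) +
      ((ContinuousLinearMap.inr ℝ Λ (E × ℝ)).comp
        (ContinuousLinearMap.inl ℝ E ℝ)).compLeftContinuous ℝ UnitIcc q.2 +
      q.1.2.2 • (⟨fun σ => (0, 0, (σ : ℝ)), by fun_prop⟩ : C(UnitIcc, Λ × E × ℝ)) := by
    ext1 q
    ext σ <;> simp [timedPath]
  rw [this]
  refine ContDiff.add (ContDiff.add ?_ ?_) ?_
  · exact (constPath (Λ × E × ℝ)).contDiff.comp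
      (by fun_prop : ContDiff ℝ ∞ fun q : (Λ × E × ℝ) × C(UnitIcc, E) => (q.1.1, (0 : E), (0 : ℝ)))
  · exact (ContinuousLinearMap.contDiff _).comp contDiff_snd
  · fun_prop

variable [FiniteDimensional ℝ Λ] [FiniteDimensional ℝ E] [CompleteSpace E]

/-- The defect of `u` in the integral equation `u σ = z + ∫ s v (λ, u r, s r)`, `0 ≤ r ≤ σ`. -/
def integralDefect (v : Λ × E × ℝ → E) (hv : Continuous v) (q : (Λ × E × ℝ) × C(UnitIcc, E)) :
    C(UnitIcc, E) :=
  q.2 - constPath E q.1.2.1 -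
    q.1.2.2 • primitive E (superposition UnitIcc v hv (timedPath q.1 q.2))

theorem contDiff_integralDefect {v : Λ × E × ℝ → E} (hv : ContDiff ℝ ∞ v) :
    ContDiff ℝ ∞ (integralDefect v hv.continuous) := by
  unfold integralDefect
  refine (contDiff_snd.sub ((constPath E).contDiff.comp
    (by fun_prop : ContDiff ℝ ∞ fun q : (Λ × E × ℝ) × C(UnitIcc, E) => q.1.2.1))).sub ?_
  refine ContDiff.smul
    (by fun_prop : ContDiff ℝ ∞ fun q : (Λ × E × ℝ) × C(UnitIcc, E) => q.1.2.2) ((primitive E).contDiff.comp ?_)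
  exact (contDiff_superposition hv).comp contDiff_timedPath

theorem exists_smooth_integral_solution {v : Λ × E × ℝ → E} (hv : ContDiff ℝ ∞ v) {l₀ : Λ}
    (hv0 : ∀ z s, v (l₀, z, s) = 0) (z₀ : E) (s₀ : ℝ) :
    ∃ U : Λ × E × ℝ → C(UnitIcc, E), SmoothNear U (l₀, z₀, s₀) ∧
      U (l₀, z₀, s₀) = constPath E z₀ ∧
      (∀ᶠ p in 𝓝 (l₀, z₀, s₀), integralDefect v hv.continuous (p, U p) = 0) ∧
      ∀ᶠ q in 𝓝 ((l₀, z₀, s₀), constPath E z₀),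
        integralDefect v hv.continuous q = 0 → U q.1 = q.2 := by
  set d := integralDefect v hv.continuous with hd
  set p₀ : Λ × E × ℝ := (l₀, z₀, s₀) with hp₀
  have hdsm := contDiff_integralDefect hv
  have hconst : ∀ u, d (p₀, u) = u - constPath E z₀ := by
    intro u
    have : superposition UnitIcc v hv.continuous (timedPath p₀ u) = 0 := by
      ext σ; exact hv0 _ _
    simp only [d, integralDefect]
    rw [this]
    simp [p₀]
  set q₀ : (Λ × E × ℝ) × C(UnitIcc, E) := (p₀, constPath E z₀)
  set D := fderiv ℝ d q₀
  have hD : HasFDerivAt d D q₀ := (hdsm.differentiable (by simp) q₀).hasFDerivAt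
  have hDinr : ∀ h, D (0, h) = h := by
    intro h
    have h1 : HasFDerivAt (fun u => d (p₀, u)) (D.comp (ContinuousLinearMap.inr ℝ _ _))
        (constPath E z₀) := HasFDerivAt.comp _ hD (hasFDerivAt_prodMk_right _ _)
    have h2 : HasFDerivAt (fun u => d (p₀, u)) (ContinuousLinearMap.id ℝ _) (constPath E z₀) := by
      simp only [hconst]
      exact (hasFDerivAt_id _).sub_const _
    have := congrArg (fun A => A h) (h1.unique h2)
    simpa using this
  set f' := ContinuousLinearEquiv.skewProd (ContinuousLinearEquiv.refl ℝ (Λ × E × ℝ))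
    (ContinuousLinearEquiv.refl ℝ C(UnitIcc, E)) (D.comp (ContinuousLinearMap.inl ℝ _ _))
  have hH : HasFDerivAt (fun q : (Λ × E × ℝ) × C(UnitIcc, E) => (q.1, d q))
      (f' : _ →L[ℝ] _) q₀ := by
    refine (hasFDerivAt_fst.prodMk hD).congr_fderiv ?_
    refine ContinuousLinearMap.ext fun q => Prod.ext (by simp [f']) ?_
    have : D q = D (q.1, 0) + D (0, q.2) := by rw [← map_add]; simp
    simp [f', this, hDinr, add_comm]
  obtain ⟨g, hg, hg0, hgl, hgr⟩ := SmoothNear.exists_local_inverse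
    ((contDiff_fst.prodMk hdsm).smoothNear q₀) f' hH
  have hH0 : (q₀.1, d q₀) = (p₀, 0) := by simp [q₀, hconst]
  rw [hH0] at hg hg0 hgr
  have hin : SmoothNear (fun p : Λ × E × ℝ => (p, (0 : C(UnitIcc, E)))) p₀ :=
    ContDiff.smoothNear (by fun_prop) _
  have key : ∀ᶠ p in 𝓝 p₀, ((g (p, 0)).1, d (g (p, 0))) = (p, 0) :=
    hin.continuousAt.eventually hgr
  refine ⟨fun p => (g (p, 0)).2, (hg.comp_of_eq hin rfl).snd, by simp [hg0, q₀], ?_, ?_⟩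
  · filter_upwards [key] with p hp
    rw [Prod.mk.injEq] at hp
    have : (p, (g (p, 0)).2) = g (p, 0) := Prod.ext hp.1.symm rfl
    rw [this]; exact hp.2
  · filter_upwards [hgl] with q hq hq0
    have hq' : g (q.1, d q) = q := hq
    rw [hq0] at hq'
    simp only [hq']

omit [NormedSpace ℝ Λ] [FiniteDimensional ℝ Λ] [FiniteDimensional ℝ E] in
theorem integralDefect_eq_zero_iff {v : Λ × E × ℝ → E} (hv : Continuous v) (p : Λ × E × ℝ)
    (u : C(UnitIcc, E)) : integralDefect v hv (p, u) = 0 ↔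
      ∀ σ : UnitIcc, u σ = p.2.1 +
        p.2.2 • ∫ r in (0 : ℝ)..σ, v (p.1, extendPath u r, p.2.2 * projIcc (-1) 1 neg_one_le_one' r) := by
  rw [integralDefect, sub_sub, sub_eq_zero, ContinuousMap.ext_iff]
  rfl

/-- Time-dependent vector fields that depend smoothly on a parameter and vanish at the parameter
`l₀` have a flow, defined for any given time near `l₀`, that is smooth in all variables. -/
theorem exists_smooth_flow {v : Λ × E × ℝ → E} (hv : ContDiff ℝ ∞ v) {l₀ : Λ}
    (hv0 : ∀ z s, v (l₀, z, s) = 0) (z₀ : E) {S : ℝ} (hS : 0 < S) :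
    ∃ y : Λ × E × ℝ → E, ∀ s₀ ∈ Ioo (-S) S, SmoothNear y (l₀, z₀, s₀) ∧
      ∀ᶠ p in 𝓝 (l₀, z₀, s₀), y (p.1, p.2.1, 0) = p.2.1 ∧ (p.1 = l₀ → y p = p.2.1) ∧
        HasDerivAt (fun s => y (p.1, p.2.1, s)) (v (p.1, y p, p.2.2)) p.2.2 := by
  obtain ⟨U, hU, hU0, hUe, hUu⟩ := exists_smooth_integral_solution hv hv0 z₀ S
  set y : Λ × E × ℝ → E := fun p => extendPath (U (p.1, p.2.1, S)) (p.2.2 / S) with hy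
  have hcS : ∀ s₀ : ℝ, ContinuousAt (fun p : Λ × E × ℝ => ((p.1, p.2.1, S) : Λ × E × ℝ))
      (l₀, z₀, s₀) := fun s₀ => by fun_prop
  have hsol : ∀ s₀ : ℝ, ∀ᶠ p in 𝓝 (l₀, z₀, s₀), ∀ σ : UnitIcc, U (p.1, p.2.1, S) σ = p.2.1 +
      S • ∫ r in (0 : ℝ)..σ, v (p.1, extendPath (U (p.1, p.2.1, S)) r,
        S * projIcc (-1) 1 neg_one_le_one' r) := by
    intro s₀
    filter_upwards [(hcS s₀).eventually hUe] with p hp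
    exact (integralDefect_eq_zero_iff hv.continuous _ _).1 hp
  refine ⟨y, fun s₀ hs₀ => ⟨?_, ?_⟩⟩
  · obtain ⟨U', hU', -, -, hUu'⟩ := exists_smooth_integral_solution hv hv0 z₀ s₀
    have hIoo : ∀ᶠ p : Λ × E × ℝ in 𝓝 (l₀, z₀, s₀), p.2.2 ∈ Ioo (-S) S := by
      have : ContinuousAt (fun p : Λ × E × ℝ => p.2.2) (l₀, z₀, s₀) := by fun_prop
      exact this.eventually (isOpen_Ioo.mem_nhds hs₀)
    -- the rescaled path
    set R : Λ × E × ℝ → C(UnitIcc, E) := fun p =>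
      ⟨fun σ => extendPath (U (p.1, p.2.1, S)) (p.2.2 / S * σ),
        (continuous_extendPath _).comp (by fun_prop)⟩ with hR
    have hRlim : Tendsto R (𝓝 (l₀, z₀, s₀)) (𝓝 (constPath E z₀)) := by
      have h1 : Tendsto (fun p : Λ × E × ℝ => U (p.1, p.2.1, S)) (𝓝 (l₀, z₀, s₀))
          (𝓝 (constPath E z₀)) := by
        have := hU.continuousAt.tendsto.comp (hcS s₀).tendsto
        rwa [hU0] at this
      rw [tendsto_iff_norm_sub_tendsto_zero] at h1 ⊢
      refine squeeze_zero (fun _ => norm_nonneg _) (fun p => ?_) h1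
      refine (ContinuousMap.norm_le _ (norm_nonneg _)).2 fun σ => ?_
      exact (U (p.1, p.2.1, S) - constPath E z₀).norm_coe_le_norm _
    have hev : ∀ᶠ p in 𝓝 (l₀, z₀, s₀), U' p = R p := by
      have h2 : Tendsto (fun p => (p, R p)) (𝓝 (l₀, z₀, s₀))
          (𝓝 ((l₀, z₀, s₀), constPath E z₀)) := by
        exact (tendsto_id.prodMk hRlim).trans_eq nhds_prod_eq.symm
      filter_upwards [h2.eventually hUu', hsol s₀, hIoo] with p hp hps hpI
      refine hp ((integralDefect_eq_zero_iff hv.continuous _ _).2 fun σ => ?_)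
      have hbound : ∀ τ : ℝ, |τ| ≤ 1 → p.2.2 / S * τ ∈ Icc (-1 : ℝ) 1 := by
        intro τ hτ
        rw [mem_Icc, ← abs_le, abs_mul, abs_div, abs_of_pos hS]
        have : |p.2.2| / S ≤ 1 := by
          rw [div_le_one hS, abs_le]; exact ⟨hpI.1.le, hpI.2.le⟩
        calc |p.2.2| / S * |τ| ≤ 1 * 1 := by gcongr
          _ = 1 := one_mul 1
      have hσ : |(σ : ℝ)| ≤ 1 := abs_le.2 σ.2
      have e1 : R p σ = U (p.1, p.2.1, S) ⟨p.2.2 / S * σ, hbound _ hσ⟩ := by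
        simp only [R, extendPath, ContinuousMap.coe_mk]
        congr 1
        exact projIcc_of_mem _ (hbound _ hσ)
      rw [e1, hps]
      congr 1
      set F : ℝ → E := fun r => v (p.1, extendPath (U (p.1, p.2.1, S)) r,
        S * projIcc (-1) 1 neg_one_le_one' r) with hF
      have e2 : ∀ r ∈ uIcc (0 : ℝ) σ, v (p.1, extendPath (R p) r,
          p.2.2 * projIcc (-1) 1 neg_one_le_one' r) = F (p.2.2 / S * r) := by
        intro r hr
        have hr1 : |r| ≤ 1 := by
          have := abs_sub_left_of_mem_uIcc hr
          simp only [sub_zero] at this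
          exact this.trans hσ
        have hrI : r ∈ Icc (-1 : ℝ) 1 := abs_le.1 hr1
        simp only [hF]
        have a1 : extendPath (R p) r = extendPath (U (p.1, p.2.1, S)) (p.2.2 / S * r) := by
          simp only [extendPath, R, ContinuousMap.coe_mk, projIcc_of_mem _ hrI]
        have a2 : p.2.2 * (projIcc (-1) 1 neg_one_le_one' r : ℝ) =
            S * projIcc (-1) 1 neg_one_le_one' (p.2.2 / S * r) := by
          rw [projIcc_of_mem _ hrI, projIcc_of_mem _ (hbound r hr1)]
          field_simp
        rw [a1, a2]
      rw [intervalIntegral.integral_congr e2]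
      have e3 := intervalIntegral.smul_integral_comp_mul_left (a := 0) (b := (σ : ℝ)) F (p.2.2 / S)
      rw [mul_zero] at e3
      have e4 : ∀ w : E, p.2.2 • w = S • (p.2.2 / S) • w := fun w => by
        rw [smul_smul, mul_div_cancel₀ _ hS.ne']
      rw [e4, e3]
    have hfin : SmoothNear (fun p => U' p ⟨1, by norm_num⟩) (l₀, z₀, s₀) := by
      have : ContDiff ℝ ∞ (fun w : C(UnitIcc, E) => w ⟨1, by norm_num⟩) :=
        (ContinuousMap.evalCLM ℝ (⟨1, by norm_num⟩ : UnitIcc) : C(UnitIcc, E) →L[ℝ] E).contDiff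
      exact (this.smoothNear _).comp hU'
    refine hfin.congr ?_
    filter_upwards [hev] with p hp
    rw [hp]
    simp [R, y]
  · have hIoo : ∀ᶠ p : Λ × E × ℝ in 𝓝 (l₀, z₀, s₀), p.2.2 ∈ Ioo (-S) S := by
      have : ContinuousAt (fun p : Λ × E × ℝ => p.2.2) (l₀, z₀, s₀) := by fun_prop
      exact this.eventually (isOpen_Ioo.mem_nhds hs₀)
    have hUc : ∀ᶠ p : Λ × E × ℝ in 𝓝 (l₀, z₀, s₀),
        p.1 = l₀ → U (l₀, p.2.1, S) = constPath E p.2.1 := by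
      have h2 : ContinuousAt (fun p : Λ × E × ℝ =>
          (((l₀, p.2.1, S) : Λ × E × ℝ), constPath E p.2.1)) (l₀, z₀, s₀) := by fun_prop
      filter_upwards [h2.eventually hUu] with p hp _
      refine hp ((integralDefect_eq_zero_iff hv.continuous _ _).2 fun σ => ?_)
      simp [hv0]
    filter_upwards [hsol s₀, hIoo, hUc] with p hp hpI hpc
    have hy' : ∀ s ∈ Icc (-S) S, y (p.1, p.2.1, s) = p.2.1 + S • ∫ r in (0 : ℝ)..(s / S),
        v (p.1, extendPath (U (p.1, p.2.1, S)) r, S * projIcc (-1) 1 neg_one_le_one' r) := by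
      intro s hs
      have hsS : s / S ∈ Icc (-1 : ℝ) 1 := by
        rw [mem_Icc, le_div_iff₀ hS, div_le_one hS]; constructor <;> linarith [hs.1, hs.2]
      simp only [y, extendPath, projIcc_of_mem _ hsS]
      rw [hp ⟨s / S, hsS⟩]; rfl
    refine ⟨by simpa using hy' 0 ⟨by linarith, hS.le⟩, fun h => ?_, ?_⟩
    · simp only [y, extendPath]
      rw [h, hpc h]; rfl
    · set F : ℝ → E := fun r => v (p.1, extendPath (U (p.1, p.2.1, S)) r,
        S * projIcc (-1) 1 neg_one_le_one' r) with hF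
      have hFc : Continuous F := by
        have h1 := continuous_extendPath (U (p.1, p.2.1, S))
        have h2 : Continuous (fun r => ((projIcc (-1) 1 neg_one_le_one' r : UnitIcc) : ℝ)) :=
          continuous_subtype_val.comp continuous_projIcc
        exact hv.continuous.comp (by fun_prop)
      have hd : HasDerivAt (fun s => p.2.1 + S • ∫ r in (0 : ℝ)..(s / S), F r)
          (S • ((1 / S) • F (p.2.2 / S))) p.2.2 := by
        have h1 := intervalIntegral.integral_hasDerivAt_right
          (hFc.intervalIntegrable 0 (p.2.2 / S)) (hFc.stronglyMeasurableAtFilter _ _) hFc.continuousAt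
        have h2 : HasDerivAt (fun s : ℝ => s / S) (1 / S) p.2.2 := (hasDerivAt_id _).div_const S
        have h3 := h1.scomp p.2.2 h2
        exact (h3.const_smul S).const_add _
      have hval : S • ((1 / S) • F (p.2.2 / S)) = v (p.1, y p, p.2.2) := by
        rw [smul_smul, mul_one_div_cancel hS.ne', one_smul]
        have hsS : p.2.2 / S ∈ Icc (-1 : ℝ) 1 := by
          rw [mem_Icc, le_div_iff₀ hS, div_le_one hS]; constructor <;> linarith [hpI.1, hpI.2]
        simp only [hF, y, projIcc_of_mem _ hsS]
        rw [mul_div_cancel₀ _ hS.ne']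
      rw [hval] at hd
      refine hd.congr_of_eventuallyEq ?_
      filter_upwards [isOpen_Ioo.mem_nhds hpI] with s hs
      exact hy' s ⟨hs.1.le, hs.2.le⟩

end Flow

/-! ### Local inverses, cutoffs and first integrals -/

section Calculus

variable {E F G : Type*} [NormedAddCommGroup E] [NormedSpace ℝ E] [NormedAddCommGroup F]
  [NormedSpace ℝ F] [NormedAddCommGroup G] [NormedSpace ℝ G]

theorem fderiv_fst_apply {f : E → F × G} {x : E} (hf : DifferentiableAt ℝ f x) (v : E) :
    fderiv ℝ (fun y => (f y).1) x v = (fderiv ℝ f x v).1 := by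
  rw [hf.hasFDerivAt.fst.fderiv]; rfl

theorem fderiv_snd_apply {f : E → F × G} {x : E} (hf : DifferentiableAt ℝ f x) (v : E) :
    fderiv ℝ (fun y => (f y).2) x v = (fderiv ℝ f x v).2 := by
  rw [hf.hasFDerivAt.snd.fderiv]; rfl

theorem fderiv_prodMk_apply {f : E → F} {g : E → G} {x : E} (hf : DifferentiableAt ℝ f x)
    (hg : DifferentiableAt ℝ g x) (v : E) :
    fderiv ℝ (fun y => (f y, g y)) x v = (fderiv ℝ f x v, fderiv ℝ g x v) := by
  rw [(hf.hasFDerivAt.prodMk hg.hasFDerivAt).fderiv]; rfl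

theorem fderiv_comp_apply' {g : F → G} {f : E → F} {x : E} (hg : DifferentiableAt ℝ g (f x))
    (hf : DifferentiableAt ℝ f x) (v : E) :
    fderiv ℝ (fun y => g (f y)) x v = fderiv ℝ g (f x) (fderiv ℝ f x v) := by
  rw [HasFDerivAt.fderiv (f := fun y => g (f y)) (hg.hasFDerivAt.comp x hf.hasFDerivAt)]; rfl

theorem fderiv_fderiv_apply {φ : E → F} {x : E} (hφ : ContDiffAt ℝ ∞ φ x) {V : E → E}
    (hV : DifferentiableAt ℝ V x) (u : E) :
    fderiv ℝ (fun q => fderiv ℝ φ q (V q)) x u =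
      fderiv ℝ (fderiv ℝ φ) x u (V x) + fderiv ℝ φ x (fderiv ℝ V x u) := by
  have h1 : DifferentiableAt ℝ (fderiv ℝ φ) x :=
    (hφ.fderiv_right (m := ∞) (by simp)).diffAt
  rw [(h1.hasFDerivAt.clm_apply hV.hasFDerivAt).fderiv]
  simp [add_comm]

theorem two_le_infty : (2 : WithTop ℕ∞) ≤ ∞ := by
  have : ((2 : ℕ∞) : WithTop ℕ∞) ≤ ((⊤ : ℕ∞) : WithTop ℕ∞) := WithTop.coe_le_coe.2 le_top
  exact this

/-- The derivative along a Lie bracket. -/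
theorem fderiv_bracket {φ : E → F} {x : E} (hφ : ContDiffAt ℝ ∞ φ x) {U V : E → E}
    (hU : DifferentiableAt ℝ U x) (hV : DifferentiableAt ℝ V x) :
    fderiv ℝ (fun q => fderiv ℝ φ q (V q)) x (U x) -
      fderiv ℝ (fun q => fderiv ℝ φ q (U q)) x (V x) =
      fderiv ℝ φ x (fderiv ℝ V x (U x) - fderiv ℝ U x (V x)) := by
  have hs : IsSymmSndFDerivAt ℝ φ x := hφ.isSymmSndFDerivAt (by
    rw [minSmoothness_of_isRCLikeNormedField]; exact two_le_infty)
  rw [fderiv_fderiv_apply hφ hV, fderiv_fderiv_apply hφ hU, map_sub, hs.eq]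
  abel

theorem bijective_of_injective [FiniteDimensional ℝ E] {A : E →L[ℝ] E}
    (hA : Function.Injective A) : Function.Bijective A :=
  ⟨hA, (LinearMap.injective_iff_surjective (f := A.toLinearMap)).1 hA⟩

theorem SmoothNear.exists_local_inverse_of_bijective [FiniteDimensional ℝ E] {f : E → F} {x : E}
    (hf : SmoothNear f x) (hb : Function.Bijective (fderiv ℝ f x)) :
    ∃ g : F → E, SmoothNear g (f x) ∧ g (f x) = x ∧ (∀ᶠ y in 𝓝 x, g (f y) = y) ∧
      ∀ᶠ z in 𝓝 (f x), f (g z) = z := by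
  have := FiniteDimensional.complete ℝ E
  have e := LinearEquiv.ofBijective (fderiv ℝ f x : E →ₗ[ℝ] F) hb
  have : FiniteDimensional ℝ F := e.finiteDimensional
  refine hf.exists_local_inverse
    (LinearEquiv.ofBijective (fderiv ℝ f x : E →ₗ[ℝ] F) hb).toContinuousLinearEquiv ?_
  exact hf.hasFDerivAt.congr_fderiv (by ext; rfl)

/-- A smooth map that is the identity on a compact set, with invertible differentials there, has a
smooth inverse near this compact set. -/
theorem exists_inverse_near_compact [FiniteDimensional ℝ E] {f : E → E} {K : Set E}
    (hK : IsCompact K) (hf : ∀ x ∈ K, SmoothNear f x) (hid : ∀ x ∈ K, f x = x)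
    (hb : ∀ x ∈ K, Function.Bijective (fderiv ℝ f x)) :
    ∃ g : E → E, ∀ x ∈ K, SmoothNear g x ∧ (∀ᶠ y in 𝓝 x, g (f y) = y) ∧
      ∀ᶠ y in 𝓝 x, f (g y) = y := by
  obtain ⟨W, hW, hinj⟩ := Set.InjOn.exists_mem_nhdsSet (f := f) (s := K)
    (fun x hx y hy h => by rwa [hid x hx, hid y hy] at h) hK (fun x hx => (hf x hx).continuousAt)
    (fun x hx => by
      obtain ⟨g, -, -, hg, -⟩ := (hf x hx).exists_local_inverse_of_bijective (hb x hx)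
      exact ⟨_, hg, fun y hy z hz h => by
        have h1 : g (f y) = y := hy
        have h2 : g (f z) = z := hz
        rw [← h1, h, h2]⟩)
  rw [mem_nhdsSet_iff_forall] at hW
  refine ⟨fun y => Function.invFunOn f W y, fun x hx => ?_⟩
  obtain ⟨g, hg, hg0, hgl, hgr⟩ := (hf x hx).exists_local_inverse_of_bijective (hb x hx)
  rw [hid x hx] at hg hg0 hgr
  have hgW : ∀ᶠ y in 𝓝 x, g y ∈ W := by
    apply hg.continuousAt.eventually
    rw [hg0]; exact hW x hx
  have heq : ∀ᶠ y in 𝓝 x, Function.invFunOn f W y = g y := by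
    filter_upwards [hgW, hgr] with y h1 h2
    have hex : ∃ a ∈ W, f a = y := ⟨g y, h1, h2⟩
    exact hinj (Function.invFunOn_mem hex) h1 ((Function.invFunOn_eq hex).trans h2.symm)
  refine ⟨hg.congr heq, ?_, ?_⟩
  · have hfc : Tendsto f (𝓝 x) (𝓝 x) := by
      have := (hf x hx).continuousAt.tendsto
      rwa [hid x hx] at this
    filter_upwards [hfc.eventually heq, hgl] with y h1 h2
    rw [h1, h2]
  · filter_upwards [heq, hgr] with y h1 h2
    rw [h1, h2]

/-- Cutoff functions near a compact set. -/
theorem exists_cutoff_near_compact [FiniteDimensional ℝ E] {K : Set E} (hK : IsCompact K)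
    {P : E → Prop} (hP : ∀ᶠ y in 𝓝ˢ K, P y) :
    ∃ c : E → ℝ, ContDiff ℝ ∞ c ∧ (∀ᶠ y in 𝓝ˢ K, c y = 1) ∧ ∀ y ∈ tsupport c, P y := by
  rw [Filter.Eventually, mem_nhdsSet_iff_exists] at hP
  obtain ⟨O, hO, hKO, hOP⟩ := hP
  have : ProperSpace E := FiniteDimensional.proper ℝ E
  obtain ⟨L, hL, hKL, hLO⟩ := exists_compact_between hK hO hKO
  obtain ⟨c, hc1, hc2, -⟩ := exists_contMDiffMap_one_nhds_of_subset_interior 𝓘(ℝ, E) (n := ⊤)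
    hK.isClosed hKL
  refine ⟨c, contMDiff_iff_contDiff.1 c.contMDiff, hc1, fun y hy => hOP (hLO ?_)⟩
  have : tsupport (c : E → ℝ) ⊆ L := closure_minimal (fun z hz => by
    by_contra h; exact hz (hc2 z h)) hL.isClosed
  exact this hy

theorem contDiff_cutoff_smul {c : E → ℝ} {f : E → F} (hc : ContDiff ℝ ∞ c)
    (h : ∀ y ∈ tsupport c, ContDiffAt ℝ ∞ f y) : ContDiff ℝ ∞ (fun y => c y • f y) := by
  rw [contDiff_iff_contDiffAt]
  intro y
  by_cases hy : y ∈ tsupport c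
  · exact hc.contDiffAt.smul (h y hy)
  · refine (contDiffAt_const (c := (0 : F))).congr_of_eventuallyEq ?_
    filter_upwards [(isClosed_tsupport c).isOpen_compl.mem_nhds hy] with z hz
    rw [image_eq_zero_of_notMem_tsupport hz, zero_smul]

end Calculus

section FirstIntegrals

variable {E : Type} [NormedAddCommGroup E] [NormedSpace ℝ E] [FiniteDimensional ℝ E]

theorem exists_local_flow {a : ℝ × E × ℝ → E} (ha : SmoothNear a 0) :
    ∃ U : ℝ × E × ℝ → E, SmoothNear U 0 ∧ ∀ᶠ p in 𝓝 (0 : ℝ × E × ℝ), U (p.1, p.2.1, 0) = p.2.1 ∧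
      HasDerivAt (fun s => U (p.1, p.2.1, s)) (a (p.1, U p, p.2.2)) p.2.2 := by
  have := FiniteDimensional.complete ℝ E
  obtain ⟨c, hc, hc1, hcs⟩ := exists_cutoff_near_compact (E := ℝ × E × ℝ) (K := {0})
    isCompact_singleton (P := fun y => ContDiffAt ℝ ∞ a y) (by rw [nhdsSet_singleton]; exact ha)
  rw [nhdsSet_singleton] at hc1
  have hac := contDiff_cutoff_smul hc hcs
  set b : ℝ × E × ℝ → E := fun y => c y • a y with hb
  have hv : ContDiff ℝ ∞ (fun p : (ℝ × ℝ) × E × ℝ => p.1.2 • b (p.1.1, p.2.1, p.1.2 * p.2.2)) :=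
    ContDiff.smul (by fun_prop : ContDiff ℝ ∞ fun p : (ℝ × ℝ) × E × ℝ => p.1.2)
      (hac.comp (by fun_prop : ContDiff ℝ ∞
        fun p : (ℝ × ℝ) × E × ℝ => (p.1.1, p.2.1, p.1.2 * p.2.2)))
  set v : (ℝ × ℝ) × E × ℝ → E := fun p => p.1.2 • b (p.1.1, p.2.1, p.1.2 * p.2.2) with hvdef
  obtain ⟨y, hy⟩ := exists_smooth_flow hv (l₀ := (0, 0)) (fun z s => by simp [hvdef]) (0 : E) one_pos
  obtain ⟨h1, h2⟩ := hy 0 (by simp)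
  have hlim : Tendsto (fun ε : ℝ => (((0 : ℝ), ε), (0 : E), (0 : ℝ))) (𝓝[>] 0)
      (𝓝 (((0 : ℝ), (0 : ℝ)), (0 : E), (0 : ℝ))) := by
    refine Tendsto.mono_left ?_ nhdsWithin_le_nhds
    have : Continuous (fun ε : ℝ => (((0 : ℝ), ε), (0 : E), (0 : ℝ))) := by fun_prop
    exact this.tendsto 0
  obtain ⟨ε, ⟨hε1, hε2⟩, hε⟩ := ((hlim.eventually (h1.eventually.and
    (eventually_eventually_nhds.2 h2))).and self_mem_nhdsWithin).exists
  have hε0 : (0 : ℝ) < ε := hε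
  have hm : ContDiff ℝ ∞ (fun p : ℝ × E × ℝ => (((p.1, ε), p.2.1, p.2.2 / ε) : (ℝ × ℝ) × E × ℝ)) := by
    fun_prop
  have hm0 : (fun p : ℝ × E × ℝ => (((p.1, ε), p.2.1, p.2.2 / ε) : (ℝ × ℝ) × E × ℝ)) 0 =
    ((0, ε), 0, 0) := by simp
  have hU : SmoothNear (fun p : ℝ × E × ℝ => y ((p.1, ε), p.2.1, p.2.2 / ε)) 0 :=
    hε1.comp_of_eq (hm.smoothNear 0) hm0
  have hmt : Tendsto (fun p : ℝ × E × ℝ => (((p.1, ε), p.2.1, p.2.2 / ε) : (ℝ × ℝ) × E × ℝ))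
      (𝓝 0) (𝓝 ((0, ε), 0, 0)) := by
    simpa using hm.continuous.tendsto 0
  have hU0 : y ((0, ε), 0, 0) = 0 := hε2.self_of_nhds.1
  refine ⟨_, hU, ?_⟩
  have hc1' : ∀ᶠ p : ℝ × E × ℝ in 𝓝 0,
      c (p.1, y ((p.1, ε), p.2.1, p.2.2 / ε), p.2.2) = 1 := by
    have h3 : ContinuousAt (fun p : ℝ × E × ℝ => (p.1, y ((p.1, ε), p.2.1, p.2.2 / ε), p.2.2)) 0 :=
      continuousAt_fst.prodMk (hU.continuousAt.prodMk (by fun_prop))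
    have h4 : Tendsto (fun p : ℝ × E × ℝ => (p.1, y ((p.1, ε), p.2.1, p.2.2 / ε), p.2.2)) (𝓝 0)
        (𝓝 0) := by
      have := h3.tendsto
      simp only [Prod.fst_zero, Prod.snd_zero, zero_div, hU0] at this
      exact this
    exact h4.eventually hc1
  filter_upwards [hmt.eventually hε2, hc1'] with p hp hpc
  refine ⟨by simpa using hp.1, ?_⟩
  have h3 := hp.2.2.scomp p.2.2 ((hasDerivAt_id p.2.2).div_const ε)
  have h4 : (1 / ε) • v ((p.1, ε), y ((p.1, ε), p.2.1, p.2.2 / ε), p.2.2 / ε) =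
      a (p.1, y ((p.1, ε), p.2.1, p.2.2 / ε), p.2.2) := by
    simp only [hvdef, hb]
    rw [mul_div_cancel₀ _ hε0.ne', hpc, one_smul, smul_smul, one_div_mul_cancel hε0.ne', one_smul]
  rw [← h4]
  exact h3

/-- First integrals of the vector field `∂/∂s + a (t, z, s)`. -/
theorem exists_first_integrals {a : ℝ × E × ℝ → E} (ha : SmoothNear a 0) :
    ∃ X : ℝ × E × ℝ → E, SmoothNear X 0 ∧ ∀ᶠ p in 𝓝 (0 : ℝ × E × ℝ), X (p.1, p.2.1, 0) = p.2.1 ∧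
      fderiv ℝ X p (0, a p, 1) = 0 := by
  obtain ⟨U, hU, hUp⟩ := exists_local_flow ha
  have hH : SmoothNear (fun p : ℝ × E × ℝ => (p.1, U p, p.2.2)) 0 :=
    (contDiff_fst.smoothNear _).prodMk (hU.prodMk (ContDiff.smoothNear (by fun_prop) _))
  set H : ℝ × E × ℝ → ℝ × E × ℝ := fun p => (p.1, U p, p.2.2) with hHdef
  have hU0 : U 0 = 0 := hUp.self_of_nhds.1
  have hH0 : H 0 = 0 := by simp [H, hU0]
  have hfd : ∀ p : ℝ × E × ℝ, DifferentiableAt ℝ U p → ∀ w,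
      fderiv ℝ H p w = (w.1, fderiv ℝ U p w, w.2.2) := by
    intro p hp w
    have := (hasFDerivAt_fst (𝕜 := ℝ) (p := p)).prodMk
      (hp.hasFDerivAt.prodMk (hasFDerivAt_snd (𝕜 := ℝ) (p := p)).snd)
    rw [HasFDerivAt.fderiv (f := H) this]
    rfl
  have hslice : ∀ᶠ p : ℝ × E × ℝ in 𝓝 0, U (p.1, p.2.1, 0) = p.2.1 := hUp.mono fun p hp => hp.1
  have hUz : ∀ t z, fderiv ℝ U 0 (t, z, 0) = z := by
    intro t z
    have hπ : DifferentiableAt ℝ (fun p : ℝ × E × ℝ => ((p.1, p.2.1, 0) : ℝ × E × ℝ)) 0 := by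
      fun_prop
    have h1 : fderiv ℝ (fun p : ℝ × E × ℝ => U (p.1, p.2.1, 0)) 0 (t, z, 0) = z := by
      rw [Filter.EventuallyEq.fderiv_eq (𝕜 := ℝ)
        (show (fun p : ℝ × E × ℝ => U (p.1, p.2.1, 0)) =ᶠ[𝓝 0] fun p => p.2.1 from hslice)]
      have : HasFDerivAt (fun p : ℝ × E × ℝ => p.2.1) _ 0 :=
        (hasFDerivAt_snd (𝕜 := ℝ) (p := (0 : ℝ × E × ℝ))).fst
      rw [this.fderiv]; rfl
    rw [fderiv_comp_apply' (g := U) (f := fun p : ℝ × E × ℝ => ((p.1, p.2.1, 0) : ℝ × E × ℝ))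
      hU.differentiableAt hπ] at h1
    have h2 : HasFDerivAt (fun p : ℝ × E × ℝ => ((p.1, p.2.1, 0) : ℝ × E × ℝ)) _ 0 :=
      (hasFDerivAt_fst (𝕜 := ℝ) (p := (0 : ℝ × E × ℝ))).prodMk
        ((hasFDerivAt_snd (𝕜 := ℝ) (p := (0 : ℝ × E × ℝ))).fst.prodMk
          (hasFDerivAt_const (0 : ℝ) _))
    rw [h2.fderiv] at h1
    exact h1
  have hinj : Function.Injective (fderiv ℝ H 0) := by
    rw [injective_iff_map_eq_zero]
    rintro ⟨t, z, s⟩ hw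
    rw [hfd 0 hU.differentiableAt] at hw
    simp only [Prod.mk_eq_zero] at hw
    obtain ⟨ht, hz, hs⟩ := hw
    subst ht hs
    rw [hUz] at hz
    rw [hz]; rfl
  obtain ⟨g, hg, hg0, hgl, hgr⟩ := hH.exists_local_inverse_of_bijective
    (bijective_of_injective hinj)
  rw [hH0] at hg hg0 hgr
  have hgt : Tendsto g (𝓝 0) (𝓝 0) := by
    have := hg.continuousAt.tendsto; rwa [hg0] at this
  refine ⟨fun p => (g p).2.1, hg.snd.fst, ?_⟩
  have hπ : Tendsto (fun p : ℝ × E × ℝ => ((p.1, p.2.1, 0) : ℝ × E × ℝ)) (𝓝 0) (𝓝 0) := by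
    have : Continuous (fun p : ℝ × E × ℝ => ((p.1, p.2.1, 0) : ℝ × E × ℝ)) := by fun_prop
    exact this.tendsto 0
  filter_upwards [hπ.eventually hgl, hslice, hgr, hgt.eventually (hgl.eventually_nhds),
    hgt.eventually hU, hgt.eventually hUp, hg] with p h1 h2 h3 h4 h5 h6 h7
  constructor
  · have : H (p.1, p.2.1, 0) = (p.1, p.2.1, 0) := by simp [H, h2]
    rw [this] at h1
    rw [h1]
  · have hUd : DifferentiableAt ℝ U (g p) := h5.diffAt
    have hgd : DifferentiableAt ℝ g p := h7.diffAt
    have hHd : DifferentiableAt ℝ H (g p) :=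
      differentiableAt_fst.prodMk (hUd.prodMk differentiableAt_snd.snd)
    have e1 : fderiv ℝ H (g p) (0, 0, 1) = (0, a p, 1) := by
      rw [hfd _ hUd]
      have h8 : HasDerivAt (fun s => U ((g p).1, (g p).2.1, s))
          (fderiv ℝ U (g p) (0, 0, 1)) (g p).2.2 := by
        have h9 : HasDerivAt (fun s : ℝ => (((g p).1, (g p).2.1, s) : ℝ × E × ℝ)) (0, 0, 1)
            (g p).2.2 :=
          (hasDerivAt_const _ _).prodMk ((hasDerivAt_const _ _).prodMk (hasDerivAt_id _))
        exact hUd.hasFDerivAt.comp_hasDerivAt (g p).2.2 h9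
      rw [h8.unique h6.2]
      have : ((g p).1, U (g p), (g p).2.2) = p := h3
      rw [this]
    have e2 : fderiv ℝ (fun q => g (H q)) (g p) (0, 0, 1) = (0, 0, 1) := by
      rw [Filter.EventuallyEq.fderiv_eq (f := fun q => q) h4]
      simp
    rw [fderiv_comp_apply' (by rw [h3]; exact hgd) hHd, e1, h3] at e2
    have : fderiv ℝ (fun p => (g p).2.1) p (0, a p, 1) = (fderiv ℝ g p (0, a p, 1)).2.1 := by
      rw [fderiv_fst_apply (f := fun p => (g p).2) hgd.snd, fderiv_snd_apply hgd]
    rw [this, e2]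

end FirstIntegrals

/-! ### Straightening a pair of vector fields that spans a contact structure -/

section Straighten

variable {E : Type*} [NormedAddCommGroup E] [NormedSpace ℝ E]

/-- At the point `q = (t, e)`, the map `κ t` takes the direction of `A t` to that of `∂/∂p`, and the
direction of `B t` to one of the form `(1, p, *)`. -/
def Straightens (κ : ℝ × E → Jet) (A B : ℝ × E → E) (q : ℝ × E) : Prop :=
  (fderiv ℝ κ q (0, A q)).1 = 0 ∧ (fderiv ℝ κ q (0, A q)).2.1 = 0 ∧
    0 < (fderiv ℝ κ q (0, A q)).2.2 ∧ 0 < (fderiv ℝ κ q (0, B q)).1 ∧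
    (fderiv ℝ κ q (0, B q)).2.1 = (κ q).2.2 * (fderiv ℝ κ q (0, B q)).1

/-- The identification of `(t, x, y, p)` with `(t, (x, y), p)`. -/
def regroup : TJet →L[ℝ] ℝ × (ℝ × ℝ) × ℝ :=
  LinearMap.toContinuousLinearMap
    { toFun := fun q => (q.1, (q.2.1, q.2.2.1), q.2.2.2)
      map_add' := fun _ _ => rfl
      map_smul' := fun _ _ => rfl }

@[simp] theorem regroup_apply (q : TJet) : regroup q = (q.1, (q.2.1, q.2.2.1), q.2.2.2) := rfl

theorem exists_straightening_of_adapted {A B : TJet → Jet} (hA : SmoothNear A 0)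
    (hB : SmoothNear B 0) (hA1 : (A 0).1 = 0) (hA2 : (A 0).2.1 = 0) (hA3 : 0 < (A 0).2.2)
    (hB1 : 0 < (B 0).1) (hB2 : (B 0).2.1 = 0)
    (hbr : 0 < (fderiv ℝ B 0 (0, A 0) - fderiv ℝ A 0 (0, B 0)).2.1) :
    ∃ κ : TJet → Jet, SmoothNear κ 0 ∧ κ 0 = 0 ∧
      Function.Injective (fun v => fderiv ℝ κ 0 (0, v)) ∧
      (∀ᶠ q in 𝓝 (0 : TJet), (κ (q.1, q.2.1, q.2.2.1, 0)).1 = q.2.1 ∧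
        (κ (q.1, q.2.1, q.2.2.1, 0)).2.1 = q.2.2.1) ∧
      ∀ᶠ q in 𝓝 (0 : TJet), Straightens κ A B q := by
  have hA3' : ∀ᶠ q in 𝓝 (0 : TJet), 0 < (A q).2.2 :=
    hA.snd.snd.continuousAt.eventually (lt_mem_nhds hA3)
  -- the slopes of `A`, in the regrouped coordinates
  have hinv : SmoothNear (fun r : ℝ × (ℝ × ℝ) × ℝ => ((r.1, r.2.1.1, r.2.1.2, r.2.2) : TJet)) 0 :=
    ContDiff.smoothNear (by fun_prop) _
  have hA' := hA.comp_of_eq hinv rfl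
  obtain ⟨X, hX, hXp⟩ := exists_first_integrals (E := ℝ × ℝ)
    (a := fun r => ((A (r.1, r.2.1.1, r.2.1.2, r.2.2)).1 / (A (r.1, r.2.1.1, r.2.1.2, r.2.2)).2.2,
      (A (r.1, r.2.1.1, r.2.1.2, r.2.2)).2.1 / (A (r.1, r.2.1.1, r.2.1.2, r.2.2)).2.2))
    ((hA'.fst.div hA'.snd.snd hA3.ne').prodMk (hA'.snd.fst.div hA'.snd.snd hA3.ne'))
  have hreg : Tendsto regroup (𝓝 0) (𝓝 0) := by
    have := regroup.continuous.tendsto 0; rwa [map_zero] at this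
  set Z : TJet → ℝ × ℝ := fun q => X (regroup q) with hZdef
  have hZ : SmoothNear Z 0 := hX.comp_of_eq (regroup.contDiff.smoothNear 0) (map_zero _)
  have hZslice : ∀ᶠ q in 𝓝 (0 : TJet), Z (q.1, q.2.1, q.2.2.1, 0) = (q.2.1, q.2.2.1) := by
    filter_upwards [hreg.eventually hXp] with q hq using hq.1
  have hZA : ∀ᶠ q in 𝓝 (0 : TJet), fderiv ℝ Z q (0, A q) = 0 := by
    filter_upwards [hreg.eventually hXp, hA3', hreg.eventually hX] with q hq hq3 hqX
    have hd : DifferentiableAt ℝ X (regroup q) := hqX.diffAt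
    rw [fderiv_comp_apply' hd regroup.differentiableAt, regroup.fderiv]
    have : regroup (0, A q) = (A q).2.2 •
        ((0, ((A q).1 / (A q).2.2, (A q).2.1 / (A q).2.2), 1) : ℝ × (ℝ × ℝ) × ℝ) := by
      simp only [regroup_apply, Prod.smul_mk, smul_eq_mul, mul_zero, mul_one]
      rw [mul_div_cancel₀ _ hq3.ne', mul_div_cancel₀ _ hq3.ne']
    rw [this, map_smul]
    have h2 := hq.2
    simp only [regroup_apply] at h2 ⊢
    rw [h2, smul_zero]
  -- the differential of `Z` at the origin
  have hA0 : A 0 = (A 0).2.2 • ((0, 0, 1) : Jet) := by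
    refine Prod.ext ?_ (Prod.ext ?_ ?_) <;> simp [hA1, hA2]
  have hZ0 : ∀ v : Jet, fderiv ℝ Z 0 (0, v) = (v.1, v.2.1) := by
    intro v
    have h1 : fderiv ℝ Z 0 (0, (0, 0, 1)) = 0 := by
      have h2 := hZA.self_of_nhds
      rw [hA0] at h2
      have : ((0 : ℝ), (A 0).2.2 • ((0, 0, 1) : Jet)) =
        (A 0).2.2 • ((0, 0, 0, 1) : TJet) := by simp
      rw [this, map_smul] at h2
      exact (smul_eq_zero.1 h2).resolve_left hA3.ne'
    have hπ : HasFDerivAt (fun q : TJet => ((q.1, q.2.1, q.2.2.1, 0) : TJet)) _ 0 :=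
      (hasFDerivAt_fst (𝕜 := ℝ) (p := (0 : TJet))).prodMk
        ((hasFDerivAt_snd (𝕜 := ℝ) (p := (0 : TJet))).fst.prodMk
          ((hasFDerivAt_snd (𝕜 := ℝ) (p := (0 : TJet))).snd.fst.prodMk
            (hasFDerivAt_const (0 : ℝ) _)))
    have hρ : HasFDerivAt (fun q : TJet => ((q.2.1, q.2.2.1) : ℝ × ℝ)) _ 0 :=
      (hasFDerivAt_snd (𝕜 := ℝ) (p := (0 : TJet))).fst.prodMk
        (hasFDerivAt_snd (𝕜 := ℝ) (p := (0 : TJet))).snd.fst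
    have h3 : fderiv ℝ (fun q : TJet => Z (q.1, q.2.1, q.2.2.1, 0)) 0 (0, v) = (v.1, v.2.1) := by
      rw [Filter.EventuallyEq.fderiv_eq (𝕜 := ℝ)
        (show (fun q : TJet => Z (q.1, q.2.1, q.2.2.1, 0)) =ᶠ[𝓝 0]
          fun q => (q.2.1, q.2.2.1) from hZslice), hρ.fderiv]
      rfl
    rw [fderiv_comp_apply' (g := Z) (f := fun q : TJet => ((q.1, q.2.1, q.2.2.1, 0) : TJet))
      hZ.differentiableAt hπ.differentiableAt, hπ.fderiv] at h3
    have h4 : ((0 : ℝ), v) = (0, v.1, v.2.1, 0) + v.2.2 • ((0, 0, 0, 1) : TJet) := by simp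
    rw [h4, map_add, map_smul, h1, smul_zero, add_zero]
    exact h3
  set At : TJet → TJet := fun q => (0, A q) with hAt
  set Bt : TJet → TJet := fun q => (0, B q) with hBt
  have hc0 : SmoothNear (fun _ : TJet => (0 : ℝ)) 0 := contDiff_const.smoothNear _
  have hAts : SmoothNear At 0 := hc0.prodMk hA
  have hBts : SmoothNear Bt 0 := hc0.prodMk hB
  set W : TJet → ℝ × ℝ := fun q => fderiv ℝ Z q (Bt q) with hW
  have hWs : SmoothNear W 0 := hZ.fderiv_apply hBts
  have hW0 : W 0 = ((B 0).1, 0) := by simp [W, Bt, hZ0, hB2]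
  have hWA : fderiv ℝ W 0 (At 0) = ((fderiv ℝ B 0 (0, A 0) - fderiv ℝ A 0 (0, B 0)).1,
      (fderiv ℝ B 0 (0, A 0) - fderiv ℝ A 0 (0, B 0)).2.1) := by
    have h1 := fderiv_bracket hZ.contDiffAt hAts.differentiableAt hBts.differentiableAt
    have h2 : fderiv ℝ (fun q => fderiv ℝ Z q (At q)) 0 (Bt 0) = 0 := by
      rw [Filter.EventuallyEq.fderiv_eq (𝕜 := ℝ)
        (show (fun q => fderiv ℝ Z q (At q)) =ᶠ[𝓝 0] fun _ => 0 from hZA)]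
      simp
    rw [h2, sub_zero] at h1
    have h3 : ∀ {C : TJet → Jet}, DifferentiableAt ℝ C 0 → ∀ w,
        fderiv ℝ (fun q => ((0 : ℝ), C q)) 0 w = (0, fderiv ℝ C 0 w) := by
      intro C hC w
      rw [fderiv_prodMk_apply (differentiableAt_const _) hC]; simp
    rw [h3 hB.differentiableAt, h3 hA.differentiableAt, Prod.mk_sub_mk, sub_zero, hZ0] at h1
    exact h1
  set P : TJet → ℝ := fun q => (W q).2 / (W q).1 with hP
  have hW01 : 0 < (W 0).1 := by rw [hW0]; exact hB1
  have hPs : SmoothNear P 0 := hWs.snd.div hWs.fst hW01.ne'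
  have hPA : 0 < fderiv ℝ P 0 (At 0) := by
    have h1 : fderiv ℝ (fun q => (W q).2) 0 = fderiv ℝ (fun q => P q * (W q).1) 0 := by
      refine Filter.EventuallyEq.fderiv_eq ?_
      filter_upwards [hWs.fst.continuousAt.eventually (lt_mem_nhds hW01)] with q hq
      simp only [P]; rw [div_mul_cancel₀ _ hq.ne']
    have h2 := congrArg (fun L => L (At 0)) h1
    rw [fderiv_snd_apply hWs.differentiableAt, hWA,
      HasFDerivAt.fderiv (f := fun q => P q * (W q).1)
        (hPs.hasFDerivAt.mul hWs.fst.hasFDerivAt)] at h2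
    have hP0 : P 0 = 0 := by simp [P, hW0]
    rw [hP0, zero_smul, zero_add, ContinuousLinearMap.smul_apply, smul_eq_mul] at h2
    simp only at h2
    rw [h2] at hbr
    exact pos_of_mul_pos_right hbr hW01.le
  have hκ : SmoothNear (fun q => ((Z q).1, (Z q).2, P q)) 0 := hZ.fst.prodMk (hZ.snd.prodMk hPs)
  have hfd : ∀ q, DifferentiableAt ℝ Z q → DifferentiableAt ℝ P q → ∀ w,
      fderiv ℝ (fun q => ((Z q).1, (Z q).2, P q)) q w =
        ((fderiv ℝ Z q w).1, (fderiv ℝ Z q w).2, fderiv ℝ P q w) := by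
    intro q h1 h2 w
    rw [fderiv_prodMk_apply h1.fst (h1.snd.prodMk h2), fderiv_prodMk_apply h1.snd h2,
      fderiv_fst_apply h1, fderiv_snd_apply h1]
  refine ⟨_, hκ, ?_, ?_, ?_, ?_⟩
  · have : Z 0 = 0 := hZslice.self_of_nhds
    simp [this, P, hW0]
  · have : Function.Injective ((fderiv ℝ (fun q => ((Z q).1, (Z q).2, P q)) 0).comp
        (ContinuousLinearMap.inr ℝ ℝ Jet)) := by
      rw [injective_iff_map_eq_zero]
      intro v hv
      simp only [ContinuousLinearMap.comp_apply, ContinuousLinearMap.inr_apply] at hv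
      rw [hfd 0 hZ.differentiableAt hPs.differentiableAt, hZ0] at hv
      simp only [Prod.mk_eq_zero] at hv
      obtain ⟨h1, h2, h3⟩ := hv
      have h4 : (A 0).2.2 • ((0 : ℝ), v) = v.2.2 • At 0 := by
        simp only [At]
        rw [hA0]
        refine Prod.ext (by simp) (Prod.ext (by simp [h1]) (Prod.ext (by simp [h2]) ?_))
        simp [mul_comm]
      have h5 := congrArg (fderiv ℝ P 0) h4
      rw [map_smul, map_smul, h3, smul_zero] at h5
      have h6 : v.2.2 = 0 := (smul_eq_zero.1 h5.symm).resolve_right hPA.ne'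
      exact Prod.ext h1 (Prod.ext h2 h6)
    exact this
  · filter_upwards [hZslice] with q hq
    simp only [hq, and_self]
  · filter_upwards [hZA, hZ, hPs, hWs.fst.continuousAt.eventually (lt_mem_nhds hW01),
      (hPs.fderiv_apply hAts).continuousAt.eventually (lt_mem_nhds hPA)] with q h1 h2 h3 h4 h5
    have h2' := h2.differentiableAt (n := ∞) (by simp)
    have h3' := h3.differentiableAt (n := ∞) (by simp)
    refine ⟨?_, ?_, ?_, ?_, ?_⟩
    · rw [hfd q h2' h3', h1]; rfl
    · rw [hfd q h2' h3', h1]; rfl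
    · rw [hfd q h2' h3']; exact h5
    · rw [hfd q h2' h3']; exact h4
    · rw [hfd q h2' h3']
      exact (div_mul_cancel₀ (W q).2 h4.ne').symm

/-- The identification of `ℝ³` with the space of 1-jets by `(p, x, y) ↦ (x, y, p)`. -/
def finThreeEquivJet : (Fin 3 → ℝ) ≃ₗ[ℝ] Jet where
  toFun f := (f 1, f 2, f 0)
  invFun z := ![z.2.2, z.1, z.2.1]
  map_add' _ _ := rfl
  map_smul' _ _ := rfl
  left_inv f := by ext i; fin_cases i <;> rfl
  right_inv _ := rfl

theorem exists_straightening [FiniteDimensional ℝ E] (hE : Module.finrank ℝ E = 3)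
    {A B : ℝ × E → E} {e₀ : E} (hA : SmoothNear A (0, e₀)) (hB : SmoothNear B (0, e₀))
    (hAB : LinearIndependent ℝ ![A (0, e₀), B (0, e₀),
      fderiv ℝ B (0, e₀) (0, A (0, e₀)) - fderiv ℝ A (0, e₀) (0, B (0, e₀))]) :
    ∃ κ : ℝ × E → Jet, SmoothNear κ (0, e₀) ∧ κ (0, e₀) = 0 ∧
      Function.Injective (fun v => fderiv ℝ κ (0, e₀) (0, v)) ∧
      ∀ᶠ q in 𝓝 (0, e₀), Straightens κ A B q := by
  set b := basisOfLinearIndependentOfCardEqFinrank hAB (by simp [hE]) with hb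
  set T : E ≃L[ℝ] Jet := (b.equivFun.trans finThreeEquivJet).toContinuousLinearEquiv with hT
  have hTv : ∀ v, T v = (b.repr v 1, b.repr v 2, b.repr v 0) := fun _ => rfl
  have hTA : T (A (0, e₀)) = (0, 0, 1) := by
    have : A (0, e₀) = b 0 := by simp [hb]
    rw [this]; simp [hTv]
  have hTB : T (B (0, e₀)) = (1, 0, 0) := by
    have : B (0, e₀) = b 1 := by simp [hb]
    rw [this]; simp [hTv]
  have hTC : T (fderiv ℝ B (0, e₀) (0, A (0, e₀)) - fderiv ℝ A (0, e₀) (0, B (0, e₀))) =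
      (0, 1, 0) := by
    have : fderiv ℝ B (0, e₀) (0, A (0, e₀)) - fderiv ℝ A (0, e₀) (0, B (0, e₀)) = b 2 := by
      simp [hb]
    rw [this]; simp [hTv]
  set S : TJet → ℝ × E := fun q => (q.1, e₀ + T.symm q.2) with hS
  have hSs : ∀ q, SmoothNear S q := fun q => ContDiff.smoothNear (by fun_prop) _
  have hS0 : S 0 = (0, e₀) := by simp [S]
  have hSd : ∀ q w, fderiv ℝ S q w = (w.1, T.symm w.2) := by
    intro q w
    have h1 : HasFDerivAt (fun q : TJet => T.symm q.2) _ q :=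
      T.symm.hasFDerivAt.comp q (hasFDerivAt_snd (𝕜 := ℝ) (p := q))
    have := (hasFDerivAt_fst (𝕜 := ℝ) (p := q)).prodMk (h1.const_add e₀)
    rw [HasFDerivAt.fderiv (f := S) this]; rfl
  have key : ∀ {C : ℝ × E → E}, SmoothNear C (0, e₀) → SmoothNear (fun q => T (C (S q))) 0 ∧
      ∀ w, fderiv ℝ (fun q => T (C (S q))) 0 w = T (fderiv ℝ C (0, e₀) (w.1, T.symm w.2)) := by
    intro C hC
    have h1 : SmoothNear (fun q => C (S q)) 0 := hC.comp_of_eq (hSs 0) hS0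
    refine ⟨(T.contDiff.smoothNear _).comp h1, fun w => ?_⟩
    rw [fderiv_comp_apply' T.differentiableAt h1.differentiableAt, T.fderiv,
      fderiv_comp_apply' (by rw [hS0]; exact hC.differentiableAt) (hSs 0).differentiableAt, hSd, hS0]
    rfl
  obtain ⟨hA's, hA'd⟩ := key hA
  obtain ⟨hB's, hB'd⟩ := key hB
  have e1 : T (A (S 0)) = (0, 0, 1) := by rw [hS0, hTA]
  have e2 : T (B (S 0)) = (1, 0, 0) := by rw [hS0, hTB]
  obtain ⟨κ, hκ, hκ0, hκi, -, hκs⟩ := exists_straightening_of_adapted hA's hB's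
    (by simp only [e1]) (by simp only [e1]) (by simp only [e1]; norm_num)
    (by simp only [e2]; norm_num) (by simp only [e2]) (by
      rw [hA'd, hB'd, ← map_sub, e1, e2, ← hTA, ← hTB]
      simp only [ContinuousLinearEquiv.symm_apply_apply]
      rw [hTC]; norm_num)
  set R : ℝ × E → TJet := fun q => (q.1, T (q.2 - e₀)) with hR
  have hRs : ∀ q, SmoothNear R q := fun q => ContDiff.smoothNear (by fun_prop) _
  have hR0 : R (0, e₀) = 0 := by simp [R]
  have hRd : ∀ q w, fderiv ℝ R q w = (w.1, T w.2) := by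
    intro q w
    have h1 : HasFDerivAt (fun q : ℝ × E => T (q.2 - e₀)) _ q :=
      T.hasFDerivAt.comp q ((hasFDerivAt_snd (𝕜 := ℝ) (p := q)).sub_const e₀)
    have := (hasFDerivAt_fst (𝕜 := ℝ) (p := q)).prodMk h1
    rw [HasFDerivAt.fderiv (f := R) this]; rfl
  have hRt : Tendsto R (𝓝 (0, e₀)) (𝓝 0) := by
    have := (hRs (0, e₀)).continuousAt.tendsto; rwa [hR0] at this
  have hSR : ∀ q, S (R q) = q := fun q => by simp [S, R]
  have hkd : ∀ q, DifferentiableAt ℝ κ (R q) → ∀ v,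
      fderiv ℝ (fun q => κ (R q)) q (0, v) = fderiv ℝ κ (R q) (0, T v) := by
    intro q hq v
    rw [fderiv_comp_apply' hq (hRs q).differentiableAt, hRd]
  refine ⟨fun q => κ (R q), hκ.comp_of_eq (hRs _) hR0, by simp [hR0, hκ0], ?_, ?_⟩
  · intro v w hvw
    simp only at hvw
    rw [hkd _ (by rw [hR0]; exact hκ.differentiableAt),
      hkd _ (by rw [hR0]; exact hκ.differentiableAt), hR0] at hvw
    exact T.injective (hκi hvw)
  · filter_upwards [hRt.eventually hκs, hRt.eventually hκ] with q hq hqd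
    have hd : DifferentiableAt ℝ κ (R q) := hqd.diffAt
    simp only [Straightens, hSR] at hq
    unfold Straightens
    rw [hkd q hd, hkd q hd]
    exact hq

end Straighten

/-! ### Jet curves and solutions -/

section Curves

theorem hasDerivAt_fst_comp {X Y : Type*} [NormedAddCommGroup X] [NormedSpace ℝ X]
    [NormedAddCommGroup Y] [NormedSpace ℝ Y] {c : ℝ → X × Y} {v : X × Y} {τ : ℝ}
    (h : HasDerivAt c v τ) : HasDerivAt (fun τ => (c τ).1) v.1 τ := h.fst

theorem hasDerivAt_snd_comp {X Y : Type*} [NormedAddCommGroup X] [NormedSpace ℝ X]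
    [NormedAddCommGroup Y] [NormedSpace ℝ Y] {c : ℝ → X × Y} {v : X × Y} {τ : ℝ}
    (h : HasDerivAt c v τ) : HasDerivAt (fun τ => (c τ).2) v.2 τ := h.snd

/-- A strictly increasing parametrization of a bounded set by an open interval. -/
theorem exists_reparametrization {X β : ℝ → ℝ} {a b : ℝ}
    (hX : ∀ τ ∈ Ioo a b, HasDerivAt X (β τ) τ) (hβ : ∀ τ ∈ Ioo a b, 0 < β τ)
    (hbd : ∃ C, ∀ τ ∈ Ioo a b, |X τ| ≤ C) :
    ∃ (g : ℝ → ℝ) (c d : ℝ), (∀ τ ∈ Ioo a b, X τ ∈ Ioo c d ∧ g (X τ) = τ) ∧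
      ∀ x ∈ Ioo c d, g x ∈ Ioo a b ∧ X (g x) = x ∧ HasDerivAt g (β (g x))⁻¹ x := by
  by_cases hab : b ≤ a
  · refine ⟨id, 0, 0, ?_, ?_⟩ <;> simp [Ioo_eq_empty_of_le hab]
  push Not at hab
  have hmono : StrictMonoOn X (Ioo a b) := by
    refine strictMonoOn_of_deriv_pos (convex_Ioo a b)
      (fun τ hτ => (hX τ hτ).continuousAt.continuousWithinAt) fun τ hτ => ?_
    rw [interior_Ioo] at hτ
    rw [(hX τ hτ).deriv]; exact hβ τ hτ
  have hcont : ContinuousOn X (Ioo a b) :=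
    fun τ hτ => (hX τ hτ).continuousAt.continuousWithinAt
  obtain ⟨C, hC⟩ := hbd
  set s := X '' Ioo a b with hs
  have hconn : IsConnected s := (isConnected_Ioo hab).image _ hcont
  have hbelow : BddBelow s := ⟨-C, by rintro _ ⟨τ, hτ, rfl⟩; exact (abs_le.1 (hC τ hτ)).1⟩
  have habove : BddAbove s := ⟨C, by rintro _ ⟨τ, hτ, rfl⟩; exact (abs_le.1 (hC τ hτ)).2⟩
  have hsub : Ioo (sInf s) (sSup s) ⊆ s := hconn.Ioo_csInf_csSup_subset hbelow habove
  have hmem : ∀ τ ∈ Ioo a b, X τ ∈ Ioo (sInf s) (sSup s) := by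
    intro τ hτ
    obtain ⟨τ₁, h1, h2⟩ := exists_between hτ.1
    obtain ⟨τ₂, h3, h4⟩ := exists_between hτ.2
    have m1 : τ₁ ∈ Ioo a b := ⟨h1, h2.trans hτ.2⟩
    have m2 : τ₂ ∈ Ioo a b := ⟨hτ.1.trans h3, h4⟩
    exact ⟨(csInf_le hbelow (mem_image_of_mem X m1)).trans_lt (hmono m1 hτ h2),
      (hmono hτ m2 h3).trans_le (le_csSup habove (mem_image_of_mem X m2))⟩
  have hgX : ∀ τ ∈ Ioo a b, Function.invFunOn X (Ioo a b) (X τ) = τ := fun τ hτ =>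
    hmono.injOn (Function.invFunOn_mem ⟨τ, hτ, rfl⟩) hτ (Function.invFunOn_eq ⟨τ, hτ, rfl⟩)
  set g := Function.invFunOn X (Ioo a b) with hg
  have hgmem : ∀ x ∈ Ioo (sInf s) (sSup s), g x ∈ Ioo a b ∧ X (g x) = x := fun x hx =>
    ⟨Function.invFunOn_mem (hsub hx), Function.invFunOn_eq (hsub hx)⟩
  refine ⟨g, sInf s, sSup s, fun τ hτ => ⟨hmem τ hτ, hgX τ hτ⟩, fun x hx => ?_⟩
  obtain ⟨h1, h2⟩ := hgmem x hx
  refine ⟨h1, h2, ?_⟩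
  have hgm : StrictMonoOn g (Ioo (sInf s) (sSup s)) := by
    intro x₁ hx₁ x₂ hx₂ hlt
    rw [← (hgmem x₁ hx₁).2, ← (hgmem x₂ hx₂).2] at hlt
    exact (hmono.lt_iff_lt (hgmem x₁ hx₁).1 (hgmem x₂ hx₂).1).1 hlt
  have himg : Ioo a b ⊆ g '' Ioo (sInf s) (sSup s) := fun τ hτ => ⟨X τ, hmem τ hτ, hgX τ hτ⟩
  have hgc : ContinuousAt g x := hgm.continuousAt_of_image_mem_nhds (isOpen_Ioo.mem_nhds hx)
    (mem_of_superset (isOpen_Ioo.mem_nhds h1) himg)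
  refine HasDerivAt.of_local_left_inverse hgc (hX _ h1) (hβ _ h1).ne' ?_
  filter_upwards [isOpen_Ioo.mem_nhds hx] with y hy using (hgmem y hy).2

/-- Curves that are tangent to `∂/∂x + p ∂/∂y + f ∂/∂p` are the jets of solutions. -/
theorem exists_solution_of_curve {f : Jet → ℝ} {c : ℝ → Jet} {β : ℝ → ℝ} {a b : ℝ}
    (hc : ∀ τ ∈ Ioo a b, HasDerivAt c (β τ • ((1, (c τ).2.2, f (c τ)) : Jet)) τ)
    (hβ : ∀ τ ∈ Ioo a b, 0 < β τ) (hbd : ∃ C, ∀ τ ∈ Ioo a b, |(c τ).1| ≤ C) :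
    ∃ (u : ℝ → ℝ) (c' d' : ℝ), IsSolutionOn f u c' d' ∧
      (fun τ => ((c τ).1, (c τ).2.1)) '' Ioo a b = graphOn u c' d' := by
  have h1 : ∀ τ ∈ Ioo a b, HasDerivAt (fun τ => (c τ).1) (β τ) τ := fun τ hτ => by
    have h := hasDerivAt_fst_comp (hc τ hτ)
    simpa only [Prod.smul_fst, smul_eq_mul, mul_one] using h
  obtain ⟨g, c', d', hg, hg'⟩ := exists_reparametrization h1 hβ hbd
  have hcg : ∀ x ∈ Ioo c' d', HasDerivAt (fun x => c (g x))
      ((1, (c (g x)).2.2, f (c (g x))) : Jet) x := by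
    intro x hx
    have := (hc _ (hg' x hx).1).scomp x (hg' x hx).2.2
    rwa [smul_smul, inv_mul_cancel₀ (hβ _ (hg' x hx).1).ne', one_smul] at this
  have hu : ∀ x ∈ Ioo c' d', HasDerivAt (fun x => (c (g x)).2.1) ((c (g x)).2.2) x :=
    fun x hx => (hcg x hx).snd.fst
  have hu' : ∀ x ∈ Ioo c' d', deriv (fun x => (c (g x)).2.1) x = (c (g x)).2.2 :=
    fun x hx => (hu x hx).deriv
  refine ⟨fun x => (c (g x)).2.1, c', d', fun x hx => ⟨(hu x hx).differentiableAt, ?_⟩, ?_⟩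
  · have e : ((x, (c (g x)).2.1, deriv (fun x => (c (g x)).2.1) x) : Jet) = c (g x) := by
      rw [hu' x hx]
      exact Prod.ext (hg' x hx).2.1.symm rfl
    rw [e]
    have h := hasDerivAt_snd_comp (hasDerivAt_snd_comp (hcg x hx))
    refine h.congr_of_eventuallyEq ?_
    filter_upwards [isOpen_Ioo.mem_nhds hx] with y hy using hu' y hy
  · ext z
    constructor
    · rintro ⟨τ, hτ, rfl⟩
      exact ⟨(c τ).1, (hg τ hτ).1, by simp only [(hg τ hτ).2]⟩
    · rintro ⟨x, hx, rfl⟩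
      exact ⟨g x, (hg' x hx).1, by simp only [(hg' x hx).2.1]⟩

/-- The 1-jet of a solution. -/
theorem IsSolutionOn.hasDerivAt_jet {f : Jet → ℝ} {u : ℝ → ℝ} {a b : ℝ} (h : IsSolutionOn f u a b)
    {x : ℝ} (hx : x ∈ Ioo a b) :
    HasDerivAt (fun x => ((x, u x, deriv u x) : Jet))
      (1, deriv u x, f (x, u x, deriv u x)) x :=
  (hasDerivAt_id x).prodMk ((h x hx).1.hasDerivAt.prodMk (h x hx).2)

theorem mapsSolutions_of_jetMap {Φ : Jet → Jet} {f f' : Jet → ℝ} {g : ℝ × ℝ → ℝ × ℝ} {N : Set Jet}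
    (hΦ : ∀ z ∈ N, DifferentiableAt ℝ Φ z)
    (hg : ∀ z ∈ N, g (z.1, z.2.1) = ((Φ z).1, (Φ z).2.1))
    (hf : ∀ z ∈ N, ∃ β : ℝ, 0 < β ∧
      fderiv ℝ Φ z (1, z.2.2, f z) = β • ((1, (Φ z).2.2, f' (Φ z)) : Jet))
    (hbd : ∃ C, ∀ z ∈ N, |(Φ z).1| ≤ C) : MapsSolutions g f f' N := by
  intro u a b hu hN
  choose! β hβ hβ' using hf
  obtain ⟨C, hC⟩ := hbd
  obtain ⟨v, c, d, hv, himg⟩ := exists_solution_of_curve (f := f')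
    (c := fun x => Φ (x, u x, deriv u x)) (β := fun x => β (x, u x, deriv u x)) (a := a) (b := b)
    (fun x hx => by
      rw [← hβ' _ (hN x hx)]
      exact (hΦ _ (hN x hx)).hasFDerivAt.comp_hasDerivAt x (hu.hasDerivAt_jet hx))
    (fun x hx => hβ _ (hN x hx)) ⟨C, fun x hx => hC _ (hN x hx)⟩
  refine ⟨v, c, d, hv, ?_⟩
  rw [← himg, graphOn, image_image]
  exact image_congr fun x hx => hg _ (hN x hx)

/-- Local solutions with a given 1-jet. -/
theorem exists_local_solution {f : Jet → ℝ} {z : Jet} (hf : ContDiffAt ℝ 1 f z) {N : Set Jet}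
    (hN : N ∈ 𝓝 z) : ∃ (u : ℝ → ℝ) (a b : ℝ), z.1 ∈ Ioo a b ∧ IsSolutionOn f u a b ∧
      u z.1 = z.2.1 ∧ deriv u z.1 = z.2.2 ∧ ∀ x ∈ Ioo a b, (x, u x, deriv u x) ∈ N := by
  have hv : ContDiffAt ℝ 1 (fun z : Jet => ((1, z.2.2, f z) : Jet)) z :=
    contDiffAt_const.prodMk ((by fun_prop : ContDiffAt ℝ 1 (fun z : Jet => z.2.2) z).prodMk hf)
  obtain ⟨α, hα0, ε, hε, hα⟩ :=
    hv.exists_forall_mem_closedBall_exists_eq_forall_mem_Ioo_hasDerivAt₀ z.1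
  have hmem : z.1 ∈ Ioo (z.1 - ε) (z.1 + ε) := ⟨by linarith, by linarith⟩
  have hαN : ∀ᶠ x in 𝓝 z.1, α x ∈ N := by
    refine (hα _ hmem).continuousAt.eventually ?_
    rw [hα0]; exact hN
  obtain ⟨δ, hδ, hδN⟩ := Metric.eventually_nhds_iff.1 hαN
  set r := min ε δ
  have hr : 0 < r := lt_min hε hδ
  have hsub : Ioo (z.1 - r) (z.1 + r) ⊆ Ioo (z.1 - ε) (z.1 + ε) :=
    Ioo_subset_Ioo (by linarith [min_le_left ε δ]) (by linarith [min_le_left ε δ])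
  have hx1 : ∀ x ∈ Ioo (z.1 - r) (z.1 + r), (α x).1 = x := by
    intro x hx
    have hd : ∀ y ∈ Ioo (z.1 - r) (z.1 + r), HasDerivAt (fun x => (α x).1 - x) 0 y := by
      intro y hy
      have h := (hasDerivAt_fst_comp (hα y (hsub hy))).sub (hasDerivAt_id y)
      rw [sub_self] at h
      exact h
    have := (isOpen_Ioo (a := z.1 - r) (b := z.1 + r)).is_const_of_deriv_eq_zero
      isPreconnected_Ioo (fun y hy => (hd y hy).differentiableAt.differentiableWithinAt)
      (fun y hy => (hd y hy).deriv) hx (⟨by linarith, by linarith⟩ : z.1 ∈ Ioo (z.1 - r) (z.1 + r))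
    simp only [hα0, sub_self] at this
    linarith
  have hu : ∀ x ∈ Ioo (z.1 - r) (z.1 + r), HasDerivAt (fun x => (α x).2.1) ((α x).2.2) x :=
    fun x hx => (hα x (hsub hx)).snd.fst
  have hu' : ∀ x ∈ Ioo (z.1 - r) (z.1 + r), deriv (fun x => (α x).2.1) x = (α x).2.2 :=
    fun x hx => (hu x hx).deriv
  have hjet : ∀ x ∈ Ioo (z.1 - r) (z.1 + r),
      ((x, (α x).2.1, deriv (fun x => (α x).2.1) x) : Jet) = α x := fun x hx => by
    rw [hu' x hx]; exact Prod.ext (hx1 x hx).symm rfl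
  have hz : z.1 ∈ Ioo (z.1 - r) (z.1 + r) := ⟨by linarith, by linarith⟩
  refine ⟨fun x => (α x).2.1, z.1 - r, z.1 + r, hz, fun x hx => ⟨(hu x hx).differentiableAt, ?_⟩,
    by simp only [hα0], by rw [hu' _ hz, hα0], fun x hx => ?_⟩
  · rw [hjet x hx]
    have h := hasDerivAt_snd_comp (hasDerivAt_snd_comp (hα x (hsub hx)))
    refine h.congr_of_eventuallyEq ?_
    filter_upwards [isOpen_Ioo.mem_nhds hx] with y hy using hu' y hy
  · rw [hjet x hx]
    refine hδN ?_
    rw [Real.dist_eq, abs_lt]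
    constructor <;> linarith [hx.1, hx.2, min_le_right ε δ]

end Curves

/-! ### Families of contact transformations over the plane -/

section JetEquiv

theorem fderiv_of_slice_id {X : Type*} [NormedAddCommGroup X] [NormedSpace ℝ X] {Ψ : ℝ × X → X}
    {x : X} (h : ∀ᶠ y in 𝓝 x, Ψ (0, y) = y) (hd : DifferentiableAt ℝ Ψ (0, x)) (v : X) :
    fderiv ℝ Ψ (0, x) (0, v) = v := by
  have h1 : HasFDerivAt (fun y => Ψ (0, y))
      ((fderiv ℝ Ψ (0, x)).comp (ContinuousLinearMap.inr ℝ ℝ X)) x :=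
    hd.hasFDerivAt.comp x (hasFDerivAt_prodMk_right (0 : ℝ) x)
  have h2 : HasFDerivAt (fun y => Ψ (0, y)) (ContinuousLinearMap.id ℝ X) x :=
    (hasFDerivAt_id x).congr_of_eventuallyEq h
  have := congrArg (fun A => A v) (h1.unique h2)
  simpa using this

/-- The total derivative `∂/∂x + p ∂/∂y + F ∂/∂p`. -/
def totalField (F : TJet → ℝ) (q : TJet) : Jet := (1, q.2.2.2, F q)

theorem SmoothNear.totalField {F : TJet → ℝ} {q : TJet} (hF : SmoothNear F q) :
    SmoothNear (totalField F) q :=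
  (contDiff_const.smoothNear _).prodMk
    ((ContDiff.smoothNear (by fun_prop) q : SmoothNear (fun q : TJet => q.2.2.2) q).prodMk hF)

/-- The family `Φ` maps vertical lines to vertical lines and jets of solutions to such jets. -/
def IntertwinesAt (Φ : TJet → Jet) (F F' : TJet → ℝ) (q : TJet) : Prop :=
  (fderiv ℝ Φ q (0, 0, 0, 1)).1 = 0 ∧ (fderiv ℝ Φ q (0, 0, 0, 1)).2.1 = 0 ∧
    fderiv ℝ Φ q (0, totalField F q) =
      (fderiv ℝ Φ q (0, totalField F q)).1 • totalField F' (q.1, Φ q)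

/-- Equivalence of deformations by prolonged families of maps of the plane. -/
def JetEquiv (F F' : TJet → ℝ) : Prop :=
  ∃ Φ : TJet → Jet, SmoothNear Φ 0 ∧ (∀ᶠ z in 𝓝 (0 : Jet), Φ (0, z) = z) ∧
    ∀ᶠ q in 𝓝 (0 : TJet), IntertwinesAt Φ F F' q

theorem JetEquiv.refl (F : TJet → ℝ) : JetEquiv F F := by
  refine ⟨Prod.snd, contDiff_snd.smoothNear _, by simp, Eventually.of_forall fun q => ?_⟩
  simp [IntertwinesAt, totalField, fderiv_snd]

/-- The total space version of a family of maps. -/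
def totalMap {X : Type*} (Φ : ℝ × X → X) (q : ℝ × X) : ℝ × X := (q.1, Φ q)

theorem SmoothNear.totalMap {X : Type*} [NormedAddCommGroup X] [NormedSpace ℝ X] {Φ : ℝ × X → X}
    {q : ℝ × X} (h : SmoothNear Φ q) : SmoothNear (totalMap Φ) q :=
  (contDiff_fst.smoothNear q).prodMk h

theorem fderiv_totalMap {X : Type*} [NormedAddCommGroup X] [NormedSpace ℝ X] {Φ : ℝ × X → X}
    {q : ℝ × X} (h : DifferentiableAt ℝ Φ q) (w : ℝ × X) :
    fderiv ℝ (totalMap Φ) q w = (w.1, fderiv ℝ Φ q w) := by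
  unfold totalMap
  rw [fderiv_prodMk_apply differentiableAt_fst h, fderiv_fst]; rfl

theorem fderiv_totalMap_injective {X : Type*} [NormedAddCommGroup X] [NormedSpace ℝ X]
    {Φ : ℝ × X → X} {x : X} (h : DifferentiableAt ℝ Φ (0, x)) (hid : ∀ᶠ y in 𝓝 x, Φ (0, y) = y) :
    Function.Injective (fderiv ℝ (totalMap Φ) (0, x)) := by
  rw [injective_iff_map_eq_zero]
  rintro ⟨t, v⟩ hw
  rw [fderiv_totalMap h, Prod.mk_eq_zero] at hw
  obtain ⟨h1, h2⟩ := hw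
  simp only at h1
  subst h1
  rw [fderiv_of_slice_id hid h] at h2
  rw [h2]; rfl

theorem JetEquiv.symm {F F' : TJet → ℝ} (h : JetEquiv F F') : JetEquiv F' F := by
  obtain ⟨Φ, hΦ, hid, hint⟩ := h
  have h0 : totalMap Φ 0 = 0 := by
    have := hid.self_of_nhds
    simp only [totalMap]
    exact Prod.ext rfl this
  obtain ⟨g, hg, hg0, hgl, hgr⟩ := hΦ.totalMap.exists_local_inverse_of_bijective
    (bijective_of_injective (fderiv_totalMap_injective (x := (0 : Jet)) hΦ.differentiableAt hid))
  rw [h0] at hg hg0 hgr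
  have hgt : Tendsto g (𝓝 0) (𝓝 0) := by
    have := hg.continuousAt.tendsto; rwa [hg0] at this
  have hslice : Tendsto (fun z : Jet => ((0 : ℝ), z)) (𝓝 0) (𝓝 0) := by
    have : Continuous (fun z : Jet => ((0 : ℝ), z)) := by fun_prop
    exact this.tendsto 0
  refine ⟨fun q => (g q).2, hg.snd, ?_, ?_⟩
  · filter_upwards [hslice.eventually hgl, hid] with z h1 h2
    have : totalMap Φ (0, z) = (0, z) := by simp [totalMap, h2]
    rw [this] at h1
    rw [h1]
  · filter_upwards [hgr, hgt.eventually hint, hgt.eventually hΦ, hgt.eventually hgl.eventually_nhds,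
      hg] with q h1 h2 h3 h4 h5
    have hd3 : DifferentiableAt ℝ Φ (g q) := h3.diffAt
    have hd5 : DifferentiableAt ℝ g q := h5.diffAt
    have hq1 : (g q).1 = q.1 := (congrArg Prod.fst h1 :)
    have hq2 : Φ (g q) = q.2 := (congrArg Prod.snd h1 :)
    have hdt : DifferentiableAt ℝ (totalMap Φ) (g q) := differentiableAt_fst.prodMk hd3
    have key : ∀ v, (fderiv ℝ g q (0, fderiv ℝ Φ (g q) (0, v))) = (0, v) := by
      intro v
      have e1 : fderiv ℝ (fun r => g (totalMap Φ r)) (g q) (0, v) = (0, v) := by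
        rw [Filter.EventuallyEq.fderiv_eq (𝕜 := ℝ)
          (show (fun r => g (totalMap Φ r)) =ᶠ[𝓝 (g q)] fun r => r from h4)]
        simp
      rw [fderiv_comp_apply' (by rw [h1]; exact hd5) hdt, fderiv_totalMap hd3, h1] at e1
      exact e1
    have hsnd : ∀ w, fderiv ℝ (fun q => (g q).2) q w = (fderiv ℝ g q w).2 :=
      fun w => fderiv_snd_apply hd5 w
    obtain ⟨i1, i2, i3⟩ := h2
    set γ := (fderiv ℝ Φ (g q) (0, 0, 0, 1)).2.2 with hγ
    have hv : fderiv ℝ Φ (g q) (0, 0, 0, 1) = γ • ((0, 0, 1) : Jet) :=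
      Prod.ext (by simp [i1]) (Prod.ext (by simp [i2]) (by simp [γ]))
    have kv := key (0, 0, 1)
    rw [hv] at kv
    have hγ0 : γ ≠ 0 := by
      intro h
      rw [h, zero_smul, Prod.mk_zero_zero, map_zero] at kv
      simpa using congrArg (fun w => w.2.2.2) kv
    have kv' : fderiv ℝ g q (0, 0, 0, 1) = γ⁻¹ • ((0, 0, 0, 1) : TJet) := by
      have : ((0 : ℝ), γ • ((0, 0, 1) : Jet)) = γ • ((0, 0, 0, 1) : TJet) := by simp
      rw [this, map_smul] at kv
      have := congrArg (γ⁻¹ • ·) kv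
      simpa only [smul_smul, inv_mul_cancel₀ hγ0, one_smul] using this
    have ke := key (totalField F (g q))
    rw [i3] at ke
    set β := (fderiv ℝ Φ (g q) (0, totalField F (g q))).1
    have hpt : ((g q).1, Φ (g q)) = q := h1
    rw [hpt] at ke
    have hβ0 : β ≠ 0 := by
      intro h
      rw [h, zero_smul, Prod.mk_zero_zero, map_zero] at ke
      simpa [totalField] using congrArg (fun w => w.2.1) ke
    have ke' : fderiv ℝ g q (0, totalField F' q) = β⁻¹ • ((0, totalField F (g q)) : TJet) := by
      have : ((0 : ℝ), β • totalField F' q) = β • ((0, totalField F' q) : TJet) := by simp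
      rw [this, map_smul] at ke
      have := congrArg (β⁻¹ • ·) ke
      simpa only [smul_smul, inv_mul_cancel₀ hβ0, one_smul] using this
    have hgq : (q.1, (g q).2) = g q := Prod.ext hq1.symm rfl
    refine ⟨?_, ?_, ?_⟩
    · rw [hsnd, kv']; simp
    · rw [hsnd, kv']; simp
    · rw [hsnd, ke', hgq]; simp [totalField]

theorem JetEquiv.trans {F F' F'' : TJet → ℝ} (h : JetEquiv F F') (h' : JetEquiv F' F'') :
    JetEquiv F F'' := by
  obtain ⟨Φ, hΦ, hid, hint⟩ := h
  obtain ⟨Φ', hΦ', hid', hint'⟩ := h'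
  have h0 : totalMap Φ 0 = 0 := Prod.ext rfl hid.self_of_nhds
  have ht : Tendsto (totalMap Φ) (𝓝 0) (𝓝 0) := by
    have := hΦ.totalMap.continuousAt.tendsto; rwa [h0] at this
  refine ⟨fun q => Φ' (totalMap Φ q), hΦ'.comp_of_eq hΦ.totalMap h0, ?_, ?_⟩
  · filter_upwards [hid, hid'] with z h1 h2
    simp [totalMap, h1, h2]
  · filter_upwards [hint, ht.eventually hint', hΦ, ht.eventually hΦ'] with q i i' d d'
    have hd : DifferentiableAt ℝ Φ q := d.diffAt
    have hd' : DifferentiableAt ℝ Φ' (totalMap Φ q) := d'.diffAt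
    have hdt : DifferentiableAt ℝ (totalMap Φ) q := differentiableAt_fst.prodMk hd
    have key : ∀ v, fderiv ℝ (fun q => Φ' (totalMap Φ q)) q (0, v) =
        fderiv ℝ Φ' (totalMap Φ q) (0, fderiv ℝ Φ q (0, v)) := fun v => by
      rw [fderiv_comp_apply' hd' hdt, fderiv_totalMap hd]
    obtain ⟨i1, i2, i3⟩ := i
    obtain ⟨j1, j2, j3⟩ := i'
    set γ := (fderiv ℝ Φ q (0, 0, 0, 1)).2.2 with hγ
    have hv : ((0 : ℝ), fderiv ℝ Φ q (0, 0, 0, 1)) = γ • ((0, 0, 0, 1) : TJet) :=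
      Prod.ext (by simp) (Prod.ext (by simp [i1]) (Prod.ext (by simp [i2]) (by simp [γ])))
    set β := (fderiv ℝ Φ q (0, totalField F q)).1
    have he : ((0 : ℝ), fderiv ℝ Φ q (0, totalField F q)) =
        β • ((0, totalField F' (totalMap Φ q)) : TJet) := by
      rw [i3]; simp [totalMap]
    refine ⟨?_, ?_, ?_⟩
    · rw [key, hv, map_smul]; simp [j1]
    · rw [key, hv, map_smul]; simp [j2]
    · rw [key, he, map_smul, j3]
      simp [totalMap, totalField, mul_assoc]

end JetEquiv

/-! ### Point equivalence of deformations in terms of jets -/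

section ProjEquiv

theorem fderiv_slice {X Y : Type*} [NormedAddCommGroup X] [NormedSpace ℝ X] [NormedAddCommGroup Y]
    [NormedSpace ℝ Y] {Φ : ℝ × X → Y} {t : ℝ} {x : X} (hd : DifferentiableAt ℝ Φ (t, x)) (v : X) :
    fderiv ℝ (fun y => Φ (t, y)) x v = fderiv ℝ Φ (t, x) (0, v) := by
  have h1 : HasFDerivAt (fun y => Φ (t, y))
      ((fderiv ℝ Φ (t, x)).comp (ContinuousLinearMap.inr ℝ ℝ X)) x :=
    hd.hasFDerivAt.comp x (hasFDerivAt_prodMk_right t x)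
  rw [h1.fderiv]; rfl

/-- A deformation as a function of all variables. -/
def ODEDeformation.total {f : Jet → ℝ} (F : ODEDeformation f) (q : TJet) : ℝ := F.rhs q.1 q.2

theorem ODEDeformation.smoothNear {f : Jet → ℝ} (F : ODEDeformation f) : SmoothNear F.total 0 := by
  obtain ⟨O, h1, h2, h3⟩ := F.smooth
  exact smoothNear_of_contDiffOn h1 h3 h2

theorem ODEDeformation.total_zero {f : Jet → ℝ} (F : ODEDeformation f) :
    ∀ᶠ z in 𝓝 (0 : Jet), F.total (0, z) = f z := F.rhs_zero

theorem tendsto_slice {X Y : Type*} [TopologicalSpace X] [TopologicalSpace Y] (x : X) (y : Y) :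
    Tendsto (fun y : Y => (x, y)) (𝓝 y) (𝓝 (x, y)) :=
  (Continuous.prodMk_right x).tendsto y

/-- The derivative of a family of plane maps along the direction of a contact element. -/
def contactDerivative (G : ℝ × ℝ × ℝ → ℝ × ℝ) (q : TJet) : ℝ × ℝ :=
  fderiv ℝ G (q.1, q.2.1, q.2.2.1) (0, 1, q.2.2.2)

/-- The prolongation to contact elements of a family of plane maps. -/
def prolongation (G : ℝ × ℝ × ℝ → ℝ × ℝ) (q : TJet) : Jet :=
  ((G (q.1, q.2.1, q.2.2.1)).1, (G (q.1, q.2.1, q.2.2.1)).2,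
    (contactDerivative G q).2 / (contactDerivative G q).1)

variable {G : ℝ × ℝ × ℝ → ℝ × ℝ}

/-- Forgetting the slope of a contact element. -/
def basePoint (q : TJet) : ℝ × ℝ × ℝ := (q.1, q.2.1, q.2.2.1)

theorem smoothNear_basePoint (q : TJet) : SmoothNear basePoint q :=
  ContDiff.smoothNear (by unfold basePoint; fun_prop) q

theorem SmoothNear.contactDerivative {q : TJet} (hG : SmoothNear G (basePoint q)) :
    SmoothNear (contactDerivative G) q :=
  (hG.fderivMap.comp (smoothNear_basePoint q)).clm_apply
    (ContDiff.smoothNear (by fun_prop) q : SmoothNear (fun q : TJet => ((0 : ℝ), (1 : ℝ), q.2.2.2)) q)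

theorem SmoothNear.prolongation {q : TJet} (hG : SmoothNear G (basePoint q))
    (h0 : (EngelODE.contactDerivative G q).1 ≠ 0) : SmoothNear (prolongation G) q :=
  (hG.comp (smoothNear_basePoint q)).fst.prodMk
    ((hG.comp (smoothNear_basePoint q)).snd.prodMk
      (hG.contactDerivative.snd.div hG.contactDerivative.fst h0))

theorem contactDerivative_of_slice_id (hG : SmoothNear G 0) (hid : ∀ᶠ z in 𝓝 (0 : ℝ × ℝ), G (0, z) = z) :
    ∀ᶠ z in 𝓝 (0 : Jet), contactDerivative G (0, z) = (1, z.2.2) := by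
  have h2 : Tendsto (fun z : Jet => (z.1, z.2.1)) (𝓝 0) (𝓝 0) := by
    have : Continuous (fun z : Jet => (z.1, z.2.1)) := by fun_prop
    exact this.tendsto 0
  have h3 := (tendsto_slice (0 : ℝ) (0 : ℝ × ℝ)).eventually hG
  filter_upwards [h2.eventually hid.eventually_nhds, h2.eventually h3] with z hz hz'
  exact fderiv_of_slice_id hz (ContDiffAt.differentiableAt hz' (by simp)) _

theorem fderiv_basePoint (q v : TJet) : fderiv ℝ basePoint q v = basePoint v := by
  have : basePoint = ((ContinuousLinearMap.fst ℝ ℝ Jet).prod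
      (((ContinuousLinearMap.fst ℝ ℝ (ℝ × ℝ)).comp (ContinuousLinearMap.snd ℝ ℝ Jet)).prod
        (((ContinuousLinearMap.fst ℝ ℝ ℝ).comp (ContinuousLinearMap.snd ℝ ℝ (ℝ × ℝ))).comp
          (ContinuousLinearMap.snd ℝ ℝ Jet))) : TJet → ℝ × ℝ × ℝ) := rfl
  rw [this, ContinuousLinearMap.fderiv]

theorem fderiv_prolongation {q : TJet} (hG : SmoothNear G (basePoint q))
    (h0 : (contactDerivative G q).1 ≠ 0) (v : TJet) :
    (fderiv ℝ (prolongation G) q v).1 = (fderiv ℝ G (basePoint q) (basePoint v)).1 ∧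
      (fderiv ℝ (prolongation G) q v).2.1 = (fderiv ℝ G (basePoint q) (basePoint v)).2 := by
  have hΦ : SmoothNear (prolongation G) q := hG.prolongation h0
  have hbd : DifferentiableAt ℝ basePoint q := (smoothNear_basePoint q).differentiableAt
  have hGb : DifferentiableAt ℝ (fun q => G (basePoint q)) q :=
    (hG.comp (smoothNear_basePoint q)).differentiableAt
  have e := fderiv_comp_apply' hG.differentiableAt hbd v
  rw [fderiv_basePoint] at e
  rw [← fderiv_fst_apply hΦ.differentiableAt, ← fderiv_snd_apply hΦ.differentiableAt,
    ← fderiv_fst_apply (hΦ.snd.differentiableAt), ← e, ← fderiv_fst_apply hGb,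
    ← fderiv_snd_apply hGb]
  exact ⟨rfl, rfl⟩

theorem intertwinesAt_prolongation {F F' : TJet → ℝ} {q : TJet}
    (hG : SmoothNear G (basePoint q)) (hpos : 0 < (contactDerivative G q).1)
    (hF : SmoothNear F q) {N : Set Jet} (hN : N ∈ 𝓝 q.2)
    (hmap : MapsSolutions (fun z => G (q.1, z)) (fun z => F (q.1, z)) (fun z => F' (q.1, z)) N) :
    IntertwinesAt (prolongation G) F F' q := by
  have hΦ : SmoothNear (prolongation G) q := hG.prolongation hpos.ne'
  have hΦd : DifferentiableAt ℝ (prolongation G) q := hΦ.differentiableAt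
  have h12 : ∀ v, (fderiv ℝ (prolongation G) q v).1 = (fderiv ℝ G (basePoint q) (basePoint v)).1 ∧
      (fderiv ℝ (prolongation G) q v).2.1 = (fderiv ℝ G (basePoint q) (basePoint v)).2 :=
    fderiv_prolongation hG hpos.ne'
  have hvert : basePoint (0, 0, 0, 1) = 0 := rfl
  refine ⟨by rw [(h12 _).1, hvert, map_zero]; rfl, by rw [(h12 _).2, hvert, map_zero]; rfl, ?_⟩
  -- follow a solution through the contact element
  have hsl := tendsto_slice q.1 q.2
  have hev : ∀ᶠ z in 𝓝 q.2, SmoothNear G (basePoint (q.1, z)) ∧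
      0 < (contactDerivative G (q.1, z)).1 := by
    refine hsl.eventually (?_ : ∀ᶠ q' in 𝓝 q, SmoothNear G (basePoint q') ∧
      0 < (contactDerivative G q').1)
    exact ((smoothNear_basePoint q).continuousAt.eventually hG.eventually).and
      (hG.contactDerivative.fst.continuousAt.eventually (lt_mem_nhds hpos))
  have hFs : ContDiffAt ℝ 1 (fun z => F (q.1, z)) q.2 :=
    (hF.contDiffAt.comp q.2 (contDiff_prodMk_right q.1).contDiffAt).of_le (by simp)
  obtain ⟨u, a, b, hx, hu, hu0, hu1, huN⟩ := exists_local_solution hFs (inter_mem hN hev)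
  obtain ⟨v, c, d, hv, himg⟩ := hmap u a b hu fun x hx => (huN x hx).1
  set j : ℝ → Jet := fun x => (x, u x, deriv u x) with hj
  have hjq : j q.2.1 = q.2 := by simp only [hj, hu0, hu1]
  have hjd : ∀ x ∈ Ioo a b, HasDerivAt (fun x => ((q.1, j x) : TJet))
      (0, 1, deriv u x, F (q.1, j x)) x := fun x hx =>
    (hasDerivAt_const x q.1).prodMk (hu.hasDerivAt_jet hx)
  have hcurve : ∀ x ∈ Ioo a b, HasDerivAt (fun x => G (basePoint (q.1, j x)))
      (contactDerivative G (q.1, j x)) x := fun x hx => by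
    refine ((huN x hx).2.1.differentiableAt.hasFDerivAt).comp_hasDerivAt (f := fun x => basePoint (q.1, j x)) x ?_
    exact (hasDerivAt_const x q.1).prodMk ((hasDerivAt_id x).prodMk (hu x hx).1.hasDerivAt)
  have hgraph : ∀ x ∈ Ioo a b, (G (basePoint (q.1, j x))).1 ∈ Ioo c d ∧
      v (G (basePoint (q.1, j x))).1 = (G (basePoint (q.1, j x))).2 := by
    intro x hx
    have : G (basePoint (q.1, j x)) ∈ graphOn v c d := by
      rw [← himg]; exact ⟨(x, u x), ⟨x, hx, rfl⟩, rfl⟩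
    obtain ⟨ξ, hξ, he⟩ := this
    rw [← he]; exact ⟨hξ, rfl⟩
  have hslope : ∀ x ∈ Ioo a b, deriv v (G (basePoint (q.1, j x))).1 = (prolongation G (q.1, j x)).2.2 := by
    intro x hx
    have h1 := hasDerivAt_fst_comp (hcurve x hx)
    have h2 := hasDerivAt_snd_comp (hcurve x hx)
    have h3 := ((hv _ (hgraph x hx).1).1.hasDerivAt).comp x h1
    have h4 : HasDerivAt (v ∘ fun x => (G (basePoint (q.1, j x))).1)
        (contactDerivative G (q.1, j x)).2 x := by
      refine h2.congr_of_eventuallyEq ?_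
      filter_upwards [isOpen_Ioo.mem_nhds hx] with y hy using (hgraph y hy).2
    rw [prolongation, eq_div_iff (huN x hx).2.2.ne']
    exact h3.unique h4
  have hq0 : q.2.1 ∈ Ioo a b := hx
  have hΦj : HasDerivAt (fun x => prolongation G (q.1, j x))
      (fderiv ℝ (prolongation G) q (0, totalField F q)) q.2.1 := by
    have h1 := hjd _ hq0
    have e : ((0 : ℝ), (1 : ℝ), deriv u q.2.1, F (q.1, j q.2.1)) = (0, totalField F q) := by
      rw [hjq, hu1]; rfl
    rw [e] at h1
    have h2 : HasFDerivAt (prolongation G) (fderiv ℝ (prolongation G) q) (q.1, j q.2.1) := by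
      rw [hjq]; exact hΦd.hasFDerivAt
    exact h2.comp_hasDerivAt q.2.1 h1
  have hX := (h12 (0, totalField F q)).1
  have hY := (h12 (0, totalField F q)).2
  have hb : fderiv ℝ G (basePoint q) (basePoint (0, totalField F q)) = contactDerivative G q := rfl
  rw [hb] at hX hY
  have h3 : HasDerivAt (fun x => (prolongation G (q.1, j x)).2.2)
      (F' (q.1, prolongation G q) * (contactDerivative G q).1) q.2.1 := by
    have h1 := hasDerivAt_fst_comp (hcurve _ hq0)
    rw [hjq] at h1
    have h2 := (hv _ (hgraph _ hq0).1).2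
    rw [(hgraph _ hq0).2, hslope _ hq0, hjq] at h2
    have h2' : HasDerivAt (deriv v) (F' (q.1, prolongation G q)) (G (basePoint (q.1, j q.2.1))).1 := by
      rw [hjq]; exact h2
    refine (h2'.comp q.2.1 h1).congr_of_eventuallyEq ?_
    filter_upwards [isOpen_Ioo.mem_nhds hq0] with y hy using (hslope y hy).symm
  have hP := (hasDerivAt_snd_comp (hasDerivAt_snd_comp hΦj)).unique h3
  refine Prod.ext (by simp [totalField]) (Prod.ext ?_ ?_)
  · rw [hY, hX]
    simp only [totalField, prolongation, Prod.smul_snd, Prod.smul_fst, smul_eq_mul]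
    field_simp
  · rw [hP, hX]
    simp only [totalField, Prod.smul_snd, smul_eq_mul, mul_comm]

theorem ODEDeformation.ProjEquiv.exists_prolongation {f : Jet → ℝ} {F F' : ODEDeformation f}
    (h : F.ProjEquiv F') : ∃ G : ℝ × ℝ × ℝ → ℝ × ℝ, SmoothNear G 0 ∧
      (∀ᶠ q in 𝓝 (0 : TJet), SmoothNear G (basePoint q) ∧ 0 < (contactDerivative G q).1) ∧
      SmoothNear (prolongation G) 0 ∧ (∀ᶠ z in 𝓝 (0 : Jet), prolongation G (0, z) = z) ∧
      ∀ᶠ q in 𝓝 (0 : TJet), IntertwinesAt (prolongation G) F.total F'.total q := by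
  obtain ⟨g, ⟨O, hO, h0, hg⟩, hid, N, hN, hmap⟩ := h
  set G : ℝ × ℝ × ℝ → ℝ × ℝ := fun z => g z.1 z.2 with hGdef
  have hG : SmoothNear G 0 := smoothNear_of_contDiffOn hO hg h0
  have hb0 : basePoint 0 = 0 := rfl
  have hD := contactDerivative_of_slice_id hG hid
  have hD0 : contactDerivative G 0 = (1, 0) := hD.self_of_nhds
  have hDs : SmoothNear (contactDerivative G) 0 := SmoothNear.contactDerivative (by rwa [hb0])
  have hpos : ∀ᶠ q in 𝓝 (0 : TJet), 0 < (contactDerivative G q).1 :=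
    hDs.fst.continuousAt.eventually (lt_mem_nhds (by simp [hD0]))
  have hGb : ∀ᶠ q in 𝓝 (0 : TJet), SmoothNear G (basePoint q) :=
    (smoothNear_basePoint 0).continuousAt.eventually hG.eventually
  refine ⟨G, hG, hGb.and hpos, SmoothNear.prolongation (by rwa [hb0]) (by simp [hD0]), ?_, ?_⟩
  · have h2 : Tendsto (fun z : Jet => (z.1, z.2.1)) (𝓝 0) (𝓝 0) := by
      have : Continuous (fun z : Jet => (z.1, z.2.1)) := by fun_prop
      exact this.tendsto 0
    filter_upwards [hD, h2.eventually hid] with z h3 h4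
    have : G (0, z.1, z.2.1) = (z.1, z.2.1) := h4
    simp [prolongation, h3, this]
  · have hNq : ∀ᶠ q in 𝓝 (0 : TJet), N ∈ 𝓝 q.2 :=
      (continuous_snd.tendsto (0 : TJet)).eventually (eventually_mem_nhds_iff.2 hN)
    have hmq : ∀ᶠ q in 𝓝 (0 : TJet), MapsSolutions (g q.1) (F.rhs q.1) (F'.rhs q.1) N :=
      (continuous_fst.tendsto (0 : TJet)).eventually hmap
    filter_upwards [hpos, hGb, hNq, hmq, F.smoothNear.eventually] with q h1 h2 h3 h4 h5
    exact intertwinesAt_prolongation h2 h1 h5 h3 h4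

theorem ODEDeformation.ProjEquiv.jetEquiv {f : Jet → ℝ} {F F' : ODEDeformation f}
    (h : F.ProjEquiv F') : JetEquiv F.total F'.total := by
  obtain ⟨G, -, -, h1, h2, h3⟩ := h.exists_prolongation
  exact ⟨prolongation G, h1, h2, h3⟩

theorem ODEDeformation.projEquiv_of_jetEquiv {f : Jet → ℝ} {F F' : ODEDeformation f}
    (h : JetEquiv F.total F'.total) : F.ProjEquiv F' := by
  obtain ⟨Φ, hΦ, hid, hint⟩ := h
  have hΦ0 : Φ 0 = 0 := hid.self_of_nhds
  set G : ℝ × ℝ × ℝ → ℝ × ℝ := fun z => ((Φ (z.1, z.2.1, z.2.2, 0)).1, (Φ (z.1, z.2.1, z.2.2, 0)).2.1)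
    with hGdef
  have hG : SmoothNear G 0 := by
    have h1 : SmoothNear (fun z : ℝ × ℝ × ℝ => Φ (z.1, z.2.1, z.2.2, 0)) 0 :=
      hΦ.comp_of_eq (ContDiff.smoothNear (by fun_prop) _) rfl
    exact h1.fst.prodMk h1.snd.fst
  have hpos : ∀ᶠ q in 𝓝 (0 : TJet), 0 < (fderiv ℝ Φ q (0, totalField F.total q)).1 := by
    have h1 : SmoothNear (fun q => (fderiv ℝ Φ q ((0 : ℝ), totalField F.total q)).1) 0 :=
      (hΦ.fderiv_apply ((contDiff_const.smoothNear _).prodMk F.smoothNear.totalField)).fst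
    refine h1.continuousAt.eventually (lt_mem_nhds ?_)
    have := fderiv_of_slice_id hid hΦ.differentiableAt (totalField F.total 0)
    change 0 < (fderiv ℝ Φ ((0 : ℝ), (0 : Jet)) (0, totalField F.total 0)).1
    rw [this]
    simp [totalField]
  have hbd : ∀ᶠ q in 𝓝 (0 : TJet), |(Φ q).1| < 1 := by
    refine (hΦ.fst.continuousAt.abs).eventually (gt_mem_nhds ?_)
    simp [hΦ0]
  obtain ⟨r, hr, hball⟩ := Metric.eventually_nhds_iff_ball.1 (hint.and (hpos.and (hbd.and hΦ)))
  have hmem : ∀ {t : ℝ} {z : Jet}, t ∈ Metric.ball (0 : ℝ) r → z ∈ Metric.ball (0 : Jet) r →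
      (t, z) ∈ Metric.ball (0 : TJet) r := by
    intro t z ht hz
    rw [show (0 : TJet) = (0, 0) from rfl, ← ball_prod_same]
    exact ⟨ht, hz⟩
  obtain ⟨O, hO, h0O, hGO⟩ := hG.exists_isOpen
  refine ⟨fun t z => G (t, z), ⟨O, hO, h0O, hGO⟩, ?_, Metric.ball 0 r, Metric.ball_mem_nhds _ hr, ?_⟩
  · have h2 : Tendsto (fun z : ℝ × ℝ => ((z.1, z.2, 0) : Jet)) (𝓝 0) (𝓝 0) := by
      have : Continuous (fun z : ℝ × ℝ => ((z.1, z.2, 0) : Jet)) := by fun_prop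
      exact this.tendsto 0
    filter_upwards [h2.eventually hid] with z hz
    simp [hGdef, hz]
  · filter_upwards [Metric.ball_mem_nhds (0 : ℝ) hr] with t ht
    refine mapsSolutions_of_jetMap (Φ := fun z => Φ (t, z)) ?_ ?_ ?_ ⟨1, fun z hz => ?_⟩
    · intro z hz
      exact (((hball _ (hmem ht hz)).2.2.2.diffAt).comp z
        (by fun_prop : DifferentiableAt ℝ (fun z : Jet => (t, z)) z))
    · rintro ⟨x, y, p⟩ hz
      have hz' : x ∈ Metric.ball (0 : ℝ) r ∧ y ∈ Metric.ball (0 : ℝ) r ∧ p ∈ Metric.ball (0 : ℝ) r := by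
        rw [show (0 : Jet) = (0, 0, 0) from rfl, ← ball_prod_same, ← ball_prod_same] at hz
        exact ⟨hz.1, hz.2.1, hz.2.2⟩
      have hderiv : ∀ p' ∈ Metric.ball (0 : ℝ) r,
          HasDerivAt (fun p => Φ (t, x, y, p)) (fderiv ℝ Φ (t, x, y, p') (0, 0, 0, 1)) p' ∧
          IntertwinesAt Φ F.total F'.total (t, x, y, p') := by
        intro p' hp'
        have hm : ((x, y, p') : Jet) ∈ Metric.ball (0 : Jet) r := by
          rw [show (0 : Jet) = (0, 0, 0) from rfl, ← ball_prod_same, ← ball_prod_same]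
          exact ⟨hz'.1, hz'.2.1, hp'⟩
        have := hball _ (hmem ht hm)
        refine ⟨?_, this.1⟩
        exact (this.2.2.2.diffAt).hasFDerivAt.comp_hasDerivAt p'
          ((hasDerivAt_const p' t).prodMk ((hasDerivAt_const p' x).prodMk
            ((hasDerivAt_const p' y).prodMk (hasDerivAt_id p'))))
      have hconst : ∀ φ : ℝ → ℝ, (∀ p' ∈ Metric.ball (0 : ℝ) r, HasDerivAt φ 0 p') → φ 0 = φ p :=
        fun φ hφ => Metric.isOpen_ball.is_const_of_deriv_eq_zero
          (convex_ball _ _).isPreconnected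
          (fun y hy => (hφ y hy).differentiableAt.differentiableWithinAt)
          (fun y hy => (hφ y hy).deriv) (Metric.mem_ball_self hr) hz'.2.2
      refine Prod.ext (hconst (fun p => (Φ (t, x, y, p)).1) fun p' hp' => ?_)
        (hconst (fun p => (Φ (t, x, y, p)).2.1) fun p' hp' => ?_)
      · have := hasDerivAt_fst_comp (hderiv p' hp').1
        rwa [(hderiv p' hp').2.1] at this
      · have := hasDerivAt_fst_comp (hasDerivAt_snd_comp (hderiv p' hp').1)
        rwa [(hderiv p' hp').2.2.1] at this
    · intro z hz
      have := hball _ (hmem ht hz)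
      refine ⟨_, this.2.1, ?_⟩
      rw [fderiv_slice (this.2.2.2.diffAt)]
      exact this.1.2.2
    · exact (hball _ (hmem ht hz)).2.2.1.le

theorem ODEDeformation.projEquiv_iff {f : Jet → ℝ} {F F' : ODEDeformation f} :
    F.ProjEquiv F' ↔ JetEquiv F.total F'.total :=
  ⟨fun h => h.jetEquiv, fun h => ODEDeformation.projEquiv_of_jetEquiv h⟩

theorem ODEDeformation.projEquiv_equivalence {f : Jet → ℝ} :
    Equivalence (ODEDeformation.ProjEquiv (f := f)) where
  refl F := projEquiv_iff.2 (JetEquiv.refl _)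
  symm h := projEquiv_iff.2 (projEquiv_iff.1 h).symm
  trans h h' := projEquiv_iff.2 ((projEquiv_iff.1 h).trans (projEquiv_iff.1 h'))

end ProjEquiv

/-! ### Infinitesimal point equivalences -/

section Moduli

theorem fderiv_totalField {F : TJet → ℝ} {q : TJet} (hF : DifferentiableAt ℝ F q)
    (w : TJet) : fderiv ℝ (totalField F) q w = (0, w.2.2.2, fderiv ℝ F q w) := by
  have h1 : HasFDerivAt (fun q : TJet => q.2.2.2) ((ContinuousLinearMap.snd ℝ ℝ ℝ).comp
      ((ContinuousLinearMap.snd ℝ ℝ (ℝ × ℝ)).comp (ContinuousLinearMap.snd ℝ ℝ Jet))) q :=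
    hasFDerivAt_snd.comp q (hasFDerivAt_snd.comp q hasFDerivAt_snd)
  have h2 := (hasFDerivAt_const (1 : ℝ) q).prodMk (h1.prodMk hF.hasFDerivAt)
  have h3 : HasFDerivAt (totalField F) _ q := h2
  rw [h3.fderiv]; rfl

/-- The time derivative at `t = 0` of the intertwining relation. -/
theorem IntertwinesAt.linearize {Φ : TJet → Jet} {F F' : TJet → ℝ} {z : Jet}
    (hΦ : SmoothNear Φ (0, z)) (hF : SmoothNear F (0, z)) (hF' : SmoothNear F' (0, z))
    (hid : ∀ᶠ z' in 𝓝 z, Φ (0, z') = z')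
    (hint : ∀ᶠ q in 𝓝 ((0 : ℝ), z), IntertwinesAt Φ F F' q) :
    ∃ l : ℝ, fderiv ℝ (fun q => fderiv ℝ Φ q (1, 0)) (0, z) (0, totalField F (0, z)) +
        (0, 0, fderiv ℝ F (0, z) (1, 0)) =
      l • totalField F' (0, z) + (0, (fderiv ℝ Φ (0, z) (1, 0)).2.2,
        fderiv ℝ F' (0, z) (1, fderiv ℝ Φ (0, z) (1, 0))) := by
  have hV : SmoothNear (fun q => ((0 : ℝ), totalField F q)) (0, z) :=
    (contDiff_const.smoothNear _).prodMk hF.totalField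
  have hlam : SmoothNear (fun q => (fderiv ℝ Φ q (0, totalField F q)).1) (0, z) :=
    (hΦ.fderiv_apply hV).fst
  have ht0 : totalMap Φ (0, z) = (0, z) := by simp [totalMap, hid.self_of_nhds]
  have hT : SmoothNear (fun q => totalField F' (totalMap Φ q)) (0, z) :=
    hF'.totalField.comp_of_eq hΦ.totalMap ht0
  have hbr := fderiv_bracket (φ := Φ) (x := ((0 : ℝ), z)) hΦ.contDiffAt
    (U := fun _ => ((1 : ℝ), (0 : Jet))) (V := fun q => ((0 : ℝ), totalField F q))
    (differentiableAt_const _) hV.differentiableAt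
  rw [Filter.EventuallyEq.fderiv_eq (𝕜 := ℝ)
    (show (fun q => fderiv ℝ Φ q ((0 : ℝ), totalField F q)) =ᶠ[𝓝 ((0 : ℝ), z)]
      fun q => (fderiv ℝ Φ q (0, totalField F q)).1 • totalField F' (totalMap Φ q) from by
        filter_upwards [hint] with q hq using hq.2.2)] at hbr
  rw [fderiv_fun_smul hlam.differentiableAt hT.differentiableAt] at hbr
  have hTd : fderiv ℝ (fun q => totalField F' (totalMap Φ q)) (0, z) (1, 0) =
      (0, (fderiv ℝ Φ (0, z) (1, 0)).2.2,
        fderiv ℝ F' (0, z) (1, fderiv ℝ Φ (0, z) (1, 0))) := by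
    rw [fderiv_comp_apply' (by rw [ht0]; exact hF'.totalField.differentiableAt)
      hΦ.totalMap.differentiableAt, ht0, fderiv_totalField hF'.differentiableAt,
      fderiv_totalMap hΦ.differentiableAt]
  have hVd : fderiv ℝ (fun q => ((0 : ℝ), totalField F q)) (0, z) (1, 0) =
      (0, 0, 0, fderiv ℝ F (0, z) (1, 0)) := by
    rw [fderiv_prodMk_apply (differentiableAt_const _) hF.totalField.differentiableAt,
      fderiv_totalField hF.differentiableAt]
    simp
  have hl1 : (fderiv ℝ Φ (0, z) (0, totalField F (0, z))).1 = 1 := by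
    rw [fderiv_of_slice_id hid hΦ.differentiableAt]; rfl
  simp only [add_apply, 
    ContinuousLinearMap.smulRight_apply, hTd, hVd, hl1, one_smul, ht0, fderiv_fun_const,
    Pi.zero_apply, zero_apply, sub_zero] at hbr
  rw [fderiv_of_slice_id hid hΦ.differentiableAt] at hbr
  refine ⟨fderiv ℝ (fun q => (fderiv ℝ Φ q ((0 : ℝ), totalField F q)).1) (0, z) (1, 0), ?_⟩
  rw [sub_eq_iff_eq_add] at hbr
  rw [add_comm, ← hbr, add_comm]

/-- The restriction to the `p`-axis of the difference of the initial velocities of two equivalent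
deformations lies in a finite-dimensional space. -/
def moduliSpan (f : Jet → ℝ) : Fin 11 → ℝ → ℝ :=
  ![fun _ => 1, fun p => p, fun p => p ^ 2, fun p => p ^ 3, fun p => f (0, 0, p),
    fun p => p * f (0, 0, p), fun p => fderiv ℝ f (0, 0, p) (1, 0, 0),
    fun p => fderiv ℝ f (0, 0, p) (0, 1, 0), fun p => fderiv ℝ f (0, 0, p) (0, 0, 1),
    fun p => p * fderiv ℝ f (0, 0, p) (0, 0, 1), fun p => p ^ 2 * fderiv ℝ f (0, 0, p) (0, 0, 1)]

theorem clm_plane_apply {Y : Type*} [NormedAddCommGroup Y] [NormedSpace ℝ Y] (A : ℝ × ℝ →L[ℝ] Y)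
    (x y : ℝ) : A (x, y) = x • A (1, 0) + y • A (0, 1) := by
  rw [← map_smul, ← map_smul, ← map_add]; simp

theorem ODEDeformation.velocity_eq {f : Jet → ℝ} (F : ODEDeformation f) {z : Jet}
    (h : DifferentiableAt ℝ F.total (0, z)) : F.velocity z = fderiv ℝ F.total (0, z) (1, 0) := by
  have := h.hasFDerivAt.comp_hasDerivAt (0 : ℝ)
    ((hasDerivAt_id (0 : ℝ)).prodMk (hasDerivAt_const (0 : ℝ) z))
  exact this.deriv

theorem ODEDeformation.ProjEquiv.velocity_sub {f : Jet → ℝ} {F F' : ODEDeformation f}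
    (h : F.ProjEquiv F') : ∃ k : Fin 11 → ℝ, ∀ᶠ p in 𝓝 (0 : ℝ),
      F.velocity (0, 0, p) - F'.velocity (0, 0, p) = ∑ i, k i * moduliSpan f i p := by
  obtain ⟨G, hG, hGb, hΦ, hid, hint⟩ := h.exists_prolongation
  set K : ℝ × ℝ → ℝ × ℝ := fun w => fderiv ℝ G (0, w) (1, 0) with hKdef
  have hK : SmoothNear K 0 :=
    (hG.fderiv_apply (contDiff_const.smoothNear _)).comp_of_eq
      (ContDiff.smoothNear (by fun_prop) 0 : SmoothNear (fun w : ℝ × ℝ => ((0 : ℝ), w)) 0) rfl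
  have hsl : Tendsto (fun z : Jet => ((0 : ℝ), z)) (𝓝 0) (𝓝 0) := tendsto_slice _ _
  have hbt : Tendsto (fun z : Jet => (z.1, z.2.1)) (𝓝 0) (𝓝 0) := by
    have : Continuous (fun z : Jet => (z.1, z.2.1)) := by fun_prop
    exact this.tendsto 0
  -- the velocity of the prolongation
  set W : Jet → Jet := fun z => fderiv ℝ (prolongation G) (0, z) (1, 0) with hWdef
  have hW12 : ∀ᶠ z in 𝓝 (0 : Jet), (W z).1 = (K (z.1, z.2.1)).1 ∧ (W z).2.1 = (K (z.1, z.2.1)).2 := by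
    filter_upwards [hsl.eventually hGb] with z hz
    exact fderiv_prolongation hz.1 hz.2.ne' _
  have hWs : SmoothNear W 0 := (hΦ.fderiv_apply (contDiff_const.smoothNear _)).comp_of_eq
      (ContDiff.smoothNear (by fun_prop) 0 : SmoothNear (fun w : Jet => ((0 : ℝ), w)) 0) rfl
  have hfz : ∀ᶠ z in 𝓝 (0 : Jet), ∀ v, fderiv ℝ F'.total (0, z) (0, v) = fderiv ℝ f z v := by
    filter_upwards [F'.total_zero.eventually_nhds, hsl.eventually F'.smoothNear] with z h1 h2 v
    rw [← fderiv_slice (h2.diffAt),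
      Filter.EventuallyEq.fderiv_eq (𝕜 := ℝ) (show (fun y => F'.total (0, y)) =ᶠ[𝓝 z] f from h1)]
  have main : ∀ᶠ z in 𝓝 (0 : Jet), ∃ l : ℝ, fderiv ℝ W z (1, z.2.2, f z) + (0, 0, F.velocity z) =
      l • ((1, z.2.2, f z) : Jet) + (0, (W z).2.2, F'.velocity z + fderiv ℝ f z (W z)) := by
    filter_upwards [hid.eventually_nhds, hsl.eventually hint.eventually_nhds,
      hsl.eventually hΦ.eventually, hsl.eventually F.smoothNear.eventually,
      hsl.eventually F'.smoothNear.eventually, F.total_zero, F'.total_zero, hfz]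
      with z h1 h2 h3 h4 h5 h6 h7 h8
    obtain ⟨l, hl⟩ := IntertwinesAt.linearize h3 h4 h5 h1 h2
    refine ⟨l, ?_⟩
    have e1 : fderiv ℝ W z (1, z.2.2, f z) =
        fderiv ℝ (fun q => fderiv ℝ (prolongation G) q (1, 0)) (0, z) (0, totalField F.total (0, z)) := by
      rw [← fderiv_slice (h3.fderiv_apply (contDiff_const.smoothNear _)).differentiableAt]
      simp only [totalField, h6]
      rfl
    have e2 : fderiv ℝ F'.total (0, z) (1, W z) = F'.velocity z + fderiv ℝ f z (W z) := by
      rw [← h8, F'.velocity_eq h5.differentiableAt, ← map_add]; simp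
    rw [e1, F.velocity_eq h4.differentiableAt, hl, ← e2]
    simp only [totalField, h7]
    rfl
  have hKd : ∀ᶠ z in 𝓝 (0 : Jet), SmoothNear K (z.1, z.2.1) := hbt.eventually hK.eventually
  have hbase : ∀ z : Jet, HasFDerivAt (fun z : Jet => (z.1, z.2.1))
      ((ContinuousLinearMap.fst ℝ ℝ (ℝ × ℝ)).prod
        ((ContinuousLinearMap.fst ℝ ℝ ℝ).comp (ContinuousLinearMap.snd ℝ ℝ (ℝ × ℝ)))) z :=
    fun z => hasFDerivAt_fst.prodMk (hasFDerivAt_fst.comp z hasFDerivAt_snd)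
  have hKcomp : ∀ᶠ z in 𝓝 (0 : Jet), ∀ v : Jet, (fderiv ℝ W z v).1 = (fderiv ℝ K (z.1, z.2.1) (v.1, v.2.1)).1 ∧
      (fderiv ℝ W z v).2.1 = (fderiv ℝ K (z.1, z.2.1) (v.1, v.2.1)).2 := by
    filter_upwards [hKd, hW12.eventually_nhds, hWs.eventually] with z h1 h2 h3 v
    have e : HasFDerivAt (fun z : Jet => K (z.1, z.2.1)) _ z :=
      HasFDerivAt.comp (g := K) (f := fun z : Jet => (z.1, z.2.1)) z h1.hasFDerivAt (hbase z)
    have ev : fderiv ℝ (fun z : Jet => K (z.1, z.2.1)) z v =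
        fderiv ℝ K (z.1, z.2.1) (v.1, v.2.1) := by rw [e.fderiv]; rfl
    rw [← ev, ← fderiv_fst_apply h3.differentiableAt, ← fderiv_snd_apply h3.differentiableAt,
      ← fderiv_fst_apply h3.snd.differentiableAt, ← fderiv_fst_apply e.differentiableAt,
      ← fderiv_snd_apply e.differentiableAt]
    constructor
    · rw [Filter.EventuallyEq.fderiv_eq (𝕜 := ℝ) (show (fun y => (W y).1) =ᶠ[𝓝 z]
        fun y : Jet => (K (y.1, y.2.1)).1 from h2.mono fun _ h => h.1)]
    · rw [Filter.EventuallyEq.fderiv_eq (𝕜 := ℝ) (show (fun y => (W y).2.1) =ᶠ[𝓝 z]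
        fun y : Jet => (K (y.1, y.2.1)).2 from h2.mono fun _ h => h.2)]
  have hc : ∀ᶠ z in 𝓝 (0 : Jet), (W z).2.2 =
      (fderiv ℝ K (z.1, z.2.1) (1, z.2.2)).2 - z.2.2 * (fderiv ℝ K (z.1, z.2.1) (1, z.2.2)).1 := by
    filter_upwards [main, hKcomp] with z ⟨l, hl⟩ hk
    have e1 := congrArg (fun w : Jet => w.1) hl
    have e2 := congrArg (fun w : Jet => w.2.1) hl
    simp only [Prod.fst_add, Prod.snd_add, Prod.smul_fst, Prod.smul_snd, smul_eq_mul, add_zero,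
      (hk _).1, (hk _).2, mul_one] at e1 e2
    rw [e1, e2]; ring
  have hdc : ∀ᶠ z in 𝓝 (0 : Jet), ∀ v : Jet, (fderiv ℝ W z v).2.2 =
      (fderiv ℝ (fderiv ℝ K) (z.1, z.2.1) (v.1, v.2.1) (1, z.2.2) + fderiv ℝ K (z.1, z.2.1) (0, v.2.2)).2
      - (z.2.2 * (fderiv ℝ (fderiv ℝ K) (z.1, z.2.1) (v.1, v.2.1) (1, z.2.2)
          + fderiv ℝ K (z.1, z.2.1) (0, v.2.2)).1
        + v.2.2 * (fderiv ℝ K (z.1, z.2.1) (1, z.2.2)).1) := by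
    filter_upwards [hKd, hc.eventually_nhds, hWs.eventually] with z h1 h2 h3 v
    have hp : HasFDerivAt (fun z : Jet => z.2.2) ((ContinuousLinearMap.snd ℝ ℝ ℝ).comp
      (ContinuousLinearMap.snd ℝ ℝ (ℝ × ℝ))) z :=
      hasFDerivAt_snd.comp z hasFDerivAt_snd
    have hKf : HasFDerivAt (fun z : Jet => fderiv ℝ K (z.1, z.2.1)) _ z :=
      HasFDerivAt.comp (g := fderiv ℝ K) (f := fun z : Jet => (z.1, z.2.1)) z
        h1.fderivMap.hasFDerivAt (hbase z)
    have hQ := hKf.clm_apply ((hasFDerivAt_const (1 : ℝ) z).prodMk hp)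
    have hQv : HasFDerivAt (fun z : Jet => (fderiv ℝ K (z.1, z.2.1) (1, z.2.2)).2 -
        z.2.2 * (fderiv ℝ K (z.1, z.2.1) (1, z.2.2)).1) _ z :=
      hQ.snd.sub (hp.mul hQ.fst)
    rw [← fderiv_snd_apply h3.differentiableAt, ← fderiv_snd_apply h3.snd.differentiableAt,
      Filter.EventuallyEq.fderiv_eq (𝕜 := ℝ) (show (fun y => (W y).2.2) =ᶠ[𝓝 z] _ from h2), hQv.fderiv]
    simp
    ring
  have hax : Tendsto (fun p : ℝ => ((0, 0, p) : Jet)) (𝓝 0) (𝓝 0) := by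
    have : Continuous (fun p : ℝ => ((0, 0, p) : Jet)) := by fun_prop
    exact this.tendsto 0
  set A := fderiv ℝ K 0
  set B := fderiv ℝ (fderiv ℝ K) 0
  refine ⟨![-(B (1, 0) (1, 0)).2, -((B (1, 0) (0, 1)).2 + (B (0, 1) (1, 0)).2) + (B (1, 0) (1, 0)).1,
    -(B (0, 1) (0, 1)).2 + ((B (1, 0) (0, 1)).1 + (B (0, 1) (1, 0)).1), (B (0, 1) (0, 1)).1,
    2 * (A (1, 0)).1 - (A (0, 1)).2, 3 * (A (0, 1)).1, (K 0).1, (K 0).2, (A (1, 0)).2,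
    (A (0, 1)).2 - (A (1, 0)).1, -(A (0, 1)).1], ?_⟩
  filter_upwards [hax.eventually main, hax.eventually hKcomp, hax.eventually hc, hax.eventually hdc,
    hax.eventually hW12] with p ⟨l, hl⟩ h1 h2 h3 h4
  have e1 := congrArg (fun w : Jet => w.1) hl
  have e3 := congrArg (fun w : Jet => w.2.2) hl
  have hWe : W (0, 0, p) = (K 0).1 • ((1, 0, 0) : Jet) + (K 0).2 • ((0, 1, 0) : Jet) +
      ((A (1, p)).2 - p * (A (1, p)).1) • ((0, 0, 1) : Jet) := by
    refine Prod.ext ((show _ = (K 0).1 from h4.1).trans (by simp))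
      (Prod.ext ((show _ = (K 0).2 from h4.2).trans (by simp))
        ((show _ = (A (1, p)).2 - p * (A (1, p)).1 from h2).trans (by simp)))
  simp only [Prod.fst_add, Prod.snd_add, Prod.smul_fst, Prod.smul_snd, smul_eq_mul, add_zero,
      (h1 _).1, h3, mul_one] at e1 e3
  rw [hWe] at e3
  rw [← e1] at e3
  have hAp : A (1, p) = A (1, 0) + p • A (0, 1) := by rw [clm_plane_apply, one_smul]
  have hA2 : A (0, f (0, 0, p)) = f (0, 0, p) • A (0, 1) := by rw [clm_plane_apply, zero_smul, zero_add]
  have hBp : B (1, p) (1, p) = B (1, 0) (1, 0) + p • B (1, 0) (0, 1) + p • (B (0, 1) (1, 0) + p • B (0, 1) (0, 1)) := by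
    rw [clm_plane_apply B 1 p, add_apply, smul_apply,
      smul_apply, clm_plane_apply (B (1, 0)), clm_plane_apply (B (0, 1))]
    simp only [one_smul]
  change (B (1, p) (1, p) + A (0, f (0, 0, p))).2 - (p * (B (1, p) (1, p) + A (0, f (0, 0, p))).1 +
    f (0, 0, p) * (A (1, p)).1) + F.velocity (0, 0, p) = (A (1, p)).1 * f (0, 0, p) + _ at e3
  rw [map_add, map_add, map_smul, map_smul, map_smul, hAp, hA2, hBp] at e3
  simp only [Fin.sum_univ_succ, moduliSpan, Matrix.cons_val_zero, Matrix.cons_val_succ,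
    Finset.univ_unique, Fin.default_eq_zero, Finset.sum_singleton]
  simp only [Prod.fst_add, Prod.snd_add, Prod.smul_fst, Prod.smul_snd, smul_eq_mul] at e3
  simp
  linear_combination e3

/-- Passing to germs is linear. -/
def germMap : (ℝ → ℝ) →ₗ[ℝ] Filter.Germ (𝓝 (0 : ℝ)) ℝ where
  toFun g := g
  map_add' _ _ := rfl
  map_smul' _ _ := rfl

theorem germMap_eq_iff {g h : ℝ → ℝ} : germMap g = germMap h ↔ g =ᶠ[𝓝 0] h := Filter.Germ.coe_eq

/-- Evaluation of polynomials. -/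
def polynomialFunction : Polynomial ℝ →ₗ[ℝ] (ℝ → ℝ) where
  toFun P x := P.eval x
  map_add' _ _ := by ext; simp
  map_smul' _ _ := by ext; simp

theorem germMap_polynomial_injective : Function.Injective (germMap ∘ₗ polynomialFunction) := by
  intro P Q h
  have h1 : ∀ᶠ x in 𝓝 (0 : ℝ), P.eval x = Q.eval x := germMap_eq_iff.1 h
  refine Polynomial.eq_of_infinite_eval_eq P Q ?_
  exact infinite_of_mem_nhds (0 : ℝ) h1

theorem exists_linearIndependent_of_finiteDimensional {V W : Type*} [AddCommGroup V] [Module ℝ V]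
    [AddCommGroup W] [Module ℝ W] {φ : V →ₗ[ℝ] W} (hφ : Function.Injective φ)
    (hV : ¬ FiniteDimensional ℝ V) (L : Submodule ℝ W) [FiniteDimensional ℝ L] (n : ℕ) :
    ∃ g : Fin n → V, LinearIndependent ℝ fun i => L.mkQ (φ (g i)) := by
  have hinf : ¬ FiniteDimensional ℝ (LinearMap.range (L.mkQ ∘ₗ φ)) := by
    intro h
    apply hV
    have hk : FiniteDimensional ℝ (LinearMap.ker (L.mkQ ∘ₗ φ)) := by
      have : LinearMap.ker (L.mkQ ∘ₗ φ) = L.comap φ := by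
        rw [LinearMap.ker_comp, Submodule.ker_mkQ]
      rw [this]
      let ψ : L.comap φ →ₗ[ℝ] L := φ.restrict fun x hx => hx
      refine FiniteDimensional.of_injective ψ ?_
      intro x y hxy
      exact Subtype.ext (hφ (congrArg Subtype.val hxy))
    have : FiniteDimensional ℝ (V ⧸ LinearMap.ker (L.mkQ ∘ₗ φ)) :=
      Module.Finite.equiv (L.mkQ ∘ₗ φ).quotKerEquivRange.symm
    exact Module.Finite.of_submodule_quotient (LinearMap.ker (L.mkQ ∘ₗ φ))
  have hr : (n : Cardinal) ≤ Module.rank ℝ (LinearMap.range (L.mkQ ∘ₗ φ)) := by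
    have := not_lt.1 (mt Module.rank_lt_aleph0_iff.1 hinf)
    exact (Cardinal.natCast_lt_aleph0).le.trans this
  obtain ⟨v, hv⟩ := Module.le_rank_iff.1 hr
  choose g hg using fun i => (v i).2
  refine ⟨g, ?_⟩
  have := hv.map' (LinearMap.range (L.mkQ ∘ₗ φ)).subtype (Submodule.ker_subtype _)
  rw [show (fun i => L.mkQ (φ (g i))) = (LinearMap.range (L.mkQ ∘ₗ φ)).subtype ∘ v from funext hg]
  exact this

theorem not_finiteDimensional_polynomial : ¬ FiniteDimensional ℝ (Polynomial ℝ) :=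
  Polynomial.not_finite

theorem infiniteDimensionalModuli (f : Jet → ℝ) : InfiniteDimensionalModuli f := by
  intro n
  let L : Submodule ℝ (Filter.Germ (𝓝 (0 : ℝ)) ℝ) :=
    Submodule.span ℝ (Set.range fun i => germMap (moduliSpan f i))
  have : FiniteDimensional ℝ L := FiniteDimensional.span_of_finite ℝ (Set.finite_range _)
  obtain ⟨P, hP⟩ := exists_linearIndependent_of_finiteDimensional germMap_polynomial_injective
    not_finiteDimensional_polynomial L n
  refine ⟨fun i z => (P i).eval z.2.2, fun i => ⟨univ, isOpen_univ, mem_univ _, ?_⟩, ?_⟩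
  · refine ContDiff.contDiffOn ?_
    have h1 : ContDiff ℝ ∞ (fun x : ℝ => (P i).eval x) := by
      simpa using (P i).contDiff_aeval (R := ℝ) (𝕜 := ℝ) ∞
    exact h1.comp (by fun_prop : ContDiff ℝ ∞ fun z : Jet => z.2.2)
  · intro F F' s s' hs hs' hFF'
    obtain ⟨k, hk⟩ := hFF'.velocity_sub
    have hax : Tendsto (fun p : ℝ => ((0, 0, p) : Jet)) (𝓝 0) (𝓝 0) := by
      have : Continuous (fun p : ℝ => ((0, 0, p) : Jet)) := by fun_prop
      exact this.tendsto 0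
    have heq : germMap (∑ i, (s i - s' i) • polynomialFunction (P i)) =
        germMap (∑ i, k i • moduliSpan f i) := by
      rw [germMap_eq_iff]
      filter_upwards [hk, hax.eventually hs, hax.eventually hs'] with p h1 h2 h3
      rw [h2, h3] at h1
      simp only [Finset.sum_apply, Pi.smul_apply, smul_eq_mul, sub_mul, Finset.sum_sub_distrib]
      exact h1
    have hmem : germMap (∑ i, (s i - s' i) • polynomialFunction (P i)) ∈ L := by
      rw [heq, map_sum]
      refine Submodule.sum_mem _ fun i _ => ?_
      rw [map_smul]
      exact Submodule.smul_mem _ _ (Submodule.subset_span ⟨i, rfl⟩)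
    have h0 := (Submodule.Quotient.mk_eq_zero L).2 hmem
    rw [map_sum] at h0
    have h0' : ∑ i, (s i - s' i) • L.mkQ ((germMap ∘ₗ polynomialFunction) (P i)) = 0 := by
      rw [← h0, ← Submodule.mkQ_apply, map_sum]
      simp only [map_smul]
      rfl
    have := Fintype.linearIndependent_iff.1 hP _ h0'
    funext i
    exact sub_eq_zero.1 (this i)

end Moduli

/-! ### Families of plane fields near a leaf, in coordinates -/

section LeafIsotopy

/-- The range of the angle. -/
notation "Quadrant" => Icc 0 (Real.pi / 2)

/-- The leaf over the origin at time zero, in coordinates `(t, (z, θ))`. -/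
def leafSet : Set Cyl := {0} ×ˢ ({0} ×ˢ Quadrant)

/-- The filter of neighbourhoods of the leaf. -/
notation "𝓛" => 𝓝ˢ leafSet

theorem mem_leafSet {y : Cyl} :
    y ∈ leafSet ↔ y.1 = 0 ∧ y.2.1 = 0 ∧ y.2.2 ∈ Quadrant := by
  simp [leafSet, mem_prod]

/-- `f` is smooth near every point of the leaf. -/
abbrev SmoothLeaf {E : Type} [NormedAddCommGroup E] [NormedSpace ℝ E] (f : Cyl → E) : Prop :=
  ∀ y ∈ leafSet, SmoothNear f y

theorem isCompact_leafSet : IsCompact leafSet :=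
  isCompact_singleton.prod (isCompact_singleton.prod isCompact_Icc)

theorem eventually_leafSet {P : Cyl → Prop} :
    (∀ᶠ y in 𝓛, P y) ↔ ∀ y ∈ leafSet, ∀ᶠ y' in 𝓝 y, P y' :=
  eventually_nhdsSet_iff_forall

theorem eventually_leafSet_nhds {P : Cyl → Prop} (h : ∀ᶠ y in 𝓛, P y) :
    ∀ᶠ y in 𝓛, ∀ᶠ y' in 𝓝 y, P y' :=
  eventually_leafSet.2 fun y hy => (eventually_leafSet.1 h y hy).eventually_nhds

theorem tendsto_leafSet {f : Cyl → Cyl} (hc : ∀ y ∈ leafSet, ContinuousAt f y)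
    (hm : ∀ y ∈ leafSet, f y ∈ leafSet) : Tendsto f 𝓛 𝓛 := by
  intro s hs
  rw [mem_map]
  refine (eventually_leafSet (P := fun y => f y ∈ s)).2 fun y hy => ?_
  exact (hc y hy).tendsto (nhds_le_nhdsSet (hm y hy) hs)

/-- The derivative in the space directions. -/
def sliceDeriv {X Y : Type*} [NormedAddCommGroup X] [NormedSpace ℝ X] [NormedAddCommGroup Y]
    [NormedSpace ℝ Y] (ψ : ℝ × X → Y) (y : ℝ × X) : X →ₗ[ℝ] Y :=
  ((fderiv ℝ ψ y).comp (ContinuousLinearMap.inr ℝ ℝ X)).toLinearMap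

theorem sliceDeriv_apply {X Y : Type*} [NormedAddCommGroup X] [NormedSpace ℝ X]
    [NormedAddCommGroup Y] [NormedSpace ℝ Y] (ψ : ℝ × X → Y) (y : ℝ × X) (v : X) :
    sliceDeriv ψ y v = fderiv ℝ ψ y (0, v) := rfl

/-- A smooth family of maps that is the identity at time zero. -/
structure IsLeafMap (ψ : Cyl → Jet × ℝ) : Prop where
  smooth : ∀ᶠ y in 𝓛, ContDiffAt ℝ ∞ ψ y
  slice_id : ∀ᶠ y in 𝓛, y.1 = 0 → ψ y = y.2
  bottom : ∀ᶠ y in 𝓛, y.2.2 = 0 → (ψ y).2 = 0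
  top : ∀ᶠ y in 𝓛, y.2.2 = Real.pi / 2 → (ψ y).2 = Real.pi / 2

/-- The family `ψ` of maps takes the planes `D` to the planes `D'` over the domain. -/
structure IsLeafIsotopy (D D' : Cyl → Submodule ℝ (Jet × ℝ)) (ψ : Cyl → Jet × ℝ) :
    Prop extends IsLeafMap ψ where
  map : ∀ᶠ y in 𝓛, y.2.2 ∈ Quadrant →
    (D y).map (sliceDeriv ψ y) = D' (y.1, ψ y)

def LeafIsotopic (D D' : Cyl → Submodule ℝ (Jet × ℝ)) : Prop := ∃ ψ, IsLeafIsotopy D D' ψ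

variable {D D' D'' : Cyl → Submodule ℝ (Jet × ℝ)} {ψ : Cyl → Jet × ℝ}

theorem IsLeafMap.smoothNear (h : IsLeafMap ψ) {y : Cyl} (hy : y ∈ leafSet) :
    SmoothNear ψ y := eventually_leafSet.1 h.smooth y hy

theorem IsLeafMap.totalMap_eq (h : IsLeafMap ψ) {y : Cyl} (hy : y ∈ leafSet) :
    totalMap ψ y = y :=
  Prod.ext rfl ((eventually_leafSet.1 h.slice_id y hy).self_of_nhds (mem_leafSet.1 hy).1)

theorem IsLeafMap.eventually_slice (h : IsLeafMap ψ) {y : Cyl} (hy : y ∈ leafSet) :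
    ∀ᶠ q in 𝓝 y.2, ψ (0, q) = q := by
  have h1 := eventually_leafSet.1 h.slice_id y hy
  have h2 := tendsto_slice y.1 y.2
  filter_upwards [h2.eventually h1] with q hq
  have := hq (mem_leafSet.1 hy).1
  rwa [(mem_leafSet.1 hy).1] at this

theorem IsLeafMap.tendsto (h : IsLeafMap ψ) : Tendsto (totalMap ψ) 𝓛 𝓛 :=
  tendsto_leafSet (fun _ hy => (h.smoothNear hy).totalMap.continuousAt)
    fun y hy => by rwa [h.totalMap_eq hy]

theorem IsLeafMap.fderiv_eq (h : IsLeafMap ψ) {y : Cyl} (hy : y ∈ leafSet) (v : Jet × ℝ) :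
    fderiv ℝ ψ y (0, v) = v := by
  obtain ⟨t, q⟩ := y
  have ht : t = 0 := (mem_leafSet.1 hy).1
  subst ht
  exact fderiv_of_slice_id (h.eventually_slice hy) (h.smoothNear hy).differentiableAt v

/-- Near the leaf, a function with positive `θ`-derivative that is equal to `c` where `θ = c`
compares to `c` as `θ` does. -/
theorem le_iff_of_leaf {h : Cyl → ℝ} {c : ℝ} (hs : ∀ y ∈ leafSet, SmoothNear h y)
    (hθ : ∀ y ∈ leafSet, h y = y.2.2) (hd : ∀ y ∈ leafSet, 0 < fderiv ℝ h y (0, 0, 1))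
    (hc : ∀ᶠ y in 𝓛, y.2.2 = c → h y = c) :
    ∀ᶠ y in 𝓛, (h y ≤ c ↔ y.2.2 ≤ c) ∧ (c ≤ h y ↔ c ≤ y.2.2) := by
  refine eventually_leafSet.2 fun y hy => ?_
  have hcont : ContinuousAt (fun y : Cyl => y.2.2) y := by fun_prop
  rcases lt_trichotomy y.2.2 c with hlt | heq | hgt
  · filter_upwards [(hs y hy).continuousAt.eventually (gt_mem_nhds (by rwa [hθ y hy])),
      hcont.eventually (gt_mem_nhds hlt)] with y' h1 h2
    exact ⟨iff_of_true h1.le h2.le, iff_of_false h1.not_ge h2.not_ge⟩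
  · have hpos : ∀ᶠ y' in 𝓝 y, 0 < fderiv ℝ h y' (0, 0, 1) :=
      ((hs y hy).fderiv_apply (contDiff_const.smoothNear _)).continuousAt.eventually
        (lt_mem_nhds (hd y hy))
    obtain ⟨r, hr, hball⟩ := Metric.eventually_nhds_iff_ball.1
      (hpos.and ((hs y hy).and (eventually_leafSet.1 hc y hy)))
    filter_upwards [Metric.ball_mem_nhds y hr] with y' hy'
    obtain ⟨t, z, θ⟩ := y'
    have hb : t ∈ Metric.ball y.1 r ∧ z ∈ Metric.ball y.2.1 r ∧ θ ∈ Metric.ball y.2.2 r := by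
      rw [show y = (y.1, y.2.1, y.2.2) from rfl, ← ball_prod_same, ← ball_prod_same] at hy'
      exact ⟨hy'.1, hy'.2.1, hy'.2.2⟩
    have hmem : ∀ s ∈ Metric.ball c r, (t, z, s) ∈ Metric.ball y r := by
      intro s hs
      rw [show y = (y.1, y.2.1, y.2.2) from rfl, ← ball_prod_same, ← ball_prod_same]
      exact ⟨hb.1, hb.2.1, by rwa [heq]⟩
    have hder : ∀ s ∈ Metric.ball c r, HasDerivAt (fun s => h (t, z, s))
        (fderiv ℝ h (t, z, s) (0, 0, 1)) s := fun s hs =>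
      ((hball _ (hmem s hs)).2.1.diffAt).hasFDerivAt.comp_hasDerivAt s
        ((hasDerivAt_const s t).prodMk ((hasDerivAt_const s z).prodMk (hasDerivAt_id s)))
    have hmono : StrictMonoOn (fun s => h (t, z, s)) (Metric.ball c r) := by
      refine strictMonoOn_of_deriv_pos (convex_ball _ _)
        (fun s hs => (hder s hs).continuousAt.continuousWithinAt) fun s hs => ?_
      rw [Metric.isOpen_ball.interior_eq] at hs
      rw [(hder s hs).deriv]
      exact (hball _ (hmem s hs)).1
    have hcm : c ∈ Metric.ball c r := Metric.mem_ball_self hr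
    have hθm : θ ∈ Metric.ball c r := by rw [← heq]; exact hb.2.2
    have hcc : h (t, z, c) = c := (hball _ (hmem c hcm)).2.2 rfl
    have e1 := hmono.le_iff_le hθm hcm
    have e2 := hmono.le_iff_le hcm hθm
    simp only [hcc] at e1 e2
    exact ⟨e1, e2⟩
  · filter_upwards [(hs y hy).continuousAt.eventually (lt_mem_nhds (by rwa [hθ y hy])),
      hcont.eventually (lt_mem_nhds hgt)] with y' h1 h2
    exact ⟨iff_of_false h1.not_ge h2.not_ge, iff_of_true h1.le h2.le⟩

theorem IsLeafMap.le_iff (h : IsLeafMap ψ) {c : ℝ}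
    (hc : ∀ᶠ y in 𝓛, y.2.2 = c → (ψ y).2 = c) :
    ∀ᶠ y in 𝓛, ((ψ y).2 ≤ c ↔ y.2.2 ≤ c) ∧ (c ≤ (ψ y).2 ↔ c ≤ y.2.2) := by
  refine le_iff_of_leaf (h := fun y => (ψ y).2) (fun y hy => (h.smoothNear hy).snd)
    (fun y hy => congrArg (fun y => y.2.2) (h.totalMap_eq hy)) (fun y hy => ?_) hc
  rw [fderiv_snd_apply (h.smoothNear hy).differentiableAt, h.fderiv_eq hy]
  exact one_pos

theorem IsLeafMap.mem_iff (h : IsLeafMap ψ) :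
    ∀ᶠ y in 𝓛, ((ψ y).2 ∈ Quadrant ↔ y.2.2 ∈ Quadrant) ∧
      ((ψ y).2 = 0 ↔ y.2.2 = 0) ∧ ((ψ y).2 = Real.pi / 2 ↔ y.2.2 = Real.pi / 2) := by
  filter_upwards [h.le_iff h.bottom, h.le_iff h.top] with y h1 h2
  refine ⟨and_congr h1.2 h2.1, ?_, ?_⟩
  · rw [le_antisymm_iff, le_antisymm_iff, h1.1, h1.2]
  · rw [le_antisymm_iff, le_antisymm_iff, h2.1, h2.2]

theorem LeafIsotopic.refl (D : Cyl → Submodule ℝ (Jet × ℝ)) : LeafIsotopic D D := by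
  refine ⟨Prod.snd, ⟨⟨Eventually.of_forall fun _ => contDiffAt_snd, by simp, by simp, by simp⟩, ?_⟩⟩
  refine Eventually.of_forall fun y _ => ?_
  have : sliceDeriv (Prod.snd : Cyl → Jet × ℝ) y = LinearMap.id := by
    ext <;> simp [sliceDeriv_apply, fderiv_snd]
  rw [this, Submodule.map_id]

theorem LeafIsotopic.of_eq
    (h : ∀ᶠ y in 𝓛, y.2.2 ∈ Quadrant → D y = D' y) : LeafIsotopic D D' := by
  obtain ⟨ψ, h1⟩ := LeafIsotopic.refl D
  refine ⟨ψ, h1.toIsLeafMap, ?_⟩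
  filter_upwards [h1.map, h1.tendsto.eventually h, h1.mem_iff] with y h2 h3 h5 h4
  rw [h2 h4]
  exact h3 (h5.1.2 h4)

theorem LeafIsotopic.trans (h : LeafIsotopic D D') (h' : LeafIsotopic D' D'') :
    LeafIsotopic D D'' := by
  obtain ⟨ψ, h⟩ := h
  obtain ⟨φ, h'⟩ := h'
  refine ⟨fun y => φ (totalMap ψ y), ⟨⟨?_, ?_, ?_, ?_⟩, ?_⟩⟩
  · filter_upwards [eventually_leafSet_nhds h.smooth,
      h.tendsto.eventually (eventually_leafSet_nhds h'.smooth)] with y h1 h2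
    exact ((show SmoothNear φ (totalMap ψ y) from h2).comp
      (show SmoothNear ψ y from h1).totalMap).contDiffAt
  · filter_upwards [h.slice_id, h.tendsto.eventually h'.slice_id] with y h1 h2 h3
    rw [h2 h3]
    exact h1 h3
  · filter_upwards [h.bottom, h.tendsto.eventually h'.bottom] with y h1 h2 h3 using h2 (h1 h3)
  · filter_upwards [h.top, h.tendsto.eventually h'.top] with y h1 h2 h3 using h2 (h1 h3)
  · filter_upwards [h.mem_iff, h.map, h.tendsto.eventually h'.map, h.smooth,
      h.tendsto.eventually h'.smooth] with y h1 h2 h3 h4 h5 h6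
    have hd : DifferentiableAt ℝ ψ y := h4.diffAt
    have hd' : DifferentiableAt ℝ φ (totalMap ψ y) := h5.diffAt
    have e : sliceDeriv (fun y => φ (totalMap ψ y)) y =
        (sliceDeriv φ (totalMap ψ y)).comp (sliceDeriv ψ y) := by
      refine LinearMap.ext fun v => ?_
      rw [LinearMap.comp_apply, sliceDeriv_apply, sliceDeriv_apply, sliceDeriv_apply,
        fderiv_comp_apply' hd' (differentiableAt_fst.prodMk hd), fderiv_totalMap hd]
    rw [e, Submodule.map_comp, h2 h6]
    exact h3 (h1.1.2 h6)

theorem IsLeafMap.exists_inverse (h : IsLeafMap ψ) : ∃ g : Cyl → Cyl,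
    (∀ᶠ y in 𝓛, ContDiffAt ℝ ∞ g y) ∧ (∀ᶠ y in 𝓛, g (totalMap ψ y) = y) ∧
      (∀ᶠ y in 𝓛, totalMap ψ (g y) = y) ∧
      Tendsto g 𝓛 𝓛 := by
  obtain ⟨g, hg⟩ := exists_inverse_near_compact isCompact_leafSet
    (fun y hy => (h.smoothNear hy).totalMap) (fun y hy => h.totalMap_eq hy) fun y hy => by
      obtain ⟨t, q⟩ := y
      have ht : t = 0 := (mem_leafSet.1 hy).1
      subst ht
      exact bijective_of_injective (fderiv_totalMap_injective (h.smoothNear hy).differentiableAt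
        (h.eventually_slice hy))
  have hgl := eventually_leafSet.2 fun y hy => (hg y hy).2.1
  refine ⟨g, eventually_leafSet.2 fun y hy => (hg y hy).1, hgl,
    eventually_leafSet.2 fun y hy => (hg y hy).2.2,
    tendsto_leafSet (fun y hy => (hg y hy).1.continuousAt) fun y hy => ?_⟩
  have := (eventually_leafSet.1 hgl y hy).self_of_nhds
  rw [h.totalMap_eq hy] at this
  rwa [this]

theorem IsLeafMap.injective_sliceDeriv (h : IsLeafMap ψ) :
    ∀ᶠ y in 𝓛, Function.Injective (sliceDeriv ψ y) := by
  obtain ⟨g, hg, hgl, -, -⟩ := h.exists_inverse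
  filter_upwards [h.tendsto.eventually hg, h.smooth, eventually_leafSet_nhds hgl] with y h1 h2 h3
  rw [injective_iff_map_eq_zero]
  intro v hv
  have h2' := h2.diffAt
  have ht : DifferentiableAt ℝ (totalMap ψ) y := differentiableAt_fst.prodMk h2'
  have e := fderiv_comp_apply' (g := g) (f := totalMap ψ) (h1.diffAt) ht (0, v)
  rw [Filter.EventuallyEq.fderiv_eq (𝕜 := ℝ) (show (fun y => g (totalMap ψ y)) =ᶠ[𝓝 y] id from h3),
    fderiv_id, fderiv_totalMap h2', show fderiv ℝ ψ y (0, v) = 0 from hv] at e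
  exact congrArg Prod.snd (e.trans (map_zero (fderiv ℝ g (totalMap ψ y))))

theorem LeafIsotopic.symm (h : LeafIsotopic D D') : LeafIsotopic D' D := by
  obtain ⟨ψ, h⟩ := h
  obtain ⟨g, hg, hgl, hgr, hgt⟩ := h.exists_inverse
  have h1 : ∀ᶠ y in 𝓛, (g y).1 = y.1 ∧ ψ (g y) = y.2 :=
    hgr.mono fun y hy => ⟨(congrArg Prod.fst hy :), (congrArg Prod.snd hy :)⟩
  refine ⟨fun y => (g y).2, ⟨⟨hg.mono fun y hy => hy.snd, ?_, ?_, ?_⟩, ?_⟩⟩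
  · filter_upwards [h1, hgt.eventually h.slice_id] with y h2 h3 h4
    rw [← h2.2, h3 (h2.1.trans h4)]
  · filter_upwards [h1, hgt.eventually h.mem_iff] with y h2 h3 h4
    rw [← h3.2.1, h2.2, h4]
  · filter_upwards [h1, hgt.eventually h.mem_iff] with y h2 h3 h4
    rw [← h3.2.2, h2.2, h4]
  · filter_upwards [h1, hgt.eventually h.mem_iff, hgt.eventually h.map, hg,
      hgt.eventually h.smooth, hgt.eventually (eventually_leafSet_nhds hgl), hgr]
      with y h2 h3 h4 h5 h6 h7 h8 h9
    have hgy : (y.1, (g y).2) = g y := Prod.ext h2.1.symm rfl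
    have hy : ((g y).1, ψ (g y)) = y := h8
    have h4' := h4 (h3.1.1 (by rw [h2.2]; exact h9))
    rw [hy] at h4'
    rw [hgy, ← h4', ← Submodule.map_comp]
    have hd : DifferentiableAt ℝ ψ (g y) := h6.diffAt
    have hd' : DifferentiableAt ℝ g y := h5.diffAt
    have : (sliceDeriv (fun y => (g y).2) y).comp (sliceDeriv ψ (g y)) = LinearMap.id := by
      refine LinearMap.ext fun v => ?_
      rw [LinearMap.comp_apply, sliceDeriv_apply, sliceDeriv_apply, fderiv_snd_apply hd']
      have e1 : fderiv ℝ (fun r => g (totalMap ψ r)) (g y) (0, v) = (0, v) := by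
        rw [Filter.EventuallyEq.fderiv_eq (𝕜 := ℝ)
          (show (fun r => g (totalMap ψ r)) =ᶠ[𝓝 (g y)] fun r => r from h7)]
        simp
      have hdt : DifferentiableAt ℝ (totalMap ψ) (g y) := differentiableAt_fst.prodMk hd
      rw [fderiv_comp_apply' (by rw [h8]; exact hd') hdt, fderiv_totalMap hd, h8] at e1
      rw [e1]; rfl
    rw [this, Submodule.map_id]

end LeafIsotopy

/-! ### Straightening and lifting plane fields -/

section Plane

/-- The plane spanned by `l + ∂/∂θ` and `w`. -/
def plane (l w : Jet) : Submodule ℝ (Jet × ℝ) := Submodule.span ℝ {(l, 1), (w, 0)}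

theorem map_plane (l w : Jet) (A : Jet × ℝ →ₗ[ℝ] Jet × ℝ) :
    (plane l w).map A = Submodule.span ℝ {A (l, 1), A (w, 0)} := by
  rw [plane, Submodule.map_span, image_pair]

theorem mem_plane {l w : Jet} {v : Jet × ℝ} : v ∈ plane l w ↔ ∃ c : ℝ, v.1 = v.2 • l + c • w := by
  rw [plane, Submodule.mem_span_pair]
  constructor
  · rintro ⟨a, b, rfl⟩
    exact ⟨b, by simp⟩
  · rintro ⟨c, hc⟩
    exact ⟨v.2, c, Prod.ext (by simp [hc]) (by simp)⟩

theorem plane_add_smul (l w : Jet) (c : ℝ) : plane (l + c • w) w = plane l w := by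
  ext v
  rw [mem_plane, mem_plane]
  constructor
  · rintro ⟨d, hd⟩
    exact ⟨v.2 * c + d, by rw [hd]; module⟩
  · rintro ⟨d, hd⟩
    exact ⟨d - v.2 * c, by rw [hd]; module⟩

theorem span_eq_plane_zero {w : Jet} {s r e : ℝ} (hs : s ≠ 0) (hr : r ≠ 0) :
    Submodule.span ℝ {((0, s) : Jet × ℝ), (r • w, e)} = plane 0 w := by
  ext v
  rw [mem_plane, Submodule.mem_span_pair]
  constructor
  · rintro ⟨a, b, rfl⟩
    exact ⟨b * r, by simp [mul_smul]⟩
  · rintro ⟨c, hc⟩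
    refine ⟨(v.2 - c / r * e) / s, c / r, Prod.ext ?_ ?_⟩
    · simp only [Prod.fst_add, Prod.smul_fst, smul_zero, zero_add, smul_smul, hc]
      rw [div_mul_cancel₀ _ hr]
    · simp only [Prod.snd_add, Prod.smul_snd, smul_eq_mul]
      field_simp
      ring

variable {ψ : Cyl → Jet × ℝ}

theorem IsLeafMap.fderiv_slice (h : IsLeafMap ψ) :
    ∀ᶠ y in 𝓛, y.1 = 0 → ∀ v, fderiv ℝ ψ y (0, v) = v := by
  filter_upwards [eventually_leafSet_nhds h.slice_id, h.smooth] with y h1 h2 h3 v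
  obtain ⟨t, q⟩ := y
  simp only at h3
  subst h3
  exact fderiv_of_slice_id ((tendsto_slice (0 : ℝ) q).eventually h1 |>.mono fun q hq => hq rfl)
    (h2.diffAt) v

/-- Plane fields can be straightened by first integrals of a section. -/
theorem exists_leafIsotopic_of_firstIntegrals {l w γ : Cyl → Jet}
    (hγ : ∀ᶠ y in 𝓛, ContDiffAt ℝ ∞ γ y)
    (hγ0 : ∀ᶠ y in 𝓛, y.1 = 0 → γ y = y.2.1)
    (hγl : ∀ᶠ y in 𝓛, fderiv ℝ γ y (0, l y, 1) = 0)
    (hw : ∀ᶠ y in 𝓛, ContDiffAt ℝ ∞ w y) :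
    ∃ (ν : Cyl → Jet) (g : Cyl → Cyl),
      (∀ᶠ y in 𝓛, ContDiffAt ℝ ∞ ν y) ∧
      (∀ᶠ y in 𝓛, y.1 = 0 → ν y = w y) ∧
      (∀ᶠ y in 𝓛, ν (y.1, γ y, y.2.2) = fderiv ℝ γ y (0, w y, 0)) ∧
      Tendsto g 𝓛 𝓛 ∧
      (∀ᶠ y in 𝓛, ((g y).1, γ (g y), (g y).2.2) = y) ∧
      LeafIsotopic (fun y => plane (l y) (w y)) (fun y => plane 0 (ν y)) := by
  have hψ : IsLeafMap (fun y => (γ y, y.2.2)) :=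
    ⟨hγ.mono fun y hy => hy.prodMk (by fun_prop),
      hγ0.mono fun y hy h => Prod.ext (hy h) rfl, by simp, by simp⟩
  obtain ⟨g, hg, hgl, hgr, hgt⟩ := hψ.exists_inverse
  have hνγ : ∀ᶠ y in 𝓛, fderiv ℝ γ (g (y.1, γ y, y.2.2)) (0, w (g (y.1, γ y, y.2.2)), 0) =
      fderiv ℝ γ y (0, w y, 0) := by
    filter_upwards [hgl] with y hy
    have : g (y.1, γ y, y.2.2) = y := hy
    rw [this]
  refine ⟨fun y => fderiv ℝ γ (g y) (0, w (g y), 0), g, ?_, ?_, hνγ, hgt, hgr, fun y => (γ y, y.2.2),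
    hψ, ?_⟩
  · filter_upwards [eventually_leafSet_nhds hg, hgt.eventually (eventually_leafSet_nhds hγ),
      hgt.eventually (eventually_leafSet_nhds hw)] with y h1 h2 h3
    have h1 : SmoothNear g y := h1
    exact (((show SmoothNear γ (g y) from h2).fderivMap.comp h1).clm_apply
      ((contDiff_const.smoothNear _).prodMk
        (((show SmoothNear w (g y) from h3).comp h1).prodMk (contDiff_const.smoothNear _)))).contDiffAt
  · filter_upwards [hγ0, hνγ, hψ.fderiv_slice, hγ] with y h1 h2 h3 h4 h5
    have e : ((y.1, γ y, y.2.2) : Cyl) = y := Prod.ext rfl (Prod.ext (h1 h5) rfl)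
    rw [e] at h2
    rw [h2]
    have := congrArg Prod.fst (h3 h5 (w y, 0))
    rwa [← fderiv_fst_apply ((h4.prodMk (by fun_prop :
      ContDiffAt ℝ ∞ (fun y : Cyl => y.2.2) y)).diffAt)] at this
  · filter_upwards [hγl, hνγ, hγ] with y h1 h2 h3 _
    have hd : DifferentiableAt ℝ γ y := h3.diffAt
    have hθ : ∀ v : Cyl, fderiv ℝ (fun y : Cyl => y.2.2) y v = v.2.2 := fun v => by
      have : HasFDerivAt (fun y : Cyl => y.2.2) ((ContinuousLinearMap.snd ℝ Jet ℝ).comp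
        (ContinuousLinearMap.snd ℝ ℝ (Jet × ℝ))) y := hasFDerivAt_snd.comp y hasFDerivAt_snd
      rw [this.fderiv]; rfl
    have e : ∀ v, fderiv ℝ (fun y => (γ y, y.2.2)) y v = (fderiv ℝ γ y v, v.2.2) := fun v => by
      rw [fderiv_prodMk_apply hd (by fun_prop), hθ]
    rw [map_plane, sliceDeriv_apply, sliceDeriv_apply, e, e, h1, ← h2]
    rfl

end Plane

section Lift

/-- The direction field `cos θ V₀ + sin θ V₁` for `V₀ = a ∂/∂p`, `V₁ = b (∂/∂x + p ∂/∂y + F ∂/∂p)`. -/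
def pairField (a b : Jet → ℝ) (F : TJet → ℝ) (y : Cyl) : Jet :=
  (Real.cos y.2.2 * a y.2.1) • ((0, 0, 1) : Jet) + (Real.sin y.2.2 * b y.2.1) • totalField F (y.1, y.2.1)

/-- The argument of a plane vector. -/
def angle (p : ℝ × ℝ) : ℝ := Complex.arg (Complex.equivRealProdCLM.symm p)

theorem angle_contDiffAt {p : ℝ × ℝ} (hp : 0 < p.1 ∨ p.2 ≠ 0) : ContDiffAt ℝ ∞ angle p := by
  have h1 : Complex.equivRealProdCLM.symm p ∈ Complex.slitPlane := by
    rw [Complex.mem_slitPlane_iff]; simpa using hp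
  have h2 : ContDiffAt ℝ ∞ Complex.log (Complex.equivRealProdCLM.symm p) :=
    (Complex.contDiffAt_log h1).restrict_scalars ℝ
  have h3 : ContDiffAt ℝ ∞ (fun p : ℝ × ℝ => Complex.log (Complex.equivRealProdCLM.symm p)) p :=
    h2.comp p Complex.equivRealProdCLM.symm.contDiff.contDiffAt
  have h4 : ContDiffAt ℝ ∞ (fun p : ℝ × ℝ =>
      Complex.imCLM (Complex.log (Complex.equivRealProdCLM.symm p))) p :=
    Complex.imCLM.contDiff.contDiffAt.comp p h3
  have h5 : (fun p : ℝ × ℝ => Complex.imCLM (Complex.log (Complex.equivRealProdCLM.symm p))) = angle := by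
    funext p; simp [angle, Complex.log_im]
  rwa [h5] at h4

theorem angle_cos_sin {θ : ℝ} (h : θ ∈ Ioc (-Real.pi) Real.pi) :
    angle (Real.cos θ, Real.sin θ) = θ := by
  have : Complex.equivRealProdCLM.symm (Real.cos θ, Real.sin θ) =
      Complex.cos θ + Complex.sin θ * Complex.I := by
    apply Complex.ext <;> simp [Complex.cos_ofReal_re, Complex.sin_ofReal_re, Complex.cos_ofReal_im,
      Complex.sin_ofReal_im]
  rw [angle, this, Complex.arg_cos_add_sin_mul_I h]

theorem exists_norm_angle (p : ℝ × ℝ) (hp : p ≠ 0) : ∃ r : ℝ, 0 < r ∧ p.1 = r * Real.cos (angle p) ∧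
    p.2 = r * Real.sin (angle p) := by
  refine ⟨‖Complex.equivRealProdCLM.symm p‖, norm_pos_iff.2 (by simpa using hp), ?_, ?_⟩
  · rw [angle, Complex.norm_mul_cos_arg]; simp
  · rw [angle, Complex.norm_mul_sin_arg]; simp

theorem angle_pos_zero {α : ℝ} (h : 0 < α) : angle (α, 0) = 0 := by
  have : Complex.equivRealProdCLM.symm (α, (0 : ℝ)) = (α : ℂ) := by
    apply Complex.ext <;> simp
  rw [angle, this, Complex.arg_ofReal_of_nonneg h.le]

theorem angle_zero_pos {β : ℝ} (h : 0 < β) : angle (0, β) = Real.pi / 2 := by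
  have : Complex.equivRealProdCLM.symm ((0 : ℝ), β) = (β : ℂ) * Complex.I := by
    apply Complex.ext <;> simp
  rw [angle, this, Complex.arg_real_mul _ h, Complex.arg_I]

theorem leaf_theta_mem : ∀ᶠ y in 𝓛, y.2.2 ∈ Ioo (-Real.pi) Real.pi := by
  refine eventually_leafSet.2 fun y hy => ?_
  have : ContinuousAt (fun y : Cyl => y.2.2) y := by fun_prop
  refine this.eventually (isOpen_Ioo.mem_nhds ?_)
  have h := (mem_leafSet.1 hy).2.2
  exact ⟨by linarith [h.1, Real.pi_pos], by linarith [h.2, Real.pi_pos]⟩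

variable {a b : Jet → ℝ}

theorem tendsto_leafSet_base : Tendsto (fun y : Cyl => (y.1, y.2.1)) 𝓛 (𝓝 0) := by
  intro s hs
  rw [mem_map]
  refine (eventually_leafSet (P := fun y => (y.1, y.2.1) ∈ s)).2 fun y hy => ?_
  have : ContinuousAt (fun y : Cyl => (y.1, y.2.1)) y := by fun_prop
  have e : (y.1, y.2.1) = (0 : TJet) := Prod.ext (mem_leafSet.1 hy).1 (mem_leafSet.1 hy).2.1
  have h := this.tendsto
  simp only [e] at h
  exact h hs

theorem tendsto_leafSet_point : Tendsto (fun y : Cyl => y.2.1) 𝓛 (𝓝 0) :=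
  (continuous_snd.tendsto (0 : TJet)).comp tendsto_leafSet_base

theorem smoothNear_base (y : Cyl) : SmoothNear (fun y : Cyl => (y.1, y.2.1)) y :=
  ContDiff.smoothNear (by fun_prop) y

theorem eventually_pos_of_eq {h : Cyl → ℝ} {c : ℝ} (hc : ∀ y ∈ leafSet, ContinuousAt h y)
    (hp : ∀ y ∈ leafSet, y.2.2 = c → 0 < h y) : ∀ᶠ y in 𝓛, y.2.2 = c → 0 < h y := by
  refine eventually_leafSet.2 fun y hy => ?_
  by_cases hyc : y.2.2 = c
  · exact ((hc y hy).eventually (lt_mem_nhds (hp y hy hyc))).mono fun _ h _ => h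
  · have : ContinuousAt (fun y : Cyl => y.2.2) y := by fun_prop
    exact (this.eventually_ne hyc).mono fun _ h h' => absurd h' h

theorem SmoothNear.pairField_at {F : TJet → ℝ} {y : Cyl} (ha : SmoothNear a y.2.1)
    (hb : SmoothNear b y.2.1) (hF : SmoothNear F (y.1, y.2.1)) : SmoothNear (pairField a b F) y := by
  have hz : SmoothNear (fun y : Cyl => y.2.1) y := ContDiff.smoothNear (by fun_prop) y
  refine SmoothNear.add (SmoothNear.smul (SmoothNear.mul ?_ (ha.comp_of_eq hz rfl))
    (contDiff_const.smoothNear _)) (SmoothNear.smul (SmoothNear.mul ?_ (hb.comp_of_eq hz rfl))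
      (hF.totalField.comp_of_eq (smoothNear_base y) rfl))
  · exact ContDiff.smoothNear (Real.contDiff_cos.comp (by fun_prop)) y
  · exact ContDiff.smoothNear (Real.contDiff_sin.comp (by fun_prop)) y

theorem SmoothNear.pairField (ha : SmoothNear a 0) (hb : SmoothNear b 0) {F : TJet → ℝ}
    (hF : SmoothNear F 0) {y : Cyl} (hy : y ∈ leafSet) : SmoothNear (pairField a b F) y := by
  obtain ⟨t, z, θ⟩ := y
  obtain ⟨rfl, rfl, -⟩ := mem_leafSet.1 hy
  exact .pairField_at ha hb hF

/-- A family of maps of the base lifts to an isotopy of prolonged plane fields. -/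
theorem exists_lift (ha : SmoothNear a 0) (hb : SmoothNear b 0) (ha0 : 0 < a 0) (hb0 : 0 < b 0)
    {F : TJet → ℝ} (hF : SmoothNear F 0) {κ : TJet → Jet} (hκ : SmoothNear κ 0)
    (hid : ∀ᶠ z in 𝓝 (0 : Jet), κ (0, z) = z) {ν : Cyl → Jet}
    (hν : ∀ᶠ y in 𝓛, ContDiffAt ℝ ∞ ν y)
    (hν0 : ∀ᶠ y in 𝓛, y.1 = 0 → ν y = pairField a b F y)
    (h1 : ∀ᶠ y in 𝓛, y.2.2 ∈ Quadrant → (fderiv ℝ κ (y.1, y.2.1) (0, ν y)).2.1 =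
      (κ (y.1, y.2.1)).2.2 * (fderiv ℝ κ (y.1, y.2.1) (0, ν y)).1) :
    ∃ Ψ : Cyl → Jet × ℝ, (∀ᶠ y in 𝓛, ContDiffAt ℝ ∞ Ψ y) ∧
      (∀ᶠ y in 𝓛, y.1 = 0 → Ψ y = y.2) ∧
      (∀ᶠ y in 𝓛, y.2.2 = 0 → (fderiv ℝ κ (y.1, y.2.1) (0, ν y)).1 = 0 → (Ψ y).2 = 0) ∧
      (∀ᶠ y in 𝓛, y.2.2 = Real.pi / 2 → (fderiv ℝ κ (y.1, y.2.1) (0, ν y)).2.2 =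
        F (y.1, κ (y.1, y.2.1)) * (fderiv ℝ κ (y.1, y.2.1) (0, ν y)).1 → (Ψ y).2 = Real.pi / 2) ∧
      ∀ᶠ y in 𝓛, y.2.2 ∈ Quadrant → (Ψ y).1 = κ (y.1, y.2.1) ∧
        (∃ r : ℝ, 0 < r ∧ fderiv ℝ κ (y.1, y.2.1) (0, ν y) = r • pairField a b F (y.1, Ψ y)) ∧
        (plane 0 (ν y)).map (sliceDeriv Ψ y) = plane 0 (pairField a b F (y.1, Ψ y)) := by
  set v : Cyl → Jet := fun y => fderiv ℝ κ (y.1, y.2.1) (0, ν y) with hv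
  set k : Cyl → Jet := fun y => κ (y.1, y.2.1) with hk
  set α : Cyl → ℝ := fun y => ((v y).2.2 - F (y.1, k y) * (v y).1) / a (k y) with hα
  set β : Cyl → ℝ := fun y => (v y).1 / b (k y) with hβ
  have hκ0 : κ 0 = 0 := hid.self_of_nhds
  have hbase : ∀ y ∈ leafSet, ((y.1, y.2.1) : TJet) = 0 := fun y hy =>
    Prod.ext (mem_leafSet.1 hy).1 (mem_leafSet.1 hy).2.1
  have ks : SmoothLeaf k := fun y hy =>
    hκ.comp_of_eq (smoothNear_base y) (hbase y hy)
  have k0 : ∀ y ∈ leafSet, k y = 0 := fun y hy => by simp only [hk, hbase y hy, hκ0]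
  have νs : SmoothLeaf ν := eventually_leafSet.1 hν
  have vs : SmoothLeaf v := fun y hy =>
    (hκ.fderivMap.comp_of_eq (smoothNear_base y) (hbase y hy)).clm_apply
      ((contDiff_const.smoothNear _).prodMk (νs y hy))
  have Fs : SmoothLeaf (fun y => F (y.1, k y)) := fun y hy =>
    hF.comp_of_eq ((contDiff_fst.smoothNear y).prodMk (ks y hy))
      (Prod.ext (mem_leafSet.1 hy).1 (k0 y hy))
  have αs : SmoothLeaf α := fun y hy =>
    ((vs y hy).snd.snd.sub ((Fs y hy).mul (vs y hy).fst)).div (ha.comp_of_eq (ks y hy) (k0 y hy))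
      (by rw [k0 y hy]; exact ha0.ne')
  have βs : SmoothLeaf β := fun y hy =>
    (vs y hy).fst.div (hb.comp_of_eq (ks y hy) (k0 y hy)) (by rw [k0 y hy]; exact hb0.ne')
  have hapos : ∀ᶠ y in 𝓛, 0 < a (k y) := eventually_leafSet.2 fun y hy =>
    (ha.comp_of_eq (ks y hy) (k0 y hy)).continuousAt.eventually
      (lt_mem_nhds (by beta_reduce; rw [k0 y hy]; exact ha0))
  have hbpos : ∀ᶠ y in 𝓛, 0 < b (k y) := eventually_leafSet.2 fun y hy =>
    (hb.comp_of_eq (ks y hy) (k0 y hy)).continuousAt.eventually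
      (lt_mem_nhds (by beta_reduce; rw [k0 y hy]; exact hb0))
  have hsl : Tendsto (fun z : Jet => ((0 : ℝ), z)) (𝓝 0) (𝓝 0) := tendsto_slice _ _
  have hzt := tendsto_leafSet_point
  have hκd : ∀ᶠ z in 𝓝 (0 : Jet), ∀ u, fderiv ℝ κ (0, z) (0, u) = u := by
    filter_upwards [hid.eventually_nhds, hsl.eventually hκ.eventually] with z h4 h5
    exact fderiv_of_slice_id h4 h5.differentiableAt
  have hαβ0 : ∀ᶠ y in 𝓛, y.1 = 0 →
      k y = y.2.1 ∧ α y = Real.cos y.2.2 ∧ β y = Real.sin y.2.2 := by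
    filter_upwards [hν0, hzt.eventually hid, hzt.eventually hκd, hapos, hbpos] with y h4 h5 h6 h7 h8 h9
    have e1 : k y = y.2.1 := by simp only [hk, h9, h5]
    have e2 : v y = pairField a b F y := by simp only [hv]; rw [h9, h6, h4 h9]
    rw [e1] at h7 h8
    refine ⟨e1, ?_, ?_⟩
    · simp only [hα, e2, e1, pairField, totalField]
      rw [div_eq_iff h7.ne']
      simp
      ring
    · simp only [hβ, e2, e1, pairField, totalField]
      rw [div_eq_iff h8.ne']
      simp
  have hαβΛ : ∀ y ∈ leafSet, α y = Real.cos y.2.2 ∧ β y = Real.sin y.2.2 := fun y hy =>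
    ((eventually_leafSet.1 hαβ0 y hy).self_of_nhds (mem_leafSet.1 hy).1).2
  have hslit : ∀ y ∈ leafSet, 0 < α y ∨ β y ≠ 0 := by
    intro y hy
    obtain ⟨e1, e2⟩ := hαβΛ y hy
    have := (mem_leafSet.1 hy).2.2
    rw [e1, e2]
    rcases eq_or_lt_of_le this.1 with h | h
    · left; rw [← h]; simp
    · right; exact (Real.sin_pos_of_pos_of_lt_pi h (by linarith [this.2, Real.pi_pos])).ne'
  have hslit' : ∀ᶠ y in 𝓛, 0 < α y ∨ β y ≠ 0 := eventually_leafSet.2 fun y hy => by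
    rcases hslit y hy with h | h
    · exact ((αs y hy).continuousAt.eventually (lt_mem_nhds h)).mono fun _ => Or.inl
    · exact ((βs y hy).continuousAt.eventually_ne h).mono fun _ => Or.inr
  have hΘ : SmoothLeaf (fun y => angle (α y, β y)) := fun y hy => by
    filter_upwards [eventually_leafSet.1 hslit' y hy, αs y hy, βs y hy] with y' h4 h5 h6
    exact (angle_contDiffAt h4).comp y' (h5.prodMk h6)
  have hsm : ∀ᶠ y in 𝓛, ContDiffAt ℝ ∞ (fun y => (k y, angle (α y, β y))) y :=
    eventually_leafSet.2 fun y hy => (ks y hy).prodMk (hΘ y hy)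
  have hsl : ∀ᶠ y in 𝓛, y.1 = 0 → (k y, angle (α y, β y)) = y.2 := by
    filter_upwards [hαβ0, leaf_theta_mem] with y h4 h5 h6
    rw [(h4 h6).1, (h4 h6).2.1, (h4 h6).2.2, angle_cos_sin ⟨h5.1, h5.2.le⟩]
  refine ⟨_, hsm, hsl, ?_, ?_, ?_⟩
  · filter_upwards [eventually_pos_of_eq (c := 0) (fun y hy => (αs y hy).continuousAt)
      (fun y hy h => by rw [(hαβΛ y hy).1, h]; simp)] with y h5 h6 h4
    have : β y = 0 := by simp only [hβ, hv, h4, zero_div]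
    rw [this, angle_pos_zero (h5 h6)]
  · filter_upwards [eventually_pos_of_eq (c := Real.pi / 2)
      (fun y hy => (βs y hy).continuousAt)
      (fun y hy h => by rw [(hαβΛ y hy).2, h]; simp)] with y h5 h6 h4
    have : α y = 0 := by simp only [hα, hv, h4, hk, sub_self, zero_div]
    rw [this, angle_zero_pos (h5 h6)]
  have hsp : ∀ᶠ y in 𝓛, 0 < (fderiv ℝ (fun y => (k y, angle (α y, β y))) y (0, 0, 1)).2 :=
    eventually_leafSet.2 fun y hy => by
      have hs : SmoothNear (fun y => (k y, angle (α y, β y))) y := (ks y hy).prodMk (hΘ y hy)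
      refine ((hs.fderiv_apply (contDiff_const.smoothNear _)).snd).continuousAt.eventually
        (lt_mem_nhds ?_)
      beta_reduce
      have h4 := (tendsto_slice y.1 y.2).eventually (eventually_leafSet.1 hsl y hy)
      have h5 := hs.differentiableAt
      obtain ⟨t, q⟩ := y
      have ht : t = 0 := (mem_leafSet.1 hy).1
      subst ht
      rw [fderiv_of_slice_id (h4.mono fun q hq => hq rfl) h5]
      exact one_pos
  have hκe : ∀ᶠ y in 𝓛, DifferentiableAt ℝ κ (y.1, y.2.1) :=
    tendsto_leafSet_base.eventually (hκ.mono fun y hy => hy.diffAt)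
  filter_upwards [h1, hsp, hκe, hsm, hapos, hbpos, hslit'] with y h4 h5 h6 h7 h8 h9 h10 h11
  have hdψ : DifferentiableAt ℝ (fun y => (k y, angle (α y, β y))) y := h7.diffAt
  have hkd : ∀ u, (fderiv ℝ (fun y => (k y, angle (α y, β y))) y u).1 =
      fderiv ℝ κ (y.1, y.2.1) (u.1, u.2.1) := by
    intro u
    rw [← fderiv_fst_apply hdψ]
    have e : HasFDerivAt k ((fderiv ℝ κ (y.1, y.2.1)).comp
        ((ContinuousLinearMap.fst ℝ ℝ (Jet × ℝ)).prod ((ContinuousLinearMap.fst ℝ Jet ℝ).comp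
          (ContinuousLinearMap.snd ℝ ℝ (Jet × ℝ))))) y :=
      HasFDerivAt.comp (g := κ) (f := fun y : Cyl => (y.1, y.2.1)) y h6.hasFDerivAt
        (hasFDerivAt_fst.prodMk (hasFDerivAt_fst.comp y hasFDerivAt_snd))
    change fderiv ℝ k y u = _
    rw [e.fderiv]; rfl
  obtain ⟨r, hr, er1, er2⟩ := exists_norm_angle (α y, β y) (by
    intro h
    rw [Prod.mk_eq_zero] at h
    rcases h10 with h' | h'
    · exact h'.ne' h.1
    · exact h' h.2)
  have e1 : (fderiv ℝ (fun y => (k y, angle (α y, β y))) y (0, 0, 1)).1 = 0 := by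
    rw [hkd]
    exact map_zero _
  have e2 : (fderiv ℝ (fun y => (k y, angle (α y, β y))) y (0, ν y, 0)).1 =
      r • pairField a b F (y.1, k y, angle (α y, β y)) := by
    rw [hkd]
    have hb1 : (v y).1 = β y * b (k y) := by simp only [hβ]; rw [div_mul_cancel₀ _ h9.ne']
    have ha1 : (v y).2.2 - F (y.1, k y) * (v y).1 = α y * a (k y) := by
      simp only [hα]; rw [div_mul_cancel₀ _ h8.ne']
    have h4' : (v y).2.1 = (k y).2.2 * (v y).1 := h4 h11
    simp only at er1 er2
    change v y = _
    generalize angle (α y, β y) = Θ at er1 er2 ⊢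
    refine Prod.ext ?_ (Prod.ext ?_ ?_)
    · simp only [pairField, totalField, Prod.smul_fst, Prod.fst_add, smul_eq_mul]
      rw [hb1, er2]; ring
    · simp only [pairField, totalField, Prod.smul_fst, Prod.fst_add, Prod.smul_snd, Prod.snd_add,
        smul_eq_mul]
      rw [h4', hb1, er2]; ring
    · simp only [pairField, totalField, Prod.smul_fst, Prod.fst_add, Prod.smul_snd, Prod.snd_add,
        smul_eq_mul]
      rw [sub_eq_iff_eq_add.1 ha1, hb1, er1, er2]; ring
  have e3 : fderiv ℝ κ (y.1, y.2.1) (0, ν y) = r • pairField a b F (y.1, k y, angle (α y, β y)) :=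
    (hkd (0, ν y, 0)).symm.trans e2
  refine ⟨rfl, ⟨r, hr, e3⟩, ?_⟩
  rw [map_plane, sliceDeriv_apply, sliceDeriv_apply]
  rw [show fderiv ℝ (fun y => (k y, angle (α y, β y))) y (0, 0, 1) =
      (0, (fderiv ℝ (fun y => (k y, angle (α y, β y))) y (0, 0, 1)).2) from Prod.ext e1 rfl,
    show fderiv ℝ (fun y => (k y, angle (α y, β y))) y (0, ν y, 0) =
      (r • pairField a b F (y.1, k y, angle (α y, β y)),
        (fderiv ℝ (fun y => (k y, angle (α y, β y))) y (0, ν y, 0)).2) from Prod.ext e2 rfl,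
    span_eq_plane_zero h5.ne' hr.ne']

theorem leafIsotopic_lift (ha : SmoothNear a 0) (hb : SmoothNear b 0) (ha0 : 0 < a 0) (hb0 : 0 < b 0)
    {F : TJet → ℝ} (hF : SmoothNear F 0) {κ : TJet → Jet} (hκ : SmoothNear κ 0)
    (hid : ∀ᶠ z in 𝓝 (0 : Jet), κ (0, z) = z) {ν : Cyl → Jet}
    (hν : ∀ᶠ y in 𝓛, ContDiffAt ℝ ∞ ν y)
    (hν0 : ∀ᶠ y in 𝓛, y.1 = 0 → ν y = pairField a b F y)
    (h1 : ∀ᶠ y in 𝓛, y.2.2 ∈ Quadrant → (fderiv ℝ κ (y.1, y.2.1) (0, ν y)).2.1 =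
      (κ (y.1, y.2.1)).2.2 * (fderiv ℝ κ (y.1, y.2.1) (0, ν y)).1)
    (h2 : ∀ᶠ y in 𝓛, y.2.2 = 0 → (fderiv ℝ κ (y.1, y.2.1) (0, ν y)).1 = 0)
    (h3 : ∀ᶠ y in 𝓛, y.2.2 = Real.pi / 2 → (fderiv ℝ κ (y.1, y.2.1) (0, ν y)).2.2 =
      F (y.1, κ (y.1, y.2.1)) * (fderiv ℝ κ (y.1, y.2.1) (0, ν y)).1) :
    LeafIsotopic (fun y => plane 0 (ν y)) (fun y => plane 0 (pairField a b F y)) := by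
  obtain ⟨Ψ, hs, hid', hbot, htop, hmap⟩ := exists_lift ha hb ha0 hb0 hF hκ hid hν hν0 h1
  exact ⟨Ψ, ⟨hs, hid', (hbot.and h2).mono fun y h h' => h.1 h' (h.2 h'),
    (htop.and h3).mono fun y h h' => h.1 h' (h.2 h')⟩, hmap.mono fun y h h' => (h h').2.2⟩

end Lift

/-! ### Isotopies of prolonged plane fields and equivalences of equations -/

section Automorphisms

theorem contact_bracket {E : Type*} [NormedAddCommGroup E] [NormedSpace ℝ E] {G : E → Jet} {x : E}
    (hG : ContDiffAt ℝ ∞ G x) {U V : E → E} (hU : DifferentiableAt ℝ U x)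
    (hV : DifferentiableAt ℝ V x)
    (hhU : ∀ᶠ y in 𝓝 x, (fderiv ℝ G y (U y)).2.1 = (G y).2.2 * (fderiv ℝ G y (U y)).1)
    (hhV : ∀ᶠ y in 𝓝 x, (fderiv ℝ G y (V y)).2.1 = (G y).2.2 * (fderiv ℝ G y (V y)).1) :
    (fderiv ℝ G x (fderiv ℝ V x (U x) - fderiv ℝ U x (V x))).2.1 -
      (G x).2.2 * (fderiv ℝ G x (fderiv ℝ V x (U x) - fderiv ℝ U x (V x))).1 =
    (fderiv ℝ G x (U x)).2.2 * (fderiv ℝ G x (V x)).1 -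
      (fderiv ℝ G x (V x)).2.2 * (fderiv ℝ G x (U x)).1 := by
  have hGd : DifferentiableAt ℝ G x := hG.diffAt
  have hGf : DifferentiableAt ℝ (fderiv ℝ G) x :=
    (hG.fderiv_right (m := ∞) (by simp)).diffAt
  have key : ∀ {V : E → E} (U : E → E), DifferentiableAt ℝ V x →
      (∀ᶠ y in 𝓝 x, (fderiv ℝ G y (V y)).2.1 = (G y).2.2 * (fderiv ℝ G y (V y)).1) →
      (fderiv ℝ (fun q => fderiv ℝ G q (V q)) x (U x)).2.1 =
        (G x).2.2 * (fderiv ℝ (fun q => fderiv ℝ G q (V q)) x (U x)).1 +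
          (fderiv ℝ G x (U x)).2.2 * (fderiv ℝ G x (V x)).1 := by
    intro V U hV hhV
    have hP : DifferentiableAt ℝ (fun q => fderiv ℝ G q (V q)) x := hGf.clm_apply hV
    rw [← fderiv_fst_apply hP, ← fderiv_snd_apply hP, ← fderiv_fst_apply hP.snd,
      Filter.EventuallyEq.fderiv_eq (𝕜 := ℝ) (show (fun y => (fderiv ℝ G y (V y)).2.1) =ᶠ[𝓝 x]
        fun y => (G y).2.2 * (fderiv ℝ G y (V y)).1 from hhV),
      fderiv_fun_mul hGd.snd.snd hP.fst]
    rw [← fderiv_snd_apply hGd, ← fderiv_snd_apply hGd.snd]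
    simp only [add_apply, smul_apply, smul_eq_mul]
    ring
  rw [← fderiv_bracket hG hU hV]
  simp only [Prod.fst_sub, Prod.snd_sub]
  rw [key U hV hhV, key V hU hhU]
  ring

variable {a b : Jet → ℝ} {F F' : TJet → ℝ}

theorem pairField_horizontal (a b : Jet → ℝ) (F : TJet → ℝ) (y : Cyl) :
    (pairField a b F y).2.1 = y.2.1.2.2 * (pairField a b F y).1 := by
  simp only [pairField, totalField, Prod.smul_fst, Prod.fst_add, Prod.smul_snd, Prod.snd_add,
        smul_eq_mul]
  ring

/-- The `θ`-derivative of `pairField`. -/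
def pairFieldDeriv (a b : Jet → ℝ) (F : TJet → ℝ) (y : Cyl) : Jet :=
  (-Real.sin y.2.2 * a y.2.1) • ((0, 0, 1) : Jet) + (Real.cos y.2.2 * b y.2.1) • totalField F (y.1, y.2.1)

theorem pairFieldDeriv_eq (a b : Jet → ℝ) (F : TJet → ℝ) (y : Cyl) :
    pairFieldDeriv a b F y = pairField a b F (y.1, y.2.1, y.2.2 + Real.pi / 2) := by
  simp only [pairFieldDeriv, pairField, Real.cos_add_pi_div_two, Real.sin_add_pi_div_two]

theorem pairFieldDeriv_horizontal (a b : Jet → ℝ) (F : TJet → ℝ) (y : Cyl) :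
    (pairFieldDeriv a b F y).2.1 = y.2.1.2.2 * (pairFieldDeriv a b F y).1 := by
  rw [pairFieldDeriv_eq]
  exact pairField_horizontal _ _ _ _

theorem pairField_cross (a b : Jet → ℝ) (F : TJet → ℝ) (y : Cyl) :
    (pairField a b F y).2.2 * (pairFieldDeriv a b F y).1 -
      (pairFieldDeriv a b F y).2.2 * (pairField a b F y).1 = a y.2.1 * b y.2.1 := by
  simp only [pairField, pairFieldDeriv, totalField, Prod.smul_fst, Prod.fst_add, Prod.smul_snd,
    Prod.snd_add, smul_eq_mul]
  linear_combination (a y.2.1 * b y.2.1) * Real.sin_sq_add_cos_sq y.2.2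

theorem SmoothNear.pairFieldDeriv_at {y : Cyl} (ha : SmoothNear a y.2.1)
    (hb : SmoothNear b y.2.1) (hF : SmoothNear F (y.1, y.2.1)) :
    SmoothNear (pairFieldDeriv a b F) y := by
  rw [show pairFieldDeriv a b F = _ from funext (pairFieldDeriv_eq a b F)]
  exact SmoothNear.comp (SmoothNear.pairField_at (y := (y.1, y.2.1, y.2.2 + Real.pi / 2)) ha hb hF)
    (ContDiff.smoothNear (by fun_prop) y)

theorem SmoothNear.pairFieldDeriv (ha : SmoothNear a 0) (hb : SmoothNear b 0)
    (hF : SmoothNear F 0) {y : Cyl} (hy : y ∈ leafSet) :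
    SmoothNear (pairFieldDeriv a b F) y := by
  obtain ⟨t, z, θ⟩ := y
  obtain ⟨rfl, rfl, -⟩ := mem_leafSet.1 hy
  exact .pairFieldDeriv_at ha hb hF

theorem hasDerivAt_theta {X : Type*} [NormedAddCommGroup X] [NormedSpace ℝ X]
    {h : Cyl → X} {y : Cyl} (hd : DifferentiableAt ℝ h y) :
    HasDerivAt (fun s => h (y.1, y.2.1, s)) (fderiv ℝ h y (0, 0, 1)) y.2.2 :=
  HasFDerivAt.comp_hasDerivAt (f := fun s => (y.1, y.2.1, s)) y.2.2 hd.hasFDerivAt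
    ((hasDerivAt_const y.2.2 y.1).prodMk ((hasDerivAt_const y.2.2 y.2.1).prodMk
      (hasDerivAt_id y.2.2)))

theorem fderiv_pairField {y : Cyl} (hd : DifferentiableAt ℝ (pairField a b F) y) :
    fderiv ℝ (pairField a b F) y (0, 0, 1) = pairFieldDeriv a b F y := by
  refine (hasDerivAt_theta hd).unique ?_
  have h1 := ((Real.hasDerivAt_cos y.2.2).mul_const (a y.2.1)).smul_const ((0, 0, 1) : Jet)
  have h2 := ((Real.hasDerivAt_sin y.2.2).mul_const (b y.2.1)).smul_const (totalField F (y.1, y.2.1))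
  exact h1.add h2

theorem fderiv_pairFieldDeriv {y : Cyl} (hd : DifferentiableAt ℝ (pairFieldDeriv a b F) y) :
    fderiv ℝ (pairFieldDeriv a b F) y (0, 0, 1) = -pairField a b F y := by
  refine (hasDerivAt_theta hd).unique ?_
  have h1 := ((Real.hasDerivAt_sin y.2.2).neg.mul_const (a y.2.1)).smul_const ((0, 0, 1) : Jet)
  have h2 := ((Real.hasDerivAt_cos y.2.2).mul_const (b y.2.1)).smul_const (totalField F (y.1, y.2.1))
  have := h1.add h2
  refine this.congr_deriv ?_
  simp only [pairField]
  module

theorem leafIsotopic_of_jetEquiv (ha : SmoothNear a 0) (hb : SmoothNear b 0) (ha0 : 0 < a 0)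
    (hb0 : 0 < b 0) (hF : SmoothNear F 0) (hF' : SmoothNear F' 0)
    (h0 : ∀ᶠ z in 𝓝 (0 : Jet), F (0, z) = F' (0, z)) (h : JetEquiv F F') :
    LeafIsotopic (fun y => plane 0 (pairField a b F y)) (fun y => plane 0 (pairField a b F' y)) := by
  obtain ⟨Φ, hΦ, hid, hint⟩ := h
  have hzt := tendsto_leafSet_point
  have hD : ∀ᶠ y in 𝓛, ∃ γ β : ℝ, fderiv ℝ Φ (y.1, y.2.1) (0, pairField a b F y) =
      (Real.cos y.2.2 * γ) • ((0, 0, 1) : Jet) +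
        (Real.sin y.2.2 * β) • totalField F' (y.1, Φ (y.1, y.2.1)) := by
    filter_upwards [tendsto_leafSet_base.eventually hint] with y hy
    obtain ⟨i1, i2, i3⟩ := hy
    refine ⟨a y.2.1 * (fderiv ℝ Φ (y.1, y.2.1) (0, 0, 0, 1)).2.2,
      b y.2.1 * (fderiv ℝ Φ (y.1, y.2.1) (0, totalField F (y.1, y.2.1))).1, ?_⟩
    have e : ((0 : ℝ), pairField a b F y) = (Real.cos y.2.2 * a y.2.1) • ((0, 0, 0, 1) : TJet) +
        (Real.sin y.2.2 * b y.2.1) • ((0, totalField F (y.1, y.2.1)) : TJet) := by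
      simp [pairField]
    have e3 : fderiv ℝ Φ (y.1, y.2.1) (0, 0, 0, 1) =
        (fderiv ℝ Φ (y.1, y.2.1) (0, 0, 0, 1)).2.2 • ((0, 0, 1) : Jet) :=
      Prod.ext (by simp [i1]) (Prod.ext (by simp [i2]) (by simp))
    rw [e, map_add, map_smul, map_smul, i3]
    conv_lhs => rw [e3]
    simp only [smul_smul, mul_assoc, Prod.smul_fst, smul_eq_mul, totalField, mul_one]
  refine leafIsotopic_lift ha hb ha0 hb0 hF' hΦ hid
    (eventually_leafSet.2 fun y hy => SmoothNear.pairField ha hb hF hy) ?_ ?_ ?_ ?_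
  · filter_upwards [hzt.eventually h0] with y h1 h2
    simp only [pairField, totalField, h2, h1]
  · filter_upwards [hD] with y ⟨γ, β, h⟩ _
    rw [h]
    simp [totalField]
    ring
  · filter_upwards [hD] with y ⟨γ, β, h⟩ h2
    rw [h, h2]
    simp
  · filter_upwards [hD] with y ⟨γ, β, h⟩ h2
    rw [h, h2]
    simp [totalField]
    ring

theorem eventually_forall_leaf {P : Cyl → Prop} (h : ∀ᶠ y in 𝓛, P y) :
    ∀ᶠ q in 𝓝 (0 : TJet), ∀ θ ∈ Quadrant, P (q.1, q.2, θ) := by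
  refine isCompact_Icc.eventually_forall_of_forall_eventually
    (P := fun (q : TJet) θ => P (q.1, q.2, θ)) fun θ hθ => ?_
  have h1 := eventually_leafSet.1 h (0, 0, θ) (mem_leafSet.2 ⟨rfl, rfl, hθ⟩)
  have h2 : Continuous (fun r : (TJet) × ℝ => (r.1.1, r.1.2, r.2)) := by fun_prop
  exact (h2.tendsto ((0 : TJet), θ)).eventually h1

theorem eq_of_deriv_eq_zero_Ioo {h : ℝ → ℝ} {c d : ℝ} (hcd : c < d) (hc : ∀ x ∈ Icc c d, ContinuousAt h x)
    (hd : ∀ x ∈ Ioo c d, HasDerivAt h 0 x) : h c = h d := by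
  obtain ⟨x, hx, hx'⟩ := exists_hasDerivAt_eq_slope h (fun _ => 0) hcd
    (fun x hx => (hc x hx).continuousWithinAt) hd
  have : d - c ≠ 0 := by linarith
  field_simp at hx'
  linarith

theorem jetEquiv_of_leafIsotopic (ha : SmoothNear a 0) (hb : SmoothNear b 0) (ha0 : 0 < a 0)
    (hb0 : 0 < b 0) (hF : SmoothNear F 0)
    (h : LeafIsotopic (fun y => plane 0 (pairField a b F y)) (fun y => plane 0 (pairField a b F' y))) :
    JetEquiv F F' := by
  obtain ⟨ψ, h⟩ := h
  set G : Cyl → Jet := fun y => (ψ y).1 with hGdef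
  have hGs : SmoothLeaf G := fun y hy => (h.smoothNear hy).fst
  have hGe : ∀ᶠ y in 𝓛, ContDiffAt ℝ ∞ G y := h.smooth.mono fun y hy => hy.fst
  set V : Cyl → Cyl := fun y => (0, pairField a b F y, 0) with hV
  set V' : Cyl → Cyl := fun y => (0, pairFieldDeriv a b F y, 0) with hV'
  have hWs : ∀ y ∈ leafSet, SmoothNear (pairField a b F) y := fun y hy => SmoothNear.pairField ha hb hF hy
  have hWs' : ∀ y ∈ leafSet, SmoothNear (pairFieldDeriv a b F) y := fun y hy =>
    SmoothNear.pairFieldDeriv ha hb hF hy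
  have hVs : SmoothLeaf V := fun y hy =>
    (contDiff_const.smoothNear _).prodMk ((hWs y hy).prodMk (contDiff_const.smoothNear _))
  have hVs' : SmoothLeaf V' := fun y hy =>
    (contDiff_const.smoothNear _).prodMk ((hWs' y hy).prodMk (contDiff_const.smoothNear _))
  have hVd : ∀ᶠ y in 𝓛, DifferentiableAt ℝ V y ∧ fderiv ℝ V y (0, 0, 1) = V' y :=
    eventually_leafSet.2 fun y hy => by
      filter_upwards [hWs y hy] with y' h1
      have hd : DifferentiableAt ℝ (pairField a b F) y' := h1.diffAt
      refine ⟨(differentiableAt_const _).prodMk (hd.prodMk (differentiableAt_const _)), ?_⟩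
      rw [hV, fderiv_prodMk_apply (differentiableAt_const _) (hd.prodMk (differentiableAt_const _)),
        fderiv_prodMk_apply hd (differentiableAt_const _), fderiv_pairField hd]
      simp [hV']
  have hVd' : ∀ᶠ y in 𝓛, DifferentiableAt ℝ V' y ∧ fderiv ℝ V' y (0, 0, 1) = -V y :=
    eventually_leafSet.2 fun y hy => by
      filter_upwards [hWs' y hy] with y' h1
      have hd : DifferentiableAt ℝ (pairFieldDeriv a b F) y' := h1.diffAt
      refine ⟨(differentiableAt_const _).prodMk (hd.prodMk (differentiableAt_const _)), ?_⟩
      rw [hV', fderiv_prodMk_apply (differentiableAt_const _) (hd.prodMk (differentiableAt_const _)),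
        fderiv_prodMk_apply hd (differentiableAt_const _), fderiv_pairFieldDeriv hd]
      simp [hV]
  -- both directions of the plane are mapped to multiples of the prolonged direction
  have hspan : ∀ᶠ y in 𝓛, y.2.2 ∈ Quadrant →
      (∃ c : ℝ, fderiv ℝ G y (0, 0, 1) = c • pairField a b F' (y.1, ψ y)) ∧
      ∃ c : ℝ, fderiv ℝ G y (V y) = c • pairField a b F' (y.1, ψ y) := by
    filter_upwards [h.map, h.smooth] with y h1 h2 h3
    have hd : DifferentiableAt ℝ ψ y := h2.diffAt
    have h4 := h1 h3
    rw [map_plane, sliceDeriv_apply, sliceDeriv_apply] at h4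
    constructor
    · have : fderiv ℝ ψ y (0, 0, 1) ∈ plane 0 (pairField a b F' (y.1, ψ y)) := by
        rw [← h4]; exact Submodule.subset_span (by simp)
      obtain ⟨c, hc⟩ := mem_plane.1 this
      exact ⟨c, by rw [hGdef, fderiv_fst_apply hd, hc]; simp⟩
    · have : fderiv ℝ ψ y (0, pairField a b F y, 0) ∈ plane 0 (pairField a b F' (y.1, ψ y)) := by
        rw [← h4]; exact Submodule.subset_span (by simp)
      obtain ⟨c, hc⟩ := mem_plane.1 this
      exact ⟨c, by rw [hGdef, fderiv_fst_apply hd, hc]; simp⟩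
  have hhor : ∀ (c : ℝ) (y : Cyl), (c • pairField a b F' (y.1, ψ y)).2.1 =
      (G y).2.2 * (c • pairField a b F' (y.1, ψ y)).1 := fun c y => by
    simp only [Prod.smul_snd, Prod.smul_fst, pairField_horizontal, smul_eq_mul, hGdef]; ring
  have hIoo : ∀ y : Cyl, y.2.2 ∈ Ioo 0 (Real.pi / 2) →
      ∀ᶠ y' in 𝓝 y, y'.2.2 ∈ Ioo 0 (Real.pi / 2) := fun y hy =>
    (by fun_prop : ContinuousAt (fun y : Cyl => y.2.2) y).eventually (isOpen_Ioo.mem_nhds hy)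
  have hU0 : ∀ y, DifferentiableAt ℝ (fun _ : Cyl => ((0, 0, 1) : Cyl)) y :=
    fun y => differentiableAt_const _
  have step1 : ∀ᶠ y in 𝓛, y.2.2 ∈ Ioo 0 (Real.pi / 2) →
      (fderiv ℝ G y (V' y)).2.1 = (G y).2.2 * (fderiv ℝ G y (V' y)).1 := by
    filter_upwards [eventually_leafSet_nhds hspan, hGe, hVd] with y h1 h2 h3 h4
    have h5 : ∀ᶠ y' in 𝓝 y, (∃ c : ℝ, fderiv ℝ G y' (0, 0, 1) = c • pairField a b F' (y'.1, ψ y')) ∧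
      ∃ c : ℝ, fderiv ℝ G y' (V y') = c • pairField a b F' (y'.1, ψ y') := by
      filter_upwards [h1, hIoo y h4] with y' h6 h7 using h6 (Ioo_subset_Icc_self h7)
    have := contact_bracket h2 (U := fun _ => (0, 0, 1)) (V := V) (hU0 y) h3.1
      (h5.mono fun y' h => by obtain ⟨⟨c, hc⟩, -⟩ := h; rw [hc, hhor])
      (h5.mono fun y' h => by obtain ⟨-, c, hc⟩ := h; rw [hc, hhor])
    simp only [fderiv_fun_const, Pi.zero_apply, zero_apply, sub_zero, h3.2] at this
    obtain ⟨⟨c, hc⟩, d, hd⟩ := h5.self_of_nhds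
    rw [hc, hd] at this
    simp only [Prod.smul_fst, Prod.smul_snd, smul_eq_mul] at this
    linear_combination this
  have hnd : ∀ᶠ y in 𝓛, 0 < (fderiv ℝ G y (V y)).2.2 * (fderiv ℝ G y (V' y)).1 -
      (fderiv ℝ G y (V' y)).2.2 * (fderiv ℝ G y (V y)).1 := eventually_leafSet.2 fun y hy => by
    have s1 := (hGs y hy).fderiv_apply (hVs y hy)
    have s2 := (hGs y hy).fderiv_apply (hVs' y hy)
    refine ((s1.snd.snd.mul s2.fst).sub (s2.snd.snd.mul s1.fst)).continuousAt.eventually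
      (lt_mem_nhds ?_)
    beta_reduce
    have e : ∀ v : Jet, fderiv ℝ G y (0, v, 0) = v := fun v => by
      rw [hGdef, fderiv_fst_apply (h.smoothNear hy).differentiableAt, h.fderiv_eq hy]
    rw [hV, hV', e, e, pairField_cross, (mem_leafSet.1 hy).2.1]
    exact mul_pos ha0 hb0
  have step2 : ∀ᶠ y in 𝓛, y.2.2 ∈ Ioo 0 (Real.pi / 2) → fderiv ℝ G y (0, 0, 1) = 0 := by
    filter_upwards [eventually_leafSet_nhds step1, eventually_leafSet_nhds hspan, hGe, hVd', hnd]
      with y h1 h2 h3 h4 h5 h6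
    have h7 : ∀ᶠ y' in 𝓝 y, (∃ c : ℝ, fderiv ℝ G y' (0, 0, 1) = c • pairField a b F' (y'.1, ψ y')) ∧
      (∃ c : ℝ, fderiv ℝ G y' (V y') = c • pairField a b F' (y'.1, ψ y')) ∧
      (fderiv ℝ G y' (V' y')).2.1 = (G y').2.2 * (fderiv ℝ G y' (V' y')).1 := by
      filter_upwards [h1, h2, hIoo y h6] with y' h8 h9 h10
      exact ⟨(h9 (Ioo_subset_Icc_self h10)).1, (h9 (Ioo_subset_Icc_self h10)).2, h8 h10⟩
    have := contact_bracket h3 (U := fun _ => (0, 0, 1)) (V := V') (hU0 y) h4.1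
      (h7.mono fun y' h => by obtain ⟨⟨c, hc⟩, -⟩ := h; rw [hc, hhor])
      (h7.mono fun y' h => h.2.2)
    simp only [fderiv_fun_const, Pi.zero_apply, zero_apply, sub_zero, h4.2, map_neg] at this
    obtain ⟨⟨c, hc⟩, ⟨d, hd⟩, -⟩ := h7.self_of_nhds
    have e1 : (fderiv ℝ G y (V y)).2.1 = (G y).2.2 * (fderiv ℝ G y (V y)).1 := by rw [hd, hhor]
    have e2 : (fderiv ℝ G y (0, 0, 1)).2.1 = (G y).2.2 * (fderiv ℝ G y (0, 0, 1)).1 := by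
      rw [hc, hhor]
    have e3 : (fderiv ℝ G y (0, 0, 1)).2.2 * (fderiv ℝ G y (V y)).1 =
        (fderiv ℝ G y (V y)).2.2 * (fderiv ℝ G y (0, 0, 1)).1 := by
      rw [hc, hd]; simp only [Prod.smul_fst, Prod.smul_snd, smul_eq_mul]; ring
    simp only [Prod.fst_neg, Prod.snd_neg, e1] at this
    set R := fderiv ℝ G y (0, 0, 1)
    set P := fderiv ℝ G y (V y)
    set P' := fderiv ℝ G y (V' y)
    have e4 : R.2.2 * P'.1 = P'.2.2 * R.1 := by linear_combination -this
    have r1 : R.1 = 0 := by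
      have : R.1 * (P.2.2 * P'.1 - P'.2.2 * P.1) = 0 := by
        linear_combination P.1 * e4 - P'.1 * e3
      exact (mul_eq_zero.1 this).resolve_right h5.ne'
    have r3 : R.2.2 = 0 := by
      have : R.2.2 * (P.2.2 * P'.1 - P'.2.2 * P.1) = 0 := by
        linear_combination P.2.2 * e4 - P'.2.2 * e3
      exact (mul_eq_zero.1 this).resolve_right h5.ne'
    exact Prod.ext r1 (Prod.ext (by rw [e2, r1, mul_zero]; rfl) r3)
  have hpi : (0 : ℝ) < Real.pi / 2 := by positivity
  have hconst : ∀ᶠ q in 𝓝 (0 : TJet), G (q.1, q.2, 0) = G (q.1, q.2, Real.pi / 2) := by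
    filter_upwards [eventually_forall_leaf step2, eventually_forall_leaf hGe] with q h1 h2
    have hd : ∀ θ ∈ Quadrant, DifferentiableAt ℝ G (q.1, q.2, θ) := fun θ hθ =>
      (h2 θ hθ).diffAt
    have hc : ∀ θ ∈ Quadrant, ContinuousAt (fun s => G (q.1, q.2, s)) θ := fun θ hθ =>
      (hasDerivAt_theta (hd θ hθ)).continuousAt
    have hz : ∀ θ ∈ Ioo 0 (Real.pi / 2), HasDerivAt (fun s => G (q.1, q.2, s)) 0 θ := fun θ hθ => by
      have := hasDerivAt_theta (hd θ (Ioo_subset_Icc_self hθ))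
      rwa [h1 θ (Ioo_subset_Icc_self hθ) hθ] at this
    refine Prod.ext ?_ (Prod.ext ?_ ?_)
    · exact eq_of_deriv_eq_zero_Ioo (h := fun s => (G (q.1, q.2, s)).1) hpi
        (fun θ hθ => (hc θ hθ).fst) fun θ hθ => hasDerivAt_fst_comp (hz θ hθ)
    · exact eq_of_deriv_eq_zero_Ioo (h := fun s => (G (q.1, q.2, s)).2.1) hpi
        (fun θ hθ => (hc θ hθ).snd.fst) fun θ hθ => hasDerivAt_fst_comp (hasDerivAt_snd_comp (hz θ hθ))
    · exact eq_of_deriv_eq_zero_Ioo (h := fun s => (G (q.1, q.2, s)).2.2) hpi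
        (fun θ hθ => (hc θ hθ).snd.snd) fun θ hθ => hasDerivAt_snd_comp (hasDerivAt_snd_comp (hz θ hθ))
  have h0mem : ((0, 0, 0) : Cyl) ∈ leafSet := mem_leafSet.2 ⟨rfl, rfl, ⟨le_rfl, hpi.le⟩⟩
  have hι : ∀ (c : ℝ) (q : TJet), SmoothNear (fun q : TJet => (q.1, q.2, c)) q := fun c q =>
    ContDiff.smoothNear (by fun_prop) q
  have hιd : ∀ {c : ℝ} {q : TJet}, DifferentiableAt ℝ G (q.1, q.2, c) → ∀ v : Jet,
      fderiv ℝ (fun q : TJet => G (q.1, q.2, c)) q (0, v) = fderiv ℝ G (q.1, q.2, c) (0, v, 0) := by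
    intro c q hd v
    have e : HasFDerivAt (fun q : TJet => (q.1, q.2, c)) ((ContinuousLinearMap.fst ℝ ℝ Jet).prod
        ((ContinuousLinearMap.snd ℝ ℝ Jet).prod 0)) q :=
      hasFDerivAt_fst.prodMk (hasFDerivAt_snd.prodMk (hasFDerivAt_const c q))
    have := HasFDerivAt.comp (g := G) (f := fun q : TJet => (q.1, q.2, c)) q hd.hasFDerivAt e
    rw [show (fun q : TJet => G (q.1, q.2, c)) = G ∘ fun q => (q.1, q.2, c) from rfl, this.fderiv]
    rfl
  have hzero := eventually_forall_leaf (hspan.and (h.bottom.and (h.top.and hGe)))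
  have hta : Tendsto (fun q : TJet => q.2) (𝓝 0) (𝓝 0) := continuous_snd.tendsto (0 : TJet)
  refine ⟨fun q => G (q.1, q.2, 0), (hGs _ h0mem).comp_of_eq (hι 0 0) rfl, ?_, ?_⟩
  · have hsl : Tendsto (fun z : Jet => ((0 : ℝ), z)) (𝓝 0) (𝓝 0) := tendsto_slice _ _
    filter_upwards [hsl.eventually (eventually_forall_leaf h.slice_id)] with z hz
    have := hz 0 ⟨le_rfl, hpi.le⟩ rfl
    simp only [hGdef]
    exact congrArg Prod.fst this
  · filter_upwards [hzero, hconst.eventually_nhds,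
      hta.eventually (ha.continuousAt.eventually (lt_mem_nhds ha0)),
      hta.eventually (hb.continuousAt.eventually (lt_mem_nhds hb0))] with q h1 h2 h3 h4
    obtain ⟨h5, h6, -, h7⟩ := h1 0 ⟨le_rfl, hpi.le⟩
    obtain ⟨h8, -, h9, h10⟩ := h1 (Real.pi / 2) ⟨hpi.le, le_rfl⟩
    have hd0 : DifferentiableAt ℝ G (q.1, q.2, 0) := h7.diffAt
    have hd1 : DifferentiableAt ℝ G (q.1, q.2, Real.pi / 2) := h10.diffAt
    obtain ⟨c, hc⟩ := (h5 ⟨le_rfl, hpi.le⟩).2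
    obtain ⟨d, hd⟩ := (h8 ⟨hpi.le, le_rfl⟩).2
    have ev : V (q.1, q.2, 0) = a q.2 • ((0, (0, 0, 1), 0) : Cyl) := by
      simp [hV, pairField]
    have ew : V (q.1, q.2, Real.pi / 2) = b q.2 • ((0, totalField F q, 0) : Cyl) := by
      simp [hV, pairField]
    rw [ev, map_smul] at hc
    rw [ew, map_smul] at hd
    have ec : pairField a b F' (q.1, ψ (q.1, q.2, 0)) = a (G (q.1, q.2, 0)) • ((0, 0, 1) : Jet) := by
      simp [pairField, h6 rfl, hGdef]
    have ed : pairField a b F' (q.1, ψ (q.1, q.2, Real.pi / 2)) =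
        b (G (q.1, q.2, 0)) • totalField F' (q.1, G (q.1, q.2, 0)) := by
      rw [h2.self_of_nhds]
      simp [pairField, h9 rfl, hGdef]
    rw [ec] at hc
    rw [ed] at hd
    have hc1 := congrArg (fun v : Jet => v.1) hc
    have hc2 := congrArg (fun v : Jet => v.2.1) hc
    simp at hc1 hc2
    have ew' : fderiv ℝ (fun q : TJet => G (q.1, q.2, 0)) q (0, totalField F q) =
        fderiv ℝ G (q.1, q.2, Real.pi / 2) (0, totalField F q, 0) := by
      rw [Filter.EventuallyEq.fderiv_eq (𝕜 := ℝ) (show (fun q : TJet => G (q.1, q.2, 0)) =ᶠ[𝓝 q]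
        fun q => G (q.1, q.2, Real.pi / 2) from h2), hιd hd1]
    refine ⟨?_, ?_, ?_⟩
    · rw [hιd hd0]; exact hc1.resolve_left h3.ne'
    · rw [hιd hd0]; exact hc2.resolve_left h3.ne'
    · rw [ew']
      have : fderiv ℝ G (q.1, q.2, Real.pi / 2) (0, totalField F q, 0) =
          ((b q.2)⁻¹ * (d * b (G (q.1, q.2, 0)))) • totalField F' (q.1, G (q.1, q.2, 0)) := by
        rw [mul_smul, mul_smul, ← hd, smul_smul, inv_mul_cancel₀ h4.ne', one_smul]
      rw [this]
      simp [totalField]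

end Automorphisms

/-! ### The characteristic direction of a family of plane fields -/

section Characteristic

variable {E E' : Type*} [NormedAddCommGroup E] [NormedSpace ℝ E] [NormedAddCommGroup E']
  [NormedSpace ℝ E']

open VectorField

theorem SmoothNear.lieBracket {U V : E → E} {x : E} (hU : SmoothNear U x) (hV : SmoothNear V x) :
    SmoothNear (VectorField.lieBracket ℝ U V) x :=
  (hV.fderiv_apply hU).sub (hU.fderiv_apply hV)

theorem lieBracket_related {φ : E → E'} {x : E} (hφ : ContDiffAt ℝ ∞ φ x) {U V : E → E}
    {U' V' : E' → E'} (hU : DifferentiableAt ℝ U x) (hV : DifferentiableAt ℝ V x)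
    (hU' : DifferentiableAt ℝ U' (φ x)) (hV' : DifferentiableAt ℝ V' (φ x))
    (hrU : ∀ᶠ y in 𝓝 x, fderiv ℝ φ y (U y) = U' (φ y))
    (hrV : ∀ᶠ y in 𝓝 x, fderiv ℝ φ y (V y) = V' (φ y)) :
    fderiv ℝ φ x (lieBracket ℝ U V x) = lieBracket ℝ U' V' (φ x) := by
  have hd : DifferentiableAt ℝ φ x := hφ.diffAt
  rw [lieBracket_eq, lieBracket_eq]
  simp only
  rw [← fderiv_bracket hφ hU hV,
    Filter.EventuallyEq.fderiv_eq (𝕜 := ℝ) (show (fun y => fderiv ℝ φ y (V y)) =ᶠ[𝓝 x]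
      fun y => V' (φ y) from hrV),
    Filter.EventuallyEq.fderiv_eq (𝕜 := ℝ) (show (fun y => fderiv ℝ φ y (U y)) =ᶠ[𝓝 x]
      fun y => U' (φ y) from hrU), fderiv_comp_apply' hV' hd, fderiv_comp_apply' hU' hd,
    hrU.self_of_nhds, hrV.self_of_nhds]

theorem lieBracket_add_smul_left' {U V X : E → E} {c : E → ℝ} {x : E} (hU : DifferentiableAt ℝ U x)
    (hV : DifferentiableAt ℝ V x) (hc : DifferentiableAt ℝ c x) :
    lieBracket ℝ (fun y => U y + c y • V y) X x =
      lieBracket ℝ U X x + c x • lieBracket ℝ V X x - fderiv ℝ c x (X x) • V x := by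
  simp only [lieBracket_eq]
  rw [fderiv_fun_add hU (hc.fun_smul hV), fderiv_fun_smul hc hV]
  simp only [add_apply, smul_apply, ContinuousLinearMap.smulRight_apply, map_add, map_smul]
  module

theorem lieBracket_add_smul_right' {V X Y : E → E} {e : E → ℝ} {x : E} (hX : DifferentiableAt ℝ X x)
    (hY : DifferentiableAt ℝ Y x) (he : DifferentiableAt ℝ e x) :
    lieBracket ℝ V (fun y => X y + e y • Y y) x =
      lieBracket ℝ V X x + e x • lieBracket ℝ V Y x + fderiv ℝ e x (V x) • Y x := by
  simp only [lieBracket_eq]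
  rw [fderiv_fun_add hX (he.fun_smul hY), fderiv_fun_smul he hY]
  simp only [add_apply, smul_apply, ContinuousLinearMap.smulRight_apply, map_add, map_smul]
  module

/-- The determinant of three vectors. -/
def det3 (u v w : Jet) : ℝ :=
  u.1 * (v.2.1 * w.2.2 - v.2.2 * w.2.1) - u.2.1 * (v.1 * w.2.2 - v.2.2 * w.1) +
    u.2.2 * (v.1 * w.2.1 - v.2.1 * w.1)

theorem det3_map (M : Jet →ₗ[ℝ] Jet) (u v w : Jet) :
    det3 (M u) (M v) (M w) = det3 (M (1, 0, 0)) (M (0, 1, 0)) (M (0, 0, 1)) * det3 u v w := by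
  have key : ∀ u : Jet, M u = u.1 • M (1, 0, 0) + u.2.1 • M (0, 1, 0) + u.2.2 • M (0, 0, 1) := by
    intro u
    rw [← map_smul, ← map_smul, ← map_smul, ← map_add, ← map_add]
    simp
  rw [key u, key v, key w]
  simp only [det3, Prod.fst_add, Prod.snd_add, Prod.smul_fst, Prod.smul_snd, smul_eq_mul]
  ring

theorem det3_of_horizontal {u v : Jet} {p : ℝ} (hu : u.2.1 = p * u.1) (hv : v.2.1 = p * v.1) (w : Jet) :
    det3 u v w = (u.2.2 * v.1 - v.2.2 * u.1) * (w.2.1 - p * w.1) := by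
  rw [det3, hu, hv]; ring

theorem SmoothNear.det3 {u v w : E → Jet} {x : E} (hu : SmoothNear u x) (hv : SmoothNear v x)
    (hw : SmoothNear w x) : SmoothNear (fun y => det3 (u y) (v y) (w y)) x :=
  ((hu.fst.mul ((hv.snd.fst.mul hw.snd.snd).sub (hv.snd.snd.mul hw.snd.fst))).sub
    (hu.snd.fst.mul ((hv.fst.mul hw.snd.snd).sub (hv.snd.snd.mul hw.fst)))).add
    (hu.snd.snd.mul ((hv.fst.mul hw.snd.fst).sub (hv.snd.fst.mul hw.fst)))

/-- The field `h + s ∂/∂θ` on the space of `(t, (z, θ))`. -/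
def liftField (h : Cyl → Jet) (s : ℝ) (y : Cyl) : Cyl := (0, h y, s)

theorem SmoothNear.liftField {h : Cyl → Jet} {s : ℝ} {y : Cyl}
    (hh : SmoothNear h y) : SmoothNear (liftField h s) y :=
  (contDiff_const.smoothNear _).prodMk (hh.prodMk (contDiff_const.smoothNear _))

theorem fderiv_liftField {h : Cyl → Jet} {s : ℝ} {y : Cyl}
    (hh : DifferentiableAt ℝ h y) (v : Cyl) :
    fderiv ℝ (liftField h s) y v = (0, fderiv ℝ h y v, 0) := by
  have : liftField h s = fun y => (0, h y, s) := rfl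
  rw [this, fderiv_prodMk_apply (differentiableAt_const _) (hh.prodMk (differentiableAt_const _)),
    fderiv_prodMk_apply hh (differentiableAt_const _)]
  simp

theorem lieBracket_liftField {h k : Cyl → Jet} {r s : ℝ} {y : Cyl}
    (hh : DifferentiableAt ℝ h y) (hk : DifferentiableAt ℝ k y) :
    lieBracket ℝ (liftField h r) (liftField k s) y =
      (0, fderiv ℝ k y (0, h y, r) - fderiv ℝ h y (0, k y, s), 0) := by
  rw [lieBracket_eq]
  simp only [fderiv_liftField hh, fderiv_liftField hk, liftField]
  simp

theorem fderiv_slice_congr {X Y : Type*} [NormedAddCommGroup X] [NormedSpace ℝ X]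
    [NormedAddCommGroup Y] [NormedSpace ℝ Y] {f g : ℝ × X → Y} {y : ℝ × X} {s : ℝ} (hy : y.1 = s)
    (h : ∀ᶠ y' in 𝓝 y, y'.1 = s → f y' = g y') (hf : DifferentiableAt ℝ f y)
    (hg : DifferentiableAt ℝ g y) (v : X) : fderiv ℝ f y (0, v) = fderiv ℝ g y (0, v) := by
  obtain ⟨t, x⟩ := y
  rw [← fderiv_slice hf, ← fderiv_slice hg]
  rw [Filter.EventuallyEq.fderiv_eq (𝕜 := ℝ) (show (fun y => f (t, y)) =ᶠ[𝓝 x] fun y => g (t, y) from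
    (tendsto_slice t x).eventually h |>.mono fun _ h => h hy)]

variable {a b : Jet → ℝ} {F : TJet → ℝ}

theorem det3_lieBracket_pairField {y : Cyl} (hp : SmoothNear (pairField a b F) y)
    (hp' : SmoothNear (pairFieldDeriv a b F) y) :
    det3 (pairField a b F y) (pairFieldDeriv a b F y) (lieBracket ℝ (liftField (pairField a b F) 0)
      (liftField (pairFieldDeriv a b F) 0) y).2.1 = (a y.2.1 * b y.2.1) ^ 2 := by
  have hG : ∀ (y v : Cyl), fderiv ℝ (fun y : Cyl => y.2.1) y v = v.2.1 := by
    intro y v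
    have : HasFDerivAt (fun y : Cyl => y.2.1) ((ContinuousLinearMap.fst ℝ Jet ℝ).comp
      (ContinuousLinearMap.snd ℝ ℝ (Jet × ℝ))) y := hasFDerivAt_fst.comp y hasFDerivAt_snd
    rw [this.fderiv]; rfl
  have cb := contact_bracket (G := fun y : Cyl => y.2.1) (x := y)
    (ContDiff.contDiffAt (by fun_prop)) (SmoothNear.liftField (s := 0) hp).differentiableAt
    (SmoothNear.liftField (s := 0) hp').differentiableAt
    (Eventually.of_forall fun y => by rw [hG]; exact pairField_horizontal a b F y)
    (Eventually.of_forall fun y => by rw [hG]; exact pairFieldDeriv_horizontal a b F y)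
  rw [det3_of_horizontal (pairField_horizontal a b F y) (pairFieldDeriv_horizontal a b F y),
    pairField_cross, lieBracket_eq]
  simp only [hG] at cb
  rw [cb.trans (pairField_cross a b F y)]
  ring

theorem exists_characteristic (ha : SmoothNear a 0) (hb : SmoothNear b 0) (ha0 : 0 < a 0)
    (hb0 : 0 < b 0) (hF : SmoothNear F 0) {l w : Cyl → Jet}
    (ls : SmoothLeaf l) (ws : SmoothLeaf w)
    (hl0 : ∀ᶠ y in 𝓛, y.1 = 0 → l y = 0)
    (hw0 : ∀ᶠ y in 𝓛, y.1 = 0 → w y = pairField a b F y) :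
    ∃ c : Cyl → ℝ, SmoothLeaf c ∧
      (∀ᶠ y in 𝓛, y.1 = 0 → c y = 0) ∧
      ∀ᶠ y in 𝓛, det3 (w y)
        (lieBracket ℝ (liftField (fun y => l y + c y • w y) 1) (liftField w 0) y).2.1
        (lieBracket ℝ (liftField (fun y => l y + c y • w y) 1)
          (lieBracket ℝ (liftField (fun y => l y + c y • w y) 1) (liftField w 0)) y).2.1 = 0 := by
  set L := liftField l 1 with hL
  set W := liftField w 0 with hW
  set W1 := lieBracket ℝ L W with hW1
  set W2 := lieBracket ℝ L W1 with hW2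
  set W3 := lieBracket ℝ W W1 with hW3
  have Ls : SmoothLeaf L := fun y hy => (ls y hy).liftField
  have Ws : SmoothLeaf W := fun y hy => (ws y hy).liftField
  have W1s : SmoothLeaf W1 := fun y hy => (Ls y hy).lieBracket (Ws y hy)
  have W2s : SmoothLeaf W2 := fun y hy => (Ls y hy).lieBracket (W1s y hy)
  have W3s : SmoothLeaf W3 := fun y hy => (Ws y hy).lieBracket (W1s y hy)
  have ps : ∀ y ∈ leafSet, SmoothNear (pairField a b F) y := fun y hy => .pairField ha hb hF hy
  have ps' : ∀ y ∈ leafSet, SmoothNear (pairFieldDeriv a b F) y :=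
    fun y hy => .pairFieldDeriv ha hb hF hy
  have hev : ∀ {h : Cyl → Jet}, SmoothLeaf h →
      ∀ᶠ y in 𝓛, DifferentiableAt ℝ h y := fun h =>
    eventually_leafSet.2 fun y hy => (h y hy).mono fun y hy => hy.diffAt
  have hW1c : ∀ y, W1 y = fderiv ℝ W y (L y) - fderiv ℝ L y (W y) := fun y => rfl
  -- the brackets at time zero
  have e1 : ∀ᶠ y in 𝓛, y.1 = 0 → W1 y = liftField (pairFieldDeriv a b F) 0 y := by
    filter_upwards [hev ls, hev ws, hev ps, hl0, hw0, eventually_leafSet_nhds hl0,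
      eventually_leafSet_nhds hw0] with y h1 h2 h3 h4 h5 h6 h7 h8
    rw [hW1, lieBracket_liftField h1 h2, liftField, h4 h8, h5 h8]
    rw [fderiv_slice_congr (g := pairField a b F) h8 h7 h2 h3,
      fderiv_slice_congr (g := fun _ => (0 : Jet)) h8 h6 h1 (differentiableAt_const _)]
    rw [show ((0 : Jet), (1 : ℝ)) = ((0, 1) : Jet × ℝ) from rfl]
    have := fderiv_pairField h3
    rw [show ((0 : ℝ), (0 : Jet), (1 : ℝ)) = (0, 0, 1) from rfl, this]
    simp
  have hlift : ∀ {h : Cyl → Jet} {s : ℝ}, SmoothLeaf h →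
      ∀ᶠ y in 𝓛, DifferentiableAt ℝ (liftField h s) y := fun h =>
    eventually_leafSet.2 fun y hy => (h y hy).liftField.mono fun y hy => hy.diffAt
  have hW1d : ∀ᶠ y in 𝓛, DifferentiableAt ℝ W1 y :=
    eventually_leafSet.2 fun y hy => (W1s y hy).mono fun y hy => hy.diffAt
  have e2 : ∀ᶠ y in 𝓛, y.1 = 0 → W2 y = (0, -pairField a b F y, 0) := by
    filter_upwards [hev ls, hW1d, hev ps', hl0, eventually_leafSet_nhds hl0,
      eventually_leafSet_nhds e1, hlift (s := 1) ls, hlift (s := 0) ps', e1]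
      with y h1 h2 h3 h4 h5 h6 h7 h8 h10 h9
    rw [hW2, lieBracket_eq]
    simp only
    have q1 : L y = (0, 0, 1) := by rw [hL, liftField, h4 h9]
    rw [q1, fderiv_slice_congr h9 h6 h2 h8, fderiv_liftField h3, fderiv_pairFieldDeriv h3, h10 h9,
      hL, fderiv_liftField h1, liftField,
      fderiv_slice_congr (g := fun _ => (0 : Jet)) h9 h5 h1 (differentiableAt_const _)]
    simp
  have e3 : ∀ y ∈ leafSet, det3 (w y) (W1 y).2.1 (W3 y).2.1 = (a 0 * b 0) ^ 2 := by
    intro y hy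
    have h0 := (mem_leafSet.1 hy).1
    have f1 := (eventually_leafSet.1 hw0 y hy).self_of_nhds h0
    have f2 := (eventually_leafSet.1 e1 y hy).self_of_nhds h0
    have f3 : W3 y = lieBracket ℝ (liftField (pairField a b F) 0) (liftField (pairFieldDeriv a b F) 0) y := by
      rw [hW3, lieBracket_eq, lieBracket_eq]
      simp only
      rw [f2]
      have f4 : W y = liftField (pairField a b F) 0 y := by rw [hW, liftField, liftField, f1]
      rw [f4, liftField, liftField]
      rw [fderiv_slice_congr h0 (eventually_leafSet.1 e1 y hy) (W1s y hy).differentiableAt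
        (ps' y hy).liftField.differentiableAt]
      rw [fderiv_slice_congr (g := liftField (pairField a b F) 0) h0
        ((eventually_leafSet.1 hw0 y hy).mono fun y h h' => by rw [hW, liftField, liftField, h h'])
        (Ws y hy).differentiableAt (ps y hy).liftField.differentiableAt]
    rw [f3, f1, f2]
    exact (det3_lieBracket_pairField (ps y hy) (ps' y hy)).trans (by rw [(mem_leafSet.1 hy).2.1])
  have d3s : SmoothLeaf (fun y => det3 (w y) (W1 y).2.1 (W3 y).2.1) := fun y hy =>
    (ws y hy).det3 (W1s y hy).snd.fst (W3s y hy).snd.fst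
  have hne : ∀ y ∈ leafSet, det3 (w y) (W1 y).2.1 (W3 y).2.1 ≠ 0 := fun y hy => by
    rw [e3 y hy]; positivity
  set c : Cyl → ℝ := fun y =>
    -det3 (w y) (W1 y).2.1 (W2 y).2.1 / det3 (w y) (W1 y).2.1 (W3 y).2.1 with hc
  have cs : SmoothLeaf c := fun y hy =>
    ((ws y hy).det3 (W1s y hy).snd.fst (W2s y hy).snd.fst).neg.div (d3s y hy) (hne y hy)
  refine ⟨c, cs, ?_, ?_⟩
  · filter_upwards [hw0, e1, e2] with y h1 h2 h3 h4
    have : det3 (w y) (W1 y).2.1 (W2 y).2.1 = 0 := by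
      rw [h1 h4, h2 h4, h3 h4, liftField, det3]
      simp only [Prod.fst_neg, Prod.snd_neg]
      ring
    simp only [hc, this, neg_zero, zero_div]
  · refine eventually_leafSet.2 fun y hy => ?_
    filter_upwards [(Ls y hy).eventually, (Ws y hy).eventually, (W1s y hy).eventually,
      (cs y hy).eventually, (d3s y hy).continuousAt.eventually_ne (hne y hy)] with x h1 h2 h3 h4 h5
    have hLb : liftField (fun y => l y + c y • w y) 1 = fun y => L y + c y • W y := by
      funext y
      simp [liftField, hL, hW]
    set e : Cyl → ℝ := fun y => -fderiv ℝ c y (W y) with he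
    have es : SmoothNear e x := (h4.fderiv_apply h2).neg
    have b1 : ∀ᶠ y in 𝓝 x, lieBracket ℝ (fun y => L y + c y • W y) W y = W1 y + e y • W y := by
      filter_upwards [h1, h2, h4] with y k1 k2 k4
      rw [lieBracket_add_smul_left' (k1.diffAt) (k2.diffAt)
        (k4.diffAt), lieBracket_self]
      simp [he, sub_eq_add_neg, hW1]
    rw [hLb]
    have b2 : lieBracket ℝ (fun y => L y + c y • W y)
        (lieBracket ℝ (fun y => L y + c y • W y) W) x =
        (W2 x + c x • W3 x - fderiv ℝ c x (W1 x) • W x) + e x • (W1 x + e x • W x) +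
          fderiv ℝ e x (L x + c x • W x) • W x := by
      have : lieBracket ℝ (fun y => L y + c y • W y)
        (lieBracket ℝ (fun y => L y + c y • W y) W) x =
        lieBracket ℝ (fun y => L y + c y • W y) (fun y => W1 y + e y • W y) x := by
        exact Filter.EventuallyEq.lieBracket_vectorField_eq (EventuallyEq.refl _ _) b1
      rw [this, lieBracket_add_smul_right' h3.differentiableAt h2.differentiableAt es.differentiableAt,
        b1.self_of_nhds,
        lieBracket_add_smul_left' h1.differentiableAt h2.differentiableAt h4.differentiableAt]
    rw [b2, b1.self_of_nhds]
    have hWx : (W x).2.1 = w x := rfl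
    have hcx : det3 (w x) (W1 x).2.1 (W2 x).2.1 + c x * det3 (w x) (W1 x).2.1 (W3 x).2.1 = 0 := by
      simp only [hc]
      rw [div_mul_cancel₀ _ h5]; ring
    rw [← hcx]
    simp only [det3, Prod.fst_add, Prod.snd_add, Prod.smul_fst, Prod.smul_snd, smul_eq_mul,
      Prod.fst_sub, Prod.snd_sub, hWx]
    ring

end Characteristic

/-! ### The equation defined by a family of Engel plane fields -/

section NormalForm

open VectorField

theorem exists_firstIntegrals_near_leaf {l : Cyl → Jet}
    (ls : SmoothLeaf l) (hl0 : ∀ᶠ y in 𝓛, y.1 = 0 → l y = 0) :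
    ∃ γ : Cyl → Jet, (∀ᶠ y in 𝓛, ContDiffAt ℝ ∞ γ y) ∧
      (∀ᶠ y in 𝓛, y.1 = 0 → γ y = y.2.1) ∧
      ∀ᶠ y in 𝓛, fderiv ℝ γ y (0, l y, 1) = 0 := by
  obtain ⟨c, hc, hc1, hcP⟩ := exists_cutoff_near_compact isCompact_leafSet
    ((eventually_leafSet.2 ls).and hl0)
  have hv : ContDiff ℝ ∞ (fun y => c y • l y) :=
    contDiff_cutoff_smul hc fun y hy => (hcP y hy).1
  have hv0 : ∀ z s, c ((0 : ℝ), (z : Jet), (s : ℝ)) • l (0, z, s) = 0 := by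
    intro z s
    by_cases hz : ((0 : ℝ), z, s) ∈ tsupport c
    · rw [(hcP _ hz).2 rfl, smul_zero]
    · rw [image_eq_zero_of_notMem_tsupport hz, zero_smul]
  obtain ⟨u, hu⟩ := exists_smooth_flow (l₀ := (0 : ℝ)) hv hv0 (0 : Jet) Real.pi_pos
  have hu' : ∀ y ∈ leafSet, SmoothNear u y ∧ ∀ᶠ p in 𝓝 y, u (p.1, p.2.1, 0) = p.2.1 ∧
      (p.1 = 0 → u p = p.2.1) ∧
        HasDerivAt (fun s => u (p.1, p.2.1, s)) (c (p.1, u p, p.2.2) • l (p.1, u p, p.2.2)) p.2.2 := by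
    intro y hy
    obtain ⟨h1, h2, h3⟩ := mem_leafSet.1 hy
    have e : y = (0, 0, y.2.2) := Prod.ext h1 (Prod.ext h2 rfl)
    rw [e]
    exact hu y.2.2 ⟨by linarith [h3.1, Real.pi_pos], by linarith [h3.2, Real.pi_pos]⟩
  have hψ : IsLeafMap (fun y => (u y, y.2.2)) :=
    ⟨eventually_leafSet.2 fun y hy => (hu' y hy).1.prodMk (ContDiff.smoothNear (by fun_prop) y),
      eventually_leafSet.2 fun y hy => (hu' y hy).2.mono fun p hp h => Prod.ext (hp.2.1 h) rfl,
      by simp, by simp⟩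
  obtain ⟨g, hg, hgl, hgr, hgt⟩ := hψ.exists_inverse
  have hgr' : ∀ᶠ y in 𝓛, (g y).1 = y.1 ∧ u (g y) = y.2.1 ∧ (g y).2.2 = y.2.2 :=
    hgr.mono fun y hy => ⟨(congrArg Prod.fst hy :), (congrArg (fun y => y.2.1) hy :),
      (congrArg (fun y => y.2.2) hy :)⟩
  refine ⟨fun y => (g y).2.1, hg.mono fun y hy => hy.snd.fst, ?_, ?_⟩
  · filter_upwards [hgr', hgt.eventually hψ.slice_id] with y h1 h2 h3
    have := congrArg Prod.fst (h2 (h1.1.trans h3))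
    rw [← this]; exact h1.2.1
  · have hder : ∀ᶠ y in 𝓛, DifferentiableAt ℝ u y ∧
        fderiv ℝ u y (0, 0, 1) = c (y.1, u y, y.2.2) • l (y.1, u y, y.2.2) :=
      eventually_leafSet.2 fun y hy => by
        filter_upwards [(hu' y hy).1, (hu' y hy).2] with p h1 h2
        have hd : DifferentiableAt ℝ u p := h1.diffAt
        exact ⟨hd, (hasDerivAt_theta hd).unique h2.2.2⟩
    filter_upwards [hgt.eventually hder, hc1, hgt.eventually (eventually_leafSet_nhds hgl), hg, hgr]
      with y h1 h2 h3 h4 h5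
    have h5' : ((g y).1, u (g y), (g y).2.2) = y := h5
    rw [h5', h2, one_smul] at h1
    have hdg : DifferentiableAt ℝ g y := h4.diffAt
    have hψd : DifferentiableAt ℝ (fun y : Cyl => (u y, y.2.2)) (g y) :=
      h1.1.prodMk (by fun_prop)
    have e1 : fderiv ℝ (fun r => g (totalMap (fun y => (u y, y.2.2)) r)) (g y) (0, 0, 1) = (0, 0, 1) := by
      rw [Filter.EventuallyEq.fderiv_eq (𝕜 := ℝ)
        (show (fun r => g (totalMap (fun y => (u y, y.2.2)) r)) =ᶠ[𝓝 (g y)] fun r => r from h3)]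
      simp
    have hdt : DifferentiableAt ℝ (totalMap (fun y : Cyl => (u y, y.2.2))) (g y) :=
      differentiableAt_fst.prodMk hψd
    have hθ : ∀ (x v : Cyl), fderiv ℝ (fun y : Cyl => y.2.2) x v = v.2.2 := fun x v => by
      have : HasFDerivAt (fun y : Cyl => y.2.2) ((ContinuousLinearMap.snd ℝ Jet ℝ).comp
        (ContinuousLinearMap.snd ℝ ℝ (Jet × ℝ))) x := hasFDerivAt_snd.comp x hasFDerivAt_snd
      rw [this.fderiv]; rfl
    rw [fderiv_comp_apply' (by rw [h5]; exact hdg) hdt, fderiv_totalMap hψd, h5,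
      fderiv_prodMk_apply h1.1 (by fun_prop), hθ, h1.2] at e1
    rw [fderiv_fst_apply hdg.snd, fderiv_snd_apply hdg]
    exact congrArg (fun v => v.2.1) e1

theorem exists_slopes {ν : Cyl → Jet} (νs : SmoothLeaf ν)
    (hpos : ∀ y ∈ leafSet, 0 < (ν y).2.2 * (fderiv ℝ ν y (0, 0, 1)).1 -
      (fderiv ℝ ν y (0, 0, 1)).2.2 * (ν y).1)
    (hdet : ∀ᶠ y in 𝓛, det3 (ν y) (fderiv ℝ ν y (0, 0, 1))
      (fderiv ℝ (fun y => fderiv ℝ ν y (0, 0, 1)) y (0, 0, 1)) = 0) :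
    ∀ᶠ q in 𝓝 (0 : TJet), ∃ m₁ m₃ : ℝ, ∀ θ ∈ Quadrant,
      (ν (q.1, q.2, θ)).2.1 = m₁ * (ν (q.1, q.2, θ)).1 + m₃ * (ν (q.1, q.2, θ)).2.2 := by
  set ν' : Cyl → Jet := fun y => fderiv ℝ ν y (0, 0, 1) with hν'
  have νs' : SmoothLeaf ν' := fun y hy =>
    (νs y hy).fderiv_apply (contDiff_const.smoothNear _)
  have hpos' : ∀ᶠ y in 𝓛, 0 < (ν y).2.2 * (ν' y).1 - (ν' y).2.2 * (ν y).1 :=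
    eventually_leafSet.2 fun y hy =>
      ((((νs y hy).snd.snd.mul (νs' y hy).fst).sub ((νs' y hy).snd.snd.mul (νs y hy).fst)).continuousAt).eventually
        (lt_mem_nhds (hpos y hy))
  filter_upwards [eventually_forall_leaf (hpos'.and (hdet.and ((eventually_leafSet.2 νs).and
    (eventually_leafSet.2 νs'))))] with q hq
  have hd : ∀ θ ∈ Quadrant, HasDerivAt (fun s => ν (q.1, q.2, s)) (ν' (q.1, q.2, θ)) θ ∧
      HasDerivAt (fun s => ν' (q.1, q.2, s)) (fderiv ℝ ν' (q.1, q.2, θ) (0, 0, 1)) θ := fun θ hθ =>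
    ⟨hasDerivAt_theta (y := (q.1, q.2, θ)) ((hq θ hθ).2.2.1.diffAt),
      hasDerivAt_theta (y := (q.1, q.2, θ)) ((hq θ hθ).2.2.2.diffAt)⟩
  set u : ℝ → Jet := fun s => ν (q.1, q.2, s) with hu
  set u' : ℝ → Jet := fun s => ν' (q.1, q.2, s) with hu'
  set u'' : ℝ → Jet := fun s => fderiv ℝ ν' (q.1, q.2, s) (0, 0, 1) with hu''
  set n₁ : ℝ → ℝ := fun s => (u s).2.1 * (u' s).2.2 - (u s).2.2 * (u' s).2.1 with hn₁
  set n₂ : ℝ → ℝ := fun s => (u s).2.2 * (u' s).1 - (u' s).2.2 * (u s).1 with hn₂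
  set n₃ : ℝ → ℝ := fun s => (u s).1 * (u' s).2.1 - (u s).2.1 * (u' s).1 with hn₃
  have hn2 : ∀ θ ∈ Quadrant, n₂ θ ≠ 0 := fun θ hθ => (hq θ hθ).1.ne'
  have hdt : ∀ θ ∈ Quadrant, det3 (u θ) (u' θ) (u'' θ) = 0 := fun θ hθ => (hq θ hθ).2.1
  have comps : ∀ θ ∈ Quadrant,
      (HasDerivAt (fun s => (u s).1) (u' θ).1 θ ∧ HasDerivAt (fun s => (u s).2.1) (u' θ).2.1 θ ∧
        HasDerivAt (fun s => (u s).2.2) (u' θ).2.2 θ) ∧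
      HasDerivAt (fun s => (u' s).1) (u'' θ).1 θ ∧ HasDerivAt (fun s => (u' s).2.1) (u'' θ).2.1 θ ∧
        HasDerivAt (fun s => (u' s).2.2) (u'' θ).2.2 θ := fun θ hθ =>
    ⟨⟨hasDerivAt_fst_comp (hd θ hθ).1, hasDerivAt_fst_comp (hasDerivAt_snd_comp (hd θ hθ).1),
      hasDerivAt_snd_comp (hasDerivAt_snd_comp (hd θ hθ).1)⟩,
     hasDerivAt_fst_comp (hd θ hθ).2, hasDerivAt_fst_comp (hasDerivAt_snd_comp (hd θ hθ).2),
      hasDerivAt_snd_comp (hasDerivAt_snd_comp (hd θ hθ).2)⟩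
  have k1 : ∀ θ ∈ Quadrant, HasDerivAt (fun s => n₁ s / n₂ s) 0 θ := by
    intro θ hθ
    obtain ⟨⟨a1, a2, a3⟩, b1, b2, b3⟩ := comps θ hθ
    have h1 := (a2.mul b3).sub (a3.mul b2)
    have h2 := (a3.mul b1).sub (b3.mul a1)
    refine (h1.div h2 (hn2 θ hθ)).congr_deriv ?_
    rw [div_eq_zero_iff]
    left
    have := hdt θ hθ
    simp only [det3] at this
    simp only [Pi.sub_apply, Pi.mul_apply]
    linear_combination (-(u θ).2.2) * this
  have k3 : ∀ θ ∈ Quadrant, HasDerivAt (fun s => n₃ s / n₂ s) 0 θ := by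
    intro θ hθ
    obtain ⟨⟨a1, a2, a3⟩, b1, b2, b3⟩ := comps θ hθ
    have h1 := (a1.mul b2).sub (a2.mul b1)
    have h2 := (a3.mul b1).sub (b3.mul a1)
    refine (h1.div h2 (hn2 θ hθ)).congr_deriv ?_
    rw [div_eq_zero_iff]
    left
    have := hdt θ hθ
    simp only [det3] at this
    simp only [Pi.sub_apply, Pi.mul_apply]
    linear_combination ((u θ).1) * this
  have hconst : ∀ {h : ℝ → ℝ}, (∀ θ ∈ Quadrant, HasDerivAt h 0 θ) →
      ∀ θ ∈ Quadrant, h 0 = h θ := by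
    intro h hh θ hθ
    rcases eq_or_lt_of_le hθ.1 with h0 | h0
    · rw [← h0]
    · exact eq_of_deriv_eq_zero_Ioo h0 (fun x hx => (hh x ⟨hx.1, hx.2.trans hθ.2⟩).continuousAt)
        fun x hx => hh x ⟨hx.1.le, hx.2.le.trans hθ.2⟩
  refine ⟨-(n₁ 0 / n₂ 0), -(n₃ 0 / n₂ 0), fun θ hθ => ?_⟩
  rw [hconst k1 θ hθ, hconst k3 θ hθ]
  change (u θ).2.1 = -(n₁ θ / n₂ θ) * (u θ).1 + -(n₃ θ / n₂ θ) * (u θ).2.2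
  have := hn2 θ hθ
  field_simp
  simp only [hn₁, hn₂, hn₃]
  ring

/-- Planes of the form `span (l + ∂/∂θ, w)` are equal to planes `span (∂/∂θ, ν)`, up to isotopy, where
`ν` turns in planes that do not depend on `θ`. -/
theorem exists_straightened {a b : Jet → ℝ} {F : TJet → ℝ} (ha : SmoothNear a 0)
    (hb : SmoothNear b 0) (ha0 : 0 < a 0) (hb0 : 0 < b 0) (hF : SmoothNear F 0)
    {l w : Cyl → Jet}
    (ls : SmoothLeaf l) (ws : SmoothLeaf w)
    (hl0 : ∀ᶠ y in 𝓛, y.1 = 0 → l y = 0)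
    (hw0 : ∀ᶠ y in 𝓛, y.1 = 0 → w y = pairField a b F y) :
    ∃ ν : Cyl → Jet, SmoothLeaf ν ∧
      (∀ᶠ y in 𝓛, y.1 = 0 → ν y = pairField a b F y) ∧
      LeafIsotopic (fun y => plane (l y) (w y)) (fun y => plane 0 (ν y)) ∧
      ∀ᶠ q in 𝓝 (0 : TJet), ∃ m₁ m₃ : ℝ, ∀ θ ∈ Quadrant,
        (ν (q.1, q.2, θ)).2.1 = m₁ * (ν (q.1, q.2, θ)).1 + m₃ * (ν (q.1, q.2, θ)).2.2 := by
  obtain ⟨c, cs, hc0, hdet⟩ := exists_characteristic ha hb ha0 hb0 hF ls ws hl0 hw0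
  set l' : Cyl → Jet := fun y => l y + c y • w y with hl'
  have ls' : SmoothLeaf l' := fun y hy => (ls y hy).add ((cs y hy).smul (ws y hy))
  obtain ⟨γ, hγ, hγ0, hγl⟩ := exists_firstIntegrals_near_leaf ls' (by
    filter_upwards [hl0, hc0] with y h1 h2 h3
    simp only [hl', h1 h3, h2 h3, zero_smul, add_zero])
  obtain ⟨ν, g, hν, hν0, hνγ, hgt, hgr, hiso⟩ := exists_leafIsotopic_of_firstIntegrals hγ hγ0 hγl
    (eventually_leafSet.2 ws)
  have νs : SmoothLeaf ν := eventually_leafSet.1 hν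
  have hν0' : ∀ᶠ y in 𝓛, y.1 = 0 → ν y = pairField a b F y := by
    filter_upwards [hν0, hw0] with y h1 h2 h3
    rw [h1 h3, h2 h3]
  refine ⟨ν, νs, hν0', ?_, exists_slopes νs ?_ ?_⟩
  · refine (LeafIsotopic.of_eq (Eventually.of_forall fun y _ => ?_)).trans hiso
    simp only [hl']
    rw [plane_add_smul]
  · intro y hy
    have h0 := (mem_leafSet.1 hy).1
    have ps := SmoothNear.pairField ha hb hF hy
    have e := fderiv_slice_congr h0 (eventually_leafSet.1 hν0' y hy) (νs y hy).differentiableAt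
      ps.differentiableAt (0, 1)
    have e' : fderiv ℝ ν y (0, 0, 1) = pairFieldDeriv a b F y :=
      e.trans (fderiv_pairField ps.differentiableAt)
    rw [e', (eventually_leafSet.1 hν0' y hy).self_of_nhds h0, pairField_cross, (mem_leafSet.1 hy).2.1]
    exact mul_pos ha0 hb0
  · set φ : Cyl → Cyl := fun y => (y.1, γ y, y.2.2) with hφ
    have γs : SmoothLeaf γ := eventually_leafSet.1 hγ
    have φs : ∀ y ∈ leafSet, SmoothNear φ y := fun y hy =>
      (contDiff_fst.smoothNear y).prodMk ((γs y hy).prodMk (ContDiff.smoothNear (by fun_prop) y))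
    have hφd : ∀ᶠ y in 𝓛, ∀ v, fderiv ℝ φ y v = (v.1, fderiv ℝ γ y v, v.2.2) := by
      filter_upwards [hγ] with y h1 v
      have hd : DifferentiableAt ℝ γ y := h1.diffAt
      have e : HasFDerivAt φ ((ContinuousLinearMap.fst ℝ ℝ (Jet × ℝ)).prod ((fderiv ℝ γ y).prod
          ((ContinuousLinearMap.snd ℝ Jet ℝ).comp (ContinuousLinearMap.snd ℝ ℝ (Jet × ℝ))))) y :=
        hasFDerivAt_fst.prodMk (hd.hasFDerivAt.prodMk (hasFDerivAt_snd.comp y hasFDerivAt_snd))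
      rw [e.fderiv]; rfl
    have hφt : Tendsto φ 𝓛 𝓛 :=
      tendsto_leafSet (fun y hy => (φs y hy).continuousAt) fun y hy => by
        have h0 := mem_leafSet.1 hy
        have := (eventually_leafSet.1 hγ0 y hy).self_of_nhds h0.1
        exact mem_leafSet.2 ⟨h0.1, this.trans h0.2.1, h0.2.2⟩
    -- the brackets of `∂/∂θ` and `ν`
    set Θ : Cyl → Cyl := fun _ => (0, 0, 1) with hΘ
    set ν' : Cyl → Jet := fun y => fderiv ℝ ν y (0, 0, 1) with hν'
    have νs' : SmoothLeaf ν' := fun y hy =>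
      (νs y hy).fderiv_apply (contDiff_const.smoothNear _)
    have hbr : ∀ {h : Cyl → Jet} {y}, DifferentiableAt ℝ h y →
        lieBracket ℝ Θ (liftField h 0) y = (0, fderiv ℝ h y (0, 0, 1), 0) := by
      intro h y hh
      rw [lieBracket_eq]
      simp only [fderiv_liftField hh, hΘ, fderiv_fun_const, Pi.zero_apply, zero_apply, sub_zero]
    set L := liftField l' 1 with hL
    set W := liftField w 0 with hW
    have Ls : SmoothLeaf L := fun y hy => (ls' y hy).liftField
    have Ws : SmoothLeaf W := fun y hy => (ws y hy).liftField
    have r0 : ∀ᶠ y in 𝓛, fderiv ℝ φ y (L y) = Θ (φ y) := by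
      filter_upwards [hφd, hγl] with y h1 h2
      rw [h1]
      simp only [hL, liftField, hΘ, h2]
    have r1 : ∀ᶠ y in 𝓛, fderiv ℝ φ y (W y) = liftField ν 0 (φ y) := by
      filter_upwards [hφd, hνγ] with y h1 h2
      rw [h1]
      simp only [hW, liftField, hφ, h2]
    have hde : ∀ {X : Type} [NormedAddCommGroup X] [NormedSpace ℝ X] {h : Cyl → X},
        SmoothLeaf h → ∀ᶠ y in 𝓛, DifferentiableAt ℝ h y := fun h =>
      eventually_leafSet.2 fun y hy => (h y hy).mono fun y hy => hy.diffAt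
    have r2 : ∀ᶠ y in 𝓛, fderiv ℝ φ y (lieBracket ℝ L W y) = liftField ν' 0 (φ y) := by
      filter_upwards [eventually_leafSet_nhds r0, eventually_leafSet_nhds r1,
        eventually_leafSet.2 φs, hde Ls, hde Ws, hφt.eventually (hde νs)] with y h1 h2 h3 h4 h5 h6
      rw [lieBracket_related h3 h4 h5 (differentiableAt_const _) ?_ h1 h2, hbr h6]
      · rfl
      · exact (differentiableAt_const _).prodMk (h6.prodMk (differentiableAt_const _))
    have r3 : ∀ᶠ y in 𝓛, fderiv ℝ φ y (lieBracket ℝ L (lieBracket ℝ L W) y) =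
        (0, fderiv ℝ ν' (φ y) (0, 0, 1), 0) := by
      filter_upwards [eventually_leafSet_nhds r0, eventually_leafSet_nhds r2,
        eventually_leafSet.2 φs, hde Ls, hde fun y hy => (Ls y hy).lieBracket (Ws y hy),
        hφt.eventually (hde νs')] with y h1 h2 h3 h4 h5 h6
      rw [lieBracket_related h3 h4 h5 (differentiableAt_const _) ?_ h1 h2, hbr h6]
      exact (differentiableAt_const _).prodMk (h6.prodMk (differentiableAt_const _))
    have hflat : ∀ᶠ y in 𝓛, lieBracket ℝ L W y = (0, (lieBracket ℝ L W y).2.1, 0) ∧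
        lieBracket ℝ L (lieBracket ℝ L W) y = (0, (lieBracket ℝ L (lieBracket ℝ L W) y).2.1, 0) := by
      have f1 : ∀ᶠ y in 𝓛, lieBracket ℝ L W y = (0, (lieBracket ℝ L W y).2.1, 0) := by
        filter_upwards [hde ls', hde ws] with y h1 h2
        rw [hL, hW, lieBracket_liftField h1 h2]
      filter_upwards [f1, eventually_leafSet_nhds f1, hde ls',
        hde fun y hy => ((Ls y hy).lieBracket (Ws y hy)).snd.fst] with y h1 h2 h3 h4
      refine ⟨h1, ?_⟩
      have : lieBracket ℝ L (lieBracket ℝ L W) y =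
          lieBracket ℝ L (liftField (fun y => (lieBracket ℝ L W y).2.1) 0) y :=
        Filter.EventuallyEq.lieBracket_vectorField_eq (EventuallyEq.refl _ _) h2
      rw [this, hL, lieBracket_liftField h3 h4]
    have hfin : ∀ᶠ y in 𝓛, det3 (ν (φ y)) (ν' (φ y)) (fderiv ℝ ν' (φ y) (0, 0, 1)) = 0 := by
      filter_upwards [hdet, r1, r2, r3, hflat] with y h1 h2 h3 h4 h5
      rw [h5.1] at h3
      rw [h5.2] at h4
      set M : Jet →ₗ[ℝ] Jet :=
        { toFun := fun v => (fderiv ℝ φ y (0, v, 0)).2.1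
          map_add' := fun v v' => by
            have : ((0 : ℝ), v + v', (0 : ℝ)) = (0, v, 0) + (0, v', 0) := by simp
            rw [this, map_add]; rfl
          map_smul' := fun s v => by
            have : ((0 : ℝ), s • v, (0 : ℝ)) = s • ((0, v, 0) : Cyl) := by simp
            rw [this, map_smul]; rfl } with hM
      have m1 : M (w y) = ν (φ y) := congrArg (fun v => v.2.1) h2
      have m2 : M (lieBracket ℝ L W y).2.1 = ν' (φ y) := congrArg (fun v => v.2.1) h3
      have m3 : M (lieBracket ℝ L (lieBracket ℝ L W) y).2.1 = fderiv ℝ ν' (φ y) (0, 0, 1) :=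
        congrArg (fun v => v.2.1) h4
      rw [← m1, ← m2, ← m3, det3_map, h1, mul_zero]
    filter_upwards [hgt.eventually hfin, hgr] with y h1 h2
    have : φ (g y) = y := h2
    rwa [this] at h1

end NormalForm

theorem eventually_eq_of_vertical {Φ : Jet → Jet}
    (hv : ∀ᶠ z in 𝓝 (0 : Jet), DifferentiableAt ℝ Φ z ∧ (fderiv ℝ Φ z (0, 0, 1)).1 = 0 ∧
      (fderiv ℝ Φ z (0, 0, 1)).2.1 = 0) :
    ∀ᶠ z in 𝓝 (0 : Jet), (Φ (z.1, z.2.1, 0)).1 = (Φ z).1 ∧ (Φ (z.1, z.2.1, 0)).2.1 = (Φ z).2.1 := by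
  obtain ⟨r, hr, hball⟩ := Metric.eventually_nhds_iff_ball.1 hv
  refine Metric.eventually_nhds_iff_ball.2 ⟨r, hr, ?_⟩
  rintro ⟨x, y, p⟩ hz
  have hmem : ∀ s ∈ Metric.ball (0 : ℝ) r, ((x, y, s) : Jet) ∈ Metric.ball (0 : Jet) r := by
    intro s hs
    rw [mem_ball_zero_iff] at hs hz ⊢
    simp only [Prod.norm_def, max_lt_iff] at hz ⊢
    exact ⟨hz.1, hz.2.1, hs⟩
  have hp : p ∈ Metric.ball (0 : ℝ) r := by
    rw [mem_ball_zero_iff] at hz ⊢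
    simp only [Prod.norm_def, max_lt_iff] at hz
    exact hz.2.2
  have hd : ∀ s ∈ Metric.ball (0 : ℝ) r, HasDerivAt (fun s => Φ (x, y, s))
      (fderiv ℝ Φ (x, y, s) (0, 0, 1)) s := by
    intro s hs
    have hl : HasDerivAt (fun s : ℝ => ((x, y, s) : Jet)) (0, 0, 1) s :=
      (hasDerivAt_const s x).prodMk ((hasDerivAt_const s y).prodMk (hasDerivAt_id s))
    exact ((hball _ (hmem s hs)).1.hasFDerivAt.comp_hasDerivAt s hl :)
  have key : ∀ h : ℝ → ℝ, (∀ s ∈ Metric.ball (0 : ℝ) r, HasDerivAt h 0 s) → h 0 = h p := fun h hh =>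
    Metric.isOpen_ball.is_const_of_deriv_eq_zero (convex_ball _ _).isPreconnected
      (fun s hs => (hh s hs).differentiableAt.differentiableWithinAt)
      (fun s hs => (hh s hs).deriv) (Metric.mem_ball_self hr) hp
  refine ⟨key (fun s => (Φ (x, y, s)).1) fun s hs => ?_,
    key (fun s => (Φ (x, y, s)).2.1) fun s hs => ?_⟩
  · exact (hasDerivAt_fst_comp (hd s hs)).congr_deriv (hball _ (hmem s hs)).2.1
  · exact (hasDerivAt_fst_comp (hasDerivAt_snd_comp (hd s hs))).congr_deriv
      (hball _ (hmem s hs)).2.2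

section NormalForm

variable {a b : Jet → ℝ} {F₀ : TJet → ℝ}

theorem tendsto_snd_zero : Tendsto (fun z : Jet => ((0 : ℝ), z)) (𝓝 0) (𝓝 (0 : TJet)) :=
  tendsto_slice (0 : ℝ) (0 : Jet)

/-- A straightening that starts from the coordinates in which the pair is in normal form, and is
normalized along `p = 0`, starts from the identity. -/
theorem slice_id_of_straightens (ha0 : 0 < a 0) (hb0 : 0 < b 0) (ha : SmoothNear a 0)
    (hb : SmoothNear b 0) {A B κ : TJet → Jet} (hκ : SmoothNear κ 0)
    (hA0 : ∀ᶠ q in 𝓝 (0 : TJet), q.1 = 0 → A q = a q.2 • (0, 0, 1))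
    (hB0 : ∀ᶠ q in 𝓝 (0 : TJet), q.1 = 0 → B q = b q.2 • totalField F₀ q)
    (hn : ∀ᶠ q in 𝓝 (0 : TJet), (κ (q.1, q.2.1, q.2.2.1, 0)).1 = q.2.1 ∧
        (κ (q.1, q.2.1, q.2.2.1, 0)).2.1 = q.2.2.1)
    (hst : ∀ᶠ q in 𝓝 (0 : TJet), Straightens κ A B q) :
    ∀ᶠ z in 𝓝 (0 : Jet), κ (0, z) = z := by
  have hap : ∀ᶠ z in 𝓝 (0 : Jet), 0 < a z := ha.continuousAt.eventually (lt_mem_nhds ha0)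
  have hbp : ∀ᶠ z in 𝓝 (0 : Jet), 0 < b z := hb.continuousAt.eventually (lt_mem_nhds hb0)
  have hvert : ∀ᶠ z in 𝓝 (0 : Jet), DifferentiableAt ℝ κ (0, z) ∧
      (fderiv ℝ κ (0, z) (0, 0, 0, 1)).1 = 0 ∧ (fderiv ℝ κ (0, z) (0, 0, 0, 1)).2.1 = 0 := by
    filter_upwards [hap, tendsto_snd_zero.eventually hA0, tendsto_snd_zero.eventually hst,
      tendsto_snd_zero.eventually hκ] with z h1 h2 h3 h4
    have e : ((0 : ℝ), A (0, z)) = a z • ((0, 0, 0, 1) : TJet) := by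
      rw [h2 rfl]; simp
    obtain ⟨k1, k2, -⟩ := h3
    rw [e, map_smul] at k1 k2
    exact ⟨h4.diffAt, by simpa [h1.ne'] using k1, by simpa [h1.ne'] using k2⟩
  have hvert' : ∀ᶠ z in 𝓝 (0 : Jet), DifferentiableAt ℝ (fun z => κ (0, z)) z ∧
      (fderiv ℝ (fun z => κ (0, z)) z (0, 0, 1)).1 = 0 ∧
      (fderiv ℝ (fun z => κ (0, z)) z (0, 0, 1)).2.1 = 0 := hvert.mono fun z h => by
    rw [fderiv_slice h.1]
    exact ⟨h.1.comp z ((differentiableAt_const _).prodMk differentiableAt_id), h.2⟩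
  have hxy : ∀ᶠ z in 𝓝 (0 : Jet), (κ (0, z)).1 = z.1 ∧ (κ (0, z)).2.1 = z.2.1 := by
    filter_upwards [eventually_eq_of_vertical hvert', tendsto_snd_zero.eventually hn] with z h1 h2
    exact ⟨h1.1.symm.trans h2.1, h1.2.symm.trans h2.2⟩
  filter_upwards [hxy, hxy.eventually_nhds, tendsto_snd_zero.eventually hst, hbp,
    tendsto_snd_zero.eventually hB0, hvert] with z h1 h2 h3 h4 h5 h6
  obtain ⟨-, -, -, -, k⟩ := h3
  have e1 : (fderiv ℝ κ (0, z) (0, B (0, z))).1 = (B (0, z)).1 := by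
    have hd : DifferentiableAt ℝ (fun z => κ (0, z)) z :=
      h6.1.comp z ((differentiableAt_const _).prodMk differentiableAt_id)
    rw [← fderiv_slice h6.1, ← fderiv_fst_apply hd,
      Filter.EventuallyEq.fderiv_eq (𝕜 := ℝ) (show (fun z => (κ (0, z)).1) =ᶠ[𝓝 z] fun z => z.1 from
        h2.mono fun _ h => h.1), fderiv_fst]; rfl
  have e2 : (fderiv ℝ κ (0, z) (0, B (0, z))).2.1 = (B (0, z)).2.1 := by
    have hd : DifferentiableAt ℝ (fun z => κ (0, z)) z :=
      h6.1.comp z ((differentiableAt_const _).prodMk differentiableAt_id)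
    rw [← fderiv_slice h6.1, ← fderiv_snd_apply hd, ← fderiv_fst_apply hd.snd,
      Filter.EventuallyEq.fderiv_eq (𝕜 := ℝ) (show (fun z => (κ (0, z)).2.1) =ᶠ[𝓝 z] fun z => z.2.1
        from h2.mono fun _ h => h.2)]
    rw [fderiv_fst_apply differentiableAt_snd, fderiv_snd]; rfl
  rw [e1, e2, h5 rfl] at k
  simp only [totalField, Prod.smul_fst, Prod.smul_snd, smul_eq_mul, mul_one] at k
  refine Prod.ext h1.1 (Prod.ext h1.2 ?_)
  have : b z ≠ 0 := h4.ne'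
  exact (mul_left_cancel₀ this (k.trans (mul_comm _ _))).symm

theorem exists_leafIsotopic_pairField (ha : SmoothNear a 0)
    (hb : SmoothNear b 0) (ha0 : 0 < a 0) (hb0 : 0 < b 0) (hF₀ : SmoothNear F₀ 0)
    {l w : Cyl → Jet}
    (ls : SmoothLeaf l) (ws : SmoothLeaf w)
    (hl0 : ∀ᶠ y in 𝓛, y.1 = 0 → l y = 0)
    (hw0 : ∀ᶠ y in 𝓛, y.1 = 0 → w y = pairField a b F₀ y) :
    ∃ F : TJet → ℝ, SmoothNear F 0 ∧ (∀ᶠ z in 𝓝 (0 : Jet), F (0, z) = F₀ (0, z)) ∧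
      LeafIsotopic (fun y => plane (l y) (w y)) (fun y => plane 0 (pairField a b F y)) := by
  obtain ⟨ν, νs, hν0, hiso, hslopes⟩ := exists_straightened ha hb ha0 hb0 hF₀ ls ws hl0 hw0
  have mem0 : ((0 : ℝ), (0 : Jet), (0 : ℝ)) ∈ leafSet :=
    mem_leafSet.2 ⟨rfl, rfl, le_rfl, Real.pi_div_two_pos.le⟩
  have mem1 : ((0 : ℝ), (0 : Jet), Real.pi / 2) ∈ leafSet :=
    mem_leafSet.2 ⟨rfl, rfl, Real.pi_div_two_pos.le, le_rfl⟩
  have hsec : ∀ θ : ℝ, SmoothNear (fun q : TJet => (q.1, q.2, θ)) 0 := fun θ =>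
    ContDiff.smoothNear (by fun_prop) _
  set A : TJet → Jet := fun q => ν (q.1, q.2, 0) with hA
  set B : TJet → Jet := fun q => ν (q.1, q.2, Real.pi / 2) with hB
  have As : SmoothNear A 0 := (νs _ mem0).comp_of_eq (hsec 0) rfl
  have Bs : SmoothNear B 0 := (νs _ mem1).comp_of_eq (hsec _) rfl
  have hA0 : ∀ᶠ q in 𝓝 (0 : TJet), q.1 = 0 → A q = a q.2 • (0, 0, 1) := by
    filter_upwards [(hsec 0).continuousAt.eventually (eventually_leafSet.1 hν0 _ mem0)] with q h1 h2
    rw [hA]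
    simp only [h1 h2, pairField, Real.cos_zero, Real.sin_zero, one_mul, zero_mul, zero_smul, add_zero]
  have hB0 : ∀ᶠ q in 𝓝 (0 : TJet), q.1 = 0 → B q = b q.2 • totalField F₀ q := by
    filter_upwards [(hsec (Real.pi / 2)).continuousAt.eventually (eventually_leafSet.1 hν0 _ mem1)]
      with q h1 h2
    rw [hB]
    simp only [h1 h2, pairField, Real.cos_pi_div_two, Real.sin_pi_div_two, one_mul, zero_mul,
      zero_smul, zero_add]
  have A0 : A 0 = a 0 • (0, 0, 1) := hA0.self_of_nhds rfl
  have B0 : B 0 = b 0 • totalField F₀ 0 := hB0.self_of_nhds rfl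
  obtain ⟨κ, hκ, hκ0, hinj, hn, hst⟩ := exists_straightening_of_adapted As Bs (by simp [A0])
    (by simp [A0]) (by simp [A0, ha0]) (by simp [B0, totalField, hb0]) (by simp [B0, totalField]) (by
      have hbs : SmoothNear (fun q : TJet => b q.2) 0 := hb.comp_of_eq (contDiff_snd.smoothNear _) rfl
      have d1 : (fderiv ℝ B 0 (0, A 0)).2.1 = b 0 * a 0 := by
        rw [← fderiv_snd_apply Bs.differentiableAt, ← fderiv_fst_apply Bs.differentiableAt.snd,
          fderiv_slice_congr (g := fun q : TJet => b q.2 * q.2.2.2) rfl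
            (hB0.mono fun q h h' => by simp [h h', totalField]) Bs.differentiableAt.snd.fst
            (hbs.differentiableAt.mul (by fun_prop)),
          fderiv_fun_mul hbs.differentiableAt (by fun_prop)]
        have : HasFDerivAt (fun q : TJet => q.2.2.2) ((ContinuousLinearMap.snd ℝ ℝ ℝ).comp
          ((ContinuousLinearMap.snd ℝ ℝ (ℝ × ℝ)).comp (ContinuousLinearMap.snd ℝ ℝ Jet))) 0 :=
          hasFDerivAt_snd.comp _ (hasFDerivAt_snd.comp _ hasFDerivAt_snd)
        rw [this.fderiv, A0]
        simp
      have d2 : (fderiv ℝ A 0 (0, B 0)).2.1 = 0 := by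
        rw [← fderiv_snd_apply As.differentiableAt, ← fderiv_fst_apply As.differentiableAt.snd,
          fderiv_slice_congr (g := fun q : TJet => (0 : ℝ)) rfl
            (hA0.mono fun q h h' => by simp [h h']) As.differentiableAt.snd.fst
            (differentiableAt_const _)]
        simp
      simp only [Prod.snd_sub, Prod.fst_sub, d1, d2, sub_zero]
      exact mul_pos hb0 ha0)
  have hid := slice_id_of_straightens ha0 hb0 ha hb hκ hA0 hB0 hn hst
  have ht0 : totalMap κ 0 = 0 := Prod.ext rfl hκ0
  obtain ⟨k, hk, hk0, hkl, hkr⟩ := hκ.totalMap.exists_local_inverse_of_bijective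
    (bijective_of_injective (fderiv_totalMap_injective (x := (0 : Jet)) hκ.differentiableAt hid))
  rw [ht0] at hk hk0
  set D : TJet → Jet := fun q => fderiv ℝ κ q (0, B q) with hD
  have Ds : SmoothNear D 0 := hκ.fderiv_apply ((contDiff_const.smoothNear _).prodMk Bs)
  have D0 : 0 < (D 0).1 := hst.self_of_nhds.2.2.2.1
  set F : TJet → ℝ := fun q => (D (k q)).2.2 / (D (k q)).1 with hF
  have Dks : SmoothNear (fun q => D (k q)) 0 := Ds.comp_of_eq hk hk0
  have Fs : SmoothNear F 0 := by
    refine Dks.snd.snd.div Dks.fst ?_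
    simp only [hk0]
    exact D0.ne'
  have hF0 : ∀ᶠ z in 𝓝 (0 : Jet), F (0, z) = F₀ (0, z) := by
    have hbp : ∀ᶠ z in 𝓝 (0 : Jet), 0 < b z := hb.continuousAt.eventually (lt_mem_nhds hb0)
    filter_upwards [hid, hid.eventually_nhds, tendsto_snd_zero.eventually hκ,
      tendsto_snd_zero.eventually hkl, tendsto_snd_zero.eventually hB0, hbp] with z h1 h2 h3 h4 h5 h6
    have e : k (0, z) = (0, z) := by
      rw [show totalMap κ (0, z) = (0, z) from Prod.ext rfl h1] at h4
      exact h4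
    have hd : DifferentiableAt ℝ κ (0, z) := h3.diffAt
    simp only [hF, e, hD, fderiv_of_slice_id h2 hd, h5 rfl]
    simp only [totalField, Prod.smul_fst, Prod.smul_snd, smul_eq_mul, mul_one]
    field_simp
  refine ⟨F, Fs, hF0, hiso.trans (leafIsotopic_lift ha hb ha0 hb0 Fs hκ hid (eventually_leafSet.2 νs)
    ?_ ?_ ?_ ?_)⟩
  · have hzt := tendsto_leafSet_point
    filter_upwards [hν0, hzt.eventually hF0] with y h1 h2 h3
    rw [h1 h3]
    simp only [pairField, totalField, h3, h2]
  · have hΔ : ∀ᶠ q in 𝓝 (0 : TJet), (A q).2.2 * (B q).1 - (A q).1 * (B q).2.2 ≠ 0 := by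
      refine ((As.snd.snd.mul Bs.fst).sub (As.fst.mul Bs.snd.snd)).continuousAt.eventually_ne ?_
      simp [A0, B0, totalField, ha0.ne', hb0.ne']
    filter_upwards [tendsto_leafSet_base.eventually hslopes, tendsto_leafSet_base.eventually hst,
      tendsto_leafSet_base.eventually hΔ] with y ⟨m₁, m₃, hm⟩ ⟨s1, s2, _, _, s5⟩ hne hy
    have hA2 : (A (y.1, y.2.1)).2.1 = m₁ * (A (y.1, y.2.1)).1 + m₃ * (A (y.1, y.2.1)).2.2 :=
      hm 0 ⟨le_rfl, Real.pi_div_two_pos.le⟩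
    have hB2 : (B (y.1, y.2.1)).2.1 = m₁ * (B (y.1, y.2.1)).1 + m₃ * (B (y.1, y.2.1)).2.2 :=
      hm (Real.pi / 2) ⟨Real.pi_div_two_pos.le, le_rfl⟩
    have hν2 : (ν y).2.1 = m₁ * (ν y).1 + m₃ * (ν y).2.2 := hm y.2.2 hy
    generalize A (y.1, y.2.1) = α at *
    generalize B (y.1, y.2.1) = β at *
    have e : ((0 : ℝ), ν y) =
        (((ν y).2.2 * β.1 - (ν y).1 * β.2.2) / (α.2.2 * β.1 - α.1 * β.2.2)) • ((0, α) : TJet) +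
        ((α.2.2 * (ν y).1 - α.1 * (ν y).2.2) / (α.2.2 * β.1 - α.1 * β.2.2)) • ((0, β) : TJet) := by
      have hi := inv_mul_cancel₀ hne
      simp only [div_eq_mul_inv]
      generalize (α.2.2 * β.1 - α.1 * β.2.2)⁻¹ = i at hi ⊢
      refine Prod.ext (by simp) (Prod.ext ?_ (Prod.ext ?_ ?_)) <;>
        simp only [Prod.snd_add, Prod.fst_add, Prod.smul_fst, Prod.smul_snd, smul_eq_mul, hA2, hB2, hν2]
      · linear_combination (-(ν y).1) * hi
      · linear_combination (-(m₁ * (ν y).1 + m₃ * (ν y).2.2)) * hi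
      · linear_combination (-(ν y).2.2) * hi
    rw [e, map_add, map_smul, map_smul]
    simp only [Prod.snd_add, Prod.fst_add, Prod.smul_fst, Prod.smul_snd, smul_eq_mul, s1, s2, s5]
    ring
  · filter_upwards [tendsto_leafSet_base.eventually hst] with y h1 h2
    have : ν y = A (y.1, y.2.1) := by rw [hA]; simp only [← h2]
    rw [this]; exact h1.1
  · filter_upwards [tendsto_leafSet_base.eventually hst, tendsto_leafSet_base.eventually hkl]
      with y h1 h2 h3
    have : ν y = B (y.1, y.2.1) := by rw [hB]; simp only [← h3]
    have h2' : k (y.1, κ (y.1, y.2.1)) = (y.1, y.2.1) := h2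
    have hne := h1.2.2.2.1.ne'
    rw [this, hF]
    simp only [h2', hD]
    rw [div_mul_cancel₀ _ hne]

end NormalForm

section Realization

variable {a b : Jet → ℝ} {F : TJet → ℝ}

/-- A family of contact maps, starting from the identity, that takes the jets of solutions of
`y'' = F (0, x, y, y')` to those of solutions of `y'' = F (t, x, y, y')`. -/
theorem exists_contactFamily (hF : SmoothNear F 0) :
    ∃ g : TJet → Jet, SmoothNear g 0 ∧ (∀ᶠ z in 𝓝 (0 : Jet), g (0, z) = z) ∧
      ∀ᶠ q in 𝓝 (0 : TJet),
        (fderiv ℝ g q (0, 0, 0, 1)).2.1 = (g q).2.2 * (fderiv ℝ g q (0, 0, 0, 1)).1 ∧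
        ∃ s : ℝ, fderiv ℝ g q (0, totalField F (0, q.2)) = s • totalField F (q.1, g q) := by
  have hdF : DifferentiableAt ℝ F (0, (0 : Jet)) := hF.differentiableAt
  have hdT : DifferentiableAt ℝ (totalField F) (0, (0 : Jet)) := hF.totalField.differentiableAt
  obtain ⟨κ, hκ, hκ0, hinj, hst⟩ := exists_straightening (E := Jet) (e₀ := 0) (A := totalField F)
    (B := fun _ => (0, 0, 1)) (by simp) hF.totalField (contDiff_const.smoothNear _) (by
      have e1 : (fderiv ℝ (totalField F) (0, (0 : Jet)) (0, 0, 0, 1)).1 = 0 := by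
        rw [← fderiv_fst_apply hdT]; simp [totalField]
      have e2 : (fderiv ℝ (totalField F) (0, (0 : Jet)) (0, 0, 0, 1)).2.1 = 1 := by
        rw [← fderiv_snd_apply hdT, ← fderiv_fst_apply hdT.snd]
        have : HasFDerivAt (fun q : TJet => q.2.2.2) ((ContinuousLinearMap.snd ℝ ℝ ℝ).comp
          ((ContinuousLinearMap.snd ℝ ℝ (ℝ × ℝ)).comp (ContinuousLinearMap.snd ℝ ℝ Jet))) 0 :=
          hasFDerivAt_snd.comp _ (hasFDerivAt_snd.comp _ hasFDerivAt_snd)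
        simp only [totalField]
        rw [show ((0 : ℝ), (0 : Jet)) = 0 from rfl, this.fderiv]
        simp
      rw [Fintype.linearIndependent_iff]
      intro c hc
      simp only [Fin.sum_univ_three, Matrix.cons_val_zero, Matrix.cons_val_one, Matrix.cons_val,
        fderiv_fun_const, Pi.zero_apply, zero_apply, zero_sub] at hc
      have c1 := congrArg Prod.fst hc
      have c2 := congrArg (fun v : Jet => v.2.1) hc
      have c3 := congrArg (fun v : Jet => v.2.2) hc
      simp only [Prod.fst_add, Prod.smul_fst, Prod.fst_neg, Prod.snd_add, Prod.smul_snd, Prod.snd_neg,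
        smul_eq_mul, e1, e2, totalField, Prod.fst_zero, Prod.snd_zero] at c1 c2 c3
      have d0 : c 0 = 0 := by linarith
      have d2 : c 2 = 0 := by rw [d0] at c2; linarith
      rw [d0, d2] at c3
      have d1 : c 1 = 0 := by linarith
      intro i
      fin_cases i
      exacts [d0, d1, d2])
  have hκd : DifferentiableAt ℝ κ (0, (0 : Jet)) := hκ.differentiableAt
  have ht0 : totalMap κ (0, 0) = 0 := Prod.ext rfl hκ0
  have htinj : Function.Injective (fderiv ℝ (totalMap κ) (0, (0 : Jet))) := by
    rw [injective_iff_map_eq_zero]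
    rintro ⟨t, v⟩ hw
    rw [fderiv_totalMap hκd, Prod.mk_eq_zero] at hw
    obtain ⟨h1, h2⟩ := hw
    simp only at h1
    subst h1
    have : v = 0 := hinj (h2.trans (map_zero (fderiv ℝ κ (0, (0 : Jet)))).symm)
    rw [this]; rfl
  obtain ⟨k, hk, hk0, hkl, hkr⟩ := hκ.totalMap.exists_local_inverse_of_bijective
    (bijective_of_injective htinj)
  rw [ht0] at hk hk0 hkr
  have hn : SmoothNear (fun q : TJet => ((q.1, κ (0, q.2)) : TJet)) 0 :=
    (contDiff_fst.smoothNear _).prodMk (hκ.comp_of_eq (f := fun q : TJet => ((0 : ℝ), q.2))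
      (ContDiff.smoothNear (by fun_prop) _) rfl)
  have hn0 : ((0 : ℝ), κ (0, (0 : Jet))) = 0 := Prod.ext rfl hκ0
  set g : TJet → Jet := fun q => (k (q.1, κ (0, q.2))).2 with hg
  have gs : SmoothNear g 0 := (hk.comp_of_eq hn hn0).snd
  have g0 : ∀ᶠ z in 𝓝 (0 : Jet), g (0, z) = z := by
    filter_upwards [tendsto_snd_zero.eventually hkl] with z hz
    exact congrArg Prod.snd hz
  have hg00 : g 0 = 0 := g0.self_of_nhds
  have hGt : Tendsto (totalMap g) (𝓝 0) (𝓝 0) := by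
    have := gs.totalMap.continuousAt.tendsto
    rwa [show totalMap g 0 = 0 from Prod.ext rfl hg00] at this
  have hkg : ∀ᶠ q in 𝓝 (0 : TJet), κ (q.1, g q) = κ (0, q.2) := by
    have hnt : Tendsto (fun q : TJet => ((q.1, κ (0, q.2)) : TJet)) (𝓝 0) (𝓝 0) := by
      have := hn.continuousAt.tendsto
      rwa [show (((0 : TJet).1, κ (0, (0 : TJet).2)) : TJet) = 0 from hn0] at this
    filter_upwards [hnt.eventually hkr] with q hq
    have e1 := congrArg Prod.fst hq
    have e2 := congrArg Prod.snd hq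
    simp only [totalMap] at e1 e2
    rw [← e2]
    exact congrArg κ (Prod.ext e1.symm rfl)
  have h0t : Tendsto (fun q : TJet => ((0 : ℝ), q.2)) (𝓝 0) (𝓝 0) :=
    (by fun_prop : Continuous fun q : TJet => ((0 : ℝ), q.2)).tendsto' _ _ rfl
  have hinj' : ∀ᶠ q in 𝓝 (0 : TJet), ∀ v, fderiv ℝ κ q (0, v) = 0 → v = 0 := by
    have hk00 : Tendsto (totalMap κ) (𝓝 0) (𝓝 0) := by
      have := hκ.totalMap.continuousAt.tendsto
      rwa [ht0] at this
    filter_upwards [hkl.eventually_nhds, hk00.eventually hk, hκ] with q h1 h2 h3 v hv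
    have hd : DifferentiableAt ℝ κ q := h3.diffAt
    have e := congrArg (fun A => A (0, v)) (Filter.EventuallyEq.fderiv_eq (𝕜 := ℝ)
      (show (fun q => k (totalMap κ q)) =ᶠ[𝓝 q] fun q => q from h1))
    rw [fderiv_comp_apply' (h2.diffAt) (differentiableAt_fst.prodMk hd),
      fderiv_totalMap hd, hv, show ((0 : ℝ), (0 : Jet)) = 0 from rfl, map_zero, fderiv_fun_id] at e
    exact (congrArg Prod.snd e).symm
  refine ⟨g, gs, g0, ?_⟩
  filter_upwards [hkg.eventually_nhds, gs, hGt.eventually hκ, h0t.eventually hκ, hGt.eventually hinj',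
    hGt.eventually hst, h0t.eventually hst] with q h1 h2 h3 h4 h5 h6 h7
  have hgd : DifferentiableAt ℝ g q := h2.diffAt
  have key : ∀ v, fderiv ℝ κ (q.1, g q) (0, fderiv ℝ g q (0, v)) = fderiv ℝ κ (0, q.2) (0, v) := by
    intro v
    have e := congrArg (fun A => A (0, v)) (Filter.EventuallyEq.fderiv_eq (𝕜 := ℝ)
      (show (fun q => κ (totalMap g q)) =ᶠ[𝓝 q] fun q => κ (0, q.2) from h1))
    rw [fderiv_comp_apply' (h3.diffAt) (differentiableAt_fst.prodMk hgd),
      fderiv_totalMap hgd] at e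
    have e2 : fderiv ℝ (fun q : TJet => κ (0, q.2)) q (0, v) = fderiv ℝ κ (0, q.2) (0, v) := by
      have hh : HasFDerivAt (fun q : TJet => ((0 : ℝ), q.2))
          ((ContinuousLinearMap.inr ℝ ℝ Jet).comp (ContinuousLinearMap.snd ℝ ℝ Jet)) q :=
        (hasFDerivAt_prodMk_right (0 : ℝ) q.2).comp q hasFDerivAt_snd
      rw [fderiv_comp_apply' (g := κ) (f := fun q : TJet => ((0 : ℝ), q.2))
        (h4.diffAt) hh.differentiableAt, hh.fderiv]
      rfl
    rw [e2] at e
    exact e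
  obtain ⟨a1, a2, a3, b1, b2⟩ := h6
  obtain ⟨a1', a2', a3', b1', b2'⟩ := h7
  simp only [totalMap] at a1 a2 a3 b1 b2 h5
  set A := fderiv ℝ κ (q.1, g q) (0, totalField F (q.1, g q)) with hA
  set B := fderiv ℝ κ (q.1, g q) (0, (0, 0, 1)) with hB
  set A' := fderiv ℝ κ (0, q.2) (0, totalField F (0, q.2)) with hA'
  set B' := fderiv ℝ κ (0, q.2) (0, (0, 0, 1)) with hB'
  have comb : ∀ (v : Jet) (r s : ℝ), fderiv ℝ κ (0, q.2) (0, v) = r • B + s • A →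
      fderiv ℝ g q (0, v) = r • (0, 0, 1) + s • totalField F (q.1, g q) := by
    intro v r s hv
    rw [← sub_eq_zero]
    refine h5 _ ?_
    have : ((0 : ℝ), fderiv ℝ g q (0, v) - (r • ((0, 0, 1) : Jet) + s • totalField F (q.1, g q))) =
        (0, fderiv ℝ g q (0, v)) - (r • ((0 : ℝ), ((0, 0, 1) : Jet)) +
          s • ((0 : ℝ), totalField F (q.1, g q))) := by simp
    rw [this, map_sub, map_add, map_smul, map_smul, key, hv, sub_self]
  have hκe : κ (q.1, g q) = κ (0, q.2) := h1.self_of_nhds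
  rw [hκe] at b2
  constructor
  · have e := comb (0, 0, 1) (B'.1 / B.1) ((B'.2.2 - B'.1 / B.1 * B.2.2) / A.2.2) (by
      refine Prod.ext ?_ (Prod.ext ?_ ?_) <;>
        simp only [Prod.snd_add, Prod.fst_add, Prod.smul_fst, Prod.smul_snd, smul_eq_mul, a1, a2, b2,
          mul_zero, add_zero]
      · exact (div_mul_cancel₀ _ b1.ne').symm
      · refine b2'.trans ?_
        have := div_mul_cancel₀ B'.1 b1.ne'
        linear_combination (-(κ (0, q.2)).2.2) * this
      · rw [div_mul_cancel₀ _ a3.ne']; ring)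
    rw [e]
    simp only [totalField, Prod.snd_add, Prod.fst_add, Prod.smul_fst, Prod.smul_snd, smul_eq_mul]
    ring
  · refine ⟨A'.2.2 / A.2.2, ?_⟩
    have e := comb (totalField F (0, q.2)) 0 (A'.2.2 / A.2.2) (by
      rw [zero_smul, zero_add]
      refine Prod.ext ?_ (Prod.ext ?_ ?_) <;>
        simp only [Prod.smul_fst, Prod.smul_snd, smul_eq_mul, a1, a2, mul_zero]
      · exact a1'
      · exact a2'
      · exact (div_mul_cancel₀ _ a3.ne').symm)
    rw [e, zero_smul, zero_add]

end Realization

section Realization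

variable {a b : Jet → ℝ} {F : TJet → ℝ}

/-- A smooth function that increases from `0` to `1` between `θ₁` and `θ₂`. -/
def transition (θ₁ θ₂ s : ℝ) : ℝ := Real.smoothTransition ((s - θ₁) / (θ₂ - θ₁))

theorem contDiff_transition (θ₁ θ₂ : ℝ) : ContDiff ℝ ∞ (transition θ₁ θ₂) :=
  Real.smoothTransition.contDiff.comp ((contDiff_id.sub contDiff_const).div_const _)

theorem transition_of_le {θ₁ θ₂ s : ℝ} (h : θ₁ < θ₂) (hs : s ≤ θ₁) : transition θ₁ θ₂ s = 0 :=
  Real.smoothTransition.zero_of_nonpos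
    (div_nonpos_of_nonpos_of_nonneg (by linarith) (by linarith))

theorem transition_of_ge {θ₁ θ₂ s : ℝ} (h : θ₁ < θ₂) (hs : θ₂ ≤ s) : transition θ₁ θ₂ s = 1 :=
  Real.smoothTransition.one_of_one_le ((one_le_div (by linarith)).2 (by linarith))

theorem deriv_transition_of_notMem {θ₁ θ₂ s : ℝ} (h : θ₁ < θ₂) (hs : s ∉ Icc θ₁ θ₂) :
    deriv (transition θ₁ θ₂) s = 0 := by
  rw [mem_Icc, not_and_or, not_le, not_le] at hs
  rcases hs with hs | hs
  · rw [Filter.EventuallyEq.deriv_eq (show transition θ₁ θ₂ =ᶠ[𝓝 s] fun _ => 0 from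
      (gt_mem_nhds hs).mono fun x hx => transition_of_le h (le_of_lt hx)), deriv_const]
  · rw [Filter.EventuallyEq.deriv_eq (show transition θ₁ θ₂ =ᶠ[𝓝 s] fun _ => 1 from
      (lt_mem_nhds hs).mono fun x hx => transition_of_ge h (le_of_lt hx)), deriv_const]

/-- Every deformation of an equation is defined by a deformation of plane fields with support in a
given neighbourhood of an arc of the leaf. -/
theorem exists_supported_deformation (ha : SmoothNear a 0) (hb : SmoothNear b 0) (ha0 : 0 < a 0)
    (hb0 : 0 < b 0) (hF : SmoothNear F 0) {O : Set Jet} (hO : O ∈ 𝓝 (0 : Jet)) {θ₁ θ₂ : ℝ}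
    (h1 : 0 < θ₁) (h12 : θ₁ < θ₂) (h2 : θ₂ < Real.pi / 2) :
    ∃ (K : Set Jet) (l : Cyl → Jet), IsCompact K ∧ K ⊆ O ∧ ContDiff ℝ ∞ l ∧
      (∀ y, y.1 = 0 → l y = 0) ∧ (∀ y, y.2 ∉ K ×ˢ Icc θ₁ θ₂ → l y = 0) ∧
      LeafIsotopic (fun y => plane (l y) (pairField a b (fun q => F (0, q.2)) y))
        (fun y => plane 0 (pairField a b F y)) := by
  obtain ⟨g, gs, g0, hg⟩ := exists_contactFamily hF
  set F₀ : TJet → ℝ := fun q => F (0, q.2) with hF₀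
  have Fs₀ : SmoothNear F₀ 0 := hF.comp_of_eq (f := fun q : TJet => ((0 : ℝ), q.2))
    (ContDiff.smoothNear (by fun_prop) _) rfl
  have hg00 : g 0 = 0 := g0.self_of_nhds
  have hG0 : totalMap g 0 = 0 := Prod.ext rfl hg00
  obtain ⟨Φ, hΦ, hΦ0, hΦl, hΦr⟩ := gs.totalMap.exists_local_inverse_of_bijective
    (bijective_of_injective (fderiv_totalMap_injective (x := (0 : Jet)) gs.differentiableAt g0))
  rw [hG0] at hΦ hΦ0 hΦr
  have hGt : Tendsto (totalMap g) (𝓝 0) (𝓝 0) := by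
    have := gs.totalMap.continuousAt.tendsto
    rwa [hG0] at this
  -- the velocity of the inverse family
  set X : TJet → Jet := fun q => (fderiv ℝ Φ (totalMap g q) (1, 0)).2 with hX
  have Xs : SmoothNear X 0 := by
    have h : SmoothNear (fun q => fderiv ℝ Φ q (1, 0)) 0 :=
      hΦ.fderiv_apply (contDiff_const.smoothNear _)
    exact (h.comp_of_eq gs.totalMap hG0).snd
  have hXg : ∀ᶠ q in 𝓝 (0 : TJet), fderiv ℝ g q (1, X q) = 0 := by
    filter_upwards [hGt.eventually hΦr.eventually_nhds, hGt.eventually hΦ, hΦl, gs] with q h1 h2 h3 h4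
    have hd : DifferentiableAt ℝ g q := h4.diffAt
    have e := congrArg (fun A => A (1, 0)) (Filter.EventuallyEq.fderiv_eq (𝕜 := ℝ)
      (show (fun q => totalMap g (Φ q)) =ᶠ[𝓝 (totalMap g q)] fun q => q from h1))
    rw [fderiv_comp_apply' (by rw [h3]; exact differentiableAt_fst.prodMk hd)
      (h2.diffAt), h3, fderiv_totalMap hd, fderiv_fun_id] at e
    have e1 := congrArg Prod.fst e
    have e2 := congrArg Prod.snd e
    simp only [ContinuousLinearMap.coe_id', id_eq] at e1 e2
    rw [← e2]
    congr 1
    exact Prod.ext e1.symm rfl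
  obtain ⟨c, hc, hc1, hcP⟩ := exists_cutoff_near_compact (K := {(0 : TJet)}) isCompact_singleton
    (P := fun q => ContDiffAt ℝ ∞ X q ∧ q.2 ∈ O ∧ q ∈ Metric.closedBall (0 : TJet) 1) (by
      rw [nhdsSet_singleton]
      exact Eventually.and Xs (((continuous_snd.tendsto (0 : TJet)).eventually hO).and
        (Metric.closedBall_mem_nhds _ one_pos)))
  rw [nhdsSet_singleton] at hc1
  have hcX : ContDiff ℝ ∞ (fun q => c q • X q) := contDiff_cutoff_smul hc fun q hq => (hcP q hq).1
  have hcK : IsCompact (tsupport c) :=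
    (isCompact_closedBall (0 : TJet) 1).of_isClosed_subset (isClosed_tsupport c)
      fun q hq => (hcP q hq).2.2
  set ρ := transition θ₁ θ₂ with hρ
  have ρs : ContDiff ℝ ∞ ρ := contDiff_transition θ₁ θ₂
  have ρs' : ContDiff ℝ ∞ (deriv ρ) := ((contDiff_infty_iff_deriv).1 ρs).2
  set σ : Cyl → TJet := fun y => (y.1 * ρ y.2.2, y.2.1) with hσ
  have hσs : ContDiff ℝ ∞ σ := by
    have : ContDiff ℝ ∞ (fun y : Cyl => ρ y.2.2) := ρs.comp (by fun_prop)
    exact (contDiff_fst.mul this).prodMk (by fun_prop)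
  have hσ0 : ∀ y ∈ leafSet, σ y = 0 := fun y hy => by
    have := mem_leafSet.1 hy
    simp only [hσ, this.1, this.2.1, zero_mul]; rfl
  have hσt : Tendsto σ 𝓛 (𝓝 0) := by
    intro s hs
    rw [mem_map]
    refine (eventually_leafSet (P := fun y => σ y ∈ s)).2 fun y hy => ?_
    have := hσs.continuous.continuousAt (x := y) |>.tendsto
    rw [hσ0 y hy] at this
    exact this hs
  set l : Cyl → Jet := fun y => (y.1 * deriv ρ y.2.2) • (c (σ y) • X (σ y)) with hl
  have ls : ContDiff ℝ ∞ l := by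
    have : ContDiff ℝ ∞ (fun y : Cyl => deriv ρ y.2.2) := ρs'.comp (by fun_prop)
    exact (contDiff_fst.mul this).smul (hcX.comp hσs)
  set γ : Cyl → Jet := fun y => g (σ y) with hγ
  have γs : ∀ᶠ y in 𝓛, ContDiffAt ℝ ∞ γ y := by
    filter_upwards [hσt.eventually gs] with y hy
    exact hy.comp y hσs.contDiffAt
  have hzt := tendsto_leafSet_point
  have hσd : ∀ y v : Cyl, fderiv ℝ σ y v = (v.1 * ρ y.2.2 + y.1 * (deriv ρ y.2.2 * v.2.2), v.2.1) := by
    intro y v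
    have e1 : HasFDerivAt (fun y : Cyl => y.2.2) ((ContinuousLinearMap.snd ℝ Jet ℝ).comp
        (ContinuousLinearMap.snd ℝ ℝ (Jet × ℝ))) y := hasFDerivAt_snd.comp y hasFDerivAt_snd
    have e2 : HasFDerivAt (fun y : Cyl => y.2.1) ((ContinuousLinearMap.fst ℝ Jet ℝ).comp
        (ContinuousLinearMap.snd ℝ ℝ (Jet × ℝ))) y := hasFDerivAt_fst.comp y hasFDerivAt_snd
    have e3 := ((ρs.differentiable (by simp) y.2.2).hasDerivAt.comp_hasFDerivAt y e1)
    have e4 := (hasFDerivAt_fst (𝕜 := ℝ) (p := y)).mul e3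
    have e5 : HasFDerivAt σ _ y := e4.prodMk e2
    rw [e5.fderiv]
    refine Prod.ext ?_ rfl
    simp
    ring
  obtain ⟨ν, j, hν, hν0, hνγ, hjt, hjr, hiso⟩ := exists_leafIsotopic_of_firstIntegrals
    (l := l) (w := pairField a b F₀) γs
    (by
      filter_upwards [hzt.eventually g0] with y h1 h2
      simp only [hγ, hσ, h2, zero_mul, h1])
    (by
      filter_upwards [hσt.eventually gs, hσt.eventually hXg, hσt.eventually hc1] with y h1 h2 h3
      have : fderiv ℝ γ y (0, l y, 1) = fderiv ℝ g (σ y) (fderiv ℝ σ y (0, l y, 1)) :=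
        fderiv_comp_apply' (h1.diffAt) (hσs.differentiable (by simp) y) _
      rw [this, hσd]
      have e : (((0 : ℝ) * ρ y.2.2 + y.1 * (deriv ρ y.2.2 * 1), l y) : TJet) =
          (y.1 * deriv ρ y.2.2) • ((1, X (σ y)) : TJet) := by
        simp [hl, h3]
      simp only [e, map_smul, h2, smul_zero])
    (eventually_leafSet.2 fun y hy => SmoothNear.pairField ha hb Fs₀ hy)
  refine ⟨Prod.snd '' tsupport c, l, hcK.image continuous_snd, ?_, ls, ?_, ?_, hiso.trans ?_⟩
  · rintro _ ⟨q, hq, rfl⟩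
    exact (hcP q hq).2.1
  · intro y hy
    simp only [hl, hy, zero_mul, zero_smul]
  · intro y hy
    rw [mem_prod, not_and_or] at hy
    rcases hy with hy | hy
    · have : c (σ y) = 0 := image_eq_zero_of_notMem_tsupport fun h => hy ⟨_, h, rfl⟩
      simp only [hl, this, zero_smul, smul_zero]
    · simp only [hl, hρ, deriv_transition_of_notMem h12 hy, mul_zero, zero_smul]
  -- the straightened planes
  have hνj : ∀ᶠ y in 𝓛, (y.1, y.2.1) = ((j y).1, γ (j y)) ∧ y.2.2 = (j y).2.2 ∧
      ν y = fderiv ℝ g (σ (j y)) (0, pairField a b F₀ (j y)) ∧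
      (fderiv ℝ g (σ (j y)) (0, 0, 0, 1)).2.1 =
        (g (σ (j y))).2.2 * (fderiv ℝ g (σ (j y)) (0, 0, 0, 1)).1 ∧
        ∃ s : ℝ, fderiv ℝ g (σ (j y)) (0, totalField F (0, (j y).2.1)) =
          s • totalField F ((σ (j y)).1, g (σ (j y))) := by
    filter_upwards [hjr, hjt.eventually hνγ, hjt.eventually (hσt.eventually hg),
      hjt.eventually (hσt.eventually gs)] with y h1 h2 h3 h4
    have e : y = ((j y).1, γ (j y), (j y).2.2) := h1.symm
    refine ⟨congrArg (fun y => (y.1, y.2.1)) e, congrArg (fun y => y.2.2) e, ?_, h3.1, h3.2⟩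
    have : fderiv ℝ γ (j y) (0, pairField a b F₀ (j y), 0) =
        fderiv ℝ g (σ (j y)) (fderiv ℝ σ (j y) (0, pairField a b F₀ (j y), 0)) :=
      fderiv_comp_apply' (h4.diffAt) (hσs.differentiable (by simp) _) _
    rw [hσd] at this
    conv_lhs => rw [e]
    rw [h2, this]
    simp
  have hsplit : ∀ y : Cyl, ((0 : ℝ), pairField a b F₀ y) =
      (Real.cos y.2.2 * a y.2.1) • ((0, 0, 0, 1) : TJet) +
      (Real.sin y.2.2 * b y.2.1) • ((0, totalField F (0, y.2.1)) : TJet) := fun y => by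
    simp [pairField, totalField, hF₀]
  refine leafIsotopic_lift ha hb ha0 hb0 hF (κ := Prod.snd) (contDiff_snd.smoothNear _) (by simp) hν
    ?_ ?_ ?_ ?_
  · filter_upwards [hν0] with y h1 h2
    rw [h1 h2]
    simp only [pairField, totalField, hF₀, h2]
  · filter_upwards [hνj] with y ⟨e1, e2, e3, e4, s, e5⟩ _
    have e6 : y.2.1 = g (σ (j y)) := congrArg Prod.snd e1
    rw [fderiv_snd, e3, hsplit, map_add, map_smul, map_smul, e5, e6]
    simp only [totalField, Prod.snd_add, Prod.fst_add, Prod.smul_fst, Prod.smul_snd, smul_eq_mul, e4,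
      ContinuousLinearMap.coe_snd']
    ring
  · filter_upwards [hνj, hjt.eventually (hzt.eventually g0.eventually_nhds),
      hjt.eventually (hσt.eventually gs)] with y ⟨e1, e2, e3, _⟩ h3 h4 h5
    have hσ1 : σ (j y) = (0, (j y).2.1) := by
      simp only [hσ, hρ, ← e2, h5, transition_of_le h12 h1.le, mul_zero]
    rw [hσ1] at h4 e3
    rw [fderiv_snd, e3, fderiv_of_slice_id h3 (h4.diffAt)]
    simp [pairField, ← e2, h5]
  · filter_upwards [hνj] with y ⟨e1, e2, e3, e4, s, e5⟩ h3
    have hσ1 : (σ (j y)).1 = y.1 := by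
      simp only [hσ, hρ, ← e2, h3, transition_of_ge h12 h2.le, mul_one]
      exact (congrArg Prod.fst e1).symm
    have e6 : y.2.1 = g (σ (j y)) := congrArg Prod.snd e1
    rw [fderiv_snd, e3, hsplit, map_add, map_smul, map_smul, e5, ← e2, h3, hσ1, ← e6]
    simp [totalField]
    ring

end Realization

section Straightening

variable {a b f : Jet → ℝ} {F : TJet → ℝ} {D : Cyl → Submodule ℝ (Jet × ℝ)}

theorem leafIsotopic_of_straightening (ha : SmoothNear a 0) (hb : SmoothNear b 0) (ha0 : 0 < a 0)
    (hb0 : 0 < b 0) (hf : SmoothNear f 0) (hF : SmoothNear F 0)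
    (hF0 : ∀ᶠ z in 𝓝 (0 : Jet), F (0, z) = f z) {Ψ : Cyl → Jet × ℝ}
    (hΨ : ∀ᶠ y in 𝓛, ContDiffAt ℝ ∞ Ψ y)
    (hΨ0 : ∀ᶠ y in 𝓛, y.1 = 0 → Ψ y = y.2)
    (hmap : ∀ᶠ y in 𝓛, y.2.2 ∈ Quadrant → (D y).map (sliceDeriv Ψ y) =
      plane 0 (pairField a b (fun q => f q.2) (y.1, Ψ y)))
    {κ : TJet → Jet} (hκ : SmoothNear κ 0) (hid : ∀ᶠ z in 𝓝 (0 : Jet), κ (0, z) = z)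
    (hbot : ∀ᶠ y in 𝓛, y.2.2 = 0 → ∃ s : ℝ,
      fderiv ℝ κ (y.1, (Ψ y).1) (0, pairField a b (fun q => f q.2) (y.1, Ψ y)) =
        s • ((0, 0, 1) : Jet))
    (htop : ∀ᶠ y in 𝓛, y.2.2 = Real.pi / 2 → ∃ s : ℝ,
      fderiv ℝ κ (y.1, (Ψ y).1) (0, pairField a b (fun q => f q.2) (y.1, Ψ y)) =
        s • totalField F (y.1, κ (y.1, (Ψ y).1))) :
    LeafIsotopic D (fun y => plane 0 (pairField a b F y)) := by
  have hψ : IsLeafMap (fun y => ((Ψ y).1, y.2.2)) :=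
    ⟨hΨ.mono fun y hy => hy.fst.prodMk (by fun_prop),
      hΨ0.mono fun y hy h => by rw [hy h], by simp, by simp⟩
  obtain ⟨g, hg, hgl, hgr, hgt⟩ := hψ.exists_inverse
  have hW := fun y hy => SmoothNear.pairField ha hb
    (hf.comp_of_eq (f := fun q : TJet => q.2) (contDiff_snd.smoothNear 0) rfl) (y := y) hy
  set W := pairField a b (fun q => f q.2) with hWdef
  set G : Cyl → Cyl := fun y => (y.1, Ψ (g y)) with hG
  have hΨg : SmoothLeaf G := fun y hy => by
    have h1 : SmoothNear g y := eventually_leafSet.1 hg y hy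
    have h2 : SmoothNear (fun y => Ψ (g y)) y := by
      filter_upwards [eventually_leafSet.1 (hgt.eventually hΨ) y hy, h1] with y' h2 h3
      exact h2.comp y' h3
    exact (contDiff_fst.smoothNear y).prodMk h2
  have hslice : ∀ᶠ y in 𝓛, y.1 = 0 → G y = y := by
    filter_upwards [hgl, hΨ0] with y h1 h2 h3
    have e : totalMap (fun y => ((Ψ y).1, y.2.2)) y = y := by simp only [totalMap, h2 h3]
    rw [e] at h1
    exact Prod.ext rfl (by simp only [hG, h1, h2 h3])
  have hG0 : ∀ y ∈ leafSet, G y = y := fun y hy =>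
    (eventually_leafSet.1 hslice y hy).self_of_nhds (mem_leafSet.1 hy).1
  have hgr' : ∀ᶠ y in 𝓛, (g y).1 = y.1 ∧ (Ψ (g y)).1 = y.2.1 ∧ (g y).2.2 = y.2.2 :=
    hgr.mono fun y hy => ⟨(congrArg Prod.fst hy :), (congrArg (fun y => y.2.1) hy :),
      (congrArg (fun y => y.2.2) hy :)⟩
  have hbot' : ∀ᶠ y in 𝓛, y.2.2 = 0 →
      ∃ s : ℝ, fderiv ℝ κ (y.1, y.2.1) (0, W (G y)) = s • ((0, 0, 1) : Jet) := by
    filter_upwards [hgt.eventually hbot, hgr'] with y h1 h2 h3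
    have := h1 (h2.2.2.trans h3)
    rwa [h2.1, h2.2.1] at this
  have htop' : ∀ᶠ y in 𝓛, y.2.2 = Real.pi / 2 → ∃ s : ℝ,
      fderiv ℝ κ (y.1, y.2.1) (0, W (G y)) = s • totalField F (y.1, κ (y.1, y.2.1)) := by
    filter_upwards [hgt.eventually htop, hgr'] with y h1 h2 h3
    have := h1 (h2.2.2.trans h3)
    rwa [h2.1, h2.2.1] at this
  have hiso : LeafIsotopic D (fun y => plane 0 (W (G y))) := by
    refine ⟨_, hψ, ?_⟩
    filter_upwards [hmap, hψ.injective_sliceDeriv, hΨ, hgl] with y h1 h2 h3 h4 h5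
    have hd : DifferentiableAt ℝ Ψ y := h3.diffAt
    have e : ∀ v, sliceDeriv (fun y => ((Ψ y).1, y.2.2)) y v = ((sliceDeriv Ψ y v).1, v.2) := by
      intro v
      have h : HasFDerivAt (fun y => ((Ψ y).1, y.2.2)) (((ContinuousLinearMap.fst ℝ Jet ℝ).comp
          (fderiv ℝ Ψ y)).prod ((ContinuousLinearMap.snd ℝ Jet ℝ).comp
          (ContinuousLinearMap.snd ℝ ℝ (Jet × ℝ)))) y :=
        hd.hasFDerivAt.fst.prodMk (hasFDerivAt_snd.comp y hasFDerivAt_snd)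
      rw [sliceDeriv_apply, h.fderiv]; rfl
    have e2 : G (y.1, (Ψ y).1, y.2.2) = (y.1, Ψ y) := by
      have : g (y.1, (Ψ y).1, y.2.2) = y := h4
      simp only [hG, this]
    have hm := h1 h5
    have hsub : ∀ v ∈ D y, ∃ c : ℝ, (sliceDeriv Ψ y v).1 = c • W (y.1, Ψ y) := fun v hv => by
      have := (hm ▸ Submodule.mem_map_of_mem hv : sliceDeriv Ψ y v ∈ plane 0 (W (y.1, Ψ y)))
      simpa [mem_plane] using this
    change _ = plane 0 (W (G (y.1, (Ψ y).1, y.2.2)))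
    rw [e2]
    refine le_antisymm ?_ ?_
    · rintro _ ⟨v, hv, rfl⟩
      obtain ⟨c, hc⟩ := hsub v hv
      exact mem_plane.2 ⟨c, by rw [e, hc]; simp⟩
    · obtain ⟨v₁, hv₁, e₁⟩ := (hm ▸ mem_plane.2 ⟨1, by simp⟩ :
        ((W (y.1, Ψ y), 0) : Jet × ℝ) ∈ (D y).map (sliceDeriv Ψ y))
      obtain ⟨v₂, hv₂, e₂⟩ := (hm ▸ mem_plane.2 ⟨0, by simp⟩ :
        ((0, 1) : Jet × ℝ) ∈ (D y).map (sliceDeriv Ψ y))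
      have hne : v₂.2 ≠ 0 := by
        intro h
        have h6 : sliceDeriv (fun y => ((Ψ y).1, y.2.2)) y v₂ = 0 := by
          rw [e, e₂, h]; rfl
        have := h2 (h6.trans (map_zero _).symm)
        rw [this, map_zero] at e₂
        simpa using congrArg Prod.snd e₂
      intro w hw
      obtain ⟨c, hc⟩ := mem_plane.1 hw
      rw [smul_zero, zero_add] at hc
      refine ⟨c • v₁ + ((w.2 - c * v₁.2) / v₂.2) • v₂,
        add_mem (Submodule.smul_mem _ _ hv₁) (Submodule.smul_mem _ _ hv₂), ?_⟩
      rw [e, map_add, map_smul, map_smul, e₁, e₂]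
      refine Prod.ext ?_ ?_
      · simp [hc]
      · simp only [Prod.snd_add, Prod.smul_snd, smul_eq_mul]
        field_simp
        ring
  refine hiso.trans (leafIsotopic_lift ha hb ha0 hb0 hF hκ hid (ν := fun y => W (G y)) ?_ ?_ ?_ ?_ ?_)
  · exact eventually_leafSet.2 fun y hy => (hW y hy).comp_of_eq (hΨg y hy) (hG0 y hy)
  · have hz := tendsto_leafSet_point
    filter_upwards [hslice, hz.eventually hF0] with y h1 h2 h3
    rw [h1 h3]
    simp only [hWdef, pairField, totalField]
    rw [h3, h2]
  · have hT : ∀ c ∈ Quadrant, Tendsto (fun y : Cyl => (y.1, y.2.1, c))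
        𝓛 𝓛 := fun c hc => tendsto_leafSet
      (fun y _ => by fun_prop) fun y hy => mem_leafSet.2 ⟨(mem_leafSet.1 hy).1, (mem_leafSet.1 hy).2.1, hc⟩
    have hT0 := hT 0 ⟨le_rfl, by positivity⟩
    have hT1 := hT (Real.pi / 2) ⟨by positivity, le_rfl⟩
    have hsin : ∀ᶠ y in 𝓛,
        0 < Real.sin ((G (y.1, y.2.1, Real.pi / 2)).2.2 - (G (y.1, y.2.1, 0)).2.2) := by
      refine eventually_leafSet.2 fun y hy => ?_
      have hm : ∀ c ∈ Quadrant, (y.1, y.2.1, c) ∈ leafSet := fun c hc =>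
        mem_leafSet.2 ⟨(mem_leafSet.1 hy).1, (mem_leafSet.1 hy).2.1, hc⟩
      have hm0 := hm 0 ⟨le_rfl, by positivity⟩
      have hm1 := hm (Real.pi / 2) ⟨by positivity, le_rfl⟩
      have hc : ∀ c, (y.1, y.2.1, c) ∈ leafSet →
          ContinuousAt (fun y : Cyl => (G (y.1, y.2.1, c)).2.2) y := fun c hc =>
        ContinuousAt.comp_of_eq (f := fun y : Cyl => (y.1, y.2.1, c))
          (hΨg _ hc).continuousAt.snd.snd (by fun_prop) rfl
      refine (Real.continuous_sin.continuousAt.comp ((hc _ hm1).sub (hc _ hm0))).eventually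
        (lt_mem_nhds ?_)
      simp only [Function.comp_apply, Pi.sub_apply]
      rw [hG0 _ hm1, hG0 _ hm0]
      simp
    filter_upwards [hT0.eventually (hbot'.and hgr'), hT1.eventually (htop'.and hgr'), hgr', hsin] with
      y h1 h2 h3 h4 _
    obtain ⟨⟨s₀, e₀⟩, -, k₀, -⟩ := And.imp_left (fun h => h rfl) h1
    obtain ⟨⟨s₁, e₁⟩, -, k₁, -⟩ := And.imp_left (fun h => h rfl) h2
    obtain ⟨-, k, -⟩ := h3
    have hform : ∀ y' : Cyl, y'.1 = y.1 → (Ψ (g y')).1 = y.2.1 → W (G y') =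
        Real.cos (G y').2.2 • (a y.2.1 • ((0, 0, 1) : Jet)) +
          Real.sin (G y').2.2 • (b y.2.1 • totalField (fun q => f q.2) (y.1, y.2.1)) := by
      intro y' h5 h6
      simp only [hWdef, pairField, hG, h5, h6, mul_smul]
    rw [hform (y.1, y.2.1, 0) rfl k₀] at e₀
    rw [hform (y.1, y.2.1, Real.pi / 2) rfl k₁] at e₁
    rw [hform y rfl k]
    rw [Real.sin_sub] at h4
    set A := a y.2.1 • ((0, 0, 1) : Jet)
    set B := b y.2.1 • totalField (fun q => f q.2) (y.1, y.2.1)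
    have hlin : ∀ c s : ℝ, fderiv ℝ κ (y.1, y.2.1) (0, c • A + s • B) =
        c • fderiv ℝ κ (y.1, y.2.1) (0, A) + s • fderiv ℝ κ (y.1, y.2.1) (0, B) := fun c s => by
      rw [← map_smul, ← map_smul, ← map_add]
      simp
    simp only [hlin] at e₀ e₁ ⊢
    generalize fderiv ℝ κ (y.1, y.2.1) (0, A) = A' at e₀ e₁ ⊢
    generalize fderiv ℝ κ (y.1, y.2.1) (0, B) = B' at e₀ e₁ ⊢
    set p := (κ (y.1, y.2.1)).2.2
    have f₀ : Real.cos (G (y.1, y.2.1, 0)).2.2 * (A'.2.1 - p * A'.1) +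
        Real.sin (G (y.1, y.2.1, 0)).2.2 * (B'.2.1 - p * B'.1) = 0 := by
      have i1 := congrArg (fun v : Jet => v.2.1 - p * v.1) e₀
      simp only [Prod.snd_add, Prod.fst_add, Prod.smul_snd, Prod.smul_fst, smul_eq_mul] at i1
      linear_combination i1
    have f₁ : Real.cos (G (y.1, y.2.1, Real.pi / 2)).2.2 * (A'.2.1 - p * A'.1) +
        Real.sin (G (y.1, y.2.1, Real.pi / 2)).2.2 * (B'.2.1 - p * B'.1) = 0 := by
      have i1 := congrArg (fun v : Jet => v.2.1 - p * v.1) e₁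
      simp only [totalField, Prod.snd_add, Prod.fst_add, Prod.smul_snd, Prod.smul_fst, smul_eq_mul] at i1
      linear_combination i1
    have g₀ : A'.2.1 - p * A'.1 = 0 := by
      refine (mul_eq_zero.1 ?_).resolve_left h4.ne'
      linear_combination Real.sin (G (y.1, y.2.1, Real.pi / 2)).2.2 * f₀ -
        Real.sin (G (y.1, y.2.1, 0)).2.2 * f₁
    have g₁ : B'.2.1 - p * B'.1 = 0 := by
      refine (mul_eq_zero.1 ?_).resolve_left h4.ne'
      linear_combination Real.cos (G (y.1, y.2.1, 0)).2.2 * f₁ -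
        Real.cos (G (y.1, y.2.1, Real.pi / 2)).2.2 * f₀
    simp only [Prod.snd_add, Prod.fst_add, Prod.smul_snd, Prod.smul_fst, smul_eq_mul]
    linear_combination Real.cos (G y).2.2 * g₀ + Real.sin (G y).2.2 * g₁
  · filter_upwards [hbot'] with y h1 h2
    obtain ⟨s, hs⟩ := h1 h2
    simp [hs]
  · filter_upwards [htop'] with y h1 h2
    obtain ⟨s, hs⟩ := h1 h2
    rw [hs]
    simp [totalField, mul_comm]

theorem exists_straightening_of_leafIsotopic (ha : SmoothNear a 0) (hb : SmoothNear b 0)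
    (ha0 : 0 < a 0) (hb0 : 0 < b 0) (hf : SmoothNear f 0) (hF : SmoothNear F 0)
    (hF0 : ∀ᶠ z in 𝓝 (0 : Jet), F (0, z) = f z) {ψ : Cyl → Jet × ℝ}
    (hψ : IsLeafIsotopy D (fun y => plane 0 (pairField a b F y)) ψ) :
    ∃ Ψ : Cyl → Jet × ℝ, (∀ᶠ y in 𝓛, ContDiffAt ℝ ∞ Ψ y) ∧
      (∀ᶠ y in 𝓛, y.1 = 0 → Ψ y = y.2) ∧
      (∀ᶠ y in 𝓛, y.2.2 ∈ Quadrant → (D y).map (sliceDeriv Ψ y) =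
        plane 0 (pairField a b (fun q => f q.2) (y.1, Ψ y))) ∧
      ∀ᶠ y in 𝓛, y.2.2 ∈ Quadrant → (Ψ y).1 = (ψ y).1 ∧
        ∃ r : ℝ, 0 < r ∧ pairField a b F (y.1, ψ y) =
          r • pairField a b (fun q => f q.2) (y.1, Ψ y) := by
  have hfd : ∀ q v, fderiv ℝ (Prod.snd : TJet → Jet) q v = v.2 := fun q v => by
    rw [fderiv_snd]; rfl
  have hz := tendsto_leafSet_point
  obtain ⟨Λ, h1, h2, -, -, h3⟩ := exists_lift ha hb ha0 hb0 (F := fun q => f q.2)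
    (hf.comp_of_eq (f := fun q : TJet => q.2) (contDiff_snd.smoothNear 0) rfl)
    (κ := Prod.snd) (contDiff_snd.smoothNear 0) (by simp) (ν := pairField a b F)
    (eventually_leafSet.2 fun y hy => SmoothNear.pairField ha hb hF hy) (by
      filter_upwards [hz.eventually hF0] with y h2 h3
      simp only [pairField, totalField]
      rw [h3, h2]) (Eventually.of_forall fun y _ => by
        simp only [hfd]
        exact pairField_horizontal a b F y)
  have ht := hψ.toIsLeafMap.tendsto
  refine ⟨fun y => Λ (totalMap ψ y), ?_, ?_, ?_, ?_⟩
  · filter_upwards [ht.eventually h1, hψ.smooth] with y h4 h5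
    exact h4.comp y (contDiffAt_fst.prodMk h5)
  · filter_upwards [ht.eventually h2, hψ.slice_id] with y h4 h5 h6
    rw [h4 h6, totalMap, h5 h6]
  · filter_upwards [ht.eventually (h1.and h3), hψ.smooth, hψ.map, hψ.toIsLeafMap.mem_iff] with
      y ⟨h4, h5⟩ h6 h7 h8 h9
    have hd : DifferentiableAt ℝ ψ y := h6.diffAt
    have e : sliceDeriv (fun y => Λ (totalMap ψ y)) y =
        sliceDeriv Λ (totalMap ψ y) ∘ₗ sliceDeriv ψ y := LinearMap.ext fun v => by
      have := fderiv_comp_apply' (g := Λ) (f := totalMap ψ) (h4.diffAt)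
        (differentiableAt_fst.prodMk hd) (0, v)
      rw [fderiv_totalMap hd] at this
      exact this
    rw [e, Submodule.map_comp, h7 h9]
    exact (h5 (h8.1.2 h9)).2.2
  · filter_upwards [ht.eventually h3, hψ.toIsLeafMap.mem_iff] with y h4 h5 h6
    obtain ⟨k1, ⟨r, hr, k2⟩, -⟩ := h4 (h5.1.2 h6)
    rw [hfd] at k2
    exact ⟨k1, r, hr, k2⟩

end Straightening

section PlaneFrame

/-- The functional that normalizes the second vector of a frame. -/
def normalize (p q : Cyl → ℝ) (y : Cyl) (v : Jet) : ℝ := p y * v.1 + q y * v.2.2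

def IsNormalizedFrame (P : Cyl → Submodule ℝ (Jet × ℝ)) (p q : Cyl → ℝ)
    (y : Cyl) (c : Jet × Jet) : Prop :=
  normalize p q y c.1 = 0 ∧ normalize p q y c.2 = 1 ∧ P y = plane c.1 c.2

variable {P : Cyl → Submodule ℝ (Jet × ℝ)} {p q : Cyl → ℝ} {y : Cyl}

theorem normalize_add_smul (u v : Jet) (s : ℝ) :
    normalize p q y (u + s • v) = normalize p q y u + s * normalize p q y v := by
  simp only [normalize, Prod.fst_add, Prod.snd_add, Prod.smul_fst, Prod.smul_snd, smul_eq_mul]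
  ring

theorem IsNormalizedFrame.unique {c d : Jet × Jet} (hc : IsNormalizedFrame P p q y c)
    (hd : IsNormalizedFrame P p q y d) : c = d := by
  obtain ⟨c1, c2, c3⟩ := hc
  obtain ⟨d1, d2, d3⟩ := hd
  have h1 : ((d.2, 0) : Jet × ℝ) ∈ plane c.1 c.2 := c3 ▸ d3 ▸ mem_plane.2 ⟨1, by simp⟩
  have h2 : ((d.1, 1) : Jet × ℝ) ∈ plane c.1 c.2 := c3 ▸ d3 ▸ mem_plane.2 ⟨0, by simp⟩
  obtain ⟨s, hs⟩ := mem_plane.1 h1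
  obtain ⟨r, hr⟩ := mem_plane.1 h2
  simp only [zero_smul, one_smul] at hs hr
  have e1 := d2
  have e2 := d1
  rw [hs, normalize_add_smul, c2] at e1
  rw [hr, normalize_add_smul, c1, c2] at e2
  have hs1 : s = 1 := by simpa [normalize] using e1
  have hr0 : r = 0 := by simpa using e2
  refine Prod.ext ?_ ?_
  · rw [hr, hr0]; simp
  · rw [hs, hs1]; simp

theorem exists_normalizedFrame_near {X Y : Cyl → Jet × ℝ} (hX : SmoothNear X y)
    (hY : SmoothNear Y y) (hp : SmoothNear p y) (hq : SmoothNear q y) {S : Set Cyl}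
    (hyS : y ∈ S) (hP : ∀ᶠ y' in 𝓝 y, y' ∈ S → P y' = Submodule.span ℝ {X y', Y y'}) {c : Jet × Jet}
    (hc : IsNormalizedFrame P p q y c) :
    ∃ g : Cyl → Jet × Jet, SmoothNear g y ∧
      ∀ᶠ y' in 𝓝 y, y' ∈ S → IsNormalizedFrame P p q y' (g y') := by
  have hn : ∀ {Z : Cyl → Jet × ℝ}, SmoothNear Z y →
      SmoothNear (fun y => normalize p q y (Z y).1) y := fun hZ =>
    (hp.mul hZ.fst.fst).add (hq.mul hZ.fst.snd.snd)
  set Δ : Cyl → ℝ := fun y => (X y).2 * normalize p q y (Y y).1 -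
    (Y y).2 * normalize p q y (X y).1 with hΔ
  have Δs : SmoothNear Δ y := (hX.snd.mul (hn hY)).sub (hY.snd.mul (hn hX))
  have Δ0 : Δ y ≠ 0 := by
    have hPy := hP.self_of_nhds hyS
    obtain ⟨c1, c2, c3⟩ := hc
    have h1 : ((c.1, 1) : Jet × ℝ) ∈ Submodule.span ℝ {X y, Y y} :=
      hPy ▸ c3 ▸ mem_plane.2 ⟨0, by simp⟩
    have h2 : ((c.2, 0) : Jet × ℝ) ∈ Submodule.span ℝ {X y, Y y} :=
      hPy ▸ c3 ▸ mem_plane.2 ⟨1, by simp⟩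
    obtain ⟨s, r, e1⟩ := Submodule.mem_span_pair.1 h1
    obtain ⟨s', r', e2⟩ := Submodule.mem_span_pair.1 h2
    have k1 := congrArg Prod.snd e1
    have k2 := congrArg Prod.snd e2
    have k3 : s * normalize p q y (X y).1 + r * normalize p q y (Y y).1 = 0 := by
      rw [← c1, ← show (s • X y + r • Y y).1 = c.1 from congrArg Prod.fst e1]
      simp only [normalize, Prod.fst_add, Prod.smul_fst, Prod.snd_add, Prod.smul_snd, smul_eq_mul]
      ring
    have k4 : s' * normalize p q y (X y).1 + r' * normalize p q y (Y y).1 = 1 := by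
      rw [← c2, ← show (s' • X y + r' • Y y).1 = c.2 from congrArg Prod.fst e2]
      simp only [normalize, Prod.fst_add, Prod.smul_fst, Prod.snd_add, Prod.smul_snd, smul_eq_mul]
      ring
    simp only [Prod.snd_add, Prod.smul_snd, smul_eq_mul] at k1 k2
    intro h
    have : Δ y * (s * r' - r * s') = 1 := by
      simp only [hΔ]
      linear_combination (s' * normalize p q y (X y).1 + r' * normalize p q y (Y y).1) * k1 + k4 -
        (s' * (X y).2 + r' * (Y y).2) * k3
    rw [h, zero_mul] at this
    exact zero_ne_one this
  refine ⟨fun y => ((Δ y)⁻¹ • (normalize p q y (Y y).1 • (X y).1 - normalize p q y (X y).1 • (Y y).1),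
    (Δ y)⁻¹ • ((X y).2 • (Y y).1 - (Y y).2 • (X y).1)), ?_, ?_⟩
  · have hi : SmoothNear (fun y => (Δ y)⁻¹) y := by
      simpa using (contDiff_const (c := (1 : ℝ)).smoothNear y).div Δs Δ0
    exact (hi.smul (((hn hY).smul hX.fst).sub ((hn hX).smul hY.fst))).prodMk
      (hi.smul ((hX.snd.smul hY.fst).sub (hY.snd.smul hX.fst)))
  · filter_upwards [hP, Δs.continuousAt.eventually_ne Δ0] with y' h1 h2 h3
    have h4 : Δ y' * (Δ y')⁻¹ = 1 := mul_inv_cancel₀ h2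
    have hΔ' : Δ y' = (X y').2 * normalize p q y' (Y y').1 - (Y y').2 * normalize p q y' (X y').1 := rfl
    generalize Δ y' = δ at h4 hΔ' h2 ⊢
    refine ⟨?_, ?_, ?_⟩
    · simp only [normalize, Prod.smul_fst, Prod.smul_snd, Prod.fst_sub, Prod.snd_sub, smul_eq_mul]
      ring
    · rw [← h4, hΔ']
      simp only [normalize, Prod.smul_fst, Prod.smul_snd, Prod.fst_sub, Prod.snd_sub, smul_eq_mul]
      ring
    · rw [h1 h3]
      have hx : ∀ (Z : Jet × ℝ) (s r : ℝ), Z.1 = (δ⁻¹ * s) • (X y').1 + (δ⁻¹ * r) • (Y y').1 →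
          Z.2 * δ = s * (X y').2 + r * (Y y').2 → Z ∈ Submodule.span ℝ {X y', Y y'} := by
        intro Z s r e1 e2
        refine Submodule.mem_span_pair.2 ⟨δ⁻¹ * s, δ⁻¹ * r, Prod.ext e1.symm ?_⟩
        simp only [Prod.snd_add, Prod.smul_snd, smul_eq_mul]
        linear_combination -δ⁻¹ * e2 + Z.2 * h4
      have hδ : ∀ v : Jet, v = (δ⁻¹ * ((X y').2 * normalize p q y' (Y y').1 -
          (Y y').2 * normalize p q y' (X y').1)) • v := fun v => by
        rw [← hΔ', inv_mul_cancel₀ h2, one_smul]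
      refine le_antisymm (Submodule.span_le.2 ?_) (Submodule.span_le.2 ?_)
      · rintro Z (rfl | rfl)
        · refine mem_plane.2 ⟨normalize p q y' (X y').1, ?_⟩
          exact (hδ _).trans (by module)
        · refine mem_plane.2 ⟨normalize p q y' (Y y').1, ?_⟩
          exact (hδ _).trans (by module)
      · rintro Z (rfl | rfl)
        · refine hx _ (normalize p q y' (Y y').1) (-normalize p q y' (X y').1) ?_ ?_
          · module
          · rw [hΔ']; simp only; ring
        · refine hx _ (-(Y y').2) (X y').2 ?_ ?_
          · module
          · simp only; ring

end PlaneFrame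

section Extraction

variable {P : Cyl → Submodule ℝ (Jet × ℝ)} {p q : Cyl → ℝ}

theorem exists_smooth_frame {W : Cyl → Jet} (hp : SmoothLeaf p)
    (hq : SmoothLeaf q) (hWs : SmoothLeaf W)
    (hW : ∀ᶠ y in 𝓛, normalize p q y (W y) = 1)
    (hP0 : ∀ᶠ y in 𝓛, y.2.2 ∈ Quadrant → y.1 = 0 → P y = plane 0 (W y))
    (hloc : ∀ y ∈ leafSet, ∃ X Y : Cyl → Jet × ℝ, SmoothNear X y ∧ SmoothNear Y y ∧
      ∀ᶠ y' in 𝓝 y, y'.2.2 ∈ Quadrant → P y' = Submodule.span ℝ {X y', Y y'}) :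
    ∃ l w : Cyl → Jet, SmoothLeaf l ∧ SmoothLeaf w ∧
      (∀ᶠ y in 𝓛, y.1 = 0 → l y = 0) ∧ (∀ᶠ y in 𝓛, y.1 = 0 → w y = W y) ∧
      ∀ᶠ y in 𝓛, y.2.2 ∈ Quadrant → P y = plane (l y) (w y) := by
  set G : Set Cyl := {x | ∃ g : Cyl → Jet × Jet, SmoothNear g x ∧
    ∀ᶠ y in 𝓝 x, y.2.2 ∈ Quadrant → IsNormalizedFrame P p q y (g y)} with hG
  have hframe0 : ∀ᶠ y in 𝓛, y.2.2 ∈ Quadrant → y.1 = 0 →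
      IsNormalizedFrame P p q y (0, W y) :=
    (hW.and hP0).mono fun y h h1 h2 => ⟨by simp [normalize], h.1, h.2 h1 h2⟩
  have hleaf : leafSet ⊆ interior G := fun y hy => by
    obtain ⟨X, Y, hX, hY, hXY⟩ := hloc y hy
    obtain ⟨g, hg, hg'⟩ := exists_normalizedFrame_near hX hY (hp y hy) (hq y hy)
      (S := {y | y.2.2 ∈ Quadrant}) (mem_leafSet.1 hy).2.2 hXY
      ((eventually_leafSet.1 hframe0 y hy).self_of_nhds (mem_leafSet.1 hy).2.2 (mem_leafSet.1 hy).1)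
    exact mem_interior_iff_mem_nhds.2
      ((hg.eventually_nhds.and hg'.eventually_nhds).mono fun x hx => ⟨g, hx.1, hx.2⟩)
  obtain ⟨C, hC, hC1, hC2⟩ := exists_compact_between isCompact_leafSet isOpen_interior hleaf
  obtain ⟨g, hg⟩ := exists_contMDiffMap_forall_mem_convex_of_local 𝓘(ℝ, Cyl) (n := ⊤)
    (t := fun x => {c : Jet × Jet | x ∈ C → x.2.2 ∈ Quadrant → IsNormalizedFrame P p q x c})
    (fun x c hc d hd s r _ _ hsr h1 h2 => by
      rw [(hc h1 h2).unique (hd h1 h2), ← add_smul, hsr, one_smul]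
      exact hd h1 h2)
    (fun x => by
      by_cases hx : x ∈ C
      · obtain ⟨g, hg, hg'⟩ := interior_subset (hC2 hx)
        exact ⟨_, hg.and hg', g, fun y hy => hy.1.contMDiffAt.contMDiffWithinAt, fun y hy _ h => hy.2 h⟩
      · exact ⟨Cᶜ, hC.isClosed.isOpen_compl.mem_nhds hx, 0, contMDiffOn_const,
          fun y hy h => absurd h hy⟩)
  have gs : ContDiff ℝ ∞ g := g.contMDiff.contDiff
  have hgC : ∀ᶠ y in 𝓛, y.2.2 ∈ Quadrant → IsNormalizedFrame P p q y (g y) :=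
    Filter.mem_of_superset (isOpen_interior.mem_nhdsSet.2 hC1) fun y hy => hg y (interior_subset hy)
  have h0 : Tendsto (fun y : Cyl => ((0 : ℝ), y.2)) 𝓛 𝓛 :=
    tendsto_leafSet (fun y _ => by fun_prop) fun y hy =>
      mem_leafSet.2 ⟨rfl, (mem_leafSet.1 hy).2.1, (mem_leafSet.1 hy).2.2⟩
  have gs0 : ContDiff ℝ ∞ (fun y : Cyl => g (0, y.2)) :=
    gs.comp (contDiff_const.prodMk contDiff_snd)
  have e : ∀ y : Cyl, y.1 = 0 → ((0 : ℝ), y.2) = y := fun y hy => Prod.ext hy.symm rfl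
  refine ⟨fun y => (g y).1 - (g (0, y.2)).1, fun y => (g y).2 - (g (0, y.2)).2 + W (0, y.2),
    fun y _ => ((gs.smoothNear y).fst).sub (gs0.smoothNear y).fst,
    fun y hy => (((gs.smoothNear y).snd).sub (gs0.smoothNear y).snd).add
      ((hWs y hy).comp_of_eq ((contDiff_const (c := (0 : ℝ))).prodMk contDiff_snd |>.smoothNear y)
        (e y (mem_leafSet.1 hy).1)),
    Eventually.of_forall fun y hy => by simp only [e y hy, sub_self],
    Eventually.of_forall fun y hy => by simp only [e y hy, sub_self, zero_add], ?_⟩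
  filter_upwards [hgC, h0.eventually hgC, h0.eventually hframe0] with y h1 h2 h3 hy
  have h4 := (h2 hy).unique (h3 hy rfl)
  simp only [h4, sub_zero, sub_add_cancel]
  exact (h1 hy).2.2

end Extraction

section LocalChart

open VectorField

variable {H E' : Type*} [NormedAddCommGroup E'] [NormedSpace ℝ E'] [TopologicalSpace H]
  {I : ModelWithCorners ℝ E' H} {N : Type*} [TopologicalSpace N] [ChartedSpace H N]
  {F : Type*} [NormedAddCommGroup F] [NormedSpace ℝ F]

variable (I) in
/-- `P` is a system of local coordinates near `x`, with inverse `Q`. -/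
structure IsLocalChart (P : N → F) (Q : F → N) (x : N) : Prop where
  smooth : ∀ᶠ x' in 𝓝 x, ContMDiffAt I 𝓘(ℝ, F) ∞ P x'
  smooth_inv : ∀ᶠ z in 𝓝 (P x), ContMDiffAt 𝓘(ℝ, F) I ∞ Q z
  left : ∀ᶠ x' in 𝓝 x, Q (P x') = x'
  right : ∀ᶠ z in 𝓝 (P x), P (Q z) = z

variable {P : N → F} {Q : F → N} {x : N}

theorem IsLocalChart.continuousAt (h : IsLocalChart I P Q x) : ContinuousAt P x :=
  h.smooth.self_of_nhds.continuousAt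

theorem IsLocalChart.inv_apply (h : IsLocalChart I P Q x) : Q (P x) = x := h.left.self_of_nhds

theorem IsLocalChart.tendsto_inv (h : IsLocalChart I P Q x) : Tendsto Q (𝓝 (P x)) (𝓝 x) := by
  have := h.smooth_inv.self_of_nhds.continuousAt.tendsto
  rwa [h.inv_apply] at this

theorem IsLocalChart.eventually (h : IsLocalChart I P Q x) :
    ∀ᶠ x' in 𝓝 x, IsLocalChart I P Q x' := by
  filter_upwards [h.smooth.eventually_nhds, h.continuousAt.eventually h.smooth_inv.eventually_nhds,
    h.left.eventually_nhds, h.continuousAt.eventually h.right.eventually_nhds] with x' h1 h2 h3 h4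
  exact ⟨h1, h2, h3, h4⟩

theorem IsLocalChart.mdifferentiableAt (h : IsLocalChart I P Q x) :
    MDifferentiableAt I 𝓘(ℝ, F) P x := h.smooth.self_of_nhds.mdifferentiableAt (by simp)

theorem IsLocalChart.mdifferentiableAt_inv (h : IsLocalChart I P Q x) :
    MDifferentiableAt 𝓘(ℝ, F) I Q (P x) := h.smooth_inv.self_of_nhds.mdifferentiableAt (by simp)

theorem IsLocalChart.mfderiv_inv_mfderiv (h : IsLocalChart I P Q x) (v : E') :
    (mfderiv 𝓘(ℝ, F) I Q (P x) (mfderiv I 𝓘(ℝ, F) P x v) : E') = v := by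
  have e := mfderiv_comp x h.mdifferentiableAt_inv h.mdifferentiableAt
  rw [Filter.EventuallyEq.mfderiv_eq (show Q ∘ P =ᶠ[𝓝 x] id from h.left), mfderiv_id] at e
  exact (congrArg (fun A : E' →L[ℝ] E' => A v) e).symm

theorem IsLocalChart.mfderiv_mfderiv_inv (h : IsLocalChart I P Q x) (v : F) :
    (mfderiv I 𝓘(ℝ, F) P x (mfderiv 𝓘(ℝ, F) I Q (P x) v : E') : F) = v := by
  have h1 : MDifferentiableAt I 𝓘(ℝ, F) P (Q (P x)) := by
    rw [h.inv_apply]; exact h.mdifferentiableAt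
  have e := mfderiv_comp (P x) h1 h.mdifferentiableAt_inv
  rw [Filter.EventuallyEq.mfderiv_eq (show P ∘ Q =ᶠ[𝓝 (P x)] id from h.right), mfderiv_id,
    h.inv_apply] at e
  exact (congrArg (fun A : F →L[ℝ] F => A v) e).symm

/-- The differential of a local chart as an equivalence. -/
def IsLocalChart.derivEquiv (h : IsLocalChart I P Q x) : E' ≃L[ℝ] F :=
  ContinuousLinearEquiv.equivOfInverse (mfderiv I 𝓘(ℝ, F) P x : E' →L[ℝ] F)
    (mfderiv 𝓘(ℝ, F) I Q (P x) : F →L[ℝ] E') h.mfderiv_inv_mfderiv h.mfderiv_mfderiv_inv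

theorem IsLocalChart.inverse_apply (h : IsLocalChart I P Q x) (v : F) :
    (mfderiv I 𝓘(ℝ, F) P x).inverse v = (mfderiv 𝓘(ℝ, F) I Q (P x) v : E') := by
  have : mfderiv I 𝓘(ℝ, F) P x = (h.derivEquiv : E' →L[ℝ] F) := rfl
  rw [this]
  exact congrArg (fun A : F →L[ℝ] E' => A v) (ContinuousLinearMap.inverse_equiv h.derivEquiv)

/-- The expression of a vector field in coordinates. -/
def coordField (I : ModelWithCorners ℝ E' H) (P : N → F) (Q : F → N)
    (V : (x : N) → TangentSpace I x) (z : F) : F := mfderiv I 𝓘(ℝ, F) P (Q z) (V (Q z))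

/-- The differential of a smooth map takes smooth families of tangent vectors to such families. -/
theorem contMDiffAt_mfderiv_section {HG G EG : Type*} [NormedAddCommGroup EG] [NormedSpace ℝ EG]
    [TopologicalSpace HG] {J : ModelWithCorners ℝ EG HG} [TopologicalSpace G] [ChartedSpace HG G]
    {H₂ E₂ N₂ : Type*} [NormedAddCommGroup E₂] [NormedSpace ℝ E₂] [TopologicalSpace H₂]
    {I₂ : ModelWithCorners ℝ E₂ H₂} [TopologicalSpace N₂] [ChartedSpace H₂ N₂]
    [IsManifold I ∞ N] [IsManifold I₂ ∞ N₂] {f : N → N₂}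
    {s : G → N} {V : (y : G) → TangentSpace I (s y)} {y : G}
    (hs : ContMDiffAt J I.tangent ∞ (fun y => (⟨s y, V y⟩ : TangentBundle I N)) y)
    (hf : ContMDiffAt I I₂ ∞ f (s y)) :
    ContMDiffAt J I₂.tangent ∞
      (fun y => (⟨f (s y), mfderiv I I₂ f (s y) (V y)⟩ : TangentBundle I₂ N₂)) y := by
  haveI : IsManifold I 1 N := IsManifold.of_le (n := ∞) (by simp)
  haveI : IsManifold I₂ 1 N₂ := IsManifold.of_le (n := ∞) (by simp)
  have hsb : ContMDiffAt J I ∞ s y := (Bundle.contMDiffAt_totalSpace.1 hs).1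
  have hφ : ContMDiffAt J 𝓘(ℝ, E' →L[ℝ] E₂) ∞ (fun y' => ContinuousLinearMap.inCoordinates E'
      (TangentSpace I (M := N)) E₂ (TangentSpace I₂ (M := N₂)) (s y) (s y') (f (s y)) (f (s y'))
      (mfderiv I I₂ f (s y'))) y :=
    (hf.mfderiv_const (m := ∞) (by simp)).comp y hsb
  exact ContMDiffAt.clm_apply_of_inCoordinates hφ hs (hf.comp y hsb)

/-- Smooth families of tangent vectors have smooth coordinate expressions. -/
theorem contDiffAt_mfderiv_section [IsManifold I ∞ N] {G : Type*}
    [NormedAddCommGroup G] [NormedSpace ℝ G] {s : G → N} {V : (y : G) → TangentSpace I (s y)} {y : G}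
    (hs : ContMDiffAt 𝓘(ℝ, G) I.tangent ∞ (fun y => (⟨s y, V y⟩ : TangentBundle I N)) y)
    (hf : ContMDiffAt I 𝓘(ℝ, F) ∞ P (s y)) :
    ContDiffAt ℝ ∞ (fun y => (mfderiv I 𝓘(ℝ, F) P (s y) (V y) : F)) y :=
  ((contMDiff_snd_tangentBundle_modelSpace F 𝓘(ℝ, F)).contMDiffAt.comp y
    (contMDiffAt_mfderiv_section hs hf)).contDiffAt

theorem IsLocalChart.mfderiv_mlieBracket [IsManifold I ∞ N] [CompleteSpace E'] [CompleteSpace F]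
    (h : IsLocalChart I P Q x)
    {V W : (x : N) → TangentSpace I x} {Vc Wc : F → F} (hV : ContDiffAt ℝ ∞ Vc (P x))
    (hW : ContDiffAt ℝ ∞ Wc (P x))
    (hVc : ∀ᶠ x' in 𝓝 x, (mfderiv I 𝓘(ℝ, F) P x' (V x') : F) = Vc (P x'))
    (hWc : ∀ᶠ x' in 𝓝 x, (mfderiv I 𝓘(ℝ, F) P x' (W x') : F) = Wc (P x')) :
    (mfderiv I 𝓘(ℝ, F) P x (mlieBracket I V W x) : F) = lieBracket ℝ Vc Wc (P x) := by
  have key : ∀ {V : (x : N) → TangentSpace I x} {Vc : F → F},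
      (∀ᶠ x' in 𝓝 x, (mfderiv I 𝓘(ℝ, F) P x' (V x') : F) = Vc (P x')) →
      V =ᶠ[𝓝 x] mpullback I 𝓘(ℝ, F) P Vc := by
    intro V Vc hVc
    filter_upwards [hVc, h.eventually] with x' h1 h2
    have h3 : mpullback I 𝓘(ℝ, F) P Vc x' = (mfderiv 𝓘(ℝ, F) I Q (P x') (Vc (P x')) : E') :=
      h2.inverse_apply _
    rw [h3, ← h1]
    exact (h2.mfderiv_inv_mfderiv _).symm
  have hmin : ∀ k : ℕ, minSmoothness ℝ k ≤ ∞ := fun k => by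
    rw [minSmoothness_of_isRCLikeNormedField]; exact_mod_cast le_top
  haveI : IsManifold I (minSmoothness ℝ 3) N := IsManifold.of_le (n := ∞) (hmin 3)
  have hb : ∀ V W : (z : F) → TangentSpace 𝓘(ℝ, F) z, mlieBracket 𝓘(ℝ, F) V W = lieBracket ℝ V W := by
    intro V W
    rw [← mlieBracketWithin_univ, mlieBracketWithin_eq_lieBracketWithin]
    exact lieBracketWithin_univ
  have hm : ∀ {V : (z : F) → TangentSpace 𝓘(ℝ, F) z}, ContDiffAt ℝ ∞ V (P x) →
      MDifferentiableAt 𝓘(ℝ, F) 𝓘(ℝ, F).tangent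
        (fun z => (⟨z, V z⟩ : TangentBundle 𝓘(ℝ, F) F)) (P x) := fun h =>
    (contMDiffAt_vectorSpace_iff_contDiffAt.2 h).mdifferentiableAt (by simp)
  have e := mpullback_mlieBracket (I := I) (I' := 𝓘(ℝ, F)) (f := P) (V := Vc) (W := Wc) (x₀ := x) (n := ∞)
    (hm hV) (hm hW) h.smooth.self_of_nhds (hmin 2)
  rw [Filter.EventuallyEq.mlieBracket_vectorField_eq (key hVc) (key hWc), ← e]
  have h3 : ∀ L : F → F, mpullback I 𝓘(ℝ, F) P L x = (mfderiv 𝓘(ℝ, F) I Q (P x) (L (P x)) : E') :=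
    fun L => h.inverse_apply _
  have h4 : mpullback I 𝓘(ℝ, F) P (mlieBracket 𝓘(ℝ, F) Vc Wc) x =
      mpullback I 𝓘(ℝ, F) P (lieBracket ℝ Vc Wc : F → F) x :=
    congrArg (fun L => mpullback I 𝓘(ℝ, F) P L x) (hb Vc Wc)
  exact (congrArg (mfderiv I 𝓘(ℝ, F) P x) (h4.trans (h3 _))).trans (h.mfderiv_mfderiv_inv _)

variable {F F' : Type} [NormedAddCommGroup F] [NormedSpace ℝ F] [NormedAddCommGroup F'] [NormedSpace ℝ F']

theorem isLocalChart_extChartAt [I.Boundaryless] [IsManifold I ∞ N] (x : N) :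
    IsLocalChart I (extChartAt I x) (extChartAt I x).symm x := by
  have hs : (extChartAt I x).source ∈ 𝓝 x := extChartAt_source_mem_nhds x
  have ht : (extChartAt I x).target ∈ 𝓝 (extChartAt I x x) := extChartAt_target_mem_nhds x
  refine ⟨?_, ?_, ?_, ?_⟩
  · filter_upwards [hs] with y hy
    exact contMDiffAt_extChartAt' (by simpa using hy)
  · filter_upwards [eventually_mem_nhds_iff.2 ht] with z hz
    exact (contMDiffOn_extChartAt_symm x).contMDiffAt hz
  · filter_upwards [hs] with y hy
    exact (extChartAt I x).left_inv hy
  · filter_upwards [ht] with z hz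
    exact (extChartAt I x).right_inv hz

variable {P : N → F} {Q : F → N} {x : N}

theorem IsLocalChart.smoothNear_comp_inv (h : IsLocalChart I P Q x) {P' : N → F'}
    (hP' : ∀ᶠ x' in 𝓝 x, ContMDiffAt I 𝓘(ℝ, F') ∞ P' x') : SmoothNear (fun z => P' (Q z)) (P x) := by
  filter_upwards [h.smooth_inv, h.tendsto_inv.eventually hP'] with z h1 h2
  exact (h2.comp z h1).contDiffAt

theorem IsLocalChart.fderiv_comp_inv (h : IsLocalChart I P Q x) {P' : N → F'}
    (hP' : MDifferentiableAt I 𝓘(ℝ, F') P' x) (v : F) :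
    fderiv ℝ (fun z => P' (Q z)) (P x) v =
      (mfderiv I 𝓘(ℝ, F') P' x (mfderiv 𝓘(ℝ, F) I Q (P x) v : E') : F') := by
  have h1 : MDifferentiableAt I 𝓘(ℝ, F') P' (Q (P x)) := by rw [h.inv_apply]; exact hP'
  have e := mfderiv_comp (P x) h1 h.mdifferentiableAt_inv
  rw [h.inv_apply, mfderiv_eq_fderiv] at e
  exact congrArg (fun A : F →L[ℝ] F' => A v) e

/-- The derivative of a change of coordinates. -/
theorem IsLocalChart.fderiv_comp_inv_mfderiv (h : IsLocalChart I P Q x) {P' : N → F'}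
    (hP' : MDifferentiableAt I 𝓘(ℝ, F') P' x) (v : E') :
    fderiv ℝ (fun z => P' (Q z)) (P x) (mfderiv I 𝓘(ℝ, F) P x v : F) =
      (mfderiv I 𝓘(ℝ, F') P' x v : F') :=
  (h.fderiv_comp_inv hP' _).trans
    (congrArg (mfderiv I 𝓘(ℝ, F') P' x) (h.mfderiv_inv_mfderiv v))

/-- A smooth map with bijective differential is a local chart. -/
theorem IsLocalChart.exists_of_bijective [FiniteDimensional ℝ F] (h : IsLocalChart I P Q x) {P' : N → F'}
    (hP' : ∀ᶠ x' in 𝓝 x, ContMDiffAt I 𝓘(ℝ, F') ∞ P' x')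
    (hb : Function.Bijective (mfderiv I 𝓘(ℝ, F') P' x)) : ∃ Q' : F' → N, IsLocalChart I P' Q' x := by
  have hd : MDifferentiableAt I 𝓘(ℝ, F') P' x := hP'.self_of_nhds.mdifferentiableAt (by simp)
  have hbij : Function.Bijective (fderiv ℝ (fun z => P' (Q z)) (P x)) := by
    have : ⇑(fderiv ℝ (fun z => P' (Q z)) (P x)) =
        fun v => (mfderiv I 𝓘(ℝ, F') P' x (h.derivEquiv.symm v) : F') := by
      ext v; exact h.fderiv_comp_inv hd v
    rw [this]
    exact hb.comp h.derivEquiv.symm.bijective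
  obtain ⟨g, hg, hg0, hgl, hgr⟩ := (h.smoothNear_comp_inv hP').exists_local_inverse_of_bijective hbij
  have e : P' (Q (P x)) = P' x := by rw [h.inv_apply]
  simp only [e] at hg hg0 hgr
  have hgt : Tendsto g (𝓝 (P' x)) (𝓝 (P x)) := by
    have := hg.continuousAt.tendsto
    rwa [hg0] at this
  refine ⟨fun z => Q (g z), hP', ?_, ?_, hgr⟩
  · filter_upwards [hg, hgt.eventually h.smooth_inv] with z h1 h2
    exact h2.comp z h1.contMDiffAt
  · filter_upwards [h.continuousAt.eventually hgl, h.left] with x' h1 h2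
    simp only [h2] at h1
    rw [h1, h2]

/-- Composition of a local chart with a local diffeomorphism. -/
theorem IsLocalChart.comp (h : IsLocalChart I P Q x) {T : F → F'} {T' : F' → F}
    (hT : SmoothNear T (P x)) (hT' : SmoothNear T' (T (P x))) (hl : ∀ᶠ z in 𝓝 (P x), T' (T z) = z)
    (hr : ∀ᶠ z in 𝓝 (T (P x)), T (T' z) = z) :
    IsLocalChart I (fun x => T (P x)) (fun z => Q (T' z)) x := by
  have hT0 : T' (T (P x)) = P x := hl.self_of_nhds
  have hgt : Tendsto T' (𝓝 (T (P x))) (𝓝 (P x)) := by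
    have := hT'.continuousAt.tendsto
    rwa [hT0] at this
  refine ⟨?_, ?_, ?_, ?_⟩
  · filter_upwards [h.smooth, h.continuousAt.eventually hT] with x' h1 h2
    exact h2.contMDiffAt.comp x' h1
  · filter_upwards [hT', hgt.eventually h.smooth_inv] with z h1 h2
    exact h2.comp z h1.contMDiffAt
  · filter_upwards [h.continuousAt.eventually hl, h.left] with x' h1 h2
    rw [h1, h2]
  · filter_upwards [hr, hgt.eventually h.right] with z h1 h2
    rw [h2, h1]

theorem hasMFDerivAt_prodMk_space {f : N → F} {g : N → F'} {f' : TangentSpace I x →L[ℝ] F}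
    {g' : TangentSpace I x →L[ℝ] F'} (hf : HasMFDerivAt I 𝓘(ℝ, F) f x f')
    (hg : HasMFDerivAt I 𝓘(ℝ, F') g x g') :
    HasMFDerivAt I 𝓘(ℝ, F × F') (fun x => (f x, g x)) x (f'.prod g') :=
  ⟨hf.1.prodMk hg.1, hf.2.prodMk hg.2⟩

end LocalChart

section Contact

open VectorField

theorem linearIndependent_iff_det3 (u v w : Jet) : LinearIndependent ℝ ![u, v, w] ↔ det3 u v w ≠ 0 := by
  have h1 : LinearIndependent ℝ ![u, v, w] ↔
      LinearIndependent ℝ (finThreeEquivJet.symm ∘ ![u, v, w]) :=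
    (LinearMap.linearIndependent_iff finThreeEquivJet.symm.toLinearMap
      (LinearMap.ker_eq_bot.2 finThreeEquivJet.symm.injective)).symm
  rw [h1]
  have h2 : finThreeEquivJet.symm ∘ ![u, v, w] = (Matrix.of (finThreeEquivJet.symm ∘ ![u, v, w])).row := rfl
  rw [h2, Matrix.linearIndependent_rows_iff_isUnit, Matrix.isUnit_iff_isUnit_det, isUnit_iff_ne_zero,
    Matrix.det_fin_three]
  refine not_congr (Eq.congr ?_ rfl)
  have h3 : ∀ z : Jet, finThreeEquivJet.symm z = ![z.2.2, z.1, z.2.1] := fun _ => rfl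
  simp [h3, det3]
  ring

theorem linearIndependent_map_two {E F : Type*} [AddCommGroup E] [Module ℝ E] [AddCommGroup F]
    [Module ℝ F] [TopologicalSpace E] [TopologicalSpace F] (e : E ≃L[ℝ] F) {u v : E}
    (h : LinearIndependent ℝ ![u, v]) : LinearIndependent ℝ ![e u, e v] := by
  have := h.map' (e : E →ₗ[ℝ] F) (LinearMap.ker_eq_bot.2 e.injective)
  rwa [show (e : E →ₗ[ℝ] F) ∘ ![u, v] = ![e u, e v] from funext fun i => by fin_cases i <;> rfl] at this

theorem linearIndependent_map_three {E F : Type*} [AddCommGroup E] [Module ℝ E] [AddCommGroup F]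
    [Module ℝ F] [TopologicalSpace E] [TopologicalSpace F] (e : E ≃L[ℝ] F) {u v w : E}
    (h : LinearIndependent ℝ ![u, v, w]) : LinearIndependent ℝ ![e u, e v, e w] := by
  have := h.map' (e : E →ₗ[ℝ] F) (LinearMap.ker_eq_bot.2 e.injective)
  rwa [show (e : E →ₗ[ℝ] F) ∘ ![u, v, w] = ![e u, e v, e w] from funext fun i => by fin_cases i <;> rfl] at this

theorem det3_deriv_eq_zero {E : Type*} [NormedAddCommGroup E] [NormedSpace ℝ E] {u v w : E → Jet}
    {u' v' w' : E →L[ℝ] Jet} {x : E} (hu : HasFDerivAt u u' x) (hv : HasFDerivAt v v' x)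
    (hw : HasFDerivAt w w' x) (h : ∀ᶠ y in 𝓝 x, det3 (u y) (v y) (w y) = 0) (e : E) :
    det3 (u' e) (v x) (w x) + det3 (u x) (v' e) (w x) + det3 (u x) (v x) (w' e) = 0 := by
  have c1 : ∀ {f : E → Jet} {f' : E →L[ℝ] Jet}, HasFDerivAt f f' x →
      HasFDerivAt (fun y => (f y).1) ((ContinuousLinearMap.fst ℝ ℝ (ℝ × ℝ)).comp f') x :=
    fun h => hasFDerivAt_fst.comp x h
  have c2 : ∀ {f : E → Jet} {f' : E →L[ℝ] Jet}, HasFDerivAt f f' x →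
      HasFDerivAt (fun y => (f y).2.1) ((ContinuousLinearMap.fst ℝ ℝ ℝ).comp
        ((ContinuousLinearMap.snd ℝ ℝ (ℝ × ℝ)).comp f')) x :=
    fun h => hasFDerivAt_fst.comp x (hasFDerivAt_snd.comp x h)
  have c3 : ∀ {f : E → Jet} {f' : E →L[ℝ] Jet}, HasFDerivAt f f' x →
      HasFDerivAt (fun y => (f y).2.2) ((ContinuousLinearMap.snd ℝ ℝ ℝ).comp
        ((ContinuousLinearMap.snd ℝ ℝ (ℝ × ℝ)).comp f')) x :=
    fun h => hasFDerivAt_snd.comp x (hasFDerivAt_snd.comp x h)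
  have k : HasFDerivAt (fun y => det3 (u y) (v y) (w y)) _ x :=
    (((c1 hu).mul (((c2 hv).mul (c3 hw)).sub ((c3 hv).mul (c2 hw)))).sub
      ((c2 hu).mul (((c1 hv).mul (c3 hw)).sub ((c3 hv).mul (c1 hw))))).add
      ((c3 hu).mul (((c1 hv).mul (c2 hw)).sub ((c2 hv).mul (c1 hw))))
  have k0 : HasFDerivAt (fun y => det3 (u y) (v y) (w y)) (0 : E →L[ℝ] ℝ) x :=
    (hasFDerivAt_const (0 : ℝ) x).congr_of_eventuallyEq h
  have := congrArg (fun A => A e) (k.unique k0)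
  simp at this
  simp only [det3]
  linear_combination this

/-- Whether a plane field is a contact structure can be read off from any frame. -/
theorem det3_bracket_ne_zero {A B X Y : Jet → Jet} {z : Jet} (hA : DifferentiableAt ℝ A z)
    (hB : DifferentiableAt ℝ B z) (hX : DifferentiableAt ℝ X z) (hY : DifferentiableAt ℝ Y z)
    (hAs : ∀ᶠ z in 𝓝 z, ∃ α β : ℝ, A z = α • X z + β • Y z)
    (hBs : ∀ᶠ z in 𝓝 z, ∃ α β : ℝ, B z = α • X z + β • Y z)
    (hXY : det3 (X z) (Y z) (lieBracket ℝ X Y z) ≠ 0) (hAB : LinearIndependent ℝ ![A z, B z]) :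
    det3 (A z) (B z) (lieBracket ℝ A B z) ≠ 0 := by
  have hz : ∀ {A : Jet → Jet}, (∀ᶠ z in 𝓝 z, ∃ α β : ℝ, A z = α • X z + β • Y z) →
      ∀ᶠ z in 𝓝 z, det3 (X z) (Y z) (A z) = 0 := fun h => h.mono fun z ⟨α, β, h⟩ => by
    rw [h]; simp [det3]; ring
  have e1 := det3_deriv_eq_zero hX.hasFDerivAt hY.hasFDerivAt hA.hasFDerivAt (hz hAs) (B z)
  have e2 := det3_deriv_eq_zero hX.hasFDerivAt hY.hasFDerivAt hB.hasFDerivAt (hz hBs) (A z)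
  obtain ⟨α, β, h1⟩ := hAs.self_of_nhds
  obtain ⟨γ, δ, h2⟩ := hBs.self_of_nhds
  have hdet : α * δ - β * γ ≠ 0 := by
    intro h0
    rw [LinearIndependent.pair_iff] at hAB
    have k1 := hAB δ (-β) (by
      have : δ • A z + (-β) • B z = (α * δ - β * γ) • X z := by rw [h1, h2]; module
      rw [this, h0, zero_smul])
    have k2 := hAB (-γ) α (by
      have : (-γ) • A z + α • B z = (α * δ - β * γ) • Y z := by rw [h1, h2]; module
      rw [this, h0, zero_smul])
    have hA0 : A z = 0 := by rw [h1, k2.2, neg_eq_zero.1 k1.2, zero_smul, zero_smul, add_zero]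
    exact one_ne_zero (hAB 1 0 (by rw [hA0, smul_zero, zero_smul, add_zero])).1
  have key : det3 (A z) (B z) (lieBracket ℝ A B z) =
      (α * δ - β * γ) ^ 2 * det3 (X z) (Y z) (lieBracket ℝ X Y z) := by
    have e3 : det3 (A z) (B z) (lieBracket ℝ A B z) =
        (α * δ - β * γ) * det3 (X z) (Y z) (lieBracket ℝ A B z) := by
      rw [h1, h2]; simp [det3]; ring
    have e4 : det3 (X z) (Y z) (lieBracket ℝ A B z) =
        (α * δ - β * γ) * det3 (X z) (Y z) (lieBracket ℝ X Y z) := by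
      rw [lieBracket_eq, lieBracket_eq]
      beta_reduce
      have e5 : fderiv ℝ X z (A z) = α • fderiv ℝ X z (X z) + β • fderiv ℝ X z (Y z) := by
        rw [h1, map_add, map_smul, map_smul]
      have e6 : fderiv ℝ Y z (A z) = α • fderiv ℝ Y z (X z) + β • fderiv ℝ Y z (Y z) := by
        rw [h1, map_add, map_smul, map_smul]
      have e7 : fderiv ℝ X z (B z) = γ • fderiv ℝ X z (X z) + δ • fderiv ℝ X z (Y z) := by
        rw [h2, map_add, map_smul, map_smul]
      have e8 : fderiv ℝ Y z (B z) = γ • fderiv ℝ Y z (X z) + δ • fderiv ℝ Y z (Y z) := by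
        rw [h2, map_add, map_smul, map_smul]
      rw [e5, e6] at e2
      rw [e7, e8] at e1
      generalize fderiv ℝ X z (X z) = p1 at *
      generalize fderiv ℝ X z (Y z) = p2 at *
      generalize fderiv ℝ Y z (X z) = p3 at *
      generalize fderiv ℝ Y z (Y z) = p4 at *
      generalize fderiv ℝ A z (B z) = p5 at *
      generalize fderiv ℝ B z (A z) = p6 at *
      rw [h1] at e1
      rw [h2] at e2
      simp only [det3, Prod.fst_add, Prod.snd_add, Prod.fst_sub, Prod.snd_sub, Prod.smul_fst,
        Prod.smul_snd, smul_eq_mul] at e1 e2 ⊢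
      linear_combination e2 - e1
    rw [e3, e4]; ring
  rw [key]
  exact mul_ne_zero (pow_ne_zero 2 hdet) hXY

end Contact

section EngelCondition

open VectorField

/-- The bracket of the fields `h + r ∂/∂θ` and `k + s ∂/∂θ`. -/
def fieldBracket (h : Cyl → Jet) (r : ℝ) (k : Cyl → Jet) (s : ℝ)
    (y : Cyl) : Jet := fderiv ℝ k y (0, h y, r) - fderiv ℝ h y (0, k y, s)

/-- The plane field spanned by `w` and `l + ∂/∂θ` is an Engel structure where this does not vanish. -/
def engelDet (l w : Cyl → Jet) (y : Cyl) : ℝ :=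
  det3 (w y) (fieldBracket w 0 l 1 y) (fieldBracket w 0 (fieldBracket w 0 l 1) 0 y)

variable {a b : Jet → ℝ} {F : TJet → ℝ} {l w h k : Cyl → Jet} {y : Cyl}

theorem SmoothNear.fieldBracket (hh : SmoothNear h y) (hk : SmoothNear k y) (r s : ℝ) :
    SmoothNear (fieldBracket h r k s) y :=
  (hk.fderiv_apply (f := k) hh.liftField).sub (hh.fderiv_apply (f := h) hk.liftField)

theorem SmoothNear.engelDet (hl : SmoothNear l y) (hw : SmoothNear w y) :
    SmoothNear (engelDet l w) y :=
  hw.det3 (hw.fieldBracket hl 0 1) (hw.fieldBracket (hw.fieldBracket hl 0 1) 0 0)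

theorem lieBracket_slice {t : ℝ} {p : Jet × ℝ} (r s : ℝ) (hh : DifferentiableAt ℝ h (t, p))
    (hk : DifferentiableAt ℝ k (t, p)) : lieBracket ℝ (fun p : Jet × ℝ => (h (t, p), r))
      (fun p => (k (t, p), s)) p = (fieldBracket h r k s (t, p), 0) := by
  have hs : ∀ {h : Cyl → Jet}, DifferentiableAt ℝ h (t, p) → ∀ (r : ℝ) v,
      fderiv ℝ (fun p : Jet × ℝ => (h (t, p), r)) p v = (fderiv ℝ h (t, p) (0, v), 0) := by
    intro h hh r v
    have hc : DifferentiableAt ℝ (fun p => h (t, p)) p :=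
      hh.comp p (f := fun p : Jet × ℝ => (t, p)) (by fun_prop)
    rw [fderiv_prodMk_apply hc (differentiableAt_const _), fderiv_slice hh]
    simp
  rw [lieBracket_eq]
  simp only [hs hh, hs hk, fieldBracket, Prod.mk_sub_mk, sub_zero]

theorem engelDet_ne_zero (ha : SmoothNear a y.2.1) (hb : SmoothNear b y.2.1)
    (hF : SmoothNear F (y.1, y.2.1)) (hl : SmoothNear l y) (ha0 : 0 < a y.2.1) (hb0 : 0 < b y.2.1)
    (h0 : ∀ᶠ y' in 𝓝 y, y'.1 = y.1 → l y' = 0) : engelDet l (pairField a b F) y ≠ 0 := by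
  have hp := SmoothNear.pairField_at ha hb hF
  have hp' := SmoothNear.pairFieldDeriv_at ha hb hF
  have e1 : ∀ᶠ y' in 𝓝 y, y'.1 = y.1 →
      fieldBracket (pairField a b F) 0 l 1 y' = -pairFieldDeriv a b F y' := by
    filter_upwards [hp, hl, h0, h0.eventually_nhds] with y' h1 h2 h3 h4 h5
    have h6 := h1.diffAt
    rw [fieldBracket, h3 h5, fderiv_slice_congr (g := fun _ => (0 : Jet)) h5 h4
      (h2.diffAt) (differentiableAt_const _)]
    have := fderiv_pairField h6
    simp only [fderiv_fun_const, Pi.zero_apply, ContinuousLinearMap.zero_apply, zero_sub]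
    exact congrArg _ this
  have e2 : fieldBracket (pairField a b F) 0 (fieldBracket (pairField a b F) 0 l 1) 0 y =
      -(lieBracket ℝ (liftField (pairField a b F) 0) (liftField (pairFieldDeriv a b F) 0) y).2.1 := by
    rw [lieBracket_liftField hp.differentiableAt hp'.differentiableAt, fieldBracket,
      e1.self_of_nhds rfl, fderiv_slice_congr (g := fun y => -pairFieldDeriv a b F y) rfl e1
      (hp.fieldBracket hl 0 1).differentiableAt hp'.neg.differentiableAt, fderiv_fun_neg,
      show ((0 : ℝ), -pairFieldDeriv a b F y, (0 : ℝ)) = -(0, pairFieldDeriv a b F y, 0) by simp,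
      map_neg, ContinuousLinearMap.neg_apply]
    simp only
    abel
  rw [engelDet, e1.self_of_nhds rfl, e2]
  have := det3_lieBracket_pairField hp hp'
  have e3 : ∀ u v w : Jet, det3 u (-v) (-w) = det3 u v w := fun u v w => by simp [det3]
  rw [e3, this]
  positivity

theorem linearIndependent_of_det3 {w l u v : Jet} (h : det3 w u v ≠ 0) :
    LinearIndependent ℝ ![((w, 0) : Jet × ℝ), (l, 1), (u, 0), (v, 0)] := by
  refine Fintype.linearIndependent_iff.2 fun g hg => ?_
  have h1 := congrArg Prod.fst hg
  have h2 := congrArg Prod.snd hg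
  simp [Fin.sum_univ_four] at h1 h2
  have h3 := Fintype.linearIndependent_iff.1 ((linearIndependent_iff_det3 _ _ _).2 h) ![g 0, g 2, g 3] (by
    rw [h2, zero_smul, add_zero] at h1
    simpa [Fin.sum_univ_three] using h1)
  intro i
  fin_cases i
  exacts [h3 0, h2, h3 1, h3 2]

end EngelCondition

section Manifold

open VectorField

variable {M : Type*} [TopologicalSpace M] [ChartedSpace E3 M]
  {χ : M → Jet} {ι : Jet → M} {m : M}

/-- The coordinates on `M × ℝ`. -/
def prodChart (χ : M → Jet) (x : M × ℝ) : Jet × ℝ := (χ x.1, x.2)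

def prodChartInv (ι : Jet → M) (z : Jet × ℝ) : M × ℝ := (ι z.1, z.2)

theorem IsLocalChart.prodChart (h : IsLocalChart (𝓡 3) χ ι m) (θ : ℝ) :
    IsLocalChart IQ (prodChart χ) (prodChartInv ι) (m, θ) := by
  have h1 : Tendsto (Prod.fst : M × ℝ → M) (𝓝 (m, θ)) (𝓝 m) := continuous_fst.tendsto _
  have h2 : Tendsto (Prod.fst : Jet × ℝ → Jet) (𝓝 (χ m, θ)) (𝓝 (χ m)) := continuous_fst.tendsto _
  refine ⟨?_, ?_, ?_, ?_⟩
  · filter_upwards [h1.eventually h.smooth] with x hx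
    exact (hx.comp x contMDiffAt_fst).prodMk_space contMDiffAt_snd
  · filter_upwards [h2.eventually h.smooth_inv] with z hz
    exact (hz.comp z contDiff_fst.contMDiff.contMDiffAt).prodMk contDiff_snd.contMDiff.contMDiffAt
  · filter_upwards [h1.eventually h.left] with x hx
    exact Prod.ext hx rfl
  · filter_upwards [h2.eventually h.right] with z hz
    exact Prod.ext hz rfl

theorem IsLocalChart.tendsto_prodChart {x : M × ℝ} (h : IsLocalChart (𝓡 3) χ ι x.1) (t : ℝ) :
    Tendsto (fun z : ℝ × (M × ℝ) => (z.1, EngelODE.prodChart χ z.2)) (𝓝 (t, x))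
      (𝓝 (t, EngelODE.prodChart χ x)) :=
  (continuous_fst.tendsto _).prodMk_nhds ((h.prodChart x.2).continuousAt.tendsto.comp
    (continuous_snd.tendsto _))

theorem tendsto_basePoint (t : ℝ) (x : M × ℝ) :
    Tendsto (fun z : ℝ × (M × ℝ) => z.2.1) (𝓝 (t, x)) (𝓝 x.1) :=
  (continuous_fst.comp continuous_snd).tendsto (t, x)

theorem mfderiv_prodChart {x : M × ℝ} (h : MDifferentiableAt (𝓡 3) 𝓘(ℝ, Jet) χ x.1)
    (v : E3 × ℝ) :
    (mfderiv IQ 𝓘(ℝ, Jet × ℝ) (prodChart χ) x v : Jet × ℝ) =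
      ((mfderiv (𝓡 3) 𝓘(ℝ, Jet) χ x.1 v.1 : Jet), v.2) := by
  have h1 := hasMFDerivAt_prodMk_space
    (h.hasMFDerivAt.comp x (hasMFDerivAt_fst (I := 𝓡 3) (I' := 𝓘(ℝ, ℝ)) x))
    (hasMFDerivAt_snd (I := 𝓡 3) (I' := 𝓘(ℝ, ℝ)) x)
  exact congrArg (fun A : E3 × ℝ →L[ℝ] Jet × ℝ => A v) h1.mfderiv

theorem map_eq_iff_map_map_eq {V V' W W' : Type*} [AddCommGroup V] [Module ℝ V] [AddCommGroup V']
    [Module ℝ V'] [AddCommGroup W] [Module ℝ W] [AddCommGroup W'] [Module ℝ W'] {A : Submodule ℝ V}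
    {B : Submodule ℝ V'} {f : V →ₗ[ℝ] V'} {p : V →ₗ[ℝ] W} {q : V' →ₗ[ℝ] W'} {g : W →ₗ[ℝ] W'}
    (hq : Function.Injective q) (h : ∀ v, g (p v) = q (f v)) :
    A.map f = B ↔ (A.map p).map g = B.map q := by
  rw [← (Submodule.map_injective_of_injective hq).eq_iff, ← Submodule.map_comp, ← Submodule.map_comp,
    show q ∘ₗ f = g ∘ₗ p from LinearMap.ext fun v => (h v).symm]

variable {D D' : ℝ → (x : M × ℝ) → Submodule ℝ (TangentSpace IQ x)}

/-- The differential of `prodChart χ`, between vector spaces. -/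
def chartDeriv (χ : M → Jet) (x : M × ℝ) : E3 × ℝ →L[ℝ] Jet × ℝ :=
  mfderiv IQ 𝓘(ℝ, Jet × ℝ) (prodChart χ) x

/-- A family of plane fields in coordinates. -/
def coordPlane (χ : M → Jet) (ι : Jet → M)
    (D : ℝ → (x : M × ℝ) → Submodule ℝ (TangentSpace IQ x)) (y : Cyl) :
    Submodule ℝ (Jet × ℝ) :=
  Submodule.map (chartDeriv χ (prodChartInv ι y.2)).toLinearMap
    (D y.1 (prodChartInv ι y.2) : Submodule ℝ (E3 × ℝ))

/-- A family of maps in coordinates. -/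
def coordMap (χ : M → Jet) (ι : Jet → M) (ψ : ℝ → M × ℝ → M × ℝ) (y : Cyl) : Jet × ℝ :=
  prodChart χ (ψ y.1 (prodChartInv ι y.2))

/-- The pointwise version of `IsEngelFamilyNear`. -/
def IsEngelMapAt (D D' : ℝ → (x : M × ℝ) → Submodule ℝ (TangentSpace IQ x))
    (ψ : ℝ → M × ℝ → M × ℝ) (t : ℝ) (x : M × ℝ) : Prop :=
  ContMDiffAt (𝓘(ℝ, ℝ).prod IQ) IQ ∞ (fun z : ℝ × (M × ℝ) => ψ z.1 z.2) (t, x) ∧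
    (t = 0 → ψ t x = x) ∧
    (x ∈ domain M → (D t x).map (mfderiv IQ IQ (ψ t) x).toLinearMap = D' t (ψ t x))

theorem IsLocalChart.tendsto_leafPoint (h : IsLocalChart (𝓡 3) χ ι m) (h0 : χ m = 0) (θ : ℝ) :
    Tendsto (fun y : Cyl => (y.1, prodChartInv ι y.2)) (𝓝 (0, 0, θ)) (𝓝 (0, m, θ)) := by
  refine (continuous_fst.tendsto _).prodMk_nhds ((h.prodChart θ).tendsto_inv.comp ?_)
  rw [show EngelODE.prodChart χ (m, θ) = (0, θ) by simp [EngelODE.prodChart, h0]]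
  exact continuous_snd.tendsto _

theorem contMDiffAt_prodChartInv {y : Cyl}
    (h : ContMDiffAt 𝓘(ℝ, Jet × ℝ) IQ ∞ (prodChartInv ι) y.2) :
    ContMDiffAt 𝓘(ℝ, Cyl) (𝓘(ℝ, ℝ).prod IQ) ∞
      (fun y : Cyl => (y.1, prodChartInv ι y.2)) y :=
  (contDiff_fst.contMDiff.contMDiffAt).prodMk (h.comp_of_eq contDiff_snd.contMDiff.contMDiffAt rfl)

theorem IsLocalChart.eventually_leafSet_iff (h : IsLocalChart (𝓡 3) χ ι m) (h0 : χ m = 0)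
    {p : ℝ × (M × ℝ) → Prop} : (∀ᶠ y in 𝓛, p (y.1, prodChartInv ι y.2)) ↔
      ∀ θ ∈ Quadrant, ∀ᶠ z in 𝓝 ((0 : ℝ), m, θ), p z := by
  rw [eventually_leafSet]
  have hP : ∀ θ, EngelODE.prodChart χ (m, θ) = (0, θ) := fun θ => by simp [EngelODE.prodChart, h0]
  constructor
  · intro hp θ hθ
    have hc := h.tendsto_prodChart (x := (m, θ)) 0
    rw [hP] at hc
    filter_upwards [hc.eventually (hp (0, 0, θ) (mem_leafSet.2 ⟨rfl, rfl, hθ⟩)),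
      (continuous_snd.tendsto ((0 : ℝ), m, θ)).eventually (h.prodChart θ).left] with z h1 h2
    rwa [h2] at h1
  · rintro hp ⟨t, z, θ⟩ hy
    obtain ⟨rfl, rfl, hθ⟩ := mem_leafSet.1 hy
    exact (h.tendsto_leafPoint h0 θ).eventually (hp θ hθ)

theorem exists_isEngelFamilyNear_iff (h : IsLocalChart (𝓡 3) χ ι m) (h0 : χ m = 0)
    {ψ : ℝ → M × ℝ → M × ℝ} {R : ℝ → M × ℝ → Prop} :
    (∃ (ε : ℝ) (N : Set (M × ℝ)), IsEngelFamilyNear m D D' ψ ε N ∧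
      ∀ t ∈ Ioo (-ε) ε, ∀ x ∈ N, R t x) ↔
    ∀ᶠ y in 𝓛, IsEngelMapAt D D' ψ y.1 (prodChartInv ι y.2) ∧
      R y.1 (prodChartInv ι y.2) := by
  refine Iff.trans ?_ (h.eventually_leafSet_iff h0 (p := fun z => IsEngelMapAt D D' ψ z.1 z.2 ∧
    R z.1 z.2)).symm
  constructor
  · rintro ⟨ε, N, ⟨hε, hN, hmN, hψ, hid, hmap⟩, hR⟩ θ hθ
    have hmem : Ioo (-ε) ε ×ˢ N ∈ 𝓝 ((0 : ℝ), m, θ) :=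
      (isOpen_Ioo.prod hN).mem_nhds ⟨⟨by linarith, hε⟩, hmN ⟨rfl, hθ⟩⟩
    filter_upwards [hmem] with z hz
    exact ⟨⟨hψ.contMDiffAt ((isOpen_Ioo.prod hN).mem_nhds hz), fun ht => ht ▸ hid _ hz.2,
      fun hd => hmap _ hz.1 _ hz.2 hd⟩, hR _ hz.1 _ hz.2⟩
  · intro hp
    have hleaf : leaf m = {m} ×ˢ Quadrant := by ext x; simp [leaf]
    have hcomp : IsCompact (leaf m) := hleaf ▸ isCompact_singleton.prod isCompact_Icc
    have h1 : ∀ᶠ z in 𝓝ˢ ({(0 : ℝ)} ×ˢ leaf m), IsEngelMapAt D D' ψ z.1 z.2 ∧ R z.1 z.2 := by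
      refine eventually_nhdsSet_iff_forall.2 ?_
      rintro ⟨t, m', θ⟩ ⟨rfl, rfl, hθ⟩
      exact hp θ hθ
    rw [isCompact_singleton.nhdsSet_prod_eq hcomp, nhdsSet_singleton] at h1
    obtain ⟨T, hT, S, hS, hTS⟩ := Filter.mem_prod_iff.1 h1
    obtain ⟨ε, hε, hεT⟩ := Metric.mem_nhds_iff.1 hT
    obtain ⟨N, hN, hmN, hNS⟩ := mem_nhdsSet_iff_exists.1 hS
    rw [Real.ball_eq_Ioo, zero_sub, zero_add] at hεT
    have key : ∀ t ∈ Ioo (-ε) ε, ∀ x ∈ N, IsEngelMapAt D D' ψ t x ∧ R t x := fun t ht x hx =>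
      hTS (show (t, x) ∈ T ×ˢ S from ⟨hεT ht, hNS hx⟩)
    exact ⟨ε, N, ⟨hε, hN, hmN, fun z hz => (key _ hz.1 _ hz.2).1.1.contMDiffWithinAt,
      fun x hx => (key 0 ⟨by linarith, hε⟩ x hx).1.2.1 rfl,
      fun t ht x hx hd => (key t ht x hx).1.2.2 hd⟩, fun t ht x hx => (key t ht x hx).2⟩

theorem IsLocalChart.prodChart' {x : M × ℝ} (h : IsLocalChart (𝓡 3) χ ι x.1) :
    IsLocalChart IQ (EngelODE.prodChart χ) (prodChartInv ι) x := h.prodChart x.2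

theorem contDiffAt_coordMap {ψ : ℝ → M × ℝ → M × ℝ} {t : ℝ} {x : M × ℝ}
    (hψ : ContMDiffAt (𝓘(ℝ, ℝ).prod IQ) IQ ∞ (fun z : ℝ × (M × ℝ) => ψ z.1 z.2) (t, x))
    (h : IsLocalChart (𝓡 3) χ ι x.1) (h' : IsLocalChart (𝓡 3) χ ι (ψ t x).1) :
    ContDiffAt ℝ ∞ (coordMap χ ι ψ) (t, prodChart χ x) := by
  have hq := contMDiffAt_prodChartInv (y := (t, prodChart χ x)) h.prodChart'.smooth_inv.self_of_nhds
  have hx : prodChartInv ι (prodChart χ x) = x := h.prodChart'.inv_apply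
  have h1 := hψ.comp_of_eq hq (by simp [hx])
  exact (h'.prodChart'.smooth.self_of_nhds.comp_of_eq h1 (by simp [hx])).contDiffAt

theorem fderiv_coordMap {ψ : ℝ → M × ℝ → M × ℝ} {t : ℝ} {x : M × ℝ}
    (hψ : ContMDiffAt (𝓘(ℝ, ℝ).prod IQ) IQ ∞ (fun z : ℝ × (M × ℝ) => ψ z.1 z.2) (t, x))
    (h : IsLocalChart (𝓡 3) χ ι x.1) (h' : IsLocalChart (𝓡 3) χ ι (ψ t x).1)
    (v : E3 × ℝ) :
    fderiv ℝ (coordMap χ ι ψ) (t, prodChart χ x) (0, chartDeriv χ x v) =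
      chartDeriv χ (ψ t x) (mfderiv IQ IQ (ψ t) x v : E3 × ℝ) := by
  have hs : ContMDiffAt IQ IQ ∞ (ψ t) x :=
    hψ.comp_of_eq (f := fun x : M × ℝ => (t, x)) (contMDiffAt_const.prodMk contMDiffAt_id) rfl
  have hd : MDifferentiableAt IQ IQ (ψ t) x := hs.mdifferentiableAt (by simp)
  rw [← fderiv_slice ((contDiffAt_coordMap hψ h h').diffAt)]
  refine (h.prodChart'.fderiv_comp_inv_mfderiv (P' := fun x => prodChart χ (ψ t x))
    (h'.prodChart'.mdifferentiableAt.comp x hd) v).trans ?_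
  exact congrArg (fun A : E3 × ℝ →L[ℝ] Jet × ℝ => A v)
    (mfderiv_comp x h'.prodChart'.mdifferentiableAt hd)

theorem coordPlane_prodChart {t : ℝ} {x : M × ℝ} (h : IsLocalChart (𝓡 3) χ ι x.1) :
    coordPlane χ ι D (t, prodChart χ x) = Submodule.map (chartDeriv χ x).toLinearMap
      (D t x : Submodule ℝ (E3 × ℝ)) := by
  have hx : prodChartInv ι (prodChart χ x) = x := h.prodChart'.inv_apply
  simp only [coordPlane]
  rw [hx]

theorem map_eq_iff_coordPlane {ψ : ℝ → M × ℝ → M × ℝ} {t : ℝ} {x : M × ℝ}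
    (hψ : ContMDiffAt (𝓘(ℝ, ℝ).prod IQ) IQ ∞ (fun z : ℝ × (M × ℝ) => ψ z.1 z.2) (t, x))
    (h : IsLocalChart (𝓡 3) χ ι x.1) (h' : IsLocalChart (𝓡 3) χ ι (ψ t x).1) :
    (D t x).map (mfderiv IQ IQ (ψ t) x).toLinearMap = D' t (ψ t x) ↔
      (coordPlane χ ι D (t, prodChart χ x)).map (sliceDeriv (coordMap χ ι ψ) (t, prodChart χ x)) =
        coordPlane χ ι D' (t, coordMap χ ι ψ (t, prodChart χ x)) := by
  have hx : prodChartInv ι (prodChart χ x) = x := h.prodChart'.inv_apply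
  have e : coordMap χ ι ψ (t, prodChart χ x) = prodChart χ (ψ t x) := by simp only [coordMap, hx]
  rw [e, coordPlane_prodChart h, coordPlane_prodChart h']
  exact map_eq_iff_map_map_eq h'.prodChart'.derivEquiv.injective fun v => fderiv_coordMap hψ h h' v

theorem IsLocalChart.eventually_leafSet_chart (h : IsLocalChart (𝓡 3) χ ι m) (h0 : χ m = 0) :
    ∀ᶠ y in 𝓛, IsLocalChart (𝓡 3) χ ι (prodChartInv ι y.2).1 ∧
      EngelODE.prodChart χ (prodChartInv ι y.2) = y.2 := by
  refine .and ((h.eventually_leafSet_iff h0 (p := fun z => IsLocalChart (𝓡 3) χ ι z.2.1)).2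
    fun θ _ => ?_) (eventually_leafSet.2 ?_)
  · exact (tendsto_basePoint 0 (m, θ)).eventually h.eventually
  · rintro ⟨t, z, θ⟩ hy
    obtain ⟨rfl, rfl, hθ⟩ := mem_leafSet.1 hy
    have := (h.prodChart θ).right
    rw [show EngelODE.prodChart χ (m, θ) = (0, θ) by simp [EngelODE.prodChart, h0]] at this
    exact (continuous_snd.tendsto ((0 : ℝ), (0 : Jet), θ)).eventually this

/-- In coordinates, a family that straightens or identifies Engel structures. -/
theorem coordMap_of_isEngelMapAt (h : IsLocalChart (𝓡 3) χ ι m) (h0 : χ m = 0)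
    {ψ : ℝ → M × ℝ → M × ℝ}
    (hψ : ∀ᶠ y in 𝓛, IsEngelMapAt D D' ψ y.1 (prodChartInv ι y.2)) :
    (∀ᶠ y in 𝓛, ContDiffAt ℝ ∞ (coordMap χ ι ψ) y) ∧
    (∀ᶠ y in 𝓛, y.1 = 0 → coordMap χ ι ψ y = y.2) ∧
    (∀ᶠ y in 𝓛, IsLocalChart (𝓡 3) χ ι (ψ y.1 (prodChartInv ι y.2)).1) ∧
    ∀ᶠ y in 𝓛, y.2.2 ∈ Quadrant → (coordPlane χ ι D y).map
      (sliceDeriv (coordMap χ ι ψ) y) = coordPlane χ ι D' (y.1, coordMap χ ι ψ y) := by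
  have hch := h.eventually_leafSet_chart h0
  have hch' : ∀ᶠ y in 𝓛, IsLocalChart (𝓡 3) χ ι (ψ y.1 (prodChartInv ι y.2)).1 := by
    refine (h.eventually_leafSet_iff h0 (p := fun z => IsLocalChart (𝓡 3) χ ι (ψ z.1 z.2).1)).2
      fun θ hθ => ?_
    have hp := ((h.eventually_leafSet_iff h0 (p := fun z => IsEngelMapAt D D' ψ z.1 z.2)).1 hψ θ
      hθ).self_of_nhds
    have hc : ContinuousAt (fun z : ℝ × (M × ℝ) => (ψ z.1 z.2).1) (0, m, θ) := hp.1.continuousAt.fst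
    refine hc.eventually ?_
    have e : ψ 0 (m, θ) = (m, θ) := hp.2.1 rfl
    simp only [e]
    exact h.eventually
  refine ⟨?_, ?_, hch', ?_⟩
  · filter_upwards [hψ, hch, hch'] with y h1 h2 h3
    have := contDiffAt_coordMap h1.1 h2.1 h3
    rwa [h2.2] at this
  · filter_upwards [hψ, hch] with y h1 h2 h3
    rw [coordMap, h1.2.1 h3, h2.2]
  · filter_upwards [hψ, hch, hch'] with y h1 h2 h3 h4
    have := (map_eq_iff_coordPlane (D := D) (D' := D') h1.1 h2.1 h3).1 (h1.2.2 h4)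
    rwa [h2.2] at this

theorem isEngelMapAt_of_coordMap (h : IsLocalChart (𝓡 3) χ ι m) (h0 : χ m = 0)
    {Φ : Cyl → Jet × ℝ} (hΦ : ∀ᶠ y in 𝓛, ContDiffAt ℝ ∞ Φ y)
    (hid : ∀ᶠ y in 𝓛, y.1 = 0 → Φ y = y.2)
    (hmap : ∀ᶠ y in 𝓛, y.2.2 ∈ Quadrant →
      (coordPlane χ ι D y).map (sliceDeriv Φ y) = coordPlane χ ι D' (y.1, Φ y)) :
    ∀ᶠ y in 𝓛, IsEngelMapAt D D' (fun t x => prodChartInv ι (Φ (t, prodChart χ x))) y.1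
      (prodChartInv ι y.2) := by
  have hch := h.eventually_leafSet_chart h0
  have htend : Tendsto (fun y : Cyl => (y.1, Φ y)) 𝓛 𝓛 :=
    tendsto_leafSet (fun y hy => continuousAt_fst.prodMk
      (eventually_leafSet.1 hΦ y hy).self_of_nhds.continuousAt) fun y hy => by
        rwa [(eventually_leafSet.1 hid y hy).self_of_nhds (mem_leafSet.1 hy).1]
  have hch' := htend.eventually hch
  have heq : ∀ᶠ y in 𝓛, coordMap χ ι (fun t x => prodChartInv ι (Φ (t, prodChart χ x))) y =
      Φ y := by
    filter_upwards [hch, hch'] with y h1 h2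
    simp only [coordMap, h1.2, h2.2]
  filter_upwards [hΦ, hid, hmap, hch, hch', eventually_leafSet_nhds heq] with y h1 h2 h3 h4 h5 h6
  have hsm : ContMDiffAt (𝓘(ℝ, ℝ).prod IQ) IQ ∞
      (fun z : ℝ × (M × ℝ) => prodChartInv ι (Φ (z.1, prodChart χ z.2)))
      (y.1, prodChartInv ι y.2) := by
    have e1 : ContMDiffAt (𝓘(ℝ, ℝ).prod IQ) 𝓘(ℝ, Cyl) ∞
        (fun z : ℝ × (M × ℝ) => (z.1, prodChart χ z.2)) (y.1, prodChartInv ι y.2) :=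
      contMDiffAt_fst.prodMk_space (h4.1.prodChart'.smooth.self_of_nhds.comp_of_eq contMDiffAt_snd rfl)
    have e2 := (h1.contMDiffAt (x := y)).comp_of_eq e1 (by simp [h4.2])
    have e3 := h5.1.prodChart'.smooth_inv.self_of_nhds
    rw [h5.2] at e3
    exact e3.comp_of_eq e2 (by simp [h4.2])
  have e : prodChartInv ι (Φ (y.1, prodChart χ (prodChartInv ι y.2))) = prodChartInv ι (Φ y) := by
    rw [h4.2]
  refine ⟨hsm, fun ht => e.trans (by rw [h2 ht]), fun hd => ?_⟩
  refine (map_eq_iff_coordPlane (χ := χ) (ι := ι) (D := D) (D' := D')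
    (ψ := fun t x => prodChartInv ι (Φ (t, prodChart χ x))) hsm h4.1
    (by simp only [e]; exact h5.1)).2 ?_
  rw [h4.2, h6.self_of_nhds, ← h3 hd]
  congr 1
  refine LinearMap.ext fun v => ?_
  rw [sliceDeriv_apply, sliceDeriv_apply]
  exact congrArg (fun A : Cyl →L[ℝ] Jet × ℝ => A (0, v)) (Filter.EventuallyEq.fderiv_eq h6)

variable [IsManifold (𝓡 3) ∞ M] {V₀ V₁ : (m : M) → TangentSpace (𝓡 3) m} {f a b : Jet → ℝ}
  {P : M → Jet} {Q : Jet → M}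

theorem IsLocalChart.smoothNear_coordField (h : IsLocalChart (𝓡 3) P Q m)
    {V : (m : M) → TangentSpace (𝓡 3) m}
    (hV : ∀ᶠ m' in 𝓝 m, ContMDiffAt (𝓡 3) (𝓡 3).tangent ∞
      (fun m => (⟨m, V m⟩ : TangentBundle (𝓡 3) M)) m') :
    SmoothNear (coordField (𝓡 3) P Q V) (P m) := by
  filter_upwards [h.smooth_inv, h.tendsto_inv.eventually h.smooth, h.tendsto_inv.eventually hV]
    with z h1 h2 h3
  exact contDiffAt_mfderiv_section (s := Q) (V := fun z => V (Q z)) (h3.comp z h1) h2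

theorem IsLocalChart.coordField_apply (h : IsLocalChart (𝓡 3) P Q m)
    (V : (m : M) → TangentSpace (𝓡 3) m) :
    (mfderiv (𝓡 3) 𝓘(ℝ, Jet) P m (V m) : Jet) = coordField (𝓡 3) P Q V (P m) := by
  rw [coordField, h.inv_apply]

/-- The contact condition in coordinates. -/
theorem IsContact.det3_ne_zero {ξ : (m : M) → Submodule ℝ (TangentSpace (𝓡 3) m)} (hξ : IsContact ξ)
    (hV₀ : ContMDiff (𝓡 3) (𝓡 3).tangent ∞ (fun m => (⟨m, V₀ m⟩ : TangentBundle (𝓡 3) M)))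
    (hV₁ : ContMDiff (𝓡 3) (𝓡 3).tangent ∞ (fun m => (⟨m, V₁ m⟩ : TangentBundle (𝓡 3) M)))
    (hξ₀ : ∀ m, V₀ m ∈ ξ m) (hξ₁ : ∀ m, V₁ m ∈ ξ m)
    (hV : LinearIndependent ℝ ![V₀ m, V₁ m]) (h : IsLocalChart (𝓡 3) P Q m) :
    det3 (coordField (𝓡 3) P Q V₀ (P m)) (coordField (𝓡 3) P Q V₁ (P m))
      (lieBracket ℝ (coordField (𝓡 3) P Q V₀) (coordField (𝓡 3) P Q V₁) (P m)) ≠ 0 := by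
  obtain ⟨X, Y, O, hO, hm, hX, hY, hspan, hind⟩ := hξ m
  have hX' := h.smoothNear_coordField (V := X) (eventually_of_mem (hO.mem_nhds hm) fun m' hm' =>
    hX.contMDiffAt (hO.mem_nhds hm'))
  have hY' := h.smoothNear_coordField (V := Y) (eventually_of_mem (hO.mem_nhds hm) fun m' hm' =>
    hY.contMDiffAt (hO.mem_nhds hm'))
  have hA := h.smoothNear_coordField (Eventually.of_forall fun m' => hV₀ m')
  have hB := h.smoothNear_coordField (Eventually.of_forall fun m' => hV₁ m')
  have hs : ∀ {V : (m : M) → TangentSpace (𝓡 3) m}, (∀ m, V m ∈ ξ m) → ∀ᶠ z in 𝓝 (P m), ∃ α β : ℝ,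
      coordField (𝓡 3) P Q V z = α • coordField (𝓡 3) P Q X z + β • coordField (𝓡 3) P Q Y z := by
    intro V hV
    filter_upwards [h.tendsto_inv.eventually (hO.mem_nhds hm)] with z hz
    have := hV (Q z)
    rw [hspan _ hz, Submodule.mem_span_pair] at this
    obtain ⟨α, β, h'⟩ := this
    refine ⟨α, β, ?_⟩
    rw [coordField, ← h', map_add, map_smul, map_smul]
    rfl
  refine det3_bracket_ne_zero hA.differentiableAt hB.differentiableAt hX'.differentiableAt
    hY'.differentiableAt (hs hξ₀) (hs hξ₁) ?_ ?_
  · have hbr := h.mfderiv_mlieBracket hX'.contDiffAt hY'.contDiffAt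
      (h.eventually.mono fun m' h' => h'.coordField_apply X)
      (h.eventually.mono fun m' h' => h'.coordField_apply Y)
    have h1 : LinearIndependent ℝ ![coordField (𝓡 3) P Q X (P m), coordField (𝓡 3) P Q Y (P m),
        lieBracket ℝ (coordField (𝓡 3) P Q X) (coordField (𝓡 3) P Q Y) (P m)] := by
      rw [← h.coordField_apply X, ← h.coordField_apply Y, ← hbr]
      exact linearIndependent_map_three h.derivEquiv hind
    exact (linearIndependent_iff_det3 _ _ _).1 h1
  · rw [← h.coordField_apply V₀, ← h.coordField_apply V₁]
    exact linearIndependent_map_two h.derivEquiv hV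

theorem exists_isLocalChart (m : M) : ∃ (P : M → Jet) (Q : Jet → M), IsLocalChart (𝓡 3) P Q m := by
  have e : E3 ≃L[ℝ] Jet := ContinuousLinearEquiv.ofFinrankEq (by simp)
  exact ⟨_, _, (isLocalChart_extChartAt m).comp (T := e) (T' := e.symm) (e.contDiff.smoothNear _)
    (e.symm.contDiff.smoothNear _) (Eventually.of_forall fun z => e.symm_apply_apply z)
    (Eventually.of_forall fun z => e.apply_symm_apply z)⟩

theorem smul_left_eq (a : ℝ) : a • ((0, 0, 1) : Jet) = (0, 0, a) := by simp

theorem smul_right_eq (b p f : ℝ) : b • ((1, p, f) : Jet) = (b, b * p, b * f) := by simp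

theorem eq_smul_left {w : Jet} {a : ℝ} (h : w = a • (0, 0, 1)) : w = w.2.2 • (0, 0, 1) := by
  rw [h]; simp

theorem eq_smul_right {w : Jet} {b p f : ℝ} (h : w = b • (1, p, f)) : w = w.1 • (1, p, f) := by
  rw [h]; simp

/-- Coordinates `χ`, with inverse `ι`, in which `V₀ = a ∂/∂p` and
`V₁ = b (∂/∂x + p ∂/∂y + f ∂/∂p)`. -/
structure IsNormalChart (V₀ V₁ : (m : M) → TangentSpace (𝓡 3) m) (χ : M → Jet) (ι : Jet → M)
    (f a b : Jet → ℝ) (m : M) : Prop where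
  chart : IsLocalChart (𝓡 3) χ ι m
  smooth_rhs : SmoothNear f (χ m)
  smooth_left : SmoothNear a (χ m)
  smooth_right : SmoothNear b (χ m)
  pos_left : 0 < a (χ m)
  pos_right : 0 < b (χ m)
  left_eq : ∀ᶠ m' in 𝓝 m, (mfderiv (𝓡 3) 𝓘(ℝ, Jet) χ m' (V₀ m') : Jet) = a (χ m') • (0, 0, 1)
  right_eq : ∀ᶠ m' in 𝓝 m, (mfderiv (𝓡 3) 𝓘(ℝ, Jet) χ m' (V₁ m') : Jet) =
    b (χ m') • (1, (χ m').2.2, f (χ m'))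

theorem IsNormalChart.eventually
    (h : IsNormalChart V₀ V₁ χ ι f a b m) : ∀ᶠ m' in 𝓝 m, IsNormalChart V₀ V₁ χ ι f a b m' := by
  have hc := h.chart.continuousAt
  filter_upwards [h.chart.eventually, hc.eventually h.smooth_rhs.eventually_nhds,
    hc.eventually h.smooth_left.eventually_nhds, hc.eventually h.smooth_right.eventually_nhds,
    hc.eventually (h.smooth_left.continuousAt.eventually (lt_mem_nhds h.pos_left)),
    hc.eventually (h.smooth_right.continuousAt.eventually (lt_mem_nhds h.pos_right)),
    h.left_eq.eventually_nhds, h.right_eq.eventually_nhds] with m' h1 h2 h3 h4 h5 h6 h7 h8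
  exact ⟨h1, h2, h3, h4, h5, h6, h7, h8⟩

theorem IsNormalChart.at_zero
    (h : IsNormalChart V₀ V₁ χ ι f a b m) (h0 : χ m = 0) : SmoothNear a 0 ∧ SmoothNear b 0 ∧
      0 < a 0 ∧ 0 < b 0 ∧ SmoothNear f 0 :=
  h0 ▸ ⟨h.smooth_left, h.smooth_right, h.pos_left, h.pos_right, h.smooth_rhs⟩

theorem IsNormalForm.exists_isNormalChart
    (hV₀ : ContMDiff (𝓡 3) (𝓡 3).tangent ∞ (fun m => (⟨m, V₀ m⟩ : TangentBundle (𝓡 3) M)))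
    (hV₁ : ContMDiff (𝓡 3) (𝓡 3).tangent ∞ (fun m => (⟨m, V₁ m⟩ : TangentBundle (𝓡 3) M)))
    {χ : M → Jet} {f : Jet → ℝ} (h : IsNormalForm V₀ V₁ m χ f) :
    ∃ (ι : Jet → M) (a b : Jet → ℝ), IsNormalChart V₀ V₁ χ ι f a b m := by
  obtain ⟨⟨O, hO, hmO, hχ⟩, hχ0, hbij, ⟨O', hO', h0, hf⟩, hev⟩ := h
  obtain ⟨P, Q, hPQ⟩ := exists_isLocalChart m
  obtain ⟨ι, hι⟩ := hPQ.exists_of_bijective (P' := χ) (eventually_of_mem (hO.mem_nhds hmO) fun m' hm' =>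
    hχ.contMDiffAt (hO.mem_nhds hm')) hbij
  have h₀ := hι.smoothNear_coordField (Eventually.of_forall fun m' => hV₀ m')
  have h₁ := hι.smoothNear_coordField (Eventually.of_forall fun m' => hV₁ m')
  have key : ∀ᶠ m' in 𝓝 m, (∃ a : ℝ, 0 < a ∧ coordField (𝓡 3) χ ι V₀ (χ m') = a • ((0, 0, 1) : Jet)) ∧
      ∃ b : ℝ, 0 < b ∧ coordField (𝓡 3) χ ι V₁ (χ m') = b • ((1, (χ m').2.2, f (χ m')) : Jet) := by
    filter_upwards [hev, hι.eventually] with m' h1 h2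
    rw [← h2.coordField_apply, ← h2.coordField_apply]
    exact h1
  refine ⟨ι, fun z => (coordField (𝓡 3) χ ι V₀ z).2.2, fun z => (coordField (𝓡 3) χ ι V₁ z).1, hι,
    smoothNear_of_contDiffOn hO' hf (by rwa [hχ0]), h₀.snd.snd, h₁.fst, ?_, ?_, ?_, ?_⟩
  · obtain ⟨⟨a, ha, h⟩, -⟩ := key.self_of_nhds
    rw [h]; simpa using ha
  · obtain ⟨-, b, hb, h⟩ := key.self_of_nhds
    rw [h]; simpa using hb
  · filter_upwards [key, hι.eventually] with m' ⟨⟨a, ha, h⟩, _⟩ h2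
    exact (h2.coordField_apply V₀).trans (eq_smul_left h)
  · filter_upwards [key, hι.eventually] with m' ⟨_, b, hb, h⟩ h2
    exact (h2.coordField_apply V₁).trans (eq_smul_right h)

theorem IsNormalChart.isNormalForm
    (h : IsNormalChart V₀ V₁ χ ι f a b m) (h0 : χ m = 0) : IsNormalForm V₀ V₁ m χ f := by
  obtain ⟨O, hO, hO1, hO2⟩ := eventually_nhds_iff.1 h.chart.smooth
  obtain ⟨O', hO'1, hO'2, hO'3⟩ := h.smooth_rhs.exists_isOpen
  rw [h0] at hO'2
  refine ⟨⟨O, hO1, hO2, fun m' hm' => (hO m' hm').contMDiffWithinAt⟩, h0,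
    h.chart.derivEquiv.bijective, ⟨O', hO'1, hO'2, hO'3⟩, ?_⟩
  filter_upwards [h.eventually] with m' h'
  exact ⟨⟨_, h'.pos_left, h'.left_eq.self_of_nhds⟩, ⟨_, h'.pos_right, h'.right_eq.self_of_nhds⟩⟩

theorem IsLocalChart.mfderiv_comp {F' : Type*} [NormedAddCommGroup F'] [NormedSpace ℝ F']
    (h : IsLocalChart (𝓡 3) P Q m) {T : Jet → F'}
    (hT : DifferentiableAt ℝ T (P m)) (v : E3) :
    (mfderiv (𝓡 3) 𝓘(ℝ, F') (fun m => T (P m)) m v : F') =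
      fderiv ℝ T (P m) (mfderiv (𝓡 3) 𝓘(ℝ, Jet) P m v : Jet) := by
  have e := _root_.mfderiv_comp m (g := T) hT.mdifferentiableAt h.mdifferentiableAt
  rw [mfderiv_eq_fderiv] at e
  exact congrArg (fun A : E3 →L[ℝ] F' => A v) e

theorem exists_isNormalChart {ξ : (m : M) → Submodule ℝ (TangentSpace (𝓡 3) m)} (hξ : IsContact ξ)
    (hV₀ : ContMDiff (𝓡 3) (𝓡 3).tangent ∞ (fun m => (⟨m, V₀ m⟩ : TangentBundle (𝓡 3) M)))
    (hV₁ : ContMDiff (𝓡 3) (𝓡 3).tangent ∞ (fun m => (⟨m, V₁ m⟩ : TangentBundle (𝓡 3) M)))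
    (hξ₀ : ∀ m, V₀ m ∈ ξ m) (hξ₁ : ∀ m, V₁ m ∈ ξ m)
    (hV : ∀ m, LinearIndependent ℝ ![V₀ m, V₁ m]) (m : M) :
    ∃ (χ : M → Jet) (ι : Jet → M) (f a b : Jet → ℝ), IsNormalChart V₀ V₁ χ ι f a b m ∧ χ m = 0 ∧
      f 0 = 0 := by
  obtain ⟨P, Q, hPQ⟩ := exists_isLocalChart m
  have h₀ := hPQ.smoothNear_coordField (Eventually.of_forall fun m' => hV₀ m')
  have h₁ := hPQ.smoothNear_coordField (Eventually.of_forall fun m' => hV₁ m')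
  have hdet := hξ.det3_ne_zero hV₀ hV₁ hξ₀ hξ₁ (hV m) hPQ
  set A := coordField (𝓡 3) P Q V₀ with hA
  set B := coordField (𝓡 3) P Q V₁ with hB
  have lift : ∀ {G : Jet → Jet}, SmoothNear G (P m) → SmoothNear (fun q : TJet => G q.2) (0, P m) :=
    fun h => h.comp_of_eq (contDiff_snd.smoothNear _) rfl
  have dlift : ∀ {G : Jet → Jet}, SmoothNear G (P m) → ∀ v,
      fderiv ℝ (fun q : TJet => G q.2) (0, P m) (0, v) = fderiv ℝ G (P m) v := fun {G} h v => by
    rw [fderiv_comp_apply' (g := G) (f := fun q : TJet => q.2) h.differentiableAt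
      differentiableAt_snd, fderiv_snd]; rfl
  obtain ⟨κ, hκ, hκ0, hinj, hst⟩ := exists_straightening (E := Jet) (by simp) (lift h₀) (lift h₁) (by
    rw [dlift h₀, dlift h₁]
    rw [lieBracket_eq] at hdet
    exact (linearIndependent_iff_det3 _ _ _).2 hdet)
  have hsl : Tendsto (fun z : Jet => ((0 : ℝ), z)) (𝓝 (P m)) (𝓝 (0, P m)) := tendsto_slice (0 : ℝ) (P m)
  set T : Jet → Jet := fun z => κ (0, z) with hT
  have Ts : SmoothNear T (P m) := hκ.comp_of_eq (f := fun z : Jet => ((0 : ℝ), z))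
    (ContDiff.smoothNear (by fun_prop) _) rfl
  have Td : ∀ᶠ z in 𝓝 (P m), ∀ v, fderiv ℝ T z v = fderiv ℝ κ (0, z) (0, v) := by
    filter_upwards [hsl.eventually hκ] with z hz v
    exact fderiv_slice (hz.diffAt) v
  have Tinj : Function.Bijective (fderiv ℝ T (P m)) := by
    refine bijective_of_injective ?_
    intro v w hvw
    rw [Td.self_of_nhds, Td.self_of_nhds] at hvw
    exact hinj hvw
  obtain ⟨T', hT', hT'0, hl, hr⟩ := Ts.exists_local_inverse_of_bijective Tinj
  have hχ₁ := hPQ.comp Ts hT' hl hr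
  -- the derivative of `V₁` along the straightened coordinates
  set D : Jet → Jet := fun z => fderiv ℝ T (T' z) (B (T' z)) with hD
  have T0 : T (P m) = 0 := hκ0
  rw [T0] at hT' hT'0
  have Ds : SmoothNear D 0 := by
    have : SmoothNear (fun z => fderiv ℝ T z (B z)) (P m) := Ts.fderiv_apply h₁
    exact this.comp_of_eq hT' hT'0
  have D0 : 0 < (D 0).1 := by
    simp only [hD, hT'0]
    rw [Td.self_of_nhds]
    exact hst.self_of_nhds.2.2.2.1
  set f₁ : Jet → ℝ := fun z => (D z).2.2 / (D z).1 with hf₁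
  have f₁s : SmoothNear f₁ 0 := Ds.snd.snd.div Ds.fst D0.ne'
  -- the shear that normalizes `f 0`
  set c := f₁ 0 with hc
  set S : Jet → Jet := fun z => (z.1, z.2.1 - c * (z.1 * z.1) / 2, z.2.2 - c * z.1) with hS
  set S' : Jet → Jet := fun z => (z.1, z.2.1 + c * (z.1 * z.1) / 2, z.2.2 + c * z.1) with hS'
  have Ss : ContDiff ℝ ∞ S := by simp only [hS]; fun_prop
  have Ss' : ContDiff ℝ ∞ S' := by simp only [hS']; fun_prop
  have Sd : ∀ z v, fderiv ℝ S z v = (v.1, v.2.1 - c * z.1 * v.1, v.2.2 - c * v.1) := by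
    intro z v
    have e1 : HasFDerivAt (fun z : Jet => z.1) (ContinuousLinearMap.fst ℝ ℝ (ℝ × ℝ)) z := hasFDerivAt_fst
    have e2 : HasFDerivAt (fun z : Jet => z.2.1) ((ContinuousLinearMap.fst ℝ ℝ ℝ).comp
      (ContinuousLinearMap.snd ℝ ℝ (ℝ × ℝ))) z := hasFDerivAt_fst.comp z hasFDerivAt_snd
    have e3 : HasFDerivAt (fun z : Jet => z.2.2) ((ContinuousLinearMap.snd ℝ ℝ ℝ).comp
      (ContinuousLinearMap.snd ℝ ℝ (ℝ × ℝ))) z := hasFDerivAt_snd.comp z hasFDerivAt_snd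
    have e : HasFDerivAt S _ z := e1.prodMk ((e2.sub (((e1.mul e1).const_mul c).mul_const (2 : ℝ)⁻¹)).prodMk
      (e3.sub (e1.const_mul c)))
    rw [e.fderiv]
    refine Prod.ext rfl (Prod.ext ?_ ?_)
    · simp; ring
    · simp
  have hχ := hχ₁.comp (T := S) (T' := S') (Ss.smoothNear _) (Ss'.smoothNear _)
    (Eventually.of_forall fun z => by simp [hS, hS']) (Eventually.of_forall fun z => by simp [hS, hS'])
  have S0 : S 0 = 0 := by simp [hS]
  have S'0 : S' 0 = 0 := by simp [hS']
  have hχ0 : S (T (P m)) = 0 := by rw [T0, S0]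
  set a : Jet → ℝ := fun z => (fderiv ℝ T (T' (S' z)) (A (T' (S' z)))).2.2 with ha
  have hd : ∀ᶠ m' in 𝓝 m, ∀ v (w : Jet), (mfderiv (𝓡 3) 𝓘(ℝ, Jet) P m' v : Jet) = w →
      (mfderiv (𝓡 3) 𝓘(ℝ, Jet) (fun m => S (T (P m))) m' v : Jet) =
        fderiv ℝ S (T (P m')) (fderiv ℝ κ (0, P m') (0, w)) := by
    filter_upwards [hPQ.eventually, hχ₁.eventually, hPQ.continuousAt.eventually Ts,
      hPQ.continuousAt.eventually Td] with m' h1 h2 h3 h4 v w hw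
    refine (h2.mfderiv_comp (Ss.differentiable (by simp) _) v).trans
      (congrArg (fderiv ℝ S (T (P m'))) ?_)
    exact (h1.mfderiv_comp (h3.diffAt) v).trans
      ((congrArg (fderiv ℝ T (P m')) hw).trans (h4 _))
  have back : ∀ᶠ m' in 𝓝 m, T' (S' (S (T (P m')))) = P m' := by
    filter_upwards [hPQ.continuousAt.eventually hl] with m' h1
    rw [show S' (S (T (P m'))) = T (P m') by simp [hS, hS'], h1]
  have hstm : ∀ᶠ m' in 𝓝 m, Straightens κ (fun q => A q.2) (fun q => B q.2) (0, P m') :=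
    (hsl.comp hPQ.continuousAt.tendsto).eventually hst
  refine ⟨fun m => S (T (P m)), _, fun z => f₁ (S' z) - c, a, fun z => (D (S' z)).1,
    ⟨hχ, ?_, ?_, ?_, ?_, ?_, ?_, ?_⟩, hχ0, by simp [S'0, hc]⟩
  · rw [hχ0]
    exact (f₁s.comp_of_eq (Ss'.smoothNear _) S'0).sub (contDiff_const.smoothNear _)
  · rw [hχ0]
    have : SmoothNear (fun z => fderiv ℝ T z (A z)) (P m) := Ts.fderiv_apply h₀
    exact ((this.comp_of_eq hT' hT'0).comp_of_eq (Ss'.smoothNear _) S'0).snd.snd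
  · rw [hχ0]
    exact (Ds.comp_of_eq (Ss'.smoothNear _) S'0).fst
  · simp only [ha, hχ0, S'0, hT'0]
    rw [Td.self_of_nhds]
    exact hst.self_of_nhds.2.2.1
  · simp only [hχ0, S'0]; exact D0
  · filter_upwards [hd, back, hstm, hPQ.continuousAt.eventually Td, hPQ.eventually] with m' h1 h2 h3 h4 h5
    refine (h1 (V₀ m') _ (h5.coordField_apply V₀)).trans ?_
    rw [Sd]
    simp only [ha, h2, h4]
    obtain ⟨k1, k2, -⟩ := h3
    change (fderiv ℝ κ (0, P m') (0, A (P m'))).1 = 0 at k1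
    change (fderiv ℝ κ (0, P m') (0, A (P m'))).2.1 = 0 at k2
    simp only [← hA]
    rw [k1, k2]
    refine .trans ?_ (smul_left_eq _).symm
    simp only [mul_zero, sub_zero]
    rfl
  · filter_upwards [hd, back, hstm, hPQ.continuousAt.eventually Td, hPQ.eventually,
      hPQ.continuousAt.eventually hl] with m' h1 h2 h3 h4 h5 h6
    have h7 : S' (S (T (P m'))) = T (P m') := by simp [hS, hS']
    obtain ⟨-, -, -, k4, k5⟩ := h3
    refine (h1 (V₁ m') _ (h5.coordField_apply V₁)).trans ?_
    rw [Sd, h7]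
    simp only [hf₁, hD, h6, h4]
    change 0 < (fderiv ℝ κ (0, P m') (0, B (P m'))).1 at k4
    change (fderiv ℝ κ (0, P m') (0, B (P m'))).2.1 = (T (P m')).2.2 * _ at k5
    simp only [← hB]
    rw [k5]
    refine .trans ?_ (smul_right_eq _ _ _).symm
    refine Prod.ext rfl (Prod.ext ?_ ?_)
    · simp only [hS]; ring
    · have := k4.ne'
      simp only
      field_simp

theorem projEquivGerm_of_jetMap {Φ : Jet → Jet} {f f' : Jet → ℝ} (hΦ : SmoothNear Φ 0) (h0 : Φ 0 = 0)
    (hinj : Function.Injective (fderiv ℝ Φ 0))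
    (hv : ∀ᶠ z in 𝓝 (0 : Jet), (fderiv ℝ Φ z (0, 0, 1)).1 = 0 ∧ (fderiv ℝ Φ z (0, 0, 1)).2.1 = 0)
    (hf : ∀ᶠ z in 𝓝 (0 : Jet), ∃ β : ℝ, 0 < β ∧
      fderiv ℝ Φ z (1, z.2.2, f z) = β • ((1, (Φ z).2.2, f' (Φ z)) : Jet)) : ProjEquivGerm f f' := by
  set B : ℝ × ℝ → Jet := fun w => (w.1, w.2, 0) with hB
  have hdiff : ∀ᶠ z in 𝓝 (0 : Jet), DifferentiableAt ℝ Φ z :=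
    hΦ.mono fun z hz => hz.diffAt
  have hconst := eventually_eq_of_vertical (hdiff.and hv)
  have hΦB : SmoothNear (fun w => Φ (B w)) 0 :=
    hΦ.comp_of_eq (ContDiff.smoothNear (by simp only [hB]; fun_prop) _) rfl
  obtain ⟨O, hO, h0O, hsm⟩ := (hΦB.fst.prodMk hΦB.snd.fst).exists_isOpen
  have hBd : ∀ w, HasFDerivAt B ((ContinuousLinearMap.fst ℝ ℝ ℝ).prod
      ((ContinuousLinearMap.snd ℝ ℝ ℝ).prod 0)) w := fun w =>
    hasFDerivAt_fst.prodMk (hasFDerivAt_snd.prodMk (hasFDerivAt_const _ _))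
  have hcd : ∀ w, fderiv ℝ (fun w => Φ (B w)) 0 w = fderiv ℝ Φ 0 (w.1, w.2, 0) := by
    intro w
    have e : HasFDerivAt (fun w => Φ (B w)) _ 0 :=
      HasFDerivAt.comp (g := Φ) (f := B) 0 (hdiff.self_of_nhds.hasFDerivAt) (hBd 0)
    rw [e.fderiv]; rfl
  have hgd : ∀ w, fderiv ℝ (fun w => ((Φ (B w)).1, (Φ (B w)).2.1)) 0 w =
      ((fderiv ℝ Φ 0 (w.1, w.2, 0)).1, (fderiv ℝ Φ 0 (w.1, w.2, 0)).2.1) := by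
    intro w
    have e := hΦB.hasFDerivAt
    have e' : HasFDerivAt (fun w => ((Φ (B w)).1, (Φ (B w)).2.1)) _ 0 := e.fst.prodMk e.snd.fst
    rw [e'.fderiv, ← hcd]; rfl
  obtain ⟨hv1, hv2⟩ := hv.self_of_nhds
  obtain ⟨β, hβ, hfd⟩ := hf.self_of_nhds
  have e3 : fderiv ℝ Φ 0 (0, 0, 1) = (0, 0, (fderiv ℝ Φ 0 (0, 0, 1)).2.2) :=
    Prod.ext hv1 (Prod.ext hv2 rfl)
  set c := (fderiv ℝ Φ 0 (0, 0, 1)).2.2 with hc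
  have hc0 : c ≠ 0 := by
    intro h
    rw [h] at e3
    have := hinj (e3.trans (map_zero (fderiv ℝ Φ 0)).symm)
    simp at this
  refine ⟨fun w => ((Φ (B w)).1, (Φ (B w)).2.1), ⟨O, hO, h0O, hsm⟩, ?_, ?_, ⟨β, hβ, ?_⟩, ?_⟩
  · have : B 0 = 0 := rfl
    simp [this, h0]
  · refine bijective_of_injective ?_
    rw [injective_iff_map_eq_zero]
    rintro ⟨w1, w2⟩ hw
    rw [hgd, Prod.mk_eq_zero] at hw
    set s := (fderiv ℝ Φ 0 (w1, w2, 0)).2.2 with hs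
    have h1 : fderiv ℝ Φ 0 (w1, w2, 0) = (0, 0, s) := Prod.ext hw.1 (Prod.ext hw.2 rfl)
    have h2 : fderiv ℝ Φ 0 ((w1, w2, 0) - (s / c) • (0, 0, 1)) = 0 := by
      rw [map_sub, map_smul, h1, e3]
      simp [hc0]
    have h3 := hinj (h2.trans (map_zero (fderiv ℝ Φ 0)).symm)
    simp only [Prod.smul_mk, Prod.mk_sub_mk, Prod.mk_eq_zero] at h3
    simpa using And.intro h3.1 h3.2.1
  · have h1 : ((1, 0, 0) : Jet) = (1, 0, f 0) - f 0 • (0, 0, 1) := by simp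
    rw [hgd]
    simp only
    rw [h1, map_sub, map_smul, e3]
    have : ((1, (0 : Jet).2.2, f 0) : Jet) = (1, 0, f 0) := rfl
    rw [this] at hfd
    rw [hfd, h0]
    simp
  · have hbd : ∀ᶠ z in 𝓝 (0 : Jet), |(Φ z).1| < 1 := by
      refine hΦ.fst.continuousAt.abs.eventually (gt_mem_nhds ?_)
      simp [h0]
    obtain ⟨N, hN, hN'⟩ := (((hdiff.and hconst).and (hf.and hbd))).exists_mem
    refine ⟨N, hN, mapsSolutions_of_jetMap (Φ := Φ) (fun z hz => (hN' z hz).1.1) (fun z hz => ?_)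
      (fun z hz => (hN' z hz).2.1) ⟨1, fun z hz => (hN' z hz).2.2.le⟩⟩
    exact Prod.ext (hN' z hz).1.2.1 (hN' z hz).1.2.2

theorem IsNormalChart.eq_rhs
    (h : IsNormalChart V₀ V₁ χ ι f a b m) :
    ∀ᶠ z in 𝓝 (χ m), IsNormalChart V₀ V₁ χ ι f a b (ι z) ∧ χ (ι z) = z :=
  (h.chart.tendsto_inv.eventually h.eventually).and h.chart.right

theorem IsNormalChart.projEquivGerm {χ χ' : M → Jet} {ι ι' : Jet → M} {f a b f' a' b' : Jet → ℝ}
    (h : IsNormalChart V₀ V₁ χ ι f a b m) (h' : IsNormalChart V₀ V₁ χ' ι' f' a' b' m)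
    (h0 : χ m = 0) (h0' : χ' m = 0) : ProjEquivGerm f f' := by
  have hd : ∀ᶠ z in 𝓝 (0 : Jet), ∀ v : E3,
      fderiv ℝ (fun z => χ' (ι z)) z (mfderiv (𝓡 3) 𝓘(ℝ, Jet) χ (ι z) v : Jet) =
        (mfderiv (𝓡 3) 𝓘(ℝ, Jet) χ' (ι z) v : Jet) := by
    rw [← h0]
    filter_upwards [h.eq_rhs, h.chart.tendsto_inv.eventually h'.eventually] with z h1 h2 v
    have := h1.1.chart.fderiv_comp_inv_mfderiv h2.chart.mdifferentiableAt v
    rwa [h1.2] at this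
  have hev : ∀ᶠ z in 𝓝 (0 : Jet), (IsNormalChart V₀ V₁ χ ι f a b (ι z) ∧ χ (ι z) = z) ∧
      IsNormalChart V₀ V₁ χ' ι' f' a' b' (ι z) := by
    rw [← h0]
    exact h.eq_rhs.and (h.chart.tendsto_inv.eventually h'.eventually)
  have hι0 : ι 0 = m := h0 ▸ h.chart.inv_apply
  refine projEquivGerm_of_jetMap (Φ := fun z => χ' (ι z)) ?_ ?_ ?_ ?_ ?_
  · rw [← h0]
    exact h.chart.smoothNear_comp_inv h'.chart.smooth
  · simp only [hι0, h0']
  · rw [injective_iff_map_eq_zero]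
    intro w hw
    obtain ⟨v, hv⟩ := hev.self_of_nhds.1.1.chart.derivEquiv.surjective w
    replace hv : (mfderiv (𝓡 3) 𝓘(ℝ, Jet) χ (ι 0) v : Jet) = w := hv
    have e := hd.self_of_nhds v
    rw [hv, hw] at e
    have : v = 0 := hev.self_of_nhds.2.chart.derivEquiv.injective
      (e.symm.trans (map_zero hev.self_of_nhds.2.chart.derivEquiv).symm)
    rw [← hv, this]
    exact map_zero (hev.self_of_nhds.1.1.chart.derivEquiv)
  · filter_upwards [hev, hd] with z ⟨⟨h1, h2⟩, h3⟩ h4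
    have e := h4 (V₀ (ι z))
    have e1 : (mfderiv (𝓡 3) 𝓘(ℝ, Jet) χ (ι z) (V₀ (ι z)) : Jet) = a z • (0, 0, 1) :=
      h1.left_eq.self_of_nhds.trans (by rw [h2])
    have e2 : (mfderiv (𝓡 3) 𝓘(ℝ, Jet) χ' (ι z) (V₀ (ι z)) : Jet) = a' (χ' (ι z)) • (0, 0, 1) :=
      h3.left_eq.self_of_nhds
    replace e : fderiv ℝ (fun z => χ' (ι z)) z (a z • (0, 0, 1)) = a' (χ' (ι z)) • (0, 0, 1) :=
      (congrArg (fderiv ℝ (fun z => χ' (ι z)) z) e1.symm).trans (e.trans e2)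
    rw [map_smul] at e
    have hpos : 0 < a z := h2 ▸ h1.pos_left
    constructor
    · have := congrArg (fun w : Jet => w.1) e
      simpa [hpos.ne'] using this
    · have := congrArg (fun w : Jet => w.2.1) e
      simpa [hpos.ne'] using this
  · filter_upwards [hev, hd] with z ⟨⟨h1, h2⟩, h3⟩ h4
    have e := h4 (V₁ (ι z))
    have e1 : (mfderiv (𝓡 3) 𝓘(ℝ, Jet) χ (ι z) (V₁ (ι z)) : Jet) = b z • (1, z.2.2, f z) :=
      h1.right_eq.self_of_nhds.trans (by rw [h2])
    have e2 : (mfderiv (𝓡 3) 𝓘(ℝ, Jet) χ' (ι z) (V₁ (ι z)) : Jet) =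
      b' (χ' (ι z)) • (1, (χ' (ι z)).2.2, f' (χ' (ι z))) := h3.right_eq.self_of_nhds
    replace e : fderiv ℝ (fun z => χ' (ι z)) z (b z • (1, z.2.2, f z)) =
        b' (χ' (ι z)) • (1, (χ' (ι z)).2.2, f' (χ' (ι z))) :=
      (congrArg (fderiv ℝ (fun z => χ' (ι z)) z) e1.symm).trans (e.trans e2)
    rw [map_smul] at e
    have hpos : 0 < b z := h2 ▸ h1.pos_right
    refine ⟨(b z)⁻¹ * b' (χ' (ι z)), mul_pos (inv_pos.2 hpos) h3.pos_right, ?_⟩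
    rw [mul_smul, ← e, inv_smul_smul₀ hpos.ne']

theorem IsNormalChart.hasMFDerivAt_curve (h : IsNormalChart V₀ V₁ χ ι f a b m) {c : ℝ → Jet} {τ : ℝ}
    (hcτ : χ m = c τ) (hc : HasDerivAt c (b (c τ) • ((1, (c τ).2.2, f (c τ)) : Jet)) τ) :
    HasMFDerivAt 𝓘(ℝ, ℝ) (𝓡 3) (fun τ => ι (c τ)) τ
      ((1 : ℝ →L[ℝ] ℝ).smulRight (V₁ (ι (c τ)))) := by
  have h1 : MDifferentiableAt 𝓘(ℝ, Jet) (𝓡 3) ι (c τ) := hcτ ▸ h.chart.mdifferentiableAt_inv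
  have h2 : HasMFDerivAt 𝓘(ℝ, ℝ) 𝓘(ℝ, Jet) c τ _ := hc.hasFDerivAt.hasMFDerivAt
  have h3 : ι (c τ) = m := hcτ ▸ h.chart.inv_apply
  have key : (mfderiv 𝓘(ℝ, Jet) (𝓡 3) ι (c τ) (b (c τ) • ((1, (c τ).2.2, f (c τ)) : Jet)) :
      E3) = V₁ (ι (c τ)) := by
    have e := h.chart.mfderiv_inv_mfderiv (V₁ m)
    have e2 := (congrArg (fun w : Jet => (mfderiv 𝓘(ℝ, Jet) (𝓡 3) ι (χ m) w : E3))
      h.right_eq.self_of_nhds).symm.trans e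
    have e3 : (V₁ m : E3) = V₁ (ι (c τ)) := by rw [h3]
    rw [← hcτ]
    rw [← hcτ] at e3
    exact e2.trans e3
  refine (h1.hasMFDerivAt.comp τ h2).congr_mfderiv ?_
  refine ContinuousLinearMap.ext fun (s : ℝ) => ?_
  have e4 : (mfderiv 𝓘(ℝ, Jet) (𝓡 3) ι (c τ) (s • (b (c τ) • ((1, (c τ).2.2, f (c τ)) : Jet)) : Jet) :
      E3) = s • (V₁ (ι (c τ)) : E3) :=
    ((mfderiv 𝓘(ℝ, Jet) (𝓡 3) ι (c τ)).map_smul s _).trans (congrArg (s • ·) key)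
  exact e4

theorem IsNormalChart.hasDerivAt_curve {γ : ℝ → M} {τ : ℝ}
    (h : IsNormalChart V₀ V₁ χ ι f a b (γ τ))
    (hγ : HasMFDerivAt 𝓘(ℝ, ℝ) (𝓡 3) γ τ ((1 : ℝ →L[ℝ] ℝ).smulRight (V₁ (γ τ)))) :
    HasDerivAt (fun τ => χ (γ τ)) (b (χ (γ τ)) • ((1, (χ (γ τ)).2.2, f (χ (γ τ))) : Jet)) τ := by
  obtain ⟨L, hL⟩ : ∃ L : E3 →L[ℝ] Jet, L = mfderiv (𝓡 3) 𝓘(ℝ, Jet) χ (γ τ) :=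
    ⟨_, rfl⟩
  obtain ⟨v, hv⟩ : ∃ v : E3, v = V₁ (γ τ) := ⟨_, rfl⟩
  have h1 : HasFDerivAt (fun τ => χ (γ τ)) (L.comp ((1 : ℝ →L[ℝ] ℝ).smulRight v)) τ := by
    rw [hL, hv]
    exact (h.chart.mdifferentiableAt.hasMFDerivAt.comp τ hγ).hasFDerivAt
  have h2 : L v = b (χ (γ τ)) • ((1, (χ (γ τ)).2.2, f (χ (γ τ))) : Jet) := by
    rw [hL, hv]
    exact h.right_eq.self_of_nhds
  refine h1.hasDerivAt.congr_deriv ?_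
  rw [← h2]
  exact congrArg L (one_smul ℝ v)

theorem exists_integralCurve_of_solution {u : ℝ → ℝ} {c d C : ℝ} (hu : IsSolutionOn f u c d)
    (hN : ∀ x ∈ Ioo c d, ∀ z : Jet, z = (x, u x, deriv u x) →
      |z.1| ≤ 1 ∧ 0 < b z ∧ |(b z)⁻¹| ≤ C ∧ ContinuousAt b z ∧
        IsNormalChart V₀ V₁ χ ι f a b (ι z) ∧ χ (ι z) = z) :
    ∃ (g : ℝ → ℝ) (c' d' : ℝ), IsMIntegralCurveOn (fun τ => ι (g τ, u (g τ), deriv u (g τ))) V₁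
      (Ioo c' d') ∧ (∀ τ ∈ Ioo c' d', g τ ∈ Ioo c d) ∧
      (fun τ => ((χ (ι (g τ, u (g τ), deriv u (g τ)))).1,
        (χ (ι (g τ, u (g τ), deriv u (g τ)))).2.1)) '' Ioo c' d' = graphOn u c d := by
  set j : ℝ → Jet := fun x => (x, u x, deriv u x) with hj
  have hjd : ∀ x ∈ Ioo c d, HasDerivAt j (1, deriv u x, f (j x)) x := fun x hx => hu.hasDerivAt_jet hx
  set k : ℝ → ℝ := fun x => (b (j x))⁻¹ with hk
  have hkc : ∀ x ∈ Ioo c d, ContinuousAt k x := fun x hx => by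
    obtain ⟨-, h2, -, h4, -⟩ := hN x hx _ rfl
    exact (ContinuousAt.comp (g := b) (f := j) h4 (hjd x hx).continuousAt).inv₀ h2.ne'
  set x₀ := (c + d) / 2 with hx₀
  have hsub : ∀ x ∈ Ioo c d, x₀ ∈ Ioo c d ∧ uIcc x₀ x ⊆ Ioo c d := by
    intro x hx
    have h0 : x₀ ∈ Ioo c d := by
      have := hx.1.trans hx.2
      constructor <;> rw [hx₀] <;> linarith
    refine ⟨h0, ?_⟩
    rw [← segment_eq_uIcc]
    exact (convex_Ioo c d).segment_subset h0 hx
  have hX : ∀ x ∈ Ioo c d, HasDerivAt (fun x => ∫ s in x₀..x, k s) (k x) x := by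
    intro x hx
    have hcon : ContinuousOn k (Ioo c d) := fun y hy => (hkc y hy).continuousWithinAt
    exact intervalIntegral.integral_hasDerivAt_right
      ((hcon.mono (hsub x hx).2).intervalIntegrable)
      (hcon.stronglyMeasurableAtFilter isOpen_Ioo x hx) (hkc x hx)
  have hbd : ∀ x ∈ Ioo c d, |∫ s in x₀..x, k s| ≤ C * 2 := by
    intro x hx
    have h1 := intervalIntegral.norm_integral_le_of_norm_le_const (f := k) (a := x₀) (b := x) (C := C)
      fun s hs => (hN s ((hsub x hx).2 (uIoc_subset_uIcc hs)) _ rfl).2.2.1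
    have hC : 0 ≤ C := (abs_nonneg _).trans (hN x hx _ rfl).2.2.1
    refine h1.trans (mul_le_mul_of_nonneg_left ?_ hC)
    have a1 := (hN x hx _ rfl).1
    have a2 := (hN x₀ (hsub x hx).1 _ rfl).1
    simp only at a1 a2
    rw [abs_le] at a1 a2 ⊢
    constructor <;> linarith [a1.1, a1.2, a2.1, a2.2]
  obtain ⟨g, c', d', h1, h2⟩ := exists_reparametrization hX
    (fun x hx => inv_pos.2 (hN x hx _ rfl).2.1) ⟨_, hbd⟩
  refine ⟨g, c', d', fun τ hτ => ?_, fun τ hτ => (h2 τ hτ).1, ?_⟩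
  · obtain ⟨g1, -, g3⟩ := h2 τ hτ
    obtain ⟨-, -, -, -, n1, n2⟩ := hN _ g1 _ rfl
    have hc : HasDerivAt (fun τ => j (g τ)) (b (j (g τ)) • ((1, (j (g τ)).2.2, f (j (g τ))) : Jet)) τ := by
      have := (hjd _ g1).scomp τ g3
      rwa [show (k (g τ))⁻¹ = b (j (g τ)) from inv_inv _] at this
    exact (n1.hasMFDerivAt_curve (c := fun τ => j (g τ)) n2 hc).hasMFDerivWithinAt
  · have e : ∀ τ ∈ Ioo c' d', χ (ι (j (g τ))) = j (g τ) := fun τ hτ => (hN _ (h2 τ hτ).1 _ rfl).2.2.2.2.2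
    ext w
    constructor
    · rintro ⟨τ, hτ, rfl⟩
      refine ⟨g τ, (h2 τ hτ).1, ?_⟩
      change _ = ((χ (ι (j (g τ)))).1, (χ (ι (j (g τ)))).2.1)
      rw [e τ hτ]
    · rintro ⟨x, hx, rfl⟩
      refine ⟨_, (h1 x hx).1, ?_⟩
      change ((χ (ι (j (g _)))).1, (χ (ι (j (g _)))).2.1) = _
      rw [e _ (h1 x hx).1, (h1 x hx).2]

theorem IsNormalChart.solutionsAreProjections (h : IsNormalChart V₀ V₁ χ ι f a b m) (h0 : χ m = 0) :
    SolutionsAreProjections V₀ V₁ m χ f := by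
  refine ⟨?_, ?_, fun N hN => ?_⟩
  · filter_upwards [h.eventually] with m' h'
    have hd : HasFDerivAt (fun z : Jet => ((z.1, z.2.1) : ℝ × ℝ))
        ((ContinuousLinearMap.fst ℝ ℝ (ℝ × ℝ)).prod ((ContinuousLinearMap.fst ℝ ℝ ℝ).comp
          (ContinuousLinearMap.snd ℝ ℝ (ℝ × ℝ)))) (χ m') :=
      ((ContinuousLinearMap.fst ℝ ℝ (ℝ × ℝ)).prod ((ContinuousLinearMap.fst ℝ ℝ ℝ).comp
        (ContinuousLinearMap.snd ℝ ℝ (ℝ × ℝ)))).hasFDerivAt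
    have key : ∀ s : ℝ, fderiv ℝ (fun z : Jet => ((z.1, z.2.1) : ℝ × ℝ)) (χ m') (s • (0, 0, 1)) = 0 := by
      intro s
      rw [hd.fderiv]
      simp
    refine (h'.chart.mfderiv_comp hd.differentiableAt (V₀ m')).trans ?_
    refine (congrArg (fderiv ℝ (fun z : Jet => ((z.1, z.2.1) : ℝ × ℝ)) (χ m'))
      h'.left_eq.self_of_nhds).trans (key _)
  · have hbd : ∀ᶠ m' in 𝓝 m, |(χ m').1| < 1 := by
      refine h.chart.continuousAt.fst.abs.eventually (gt_mem_nhds ?_)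
      simp [h0]
    refine ⟨_, h.eventually.and hbd, fun γ c d hγ hN => ?_⟩
    refine exists_solution_of_curve (c := fun τ => χ (γ τ)) (β := fun τ => b (χ (γ τ)))
      (fun τ hτ => ?_) (fun τ hτ => (hN τ hτ).1.pos_right) ⟨1, fun τ hτ => (hN τ hτ).2.le⟩
    exact (hN τ hτ).1.hasDerivAt_curve ((hγ τ hτ).hasMFDerivAt (isOpen_Ioo.mem_nhds hτ))
  · have hbinv : ∀ᶠ z in 𝓝 (χ m), |(b z)⁻¹| < |(b (χ m))⁻¹| + 1 :=
      (h.smooth_right.continuousAt.inv₀ h.pos_right.ne').abs.eventually (gt_mem_nhds (lt_add_one _))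
    have hfst : ∀ᶠ z in 𝓝 (χ m), |z.1| < 1 := by
      refine continuousAt_fst.abs.eventually (gt_mem_nhds ?_)
      simp [h0]
    have hev := (((h.eq_rhs.and hbinv).and hfst).and (h.smooth_right.and
      (h.smooth_right.continuousAt.eventually (lt_mem_nhds h.pos_right)))).and
      (h.chart.tendsto_inv.eventually hN)
    rw [h0] at hev
    obtain ⟨N', hN', hN'h⟩ := hev.exists_mem
    refine ⟨N', hN', fun u c d hu hj => ?_⟩
    obtain ⟨g, c', d', h1, h2, h3⟩ := exists_integralCurve_of_solution (V₀ := V₀) (V₁ := V₁) (χ := χ)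
      (ι := ι) (f := f) (a := a) (b := b) (C := |(b 0)⁻¹| + 1) hu (by
        rintro x hx z rfl
        obtain ⟨⟨⟨⟨e1, e2⟩, e3⟩, e4, e5⟩, -⟩ := hN'h _ (hj x hx)
        exact ⟨e3.le, e5, e2.le, e4.continuousAt, e1.1, e1.2⟩)
    exact ⟨_, c', d', h1, fun τ hτ => (hN'h _ (hj _ (h2 τ hτ))).2, h3⟩

theorem mem_stdEngel {x : M × ℝ} {v : E3 × ℝ} :
    v ∈ (stdEngel V₀ V₁ x : Submodule ℝ (E3 × ℝ)) ↔
      ∃ c : ℝ, (c • direction V₀ V₁ x : E3) = v.1 := by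
  have e : (mfderiv IQ (𝓡 3) (Prod.fst : M × ℝ → M) x v : E3) = v.1 := by
    rw [mfderiv_fst]; rfl
  rw [← e]
  exact Submodule.mem_span_singleton

theorem chartDeriv_apply {x : M × ℝ} (h : IsLocalChart (𝓡 3) χ ι x.1)
    (v : E3 × ℝ) :
    chartDeriv χ x v = ((mfderiv (𝓡 3) 𝓘(ℝ, Jet) χ x.1 v.1 : Jet), v.2) :=
  mfderiv_prodChart h.mdifferentiableAt v

theorem IsNormalChart.mfderiv_direction {x : M × ℝ} (h : IsNormalChart V₀ V₁ χ ι f a b x.1) (t : ℝ) :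
    (mfderiv (𝓡 3) 𝓘(ℝ, Jet) χ x.1 (direction V₀ V₁ x) : Jet) =
      pairField a b (fun q => f q.2) (t, prodChart χ x) := by
  obtain ⟨L, hL⟩ : ∃ L : E3 →L[ℝ] Jet, L = mfderiv (𝓡 3) 𝓘(ℝ, Jet) χ x.1 :=
    ⟨_, rfl⟩
  obtain ⟨v₀, hv₀⟩ : ∃ v : E3, v = V₀ x.1 := ⟨_, rfl⟩
  obtain ⟨v₁, hv₁⟩ : ∃ v : E3, v = V₁ x.1 := ⟨_, rfl⟩
  have e₀ : L v₀ = a (χ x.1) • (0, 0, 1) := by rw [hL, hv₀]; exact h.left_eq.self_of_nhds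
  have e₁ : L v₁ = b (χ x.1) • (1, (χ x.1).2.2, f (χ x.1)) := by
    rw [hL, hv₁]; exact h.right_eq.self_of_nhds
  have e : L (Real.cos x.2 • v₀ + Real.sin x.2 • v₁) =
      pairField a b (fun q => f q.2) (t, prodChart χ x) := by
    rw [map_add, map_smul, map_smul, e₀, e₁, smul_smul, smul_smul]
    rfl
  rw [hL, hv₀, hv₁] at e
  exact e

/-- The plane field spanned by the direction `V(θ, m)` and by `u + ∂/∂θ`. -/
def tiltedEngel (V₀ V₁ : (m : M) → TangentSpace (𝓡 3) m) (u : E3) (x : M × ℝ) :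
    Submodule ℝ (TangentSpace IQ x) :=
  ((Submodule.span ℝ {(direction V₀ V₁ x : E3)}).comap
    (LinearMap.fst ℝ E3 ℝ - (LinearMap.snd ℝ _ ℝ).smulRight u) :
    Submodule ℝ (E3 × ℝ))

theorem mem_tiltedEngel {x : M × ℝ} {u : E3} {v : E3 × ℝ} :
    v ∈ (tiltedEngel V₀ V₁ u x : Submodule ℝ (E3 × ℝ)) ↔
      ∃ c : ℝ, (c • direction V₀ V₁ x : E3) = v.1 - v.2 • u :=
  Submodule.mem_span_singleton

theorem tiltedEngel_zero (x : M × ℝ) : tiltedEngel V₀ V₁ 0 x = stdEngel V₀ V₁ x :=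
  Submodule.ext fun _ => mem_tiltedEngel.trans (by rw [smul_zero, sub_zero]; exact mem_stdEngel.symm)

theorem IsNormalChart.map_tiltedEngel {x : M × ℝ} (h : IsNormalChart V₀ V₁ χ ι f a b x.1) (t : ℝ)
    (u : E3) : Submodule.map (chartDeriv χ x).toLinearMap
      (tiltedEngel V₀ V₁ u x : Submodule ℝ (E3 × ℝ)) =
      plane (mfderiv (𝓡 3) 𝓘(ℝ, Jet) χ x.1 u) (pairField a b (fun q => f q.2) (t, prodChart χ x)) := by
  rw [← h.mfderiv_direction t]
  obtain ⟨L, hL⟩ : ∃ L : E3 →L[ℝ] Jet, L = mfderiv (𝓡 3) 𝓘(ℝ, Jet) χ x.1 :=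
    ⟨_, rfl⟩
  obtain ⟨d, hd⟩ : ∃ d : E3, d = direction V₀ V₁ x := ⟨_, rfl⟩
  have e : ∀ v, chartDeriv χ x v = (L v.1, v.2) := fun v => hL ▸ chartDeriv_apply h.chart v
  have key : ∀ p q r : E3, p = q - r ↔ q = r + p := fun p q r => by
    rw [eq_sub_iff_add_eq']; exact eq_comm
  have hm : ∀ v : E3 × ℝ, v ∈ (tiltedEngel V₀ V₁ u x :
      Submodule ℝ (E3 × ℝ)) ↔ ∃ c : ℝ, v.1 = v.2 • u + c • d := fun v =>
    mem_tiltedEngel.trans (exists_congr fun c => hd ▸ key (c • d) _ _)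
  refine Eq.trans ?_ (congrArg₂ plane (congrArg (fun A : E3 →L[ℝ] Jet => A u) hL)
    (show L d = _ by rw [hL, hd]; rfl))
  refine Submodule.ext fun w => Iff.trans ?_ mem_plane.symm
  constructor
  · rintro ⟨v, hv, rfl⟩
    obtain ⟨c, hc⟩ := (hm v).1 hv
    refine ⟨c, ?_⟩
    change (chartDeriv χ x v).1 = (chartDeriv χ x v).2 • L u + c • L d
    rw [e, hc, map_add, map_smul, map_smul]
  · rintro ⟨c, hc⟩
    refine ⟨(w.2 • u + c • d, w.2), (hm _).2 ⟨c, rfl⟩, (e _).trans (Prod.ext ?_ rfl)⟩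
    change L (w.2 • u + c • d) = w.1
    rw [hc, map_add, map_smul, map_smul]

theorem IsNormalChart.coordPlane_stdEngel {x : M × ℝ} (h : IsNormalChart V₀ V₁ χ ι f a b x.1)
    (t : ℝ) : coordPlane χ ι (fun _ => stdEngel V₀ V₁) (t, prodChart χ x) =
      plane 0 (pairField a b (fun q => f q.2) (t, prodChart χ x)) := by
  rw [coordPlane_prodChart h.chart, ← tiltedEngel_zero]
  exact (h.map_tiltedEngel t 0).trans (congrArg (fun l => plane l _) (map_zero _))

theorem IsNormalChart.eventually_leafSet (h : IsNormalChart V₀ V₁ χ ι f a b m) (h0 : χ m = 0) :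
    ∀ᶠ y in 𝓛, IsNormalChart V₀ V₁ χ ι f a b (prodChartInv ι y.2).1 ∧
      prodChart χ (prodChartInv ι y.2) = y.2 := by
  refine .and ((h.chart.eventually_leafSet_iff h0
    (p := fun z => IsNormalChart V₀ V₁ χ ι f a b z.2.1)).2 fun θ _ => ?_)
    ((h.chart.eventually_leafSet_chart h0).mono fun _ h => h.2)
  exact (tendsto_basePoint 0 (m, θ)).eventually h.eventually

theorem IsNormalChart.eventually_coordPlane_stdEngel (h : IsNormalChart V₀ V₁ χ ι f a b m)
    (h0 : χ m = 0) : ∀ᶠ y in 𝓛, coordPlane χ ι (fun _ => stdEngel V₀ V₁) y =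
      plane 0 (pairField a b (fun q => f q.2) y) := by
  filter_upwards [h.eventually_leafSet h0] with y h1
  have := h1.1.coordPlane_stdEngel y.1
  rwa [h1.2] at this

variable {U : Set (M × ℝ)} {D D' : EngelDeformation V₀ V₁ U}

theorem isotopic_iff (h : IsLocalChart (𝓡 3) χ ι m) (h0 : χ m = 0) :
    D.Isotopic m D' ↔ LeafIsotopic (coordPlane χ ι D.plane) (coordPlane χ ι D'.plane) := by
  constructor
  · rintro ⟨ψ, hψ⟩
    have hev := (exists_isEngelFamilyNear_iff h h0 (R := fun t x =>
      (x ∈ domain M → ψ t x ∈ domain M) ∧ (x.2 = 0 → (ψ t x).2 = 0) ∧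
      (x.2 = Real.pi / 2 → (ψ t x).2 = Real.pi / 2))).1 hψ
    obtain ⟨h1, h2, -, h3⟩ := coordMap_of_isEngelMapAt h h0 (hev.mono fun _ h => h.1)
    exact ⟨coordMap χ ι ψ, ⟨h1, h2, hev.mono fun _ h => h.2.2.1, hev.mono fun _ h => h.2.2.2⟩, h3⟩
  · rintro ⟨Φ, hΦ⟩
    refine ⟨fun t x => prodChartInv ι (Φ (t, prodChart χ x)), (exists_isEngelFamilyNear_iff h h0
      (R := fun t x => (x ∈ domain M → prodChartInv ι (Φ (t, prodChart χ x)) ∈ domain M) ∧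
        (x.2 = 0 → (prodChartInv ι (Φ (t, prodChart χ x))).2 = 0) ∧
        (x.2 = Real.pi / 2 → (prodChartInv ι (Φ (t, prodChart χ x))).2 = Real.pi / 2))).2 ?_⟩
    filter_upwards [isEngelMapAt_of_coordMap h h0 hΦ.smooth hΦ.slice_id hΦ.map, hΦ.mem_iff,
      h.eventually_leafSet_chart h0] with y h1 h2 h3
    refine ⟨h1, ?_⟩
    rw [h3.2]
    exact ⟨fun hd => h2.1.2 hd, fun hd => h2.2.1.2 hd, fun hd => h2.2.2.2 hd⟩

theorem smul_pairField_of_zero {a b : Jet → ℝ} {F : TJet → ℝ} {y : Cyl} (r : ℝ)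
    (h : y.2.2 = 0) : r • pairField a b F y = (r * a y.2.1) • ((0, 0, 1) : Jet) := by
  simp [pairField, h]

theorem smul_pairField_of_pi_div_two {a b : Jet → ℝ} {F : TJet → ℝ} {y : Cyl} (r : ℝ)
    (h : y.2.2 = Real.pi / 2) :
    r • pairField a b F y = (r * b y.2.1) • totalField F (y.1, y.2.1) := by
  simp [pairField, h, smul_smul]

variable {U : Set (M × ℝ)} {D : EngelDeformation V₀ V₁ U}
  {F : ODEDeformation f}

theorem contDiffAt_comp_chart {κ : ℝ → M → Jet} {t : ℝ}
    (hκ : ContMDiffAt (𝓘(ℝ, ℝ).prod (𝓡 3)) 𝓘(ℝ, Jet) ∞ (fun z : ℝ × M => κ z.1 z.2) (t, m))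
    (h : IsLocalChart (𝓡 3) χ ι m) : ContDiffAt ℝ ∞ (fun q : TJet => κ q.1 (ι q.2)) (t, χ m) := by
  have hq : ContMDiffAt 𝓘(ℝ, TJet) (𝓘(ℝ, ℝ).prod (𝓡 3)) ∞ (fun q : TJet => (q.1, ι q.2))
      (t, χ m) :=
    (contDiff_fst.contMDiff.contMDiffAt).prodMk (h.smooth_inv.self_of_nhds.comp_of_eq
      contDiff_snd.contMDiff.contMDiffAt rfl)
  exact (hκ.comp_of_eq hq (by simp [h.inv_apply])).contDiffAt

theorem fderiv_comp_chart {κ : ℝ → M → Jet} {t : ℝ}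
    (hκ : ContMDiffAt (𝓘(ℝ, ℝ).prod (𝓡 3)) 𝓘(ℝ, Jet) ∞ (fun z : ℝ × M => κ z.1 z.2) (t, m))
    (h : IsLocalChart (𝓡 3) χ ι m) (v : E3) :
    fderiv ℝ (fun q : TJet => κ q.1 (ι q.2)) (t, χ m) (0, (mfderiv (𝓡 3) 𝓘(ℝ, Jet) χ m v : Jet)) =
      (mfderiv (𝓡 3) 𝓘(ℝ, Jet) (κ t) m v : Jet) := by
  have hs : ContMDiffAt (𝓡 3) 𝓘(ℝ, Jet) ∞ (κ t) m :=
    hκ.comp_of_eq (f := fun x : M => (t, x)) (contMDiffAt_const.prodMk contMDiffAt_id) rfl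
  refine (fderiv_slice ((contDiffAt_comp_chart hκ h).diffAt) _).symm.trans ?_
  exact h.fderiv_comp_inv_mfderiv (hs.mdifferentiableAt (by simp)) v

theorem IsNormalChart.eventually_base (h : IsNormalChart V₀ V₁ χ ι f a b m) (h0 : χ m = 0) :
    (∀ᶠ q in 𝓝 (0 : TJet), IsNormalChart V₀ V₁ χ ι f a b (ι q.2) ∧ χ (ι q.2) = q.2) ∧
      Tendsto (fun q : TJet => (q.1, ι q.2)) (𝓝 0) (𝓝 ((0 : ℝ), m)) := by
  have h1 := h.eq_rhs
  have h2 := h.chart.tendsto_inv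
  rw [h0] at h1 h2
  have h3 : Tendsto (Prod.snd : TJet → Jet) (𝓝 0) (𝓝 0) := continuous_snd.tendsto _
  exact ⟨h3.eventually h1, (continuous_fst.tendsto (0 : TJet)).prodMk_nhds (h2.comp h3)⟩

theorem tendsto_total {Ψ : Cyl → Jet × ℝ} (hΨ : ∀ᶠ y in 𝓛, ContDiffAt ℝ ∞ Ψ y)
    (hid : ∀ᶠ y in 𝓛, y.1 = 0 → Ψ y = y.2) :
    Tendsto (fun y : Cyl => (y.1, Ψ y)) 𝓛 𝓛 :=
  tendsto_leafSet (fun y hy => continuousAt_fst.prodMk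
    (eventually_leafSet.1 hΨ y hy).self_of_nhds.continuousAt) fun y hy => by
      rwa [(eventually_leafSet.1 hid y hy).self_of_nhds (mem_leafSet.1 hy).1]

theorem leafIsotopic_of_defines (h : IsNormalChart V₀ V₁ χ ι f a b m) (h0 : χ m = 0)
    (hD : Defines m χ D F) :
    LeafIsotopic (coordPlane χ ι D.plane) (fun y => plane 0 (pairField a b F.total y)) := by
  obtain ⟨Ψ, ε, N, κ, hΨ, ⟨O, hO, hmO, hκ⟩, hκ0, hev⟩ := hD
  have hE := (exists_isEngelFamilyNear_iff h.chart h0 (R := fun _ _ => True)).1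
    ⟨ε, N, hΨ, fun _ _ _ _ => trivial⟩
  obtain ⟨h1, h2, h3, h4⟩ := coordMap_of_isEngelMapAt h.chart h0 (hE.mono fun _ h => h.1)
  have ht := tendsto_total h1 h2
  obtain ⟨hb1, hb2⟩ := h.eventually_base h0
  have hκs : ∀ᶠ q in 𝓝 (0 : TJet), ContMDiffAt (𝓘(ℝ, ℝ).prod (𝓡 3)) 𝓘(ℝ, Jet) ∞
      (fun z : ℝ × M => κ z.1 z.2) (q.1, ι q.2) :=
    hb2.eventually ((hO.eventually_mem hmO).mono fun z hz => hκ.contMDiffAt (hO.mem_nhds hz))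
  -- the differential of the coordinates on the straightened direction fields
  have key : ∀ᶠ y in 𝓛, ∀ θ, y.2.2 = θ →
      fderiv ℝ (fun q : TJet => κ q.1 (ι q.2)) (y.1, (coordMap χ ι Ψ y).1)
        (0, pairField a b (fun q => f q.2) (y.1, coordMap χ ι Ψ y)) =
      (mfderiv (𝓡 3) 𝓘(ℝ, Jet) (κ y.1) (Ψ y.1 (ι y.2.1, θ)).1
        (direction V₀ V₁ (Ψ y.1 (ι y.2.1, θ))) : Jet) ∧
      ι (coordMap χ ι Ψ y).1 = (Ψ y.1 (ι y.2.1, θ)).1 := by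
    filter_upwards [(tendsto_leafSet_base.comp ht).eventually (hb1.and hκs), h3] with y ⟨h5, h6⟩ h7
    rintro θ rfl
    change IsLocalChart (𝓡 3) χ ι (Ψ y.1 (ι y.2.1, y.2.2)).1 at h7
    change ContMDiffAt _ _ _ _ (y.1, ι (χ (Ψ y.1 (ι y.2.1, y.2.2)).1)) at h6
    change IsNormalChart V₀ V₁ χ ι f a b (ι (χ (Ψ y.1 (ι y.2.1, y.2.2)).1)) ∧ _ at h5
    rw [h7.inv_apply] at h5 h6
    refine ⟨?_, h7.inv_apply⟩
    refine Eq.trans ?_ (fderiv_comp_chart h6 h7 _)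
    exact congrArg (fun w : Jet => fderiv ℝ (fun q : TJet => κ q.1 (ι q.2))
      (y.1, χ (Ψ y.1 (ι y.2.1, y.2.2)).1) (0, w)) (h5.1.mfderiv_direction y.1).symm
  obtain ⟨hleft, hright, hpl, hpr, hrhs⟩ := h.at_zero h0
  refine leafIsotopic_of_straightening hleft hright hpl hpr hrhs F.smoothNear F.total_zero h1 h2 ?_
    (κ := fun q => κ q.1 (ι q.2)) ?_ ?_ ?_ ?_
  · filter_upwards [h4, ht.eventually (h.eventually_coordPlane_stdEngel h0)] with y h5 h6 h7
    rw [h5 h7, h6]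
  · filter_upwards [hb1, hκs] with q h5 h6
    have := contDiffAt_comp_chart h6 h5.1.chart
    rwa [h5.2] at this
  · have h5 : Tendsto ι (𝓝 0) (𝓝 m) := h0 ▸ h.chart.tendsto_inv
    filter_upwards [h5.eventually hκ0, tendsto_snd_zero.eventually hb1] with z h6 h7
    exact h6.trans h7.2
  · filter_upwards [key, (hb2.comp tendsto_leafSet_base).eventually hev] with y h5 h6 h7
    obtain ⟨s, -, hs⟩ := h6.1
    exact ⟨s, (h5 0 h7).1.trans hs⟩
  · filter_upwards [key, (hb2.comp tendsto_leafSet_base).eventually hev] with y h5 h6 h7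
    obtain ⟨s, -, hs⟩ := h6.2
    refine ⟨s, (h5 _ h7).1.trans (hs.trans ?_)⟩
    rw [totalField, (h5 _ h7).2]
    rfl

theorem defines_of_leafIsotopic (h : IsNormalChart V₀ V₁ χ ι f a b m) (h0 : χ m = 0)
    (hD : LeafIsotopic (coordPlane χ ι D.plane) (fun y => plane 0 (pairField a b F.total y))) :
    Defines m χ D F := by
  obtain ⟨ψ, hψ⟩ := hD
  obtain ⟨hleft, hright, hpl, hpr, hrhs⟩ := h.at_zero h0
  obtain ⟨Ψ, h1, h2, h3, h4⟩ := exists_straightening_of_leafIsotopic hleft hright hpl hpr hrhs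
    F.smoothNear F.total_zero hψ
  have ht := tendsto_total h1 h2
  obtain ⟨hb1, hb2⟩ := h.eventually_base h0
  have hE := isEngelMapAt_of_coordMap (D := D.plane) (D' := fun _ => stdEngel V₀ V₁) h.chart h0 h1 h2 (by
    filter_upwards [h3, ht.eventually (h.eventually_coordPlane_stdEngel h0)] with y h5 h6 h7
    rw [h5 h7, h6])
  obtain ⟨ε, N, hN, -⟩ := (exists_isEngelFamilyNear_iff h.chart h0 (R := fun _ _ => True)).2
    (hE.mono fun _ h => ⟨h, trivial⟩)
  obtain ⟨O, hχ, hO, hmO⟩ := eventually_nhds_iff.1 h.chart.smooth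
  refine ⟨_, ε, N, fun _ => χ, hN, ⟨univ ×ˢ O, isOpen_univ.prod hO, ⟨trivial, hmO⟩, fun z hz =>
    ((hχ z.2 hz.2).comp z contMDiffAt_snd).contMDiffWithinAt⟩, Filter.EventuallyEq.rfl, ?_⟩
  -- the straightened direction fields at the bottom and the top
  have key : ∀ᶠ y in 𝓛, y.2.2 ∈ Quadrant →
      ((ψ y).2 = 0 ↔ y.2.2 = 0) ∧ ((ψ y).2 = Real.pi / 2 ↔ y.2.2 = Real.pi / 2) ∧
      0 < a (ψ y).1 ∧ 0 < b (ψ y).1 ∧ χ (ι (Ψ y).1) = (ψ y).1 ∧ ∃ r : ℝ, 0 < r ∧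
      (mfderiv (𝓡 3) 𝓘(ℝ, Jet) χ (prodChartInv ι (Ψ y)).1 (direction V₀ V₁ (prodChartInv ι (Ψ y))) :
        Jet) = r • pairField a b F.total (y.1, ψ y) := by
    filter_upwards [hψ.toIsLeafMap.mem_iff, (tendsto_leafSet_base.comp ht).eventually hb1,
      ht.eventually (h.eventually_leafSet h0), h4] with y h5 h6 h7 h8 h9
    obtain ⟨h10, r, hr, h11⟩ := h8 h9
    have h12 : χ (ι (Ψ y).1) = (Ψ y).1 := h6.2
    refine ⟨h5.2.1, h5.2.2, ?_, ?_, h12.trans h10, r⁻¹, inv_pos.2 hr, ?_⟩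
    · rw [← h10, ← h12]; exact h6.1.pos_left
    · rw [← h10, ← h12]; exact h6.1.pos_right
    · refine (h7.1.mfderiv_direction y.1).trans ?_
      rw [h11, inv_smul_smul₀ hr.ne', h7.2]
  have hbase : Tendsto (fun z : ℝ × M => (z.1, χ z.2)) (𝓝 (0, m)) (𝓝 0) := by
    have := (continuous_fst.tendsto ((0 : ℝ), m)).prodMk_nhds
      (h.chart.continuousAt.tendsto.comp (continuous_snd.tendsto ((0 : ℝ), m)))
    rwa [h0] at this
  filter_upwards [hbase.eventually (eventually_forall_leaf key)] with z hz
  constructor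
  · obtain ⟨k1, -, k2, -, -, r, hr, k3⟩ := hz 0 ⟨le_rfl, by positivity⟩ ⟨le_rfl, by positivity⟩
    exact ⟨_, mul_pos hr k2, k3.trans (smul_pairField_of_zero r (k1.2 rfl))⟩
  · obtain ⟨-, k1, -, k2, k4, r, hr, k3⟩ :=
      hz (Real.pi / 2) ⟨by positivity, le_rfl⟩ ⟨by positivity, le_rfl⟩
    refine ⟨_, mul_pos hr k2, (k3.trans (smul_pairField_of_pi_div_two r (k1.2 rfl))).trans ?_⟩
    have e : χ (prodChartInv ι (Ψ (z.1, prodChart χ (z.2, Real.pi / 2)))).1 =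
      (ψ (z.1, χ z.2, Real.pi / 2)).1 := k4
    simp only [e]
    rfl

variable {U : Set (M × ℝ)}

/-- The coordinate expression of a family of vector fields on `M × ℝ`. -/
def coordVector (χ : M → Jet) (ι : Jet → M) (X : ℝ → (x : M × ℝ) → TangentSpace IQ x)
    (y : Cyl) : Jet × ℝ := chartDeriv χ (prodChartInv ι y.2) (X y.1 (prodChartInv ι y.2))

theorem IsLocalChart.smoothNear_coordVector (h : IsLocalChart (𝓡 3) χ ι m) (h0 : χ m = 0) {θ : ℝ}
    {X : ℝ → (x : M × ℝ) → TangentSpace IQ x} {O : Set (ℝ × (M × ℝ))} (hO : O ∈ 𝓝 ((0 : ℝ), m, θ))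
    (hX : ∀ z ∈ O, ContMDiffAt (𝓘(ℝ, ℝ).prod IQ) IQ.tangent ∞
      (fun z : ℝ × (M × ℝ) => (⟨z.2, X z.1 z.2⟩ : TangentBundle IQ (M × ℝ))) z) :
    SmoothNear (coordVector χ ι X) (0, 0, θ) := by
  have hx : EngelODE.prodChart χ (m, θ) = (0, θ) := Prod.ext h0 rfl
  have h1 := (h.prodChart θ).smooth_inv
  have h2 := (h.prodChart θ).tendsto_inv
  rw [hx] at h1 h2
  have hs : Tendsto (Prod.snd : Cyl → Jet × ℝ) (𝓝 (0, 0, θ)) (𝓝 (0, θ)) :=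
    continuous_snd.tendsto _
  filter_upwards [hs.eventually h1, hs.eventually (h2.eventually (h.prodChart θ).smooth),
    (h.tendsto_leafPoint h0 θ).eventually hO] with y h3 h4 h5
  exact contDiffAt_mfderiv_section (s := fun y : Cyl => prodChartInv ι y.2)
    (V := fun y => X y.1 (prodChartInv ι y.2)) ((hX _ h5).comp y (contMDiffAt_prodChartInv h3)) h4

theorem exists_coordFrame (h : IsLocalChart (𝓡 3) χ ι m) (h0 : χ m = 0)
    (D : EngelDeformation V₀ V₁ U) {y : Cyl} (hy : y ∈ leafSet) :
    ∃ X Y : Cyl → Jet × ℝ, SmoothNear X y ∧ SmoothNear Y y ∧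
      ∀ᶠ y' in 𝓝 y, y'.2.2 ∈ Quadrant →
        coordPlane χ ι D.plane y' = Submodule.span ℝ {X y', Y y'} := by
  obtain ⟨t, z, θ⟩ := y
  obtain ⟨rfl, rfl, hθ⟩ := mem_leafSet.1 hy
  obtain ⟨ε, hε, K, -, -, hD⟩ := D.engel
  obtain ⟨X, Y, O, hO, hm, hX, hY, hXY, -⟩ := (hD 0 ⟨neg_lt_zero.2 hε, hε⟩ (m, θ) hθ).1
  have hO' := hO.mem_nhds hm
  refine ⟨coordVector χ ι X, coordVector χ ι Y,
    h.smoothNear_coordVector h0 hO' fun z hz => hX.contMDiffAt (hO.mem_nhds hz),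
    h.smoothNear_coordVector h0 hO' fun z hz => hY.contMDiffAt (hO.mem_nhds hz), ?_⟩
  filter_upwards [(h.tendsto_leafPoint h0 θ).eventually hO'] with y h1 h2
  have := hXY _ h1 h2
  simp only [coordPlane, this, coordVector]
  exact (Submodule.map_span _ _).trans (congrArg _ (image_pair _ _ _))

/-- Every Engel deformation defines a deformation of the equation. -/
theorem exists_defines (h : IsNormalChart V₀ V₁ χ ι f a b m) (h0 : χ m = 0)
    (D : EngelDeformation V₀ V₁ U) : ∃ F : ODEDeformation f, Defines m χ D F := by
  obtain ⟨ha, hb, ha0, hb0, hf⟩ := h.at_zero h0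
  have hf' : SmoothNear (fun q : TJet => f q.2) 0 := hf.comp_of_eq (contDiff_snd.smoothNear 0) rfl
  have hz : ∀ {g : Jet → ℝ}, SmoothNear g 0 → ∀ y ∈ leafSet,
      SmoothNear (fun y : Cyl => g y.2.1) y := fun hg y hy =>
    hg.comp_of_eq ((contDiff_fst.comp contDiff_snd).smoothNear y) (mem_leafSet.1 hy).2.1
  have hc : ∀ y, SmoothNear (fun y : Cyl => Real.cos y.2.2) y := fun y =>
    (Real.contDiff_cos.comp (contDiff_snd.comp contDiff_snd)).smoothNear y
  have hs : ∀ y, SmoothNear (fun y : Cyl => Real.sin y.2.2) y := fun y =>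
    (Real.contDiff_sin.comp (contDiff_snd.comp contDiff_snd)).smoothNear y
  have hne : ∀ {g : Jet → ℝ}, 0 < g 0 → ∀ y : Cyl, y ∈ leafSet → g y.2.1 ≠ 0 :=
    fun hg y hy => by rw [(mem_leafSet.1 hy).2.1]; exact hg.ne'
  have hzt := tendsto_leafSet_point
  have ws : ∀ y ∈ leafSet, SmoothNear (pairField a b (fun q => f q.2)) y := fun y hy =>
    SmoothNear.pairField ha hb hf' hy
  obtain ⟨l, w, hl, hw, hl0, hw0, hlw⟩ := exists_smooth_frame (P := coordPlane χ ι D.plane)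
    (p := fun y => Real.sin y.2.2 / b y.2.1 - f y.2.1 * (Real.cos y.2.2 / a y.2.1))
    (q := fun y => Real.cos y.2.2 / a y.2.1) (W := pairField a b (fun q => f q.2))
    (fun y hy => ((hs y).div (hz hb y hy) (hne hb0 y hy)).sub
      ((hz hf y hy).mul ((hc y).div (hz ha y hy) (hne ha0 y hy))))
    (fun y hy => (hc y).div (hz ha y hy) (hne ha0 y hy)) ws (by
      filter_upwards [hzt.eventually (ha.continuousAt.eventually_ne ha0.ne'),
        hzt.eventually (hb.continuousAt.eventually_ne hb0.ne')] with y h1 h2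
      simp only [normalize, pairField, totalField, Prod.fst_add, Prod.snd_add, Prod.smul_fst,
        Prod.smul_snd, smul_eq_mul, mul_zero, mul_one, zero_add]
      field_simp
      linear_combination (a y.2.1) * Real.sin_sq_add_cos_sq y.2.2)
    (by
      filter_upwards [h.eventually_coordPlane_stdEngel h0] with y h1 h2 h3
      rw [← h1]
      simp only [coordPlane]
      rw [h3, D.plane_zero _ h2])
    fun y hy => exists_coordFrame h.chart h0 D hy
  obtain ⟨F, hF, hF0, hiso⟩ := exists_leafIsotopic_pairField ha hb ha0 hb0 hf' hl hw hl0 hw0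
  obtain ⟨O, hO, h0O, hFO⟩ := hF.exists_isOpen
  refine ⟨⟨fun t z => F (t, z), ⟨O, hO, h0O, hFO⟩, hF0⟩, defines_of_leafIsotopic h h0 ?_⟩
  exact (LeafIsotopic.of_eq hlw).trans hiso

variable {l w h : Cyl → Jet} {x : M × ℝ}

/-- The family of vector fields on `M × ℝ` with the given coordinate expression. -/
def chartVector (χ : M → Jet) (ι : Jet → M) (h : Cyl → Jet) (r t : ℝ) (x : M × ℝ) :
    TangentSpace IQ x :=
  (mfderiv 𝓘(ℝ, Jet × ℝ) IQ (prodChartInv ι) (prodChart χ x) (h (t, prodChart χ x), r) :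
    E3 × ℝ)

theorem contMDiffAt_chartVector {t : ℝ} (hc : IsLocalChart (𝓡 3) χ ι x.1)
    (hh : ContDiffAt ℝ ∞ h (t, prodChart χ x)) (r : ℝ) :
    ContMDiffAt (𝓘(ℝ, ℝ).prod IQ) IQ.tangent ∞
      (fun z : ℝ × (M × ℝ) => (⟨z.2, chartVector χ ι h r z.1 z.2⟩ : TangentBundle IQ (M × ℝ))) (t, x) := by
  have h1 : ContMDiffAt (𝓘(ℝ, ℝ).prod IQ) 𝓘(ℝ, Jet × ℝ) ∞
      (fun z : ℝ × (M × ℝ) => prodChart χ z.2) (t, x) :=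
    hc.prodChart'.smooth.self_of_nhds.comp (t, x) contMDiffAt_snd
  have h2 : ContMDiffAt (𝓘(ℝ, ℝ).prod IQ) 𝓘(ℝ, Jet × ℝ) ∞
      (fun z : ℝ × (M × ℝ) => (h (z.1, prodChart χ z.2), r)) (t, x) :=
    (hh.contMDiffAt.comp_of_eq (contMDiffAt_fst.prodMk_space h1) rfl).prodMk_space contMDiffAt_const
  have h12 := h1.prodMk h2
  rw [chartedSpaceSelf_prod] at h12
  have h3 := (contMDiff_tangentBundleModelSpaceHomeomorph_symm (I := 𝓘(ℝ, Jet × ℝ))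
    (n := ∞)).contMDiffAt.comp (t, x) h12
  refine (contMDiffAt_mfderiv_section (s := fun z : ℝ × (M × ℝ) => prodChart χ z.2)
    (V := fun z => ((h (z.1, prodChart χ z.2), r) : Jet × ℝ)) h3
    hc.prodChart'.smooth_inv.self_of_nhds).congr_of_eventuallyEq ?_
  filter_upwards [(continuous_snd.tendsto (t, x)).eventually hc.prodChart'.left] with z hz
  exact congrArg (fun p => (⟨p, chartVector χ ι h r z.1 z.2⟩ : TangentBundle IQ (M × ℝ))) hz.symm

theorem chartDeriv_chartVector (hc : IsLocalChart (𝓡 3) χ ι x.1) (r t : ℝ) :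
    chartDeriv χ x (chartVector χ ι h r t x) = (h (t, prodChart χ x), r) :=
  hc.prodChart'.mfderiv_mfderiv_inv _

theorem isEngelFamilyAt_of_chart {D : ℝ → (x : M × ℝ) → Submodule ℝ (TangentSpace IQ x)} {t : ℝ}
    (hc : IsLocalChart (𝓡 3) χ ι x.1) (hl : SmoothNear l (t, prodChart χ x))
    (hw : SmoothNear w (t, prodChart χ x)) (hD : ∀ᶠ z in 𝓝 (t, x),
      Submodule.map (chartDeriv χ z.2).toLinearMap
        (D z.1 z.2 : Submodule ℝ (E3 × ℝ)) =
      plane (l (z.1, prodChart χ z.2)) (w (z.1, prodChart χ z.2)))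
    (hne : engelDet l w (t, prodChart χ x) ≠ 0) : IsEngelFamilyAt D t x := by
  have hy := hc.tendsto_prodChart t
  have hcz := (tendsto_basePoint t x).eventually hc.eventually
  obtain ⟨O, hOp, hO, hm⟩ := eventually_nhds_iff.1
    (hD.and (hcz.and ((hy.eventually hl.eventually).and (hy.eventually hw.eventually))))
  refine ⟨chartVector χ ι w 0, chartVector χ ι l 1, O, hO, hm, fun z hz =>
    (contMDiffAt_chartVector (hOp z hz).2.1 (hOp z hz).2.2.2.contDiffAt 0).contMDiffWithinAt,
    fun z hz => (contMDiffAt_chartVector (hOp z hz).2.1 (hOp z hz).2.2.1.contDiffAt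
      1).contMDiffWithinAt, fun z hz _ => ?_, ?_⟩
  · obtain ⟨h1, h2, -⟩ := hOp z hz
    have hi : Function.Injective (chartDeriv χ z.2).toLinearMap := h2.prodChart'.derivEquiv.injective
    refine Submodule.map_injective_of_injective hi (h1.trans ?_)
    refine Eq.trans ?_ ((Submodule.map_span _ _).trans (congrArg _ (image_pair _ _ _))).symm
    rw [plane, Set.pair_comm]
    exact congrArg₂ (fun u v => Submodule.span ℝ {u, v}) (chartDeriv_chartVector h2 0 z.1).symm
      (chartDeriv_chartVector h2 1 z.1).symm
  · have hx : ∀ᶠ x' in 𝓝 x, (t, x') ∈ O := (tendsto_slice t x).eventually (hO.mem_nhds hm)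
    have sl : ∀ {g : Cyl → Jet} {p : Jet × ℝ} (r : ℝ), SmoothNear g (t, p) →
        ContDiffAt ℝ ∞ (fun p : Jet × ℝ => (g (t, p), r)) p := fun r hg =>
      (hg.contDiffAt.comp _ (f := fun p : Jet × ℝ => (t, p)) (by fun_prop)).prodMk contDiffAt_const
    have cv : ∀ {x' : M × ℝ}, (t, x') ∈ O → ∀ (g : Cyl → Jet) (r : ℝ), ∀ᶠ x'' in 𝓝 x',
        (mfderiv IQ 𝓘(ℝ, Jet × ℝ) (prodChart χ) x'' (chartVector χ ι g r t x'') : Jet × ℝ) =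
          (g (t, prodChart χ x''), r) := fun {x'} hx' g r => by
      filter_upwards [(tendsto_slice t x').eventually (hO.mem_nhds hx')] with x'' h1
      exact chartDeriv_chartVector (hOp _ h1).2.1 r t
    have hb : ∀ {x' : M × ℝ}, (t, x') ∈ O → (mfderiv IQ 𝓘(ℝ, Jet × ℝ) (prodChart χ) x'
        (mlieBracket IQ (chartVector χ ι w 0 t) (chartVector χ ι l 1 t) x') : Jet × ℝ) =
        (fieldBracket w 0 l 1 (t, prodChart χ x'), 0) := fun {x'} hx' => by
      obtain ⟨-, h2, h3, h4⟩ := hOp _ hx'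
      exact (h2.prodChart'.mfderiv_mlieBracket (sl 0 h4) (sl 1 h3) (cv hx' w 0) (cv hx' l 1)).trans
        (lieBracket_slice 0 1 h4.differentiableAt h3.differentiableAt)
    have hbb := (hc.prodChart'.mfderiv_mlieBracket (sl 0 hw) (sl 0 (hw.fieldBracket hl 0 1))
      (cv hm w 0) (hx.mono fun x' hx' => hb hx')).trans
      (lieBracket_slice 0 0 hw.differentiableAt (hw.fieldBracket hl 0 1).differentiableAt)
    have key := linearIndependent_of_det3 (l := l (t, prodChart χ x)) hne
    refine LinearIndependent.of_comp (chartDeriv χ x).toLinearMap ?_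
    convert key using 1
    funext i
    fin_cases i
    exacts [chartDeriv_chartVector hc 0 t, chartDeriv_chartVector hc 1 t, hb hm, hbb]

variable {l : Cyl → Jet} {t : ℝ} {x : M × ℝ}

open Classical in
/-- The vector with coordinate expression `l`, extended by zero outside the chart. -/
def tilt (χ : M → Jet) (ι : Jet → M) (l : Cyl → Jet) (t : ℝ) (x : M × ℝ) :
    E3 :=
  if IsLocalChart (𝓡 3) χ ι x.1 then
    (mfderiv 𝓘(ℝ, Jet) (𝓡 3) ι (χ x.1) (l (t, prodChart χ x)) : E3) else 0

theorem tilt_of_chart (h : IsLocalChart (𝓡 3) χ ι x.1) : tilt χ ι l t x =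
    (mfderiv 𝓘(ℝ, Jet) (𝓡 3) ι (χ x.1) (l (t, prodChart χ x)) : E3) := if_pos h

theorem tilt_eq_zero (h : IsLocalChart (𝓡 3) χ ι x.1 → l (t, prodChart χ x) = 0) :
    tilt χ ι l t x = 0 := by
  by_cases hc : IsLocalChart (𝓡 3) χ ι x.1
  · rw [tilt_of_chart hc, h hc]
    exact map_zero (mfderiv 𝓘(ℝ, Jet) (𝓡 3) ι (χ x.1) : Jet →L[ℝ] E3)
  · exact if_neg hc

theorem mfderiv_tilt (h : IsLocalChart (𝓡 3) χ ι x.1) :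
    (mfderiv (𝓡 3) 𝓘(ℝ, Jet) χ x.1 (tilt χ ι l t x) : Jet) = l (t, prodChart χ x) := by
  rw [tilt_of_chart h]
  exact h.mfderiv_mfderiv_inv _

theorem IsNormalChart.map_tilt (h : IsNormalChart V₀ V₁ χ ι f a b x.1) (t : ℝ) :
    Submodule.map (chartDeriv χ x).toLinearMap
      (tiltedEngel V₀ V₁ (tilt χ ι l t x) x : Submodule ℝ (E3 × ℝ)) =
      plane (l (t, prodChart χ x)) (pairField a b (fun q => f q.2) (t, prodChart χ x)) :=
  (h.map_tiltedEngel t _).trans (congrArg (fun l => plane l _) (mfderiv_tilt h.chart))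

theorem IsNormalChart.eventually_tiltedEngel (h : IsNormalChart V₀ V₁ χ ι f a b x.1)
    (hl : SmoothNear l (0, prodChart χ x)) (h0 : ∀ y, y.1 = 0 → l y = 0) :
    ∀ᶠ z in 𝓝 ((0 : ℝ), x),
      IsEngelFamilyAt (fun t x => tiltedEngel V₀ V₁ (tilt χ ι l t x) x) z.1 z.2 := by
  have hy := h.chart.tendsto_prodChart 0
  have hN := (tendsto_basePoint 0 x).eventually h.eventually
  have hf : SmoothNear (fun q : TJet => f q.2) (0, χ x.1) :=
    h.smooth_rhs.comp_of_eq (contDiff_snd.smoothNear _) rfl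
  have hw : SmoothNear (pairField a b (fun q => f q.2)) (0, prodChart χ x) :=
    .pairField_at h.smooth_left h.smooth_right hf
  have hne : engelDet l (pairField a b (fun q => f q.2)) (0, prodChart χ x) ≠ 0 :=
    engelDet_ne_zero h.smooth_left h.smooth_right hf hl h.pos_left h.pos_right
      (Eventually.of_forall h0)
  filter_upwards [hN.eventually_nhds, hy.eventually hl.eventually, hy.eventually hw.eventually,
    hy.eventually ((hl.engelDet hw).continuousAt.eventually_ne hne)] with z h1 h2 h3 h4
  exact isEngelFamilyAt_of_chart h1.self_of_nhds.chart h2 h3 (h1.mono fun z' h' => h'.map_tilt z'.1) h4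

theorem IsNormalChart.isEngelFamilyAt_of_eq (h : IsNormalChart V₀ V₁ χ ι f a b x.1)
    {D : ℝ → (x : M × ℝ) → Submodule ℝ (TangentSpace IQ x)}
    (hD : ∀ᶠ z in 𝓝 (t, x), D z.1 z.2 = stdEngel V₀ V₁ z.2) : IsEngelFamilyAt D t x := by
  have hN := (tendsto_basePoint t x).eventually h.eventually
  have hf : SmoothNear (fun q : TJet => f q.2) (t, χ x.1) :=
    h.smooth_rhs.comp_of_eq (contDiff_snd.smoothNear _) rfl
  have hl := (contDiff_const (c := (0 : Jet))).smoothNear (t, prodChart χ x)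
  refine isEngelFamilyAt_of_chart h.chart hl (.pairField_at h.smooth_left h.smooth_right hf) ?_
    (engelDet_ne_zero h.smooth_left h.smooth_right hf hl h.pos_left h.pos_right (by simp))
  filter_upwards [hD, hN] with z h1 h2
  rw [h1, ← tiltedEngel_zero]
  exact (h2.map_tiltedEngel z.1 0).trans (congrArg (fun l => plane l _) (map_zero _))

/-- Every deformation of the equation is defined by an Engel deformation supported near a given
point of the leaf. -/
theorem exists_deformation [T2Space M]
    (hch : ∀ m : M, ∃ (χ : M → Jet) (ι : Jet → M) (f a b : Jet → ℝ), IsNormalChart V₀ V₁ χ ι f a b m)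
    (h : IsNormalChart V₀ V₁ χ ι f a b m) (h0 : χ m = 0) {θ₀ : ℝ} (hθ : θ₀ ∈ Quadrant)
    {U : Set (M × ℝ)} (hU : U ∈ 𝓝 (m, θ₀)) (F : ODEDeformation f) :
    ∃ D : EngelDeformation V₀ V₁ U, Defines m χ D F := by
  obtain ⟨ha, hb, ha0, hb0, -⟩ := h.at_zero h0
  have hN := h.eq_rhs
  have hQ := (h.chart.prodChart θ₀).tendsto_inv
  rw [show prodChart χ (m, θ₀) = (0, θ₀) from Prod.ext h0 rfl] at hQ
  rw [h0] at hN
  obtain ⟨A, hA, B, hB, hAB⟩ := mem_nhds_prod_iff.1 (hQ hU)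
  obtain ⟨δ, hδ, hδB⟩ := Metric.mem_nhds_iff.1 hB
  obtain ⟨θ₁, h1, h1'⟩ := exists_between (show max 0 (θ₀ - δ) < min (Real.pi / 2) (θ₀ + δ) by
    have := Real.pi_pos
    refine max_lt (lt_min ?_ ?_) (lt_min ?_ ?_) <;> linarith [hθ.1, hθ.2])
  obtain ⟨θ₂, h12, h2⟩ := exists_between h1'
  obtain ⟨K, l, hK, hKO, ls, l0, lK, hiso⟩ := exists_supported_deformation ha hb ha0 hb0 F.smoothNear
    (Filter.inter_mem hA hN) ((le_max_left _ _).trans_lt h1) h12 (h2.trans_le (min_le_left _ _))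
  set K' := prodChartInv ι '' K ×ˢ Icc θ₁ θ₂ with hK'
  have hK'c : IsCompact K' := by
    refine (hK.prod isCompact_Icc).image_of_continuousOn fun z hz => ?_
    obtain ⟨h3, h4⟩ := (hKO hz.1).2
    have := (h3.chart.prodChart z.2).smooth_inv.self_of_nhds.continuousAt
    rw [show prodChart χ (ι z.1, z.2) = z from Prod.ext h4 rfl] at this
    exact this.continuousWithinAt
  have hK'U : K' ⊆ U := by
    rintro _ ⟨z, hz, rfl⟩
    refine hAB ⟨(hKO hz.1).1, hδB ?_⟩
    rw [Metric.mem_ball, Real.dist_eq, abs_lt]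
    constructor <;> linarith [hz.2.1, hz.2.2, (le_max_right 0 (θ₀ - δ)).trans_lt h1,
      h2.trans_le (min_le_right (Real.pi / 2) (θ₀ + δ))]
  have hsupp : ∀ t, ∀ x ∉ K', tiltedEngel V₀ V₁ (tilt χ ι l t x) x = stdEngel V₀ V₁ x := fun t x hx => by
    rw [tilt_eq_zero fun hc => lK _ fun hl => hx ⟨prodChart χ x, hl, hc.prodChart'.inv_apply⟩,
      tiltedEngel_zero]
  have hev : ∀ᶠ t in 𝓝 (0 : ℝ), ∀ x ∈ K',
      IsEngelFamilyAt (fun t x => tiltedEngel V₀ V₁ (tilt χ ι l t x) x) t x := by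
    refine hK'c.eventually_forall_of_forall_eventually ?_
    rintro _ ⟨z, hz, rfl⟩
    exact IsNormalChart.eventually_tiltedEngel (x := prodChartInv ι z) (hKO hz.1).2.1
      (ls.smoothNear _) l0
  obtain ⟨ε, hε, hball⟩ := Metric.eventually_nhds_iff_ball.1 hev
  refine ⟨⟨fun t x => tiltedEngel V₀ V₁ (tilt χ ι l t x) x, fun x _ => ?_, ε, hε, K', hK'c, hK'U,
    fun t ht x _ => ⟨?_, hsupp t x⟩⟩, defines_of_leafIsotopic h h0 ((LeafIsotopic.of_eq ?_).trans hiso)⟩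
  · rw [tilt_eq_zero fun _ => l0 _ rfl, tiltedEngel_zero]
  · by_cases hx : x ∈ K'
    · exact hball t (by rwa [Real.ball_eq_Ioo, zero_sub, zero_add]) x hx
    · obtain ⟨χ₁, ι₁, f₁, a₁, b₁, hx₁⟩ := hch x.1
      refine hx₁.isEngelFamilyAt_of_eq ?_
      filter_upwards [(continuous_snd.tendsto (t, x)).eventually
        (hK'c.isClosed.isOpen_compl.mem_nhds hx)] with z hz using hsupp z.1 z.2 hz
  · have hzt := tendsto_leafSet_point
    filter_upwards [h.eventually_leafSet h0, hzt.eventually F.total_zero] with y h3 h4 _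
    refine (h3.1.map_tilt y.1).trans ?_
    rw [h3.2]
    simp only [pairField, totalField, h4]

end Manifold

end EngelODE

end

open EngelODE in
theorem theorem3 {M : Type*} [TopologicalSpace M] [T2Space M]
    [ChartedSpace (EuclideanSpace ℝ (Fin 3)) M] [IsManifold (𝓡 3) ∞ M]
    (ξ : (m : M) → Submodule ℝ (TangentSpace (𝓡 3) m)) (hξ : IsContact ξ)
    (V₀ V₁ : (m : M) → TangentSpace (𝓡 3) m)
    (hV₀ : ContMDiff (𝓡 3) (𝓡 3).tangent ∞ (fun m => (⟨m, V₀ m⟩ : TangentBundle (𝓡 3) M)))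
    (hV₁ : ContMDiff (𝓡 3) (𝓡 3).tangent ∞ (fun m => (⟨m, V₁ m⟩ : TangentBundle (𝓡 3) M)))
    (hξ₀ : ∀ m, V₀ m ∈ ξ m) (hξ₁ : ∀ m, V₁ m ∈ ξ m)
    (hV : ∀ m, LinearIndependent ℝ ![V₀ m, V₁ m])
    (m : M) :
    (∃ (χ : M → Jet) (f : Jet → ℝ), IsNormalForm V₀ V₁ m χ f ∧ f 0 = 0) ∧
    (∀ (χ χ' : M → Jet) (f f' : Jet → ℝ), IsNormalForm V₀ V₁ m χ f → IsNormalForm V₀ V₁ m χ' f' →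
      ProjEquivGerm f f') ∧
    ∀ (χ : M → Jet) (f : Jet → ℝ), IsNormalForm V₀ V₁ m χ f →
      SolutionsAreProjections V₀ V₁ m χ f ∧
      (∀ q : M × ℝ, q ∈ domain M → q.1 = m → ∀ U : Set (M × ℝ), IsOpen U → q ∈ U →
        Equivalence (EngelDeformation.Isotopic (V₀ := V₀) (V₁ := V₁) (U := U) m) ∧
        Equivalence (ODEDeformation.ProjEquiv (f := f)) ∧
        (∀ D : EngelDeformation V₀ V₁ U, ∃ F : ODEDeformation f, Defines m χ D F) ∧
        ∃ e : Quot (EngelDeformation.Isotopic (V₀ := V₀) (V₁ := V₁) (U := U) m) ≃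
            Quot (ODEDeformation.ProjEquiv (f := f)),
          ∀ (D : EngelDeformation V₀ V₁ U) (F : ODEDeformation f), Defines m χ D F →
            e (Quot.mk _ D) = Quot.mk _ F) ∧
      InfiniteDimensionalModuli f := by
  refine ⟨?_, ?_, ?_⟩
  · obtain ⟨χ, ι, f, a, b, h, h0, hf0⟩ := exists_isNormalChart hξ hV₀ hV₁ hξ₀ hξ₁ hV m
    exact ⟨χ, f, h.isNormalForm h0, hf0⟩
  · intro χ χ' f f' h h'
    obtain ⟨ι, a, b, hc⟩ := h.exists_isNormalChart hV₀ hV₁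
    obtain ⟨ι', a', b', hc'⟩ := h'.exists_isNormalChart hV₀ hV₁
    exact hc.projEquivGerm hc' h.2.1 h'.2.1
  intro χ f h
  obtain ⟨ι, a, b, hc⟩ := h.exists_isNormalChart hV₀ hV₁
  have h0 : χ m = 0 := h.2.1
  refine ⟨hc.solutionsAreProjections h0, ?_, infiniteDimensionalModuli f⟩
  rintro ⟨m', θ₀⟩ hq hm U hU hqU
  obtain rfl : m' = m := hm
  obtain ⟨ha, hb, ha0, hb0, -⟩ := hc.at_zero h0
  have hI : ∀ {D D' : EngelDeformation V₀ V₁ U}, D.Isotopic _ D' ↔ _ :=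
    fun {D D'} => isotopic_iff hc.chart h0
  have hE : Equivalence (EngelDeformation.Isotopic (V₀ := V₀) (V₁ := V₁) (U := U) _) :=
    ⟨fun D => hI.2 (.refl _), fun hD => hI.2 (hI.1 hD).symm, fun hD hD' => hI.2 ((hI.1 hD).trans (hI.1 hD'))⟩
  have hE' := ODEDeformation.projEquiv_equivalence (f := f)
  have hdef : ∀ {D D' : EngelDeformation V₀ V₁ U} {F F' : ODEDeformation f}, Defines _ χ D F →
      Defines _ χ D' F' → (D.Isotopic _ D' ↔ F.ProjEquiv F') := fun {D D' F F'} hD hD' => by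
    have k := leafIsotopic_of_defines hc h0 hD
    have k' := leafIsotopic_of_defines hc h0 hD'
    rw [hI, F.projEquiv_iff]
    refine ⟨fun hi => jetEquiv_of_leafIsotopic ha hb ha0 hb0 F.smoothNear ((k.symm.trans hi).trans k'),
      fun hj => (k.trans (leafIsotopic_of_jetEquiv ha hb ha0 hb0 F.smoothNear F'.smoothNear ?_ hj)).trans
        k'.symm⟩
    filter_upwards [F.total_zero, F'.total_zero] with z h1 h2
    rw [h1, h2]
  choose F hF using fun D : EngelDeformation V₀ V₁ U => exists_defines hc h0 D
  refine ⟨hE, hE', fun D => ⟨F D, hF D⟩, Equiv.ofBijective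
    (Quot.map F fun D D' hD => (hdef (hF D) (hF D')).1 hD) ⟨?_, ?_⟩, fun D G hG =>
      Quot.sound ((hdef (hF D) hG).1 (hE.refl D))⟩
  · rintro ⟨D⟩ ⟨D'⟩ hD
    exact Quot.sound ((hdef (hF D) (hF D')).2 (hE'.eqvGen_iff.1 (Quot.eqvGen_exact hD)))
  · rintro ⟨G⟩
    obtain ⟨D, hD⟩ := exists_deformation (fun m => by
      obtain ⟨χ, ι, f, a, b, h, -⟩ := exists_isNormalChart hξ hV₀ hV₁ hξ₀ hξ₁ hV m
      exact ⟨χ, ι, f, a, b, h⟩) hc h0 hq (hU.mem_nhds hqU) G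
    exact ⟨Quot.mk _ D, Quot.sound ((hdef (hF D) hD).1 (hE.refl D))⟩
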